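/- Let $k$ be a commutative ring. **Quivers.** For a set $S$, a $k$-quiver on $S$ is a family $Q=(Q(a,b))_{a,b\in S}$ of $k$-modules. Quivers on $S$ form a monoidal category $\mathrm{Quiv}_S(k)$ with $(Q\otimes P)(a,b)=\bigoplus_{c\in S}Q(a,c)\otimes_k P(c,b)$ and unit $\mathbf 1_S$, where $\mathbf 1_S(a,a)=k$ and $\mathbf 1_S(a,b)=0$ for $a\neq b$. A map of sets $f:S\to T$ gives the lax monoidal functor $f^*:\mathrm{Quiv}_T(k)\to\mathrm{Quiv}_S(k)$, $(f^*Q)(a,b)=Q(f(a),f(b))$, whose left adjoint $f_!$ is colax monoidal. **Frobenius templicial modules.** Let $\mathbf{fint}$ be the category of finite intervals: its objects are $[n]=\{0<\dots<n\}$, $n\ge 0$, its morphisms $[m]\to[n]$ are the monotone maps preserving both endpoints, and it is monoidal with $[m]+[n]=[m+n]$ (gluing the last point of $[m]$ to the first point of $[n]$) and unit $[0]$. A *Frobenius templicial $k$-module* is a pair $(X,S)$ of a set $S$ and a functor $X:\mathbf{fint}^{op}\to\mathrm{Quiv}_S(k)$ with a strongly unital Frobenius monoidal structure, i.e. a lax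 structure $Z^{p,q}:X_p\otimes X_q\to X_{p+q}$, $\varepsilon:\mathbf 1_S\to X_0$ and a colax structure $\mu_{p,q}:X_{p+q}\to X_p\otimes X_q$, $X_0\to\mathbf 1_S$ (both natural, associative and unital) such that the unit and the counit are mutually inverse and, suppressing associators, $$\mu_{p,q+r}\,Z^{p+q,r}=(\mathrm{id}\otimes Z^{q,r})(\mu_{p,q}\otimes\mathrm{id}),\qquad \mu_{p+q,r}\,Z^{p,q+r}=(Z^{p,q}\otimes\mathrm{id})(\mathrm{id}\otimes\mu_{q,r}).$$ A morphism $(X,S)\to(Y,T)$ is a map $f:S\to T$ with a natural transformation $\alpha:f_!X\to Y$ that is comonoidal and whose adjoint $X\to f^*Y$ is monoidal. Let $\mathrm{F}_s\mathrm{Mod}(k)$ denote the resulting category. **Narrow simplicial modules.** Let $\Delta_-$ be the category with objects $[n]$, $n\ge 1$, and with morphisms $[m]\to[n]$ the monotone maps $f$ with $f^{-1}(0)=\{0\}$ and $f^{-1}(n)=\{m\}$. It is monoidal with $[m]\diamond[n]=[m+n-1]$ and unit $[1]$: for $f:[m]\to[r]$ and $g:[n]\to[s]$, $(f\diamond g)(i)=f(i)$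 for $i<m$ and $(f\diamond g)(i)=r-1+g(i-m+1)$ for $i\ge m$. A narrow simplicial $k$-module is a functor $\Delta_-^{op}\to\mathrm{Mod}(k)$; these form a category $S_-\mathrm{Mod}(k)$, monoidal under Day convolution. (Via $[n]\mapsto[n+2]$, $n\ge -1$, this is the same as augmented simplicial $k$-modules with the Day convolution (join) product.) For a monoidal category $\mathcal V$, let $\mathrm{Cat}(\mathcal V)$ be the category of small $\mathcal V$-enriched categories and $\mathcal V$-enriched functors, and let $dg\mathrm{Cat}_{\ge 0}(k)=\mathrm{Cat}(\mathrm{Ch}_{\ge 0}(k))$ be the category of small dg-categories over $k$ in non-negative homological degrees. **Statement.** There is an adjoint equivalence of categories $$\mathrm{F}_s\mathrm{Mod}(k)\;\simeq\; dg\mathrm{Cat}_{\ge 0}(k).$$ More precisely, there are adjoint equivalences $$K:\mathrm{F}_s\mathrm{Mod}(k)\to\mathrm{Cat}(S_-\mathrm{Mod}(k)),\qquad \tilde N:\mathrm{Cat}(S_-\mathrm{Mod}(k))\to dg\mathrm{Cat}_{\ge 0}(k)$$ such that the functor from left to right above is isomorphic to $\tilde N\circ K$, and such that, up to canonical identification,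 $K$ and $\tilde N$ are the following functors. * $K(X,S)$ has set of objects $S$ and, for $n\ge 1$, $K(X)(a,b)_n=\bigcap_{p+q=n,\;p,q\ge 1}\ker(\mu_{p,q})\subseteq X_n(a,b)$, with $\Delta_-$ acting as on $X$. The composition of $x\in K(X)(a,b)_{p+1}$ and $y\in K(X)(b,c)_{q+1}$ is $d_{p+1}Z^{p+1,q+1}(x\otimes y)\in K(X)(a,c)_{p+q+1}$, where $d_{p+1}$ is the inner face map that omits the vertex $p+1$. The identity at $a$ is the degenerate element $s_0\varepsilon(1_a)\in K(X)(a,a)_1$, and a morphism acts by restriction of $X\to f^*Y$. * $\tilde N$ does not change the objects. For an enriched category $\mathcal A$ and $n\ge 0$, $\tilde N(\mathcal A)(x,y)_n$ is the quotient of $\mathcal A(x,y)_{[n+1]}$ by the submodule generated by the images of all degeneracy maps $\mathcal A(x,y)_{[n]}\to\mathcal A(x,y)_{[n+1]}$ (which is zero for $n=0$). The differential from degree $n+1$ to degree $n$ is induced by $\sum_{i=0}^{n}(-1)^i d_i$, where $d_i$ omits the inner vertex $i+1$ of $[n+2]$. Composition, identities and the action of enriched functors are induced by those of $\mathcal A$.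 This is the augmented normalized chains functor of the augmented Dold–Kan correspondence, applied to the hom-objects. -/

import Mathlib

open CategoryTheory MonoidalCategory Opposite
open scoped TensorProduct DirectSum

universe u

/-- The object `[len] = {0 < ⋯ < len}` of the category of finite intervals. -/
@[ext]
structure FinInterval where
  len : ℕ

namespace FinInterval

/-- A morphism of finite intervals: a monotone map preserving both endpoints. -/
structure Hom (m n : FinInterval) where
  toOrderHom : Fin (m.len + 1) →o Fin (n.len + 1)
  map_zero : toOrderHom 0 = 0
  map_last : toOrderHom (Fin.last m.len) = Fin.last n.len

instance : Category FinInterval where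
  Hom := Hom
  id m := ⟨OrderHom.id, rfl, rfl⟩
  comp f g := ⟨g.toOrderHom.comp f.toOrderHom,
    by simp [f.map_zero, g.map_zero], by simp [f.map_last, g.map_last]⟩

variable {m n p q : FinInterval}

theorem hom_ext {f g : m ⟶ n}
    (h : ∀ i, (f.toOrderHom i).val = (g.toOrderHom i).val) : f = g := by
  obtain ⟨f, _, _⟩ := f
  obtain ⟨g, _, _⟩ := g
  have : f = g := by
    ext i
    exact h i
  subst this
  rfl

@[simp] theorem id_apply (i : Fin (m.len + 1)) : Hom.toOrderHom (𝟙 m) i = i := rfl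

@[simp] theorem comp_apply (f : m ⟶ n) (g : n ⟶ p) (i : Fin (m.len + 1)) :
    Hom.toOrderHom (f ≫ g) i = g.toOrderHom (f.toOrderHom i) := rfl

/-- The action of a morphism on the underlying natural numbers (constant beyond the end). -/
def Hom.nat (f : m ⟶ n) (i : ℕ) : ℕ :=
  if h : i < m.len + 1 then (f.toOrderHom ⟨i, h⟩).val else n.len

theorem Hom.nat_eq (f : m ⟶ n) (i : Fin (m.len + 1)) : (f.toOrderHom i).val = Hom.nat f i.val := by
  simp [Hom.nat, i.isLt]

theorem Hom.nat_zero (f : m ⟶ n) : Hom.nat f 0 = 0 := by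
  have := Hom.nat_eq f 0
  rw [f.map_zero] at this
  simpa using this.symm

theorem Hom.nat_of_len_le (f : m ⟶ n) {i : ℕ} (h : m.len ≤ i) : Hom.nat f i = n.len := by
  rcases h.eq_or_lt with rfl | h
  · have := Hom.nat_eq f (Fin.last _)
    rw [f.map_last] at this
    simpa using this.symm
  · rw [Hom.nat, dif_neg (by lia)]

theorem Hom.nat_le (f : m ⟶ n) (i : ℕ) : Hom.nat f i ≤ n.len := by
  unfold Hom.nat
  split_ifs with h
  · have := (f.toOrderHom ⟨i, h⟩).isLt
    lia
  · exact le_rfl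

theorem Hom.nat_mono (f : m ⟶ n) {i j : ℕ} (h : i ≤ j) : Hom.nat f i ≤ Hom.nat f j := by
  by_cases hj : j < m.len + 1
  · unfold Hom.nat
    rw [dif_pos hj, dif_pos (by lia)]
    exact f.toOrderHom.monotone h
  · rw [Hom.nat_of_len_le f (i := j) (by lia)]
    exact Hom.nat_le f i

@[simp] theorem Hom.nat_id (i : ℕ) (h : i ≤ m.len) : Hom.nat (𝟙 m) i = i := by
  simp [Hom.nat, Nat.lt_succ_of_le h]

@[simp] theorem Hom.nat_comp (f : m ⟶ n) (g : n ⟶ p) (i : ℕ) :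
    Hom.nat (f ≫ g) i = Hom.nat g (Hom.nat f i) := by
  by_cases h : i ≤ m.len
  · have := Hom.nat_eq (f ≫ g) ⟨i, by lia⟩
    rw [← this, comp_apply, Hom.nat_eq, Hom.nat_eq]
  · rw [Hom.nat_of_len_le (f ≫ g) (by lia), Hom.nat_of_len_le f (by lia),
      Hom.nat_of_len_le g le_rfl]

theorem hom_ext_nat {f g : m ⟶ n} (h : ∀ i, i ≤ m.len → Hom.nat f i = Hom.nat g i) : f = g :=
  hom_ext fun i => by
    rw [Hom.nat_eq, Hom.nat_eq]
    exact h i (by lia)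

/-- Construct a morphism from a function on natural numbers. -/
def homMk (m n : FinInterval) (f : ℕ → ℕ) (mono : ∀ i j, i ≤ j → j ≤ m.len → f i ≤ f j)
    (zero : f 0 = 0) (last : f m.len = n.len) : m ⟶ n where
  toOrderHom :=
    { toFun := fun i => ⟨f i, by
        have := mono i m.len (by lia) le_rfl
        lia⟩
      monotone' := fun i j h => mono i j h (by lia) }
  map_zero := Fin.ext zero
  map_last := Fin.ext last

@[simp] theorem nat_homMk (f : ℕ → ℕ) (mono zero last) {i : ℕ} (h : i ≤ m.len) :
    Hom.nat (homMk m n f mono zero last) i = f i := by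
  rw [Hom.nat, dif_pos (Nat.lt_succ_of_le h)]
  rfl

/-- The sum of morphisms, glueing along the common endpoint. -/
def tensorHom (f : m ⟶ p) (g : n ⟶ q) :
    (⟨m.len + n.len⟩ : FinInterval) ⟶ ⟨p.len + q.len⟩ :=
  homMk _ _ (fun i => if i ≤ m.len then Hom.nat f i else p.len + Hom.nat g (i - m.len))
    (fun i j h _ => by
      split_ifs with h1 h2
      · exact Hom.nat_mono f h
      · have := Hom.nat_le f i
        lia
      · lia
      · have := Hom.nat_mono g (Nat.sub_le_sub_right h m.len)
        lia)
    (by simp [Hom.nat_zero])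
    (by
      split_ifs with h
      · have : n.len = 0 := by lia
        have h2 := Hom.nat_of_len_le g (i := 0) (by lia)
        rw [Hom.nat_zero] at h2
        rw [Hom.nat_of_len_le f (by lia)]
        lia
      · rw [Hom.nat_of_len_le g (by lia)])

theorem nat_tensorHom (f : m ⟶ p) (g : n ⟶ q) {i : ℕ} (h : i ≤ m.len + n.len) :
    Hom.nat (tensorHom f g) i =
      if i ≤ m.len then Hom.nat f i else p.len + Hom.nat g (i - m.len) :=
  nat_homMk _ _ _ _ h

/-- The isomorphism between finite intervals of equal length. -/
def castIso (h : m.len = n.len) : m ≅ n where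
  hom := homMk _ _ id (fun _ _ h _ => h) rfl h
  inv := homMk _ _ id (fun _ _ h _ => h) rfl h.symm
  hom_inv_id := hom_ext_nat fun i hi => by
    rw [Hom.nat_comp, nat_homMk _ _ _ _ hi, nat_homMk _ _ _ _ (by simpa [← h] using hi),
      Hom.nat_id _ hi]
    rfl
  inv_hom_id := hom_ext_nat fun i hi => by
    rw [Hom.nat_comp, nat_homMk _ _ _ _ hi, nat_homMk _ _ _ _ (by simpa [h] using hi),
      Hom.nat_id _ hi]
    rfl

@[simp] theorem nat_castIso_hom (h : m.len = n.len) {i : ℕ} (hi : i ≤ m.len) :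
    Hom.nat (castIso h).hom i = i :=
  nat_homMk _ (fun _ _ h _ => h) rfl h hi

instance : MonoidalCategoryStruct FinInterval where
  tensorObj m n := ⟨m.len + n.len⟩
  tensorUnit := ⟨0⟩
  tensorHom f g := tensorHom f g
  whiskerLeft m _ _ f := tensorHom (𝟙 m) f
  whiskerRight f n := tensorHom f (𝟙 n)
  associator _ _ _ := castIso (Nat.add_assoc _ _ _)
  leftUnitor _ := castIso (Nat.zero_add _)
  rightUnitor _ := castIso (Nat.add_zero _)

@[simp] theorem len_tensorObj : (m ⊗ n).len = m.len + n.len := rfl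

@[simp] theorem len_tensorUnit : (𝟙_ FinInterval).len = 0 := rfl

theorem nat_tensorHom' (f : m ⟶ p) (g : n ⟶ q) {i : ℕ} (h : i ≤ m.len + n.len) :
    Hom.nat (f ⊗ₘ g) i = if i ≤ m.len then Hom.nat f i else p.len + Hom.nat g (i - m.len) :=
  nat_tensorHom f g h

theorem nat_associator (m n p : FinInterval) {i : ℕ} (h : i ≤ m.len + n.len + p.len) :
    Hom.nat (α_ m n p).hom i = i :=
  nat_castIso_hom _ h

theorem nat_leftUnitor (m : FinInterval) {i : ℕ} (h : i ≤ m.len) :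
    Hom.nat (λ_ m).hom i = i :=
  nat_castIso_hom _ (by simpa using h)

theorem nat_rightUnitor (m : FinInterval) {i : ℕ} (h : i ≤ m.len) :
    Hom.nat (ρ_ m).hom i = i :=
  nat_castIso_hom _ (by simpa using h)

instance : MonoidalCategory FinInterval :=
  MonoidalCategory.ofTensorHom
    (id_tensorHom_id := fun m n => hom_ext_nat fun i (hi : i ≤ m.len + n.len) => by
      rw [nat_tensorHom' _ _ hi, Hom.nat_id (m := m ⊗ n) _ hi]
      split_ifs with h
      · exact Hom.nat_id _ h
      · rw [Hom.nat_id _ (by lia)]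
        lia)
    (tensorHom_comp_tensorHom := fun {X₁ Y₁ Z₁ X₂ Y₂ Z₂} f₁ f₂ g₁ g₂ =>
        hom_ext_nat fun i (hi : i ≤ X₁.len + X₂.len) => by
      have h1 := Hom.nat_le (f₁ ⊗ₘ f₂) i
      rw [Hom.nat_comp, nat_tensorHom' _ _ (by simpa using h1), nat_tensorHom' _ _ hi,
        nat_tensorHom' _ _ hi, Hom.nat_comp, Hom.nat_comp]
      by_cases h : i ≤ X₁.len
      · simp only [h, if_true, Hom.nat_le]
      · simp only [h, if_false]
        by_cases h2 : Hom.nat f₂ (i - X₁.len) = 0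
        · simp [h2, Hom.nat_zero, Hom.nat_of_len_le g₁ le_rfl]
        · rw [if_neg (by lia), Nat.add_sub_cancel_left])
    (associator_naturality := fun {X₁ X₂ X₃ Y₁ Y₂ Y₃} f₁ f₂ f₃ =>
        hom_ext_nat fun i (hi : i ≤ X₁.len + X₂.len + X₃.len) => by
      have h1 := Hom.nat_le ((f₁ ⊗ₘ f₂) ⊗ₘ f₃) i
      rw [Hom.nat_comp, Hom.nat_comp, nat_associator _ _ _ h1, nat_associator _ _ _ hi,
        nat_tensorHom' (f₁ ⊗ₘ f₂) f₃ (by simpa using hi),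
        nat_tensorHom' f₁ (f₂ ⊗ₘ f₃) (by simp only [len_tensorObj]; lia)]
      simp only [len_tensorObj]
      by_cases h : i ≤ X₁.len
      · rw [if_pos (by lia), if_pos h, nat_tensorHom' _ _ (by lia), if_pos h]
      · rw [if_neg h, nat_tensorHom' f₂ f₃ (by lia)]
        by_cases h2 : i ≤ X₁.len + X₂.len
        · rw [if_pos h2, if_pos (by lia), nat_tensorHom' _ _ h2, if_neg h]
        · rw [if_neg h2, if_neg (by lia), Nat.add_assoc, Nat.sub_sub])
    (leftUnitor_naturality := fun {X Y} f => hom_ext_nat fun i (hi : i ≤ 0 + X.len) => by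
      have h1 := Hom.nat_le (𝟙 (𝟙_ FinInterval) ⊗ₘ f) i
      rw [Hom.nat_comp, Hom.nat_comp, nat_leftUnitor _ (by simpa using h1),
        nat_leftUnitor _ (by simpa using hi), nat_tensorHom' _ _ hi]
      split_ifs with h
      · obtain rfl : i = 0 := by simpa using h
        simp [Hom.nat_zero]
      · simp)
    (rightUnitor_naturality := fun {X Y} f => hom_ext_nat fun i (hi : i ≤ X.len + 0) => by
      have h1 := Hom.nat_le (f ⊗ₘ 𝟙 (𝟙_ FinInterval)) i
      rw [Hom.nat_comp, Hom.nat_comp, nat_rightUnitor _ (by simpa using h1),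
        nat_rightUnitor _ (by simpa using hi), nat_tensorHom' _ _ hi, if_pos (by simpa using hi)])
    (pentagon := fun W X Y Z => hom_ext_nat fun i (hi : i ≤ W.len + X.len + Y.len + Z.len) => by
      have e1 : Hom.nat ((α_ W X Y).hom ⊗ₘ 𝟙 Z) i = i := by
        rw [nat_tensorHom' _ _ (by simpa using hi)]
        split_ifs with h
        · exact nat_associator _ _ _ (by simpa using h)
        · simp only [len_tensorObj] at h ⊢
          rw [Hom.nat_id _ (by lia)]
          lia
      have e2 : Hom.nat (𝟙 W ⊗ₘ (α_ X Y Z).hom) i = i := by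
        rw [nat_tensorHom' _ _ (by simp only [len_tensorObj]; lia)]
        split_ifs with h
        · exact Hom.nat_id _ h
        · rw [nat_associator _ _ _ (by lia)]
          lia
      simp only [Hom.nat_comp]
      rw [e1, nat_associator W (X ⊗ Y) Z (by simp only [len_tensorObj]; lia), e2,
        nat_associator (W ⊗ X) Y Z (by simpa using hi),
        nat_associator W X (Y ⊗ Z) (by simp only [len_tensorObj]; lia)])
    (triangle := fun X Y => hom_ext_nat fun i (hi : i ≤ X.len + 0 + Y.len) => by
      rw [Hom.nat_comp, nat_associator _ _ _ (by simpa using hi),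
        nat_tensorHom' _ _ (by simp only [len_tensorObj, len_tensorUnit]; lia),
        nat_tensorHom' _ _ (by simpa using hi)]
      simp only [len_tensorObj, len_tensorUnit, Nat.add_zero]
      split_ifs with h
      · rw [Hom.nat_id _ h, nat_rightUnitor _ h]
      · rw [nat_leftUnitor _ (by lia), Hom.nat_id _ (by lia)])

/-- The coface map `[p + q + 1] ⟶ [p + 1] + [q + 1]` omitting the vertex `p + 1` at which the two
intervals are glued. -/
def glueCoface (p q : ℕ) :
    (⟨p + q + 1⟩ : FinInterval) ⟶ (⟨p + 1⟩ : FinInterval) ⊗ (⟨q + 1⟩ : FinInterval) :=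
  homMk _ _ (fun i => if i ≤ p then i else i + 1)
    (fun i j h _ => by split_ifs <;> lia) (by simp)
    (by simp only [len_tensorObj]; split_ifs <;> lia)

/-- The codegeneracy `[1] ⟶ [0]`. -/
def codegeneracyZero : (⟨1⟩ : FinInterval) ⟶ 𝟙_ FinInterval :=
  homMk _ _ (fun _ => 0) (fun _ _ _ _ => le_rfl) rfl rfl

end FinInterval

/-- The object `[inner + 1]` of the narrow simplex category; `inner` counts the vertices that are
different from the two endpoints, so that the objects are the `[n]` with `n > 0`. -/
@[ext]
structure NarrowSimplex where
  inner : ℕ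

namespace NarrowSimplex

/-- The interval `[inner + 1]` underlying an object. -/
def toInterval (p : NarrowSimplex) : FinInterval := ⟨p.inner + 1⟩

@[simp] theorem len_toInterval (p : NarrowSimplex) : p.toInterval.len = p.inner + 1 := rfl

/-- A morphism `f : [m] ⟶ [n]`: a monotone map with `f⁻¹ {0} = {0}` and `f⁻¹ {n} = {m}`. -/
structure Hom (p q : NarrowSimplex) where
  toInterval : p.toInterval ⟶ q.toInterval
  eq_zero : ∀ i, toInterval.toOrderHom i = 0 → i = 0
  eq_last : ∀ i, toInterval.toOrderHom i = Fin.last _ → i = Fin.last _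

instance : Category NarrowSimplex where
  Hom := Hom
  id p := ⟨𝟙 _, fun _ h => h, fun _ h => h⟩
  comp f g := ⟨f.toInterval ≫ g.toInterval,
    fun i h => f.eq_zero i (g.eq_zero _ h), fun i h => f.eq_last i (g.eq_last _ h)⟩

/-- The inclusion of the narrow simplex category into the category of finite intervals. -/
@[simps]
def inclusion : NarrowSimplex ⥤ FinInterval where
  obj p := p.toInterval
  map f := f.toInterval

variable {p q r s : NarrowSimplex}

theorem hom_ext {f g : p ⟶ q} (h : f.toInterval = g.toInterval) : f = g := by
  obtain ⟨f, _, _⟩ := f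
  obtain ⟨g, _, _⟩ := g
  obtain rfl : f = g := h
  rfl

@[simp] theorem toInterval_id : Hom.toInterval (𝟙 p) = 𝟙 _ := rfl

@[simp] theorem toInterval_comp (f : p ⟶ q) (g : q ⟶ r) :
    Hom.toInterval (f ≫ g) = f.toInterval ≫ g.toInterval := rfl

/-- The action of a morphism on the underlying natural numbers. -/
def Hom.nat (f : p ⟶ q) (i : ℕ) : ℕ := FinInterval.Hom.nat f.toInterval i

theorem hom_ext_nat {f g : p ⟶ q} (h : ∀ i, i ≤ p.inner + 1 → Hom.nat f i = Hom.nat g i) :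
    f = g :=
  hom_ext (FinInterval.hom_ext_nat h)

@[simp] theorem Hom.nat_id {i : ℕ} (h : i ≤ p.inner + 1) : Hom.nat (𝟙 p) i = i :=
  FinInterval.Hom.nat_id _ h

@[simp] theorem Hom.nat_comp (f : p ⟶ q) (g : q ⟶ r) (i : ℕ) :
    Hom.nat (f ≫ g) i = Hom.nat g (Hom.nat f i) :=
  FinInterval.Hom.nat_comp _ _ _

theorem Hom.nat_zero (f : p ⟶ q) : Hom.nat f 0 = 0 := FinInterval.Hom.nat_zero _

theorem Hom.nat_last (f : p ⟶ q) : Hom.nat f (p.inner + 1) = q.inner + 1 :=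
  FinInterval.Hom.nat_of_len_le f.toInterval le_rfl

theorem Hom.nat_mono (f : p ⟶ q) {i j : ℕ} (h : i ≤ j) : Hom.nat f i ≤ Hom.nat f j :=
  FinInterval.Hom.nat_mono _ h

theorem Hom.nat_pos (f : p ⟶ q) {i : ℕ} (h : 0 < i) : 0 < Hom.nat f i := by
  rcases Nat.lt_or_ge i (p.inner + 2) with h2 | h2
  · by_contra h3
    have h4 := f.eq_zero ⟨i, h2⟩ (Fin.ext (by
      rw [FinInterval.Hom.nat_eq]
      exact Nat.eq_zero_of_not_pos h3))
    have := congrArg Fin.val h4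
    simp at this
    lia
  · have : Hom.nat f i = q.inner + 1 :=
      FinInterval.Hom.nat_of_len_le f.toInterval (by simp; lia)
    lia

theorem Hom.nat_lt (f : p ⟶ q) {i : ℕ} (h : i < p.inner + 1) : Hom.nat f i < q.inner + 1 := by
  have h1 : Hom.nat f i ≤ q.inner + 1 := FinInterval.Hom.nat_le f.toInterval i
  refine lt_of_le_of_ne h1 fun h3 => ?_
  have h4 := f.eq_last ⟨i, by simp; lia⟩ (Fin.ext (by
    rw [FinInterval.Hom.nat_eq]
    exact h3))
  have := congrArg Fin.val h4
  simp at this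
  lia

/-- Construct a morphism from a function on natural numbers. -/
def homMk (p q : NarrowSimplex) (f : ℕ → ℕ) (mono : ∀ i j, i ≤ j → j ≤ p.inner + 1 → f i ≤ f j)
    (zero : f 0 = 0) (last : f (p.inner + 1) = q.inner + 1)
    (pos : ∀ i, 0 < i → i ≤ p.inner + 1 → 0 < f i)
    (lt : ∀ i, i < p.inner + 1 → f i < q.inner + 1) : p ⟶ q where
  toInterval := FinInterval.homMk _ _ f mono zero last
  eq_zero := fun i h => by
    have h' : f i.val = 0 := congrArg Fin.val h
    by_contra h2
    have := pos i.val (Nat.pos_of_ne_zero fun h3 => h2 (Fin.ext h3))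
      (by have := i.isLt; simp only [len_toInterval] at this; lia)
    lia
  eq_last := fun i h => by
    have h' : f i.val = q.inner + 1 := congrArg Fin.val h
    by_contra h2
    have h3 : i.val ≠ p.inner + 1 := fun h3 => h2 (Fin.ext h3)
    have := lt i.val (by have := i.isLt; simp only [len_toInterval] at this; lia)
    lia

@[simp] theorem nat_homMk (f : ℕ → ℕ) (mono zero last pos lt) {i : ℕ} (h : i ≤ p.inner + 1) :
    Hom.nat (homMk p q f mono zero last pos lt) i = f i :=
  FinInterval.nat_homMk (m := p.toInterval) (n := q.toInterval) f mono zero last h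

/-- The product `f ⋄ g` of morphisms: `i ↦ f i` before the last vertex of `f`, and a shifted copy
of `g` from there on. -/
def tensorHom (f : p ⟶ r) (g : q ⟶ s) :
    (⟨p.inner + q.inner⟩ : NarrowSimplex) ⟶ ⟨r.inner + s.inner⟩ :=
  homMk _ _ (fun i => if i < p.inner + 1 then Hom.nat f i else r.inner + Hom.nat g (i - p.inner))
    (fun i j h _ => by
      split_ifs with h1 h2
      · exact Hom.nat_mono f h
      · have := Hom.nat_lt f h1
        lia
      · lia
      · have := Hom.nat_mono g (Nat.sub_le_sub_right h p.inner)
        lia)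
    (by simp [Hom.nat_zero])
    (by
      rw [if_neg (by lia), show p.inner + q.inner + 1 - p.inner = q.inner + 1 by lia, Hom.nat_last]
      lia)
    (fun i h _ => by
      split_ifs with h1
      · exact Hom.nat_pos f h
      · have := Hom.nat_pos g (i := i - p.inner) (by lia)
        lia)
    (fun i h => by
      dsimp only at h ⊢
      split_ifs with h1
      · have := Hom.nat_lt f h1
        lia
      · have := Hom.nat_lt g (i := i - p.inner) (by lia)
        lia)

/-- The isomorphism between narrow simplices with equally many vertices. -/
def castIso (h : p.inner = q.inner) : p ≅ q where
  hom := homMk _ _ id (fun _ _ h _ => h) rfl (by simp [h]) (fun _ h _ => h)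
    (fun _ hi => by simpa [h] using hi)
  inv := homMk _ _ id (fun _ _ h _ => h) rfl (by simp [h]) (fun _ h _ => h)
    (fun _ hi => by simpa [h] using hi)
  hom_inv_id := hom_ext_nat fun i hi => by
    rw [Hom.nat_comp, nat_homMk _ _ _ _ _ _ hi, nat_homMk _ _ _ _ _ _ (by simpa [← h] using hi),
      Hom.nat_id hi]
    rfl
  inv_hom_id := hom_ext_nat fun i hi => by
    rw [Hom.nat_comp, nat_homMk _ _ _ _ _ _ hi, nat_homMk _ _ _ _ _ _ (by simpa [h] using hi),
      Hom.nat_id hi]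
    rfl

theorem nat_castIso_hom (h : p.inner = q.inner) {i : ℕ} (hi : i ≤ p.inner + 1) :
    Hom.nat (castIso h).hom i = i :=
  nat_homMk _ (fun _ _ h _ => h) rfl (by simp [h]) (fun _ h _ => h)
    (fun _ hi => by simpa [h] using hi) hi

instance : MonoidalCategoryStruct NarrowSimplex where
  tensorObj p q := ⟨p.inner + q.inner⟩
  tensorUnit := ⟨0⟩
  tensorHom f g := tensorHom f g
  whiskerLeft p _ _ f := tensorHom (𝟙 p) f
  whiskerRight f q := tensorHom f (𝟙 q)
  associator _ _ _ := castIso (Nat.add_assoc _ _ _)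
  leftUnitor _ := castIso (Nat.zero_add _)
  rightUnitor _ := castIso (Nat.add_zero _)

@[simp] theorem inner_tensorObj : (p ⊗ q).inner = p.inner + q.inner := rfl

@[simp] theorem inner_tensorUnit : (𝟙_ NarrowSimplex).inner = 0 := rfl

theorem nat_tensorHom (f : p ⟶ r) (g : q ⟶ s) {i : ℕ} (h : i ≤ p.inner + q.inner + 1) :
    Hom.nat (f ⊗ₘ g) i =
      if i < p.inner + 1 then Hom.nat f i else r.inner + Hom.nat g (i - p.inner) := by
  change Hom.nat (tensorHom f g) i = _
  exact nat_homMk (p := ⟨p.inner + q.inner⟩) (q := ⟨r.inner + s.inner⟩)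
    (fun i => if i < p.inner + 1 then Hom.nat f i else r.inner + Hom.nat g (i - p.inner))
    _ _ _ _ _ h

theorem nat_associator (p q r : NarrowSimplex) {i : ℕ} (h : i ≤ p.inner + q.inner + r.inner + 1) :
    Hom.nat (α_ p q r).hom i = i :=
  nat_castIso_hom _ h

theorem nat_leftUnitor (p : NarrowSimplex) {i : ℕ} (h : i ≤ p.inner + 1) :
    Hom.nat (λ_ p).hom i = i :=
  nat_castIso_hom _ (by simpa using h)

theorem nat_rightUnitor (p : NarrowSimplex) {i : ℕ} (h : i ≤ p.inner + 1) :
    Hom.nat (ρ_ p).hom i = i :=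
  nat_castIso_hom _ (by simpa using h)

instance : MonoidalCategory NarrowSimplex :=
  MonoidalCategory.ofTensorHom
    (id_tensorHom_id := fun p q => hom_ext_nat fun i (hi : i ≤ p.inner + q.inner + 1) => by
      rw [nat_tensorHom _ _ hi, Hom.nat_id (p := p ⊗ q) hi]
      split_ifs with h
      · exact Hom.nat_id h.le
      · rw [Hom.nat_id (by lia)]
        lia)
    (tensorHom_comp_tensorHom := fun {X₁ Y₁ Z₁ X₂ Y₂ Z₂} f₁ f₂ g₁ g₂ =>
        hom_ext_nat fun i (hi : i ≤ X₁.inner + X₂.inner + 1) => by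
      have h1 : Hom.nat (f₁ ⊗ₘ f₂) i ≤ Y₁.inner + Y₂.inner + 1 := FinInterval.Hom.nat_le _ i
      rw [Hom.nat_comp, nat_tensorHom _ _ h1, nat_tensorHom _ _ hi,
        nat_tensorHom _ _ hi, Hom.nat_comp, Hom.nat_comp]
      by_cases h : i < X₁.inner + 1
      · simp only [h, if_true, Hom.nat_lt f₁ h]
      · have h2 := Hom.nat_pos f₂ (i := i - X₁.inner) (by lia)
        simp only [h, if_false]
        rw [if_neg (by lia), Nat.add_sub_cancel_left])
    (associator_naturality := fun {X₁ X₂ X₃ Y₁ Y₂ Y₃} f₁ f₂ f₃ =>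
        hom_ext_nat fun i (hi : i ≤ X₁.inner + X₂.inner + X₃.inner + 1) => by
      have h1 : Hom.nat ((f₁ ⊗ₘ f₂) ⊗ₘ f₃) i ≤ Y₁.inner + Y₂.inner + Y₃.inner + 1 :=
        FinInterval.Hom.nat_le _ i
      rw [Hom.nat_comp, Hom.nat_comp, nat_associator _ _ _ h1, nat_associator _ _ _ hi,
        nat_tensorHom (f₁ ⊗ₘ f₂) f₃ (by simpa using hi),
        nat_tensorHom f₁ (f₂ ⊗ₘ f₃) (by simp only [inner_tensorObj]; lia)]
      simp only [inner_tensorObj]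
      by_cases h : i < X₁.inner + 1
      · rw [if_pos (by lia), if_pos h, nat_tensorHom _ _ (by lia), if_pos h]
      · rw [if_neg h, nat_tensorHom f₂ f₃ (by lia)]
        by_cases h2 : i < X₁.inner + X₂.inner + 1
        · rw [if_pos h2, if_pos (by lia), nat_tensorHom _ _ (by lia), if_neg h]
        · rw [if_neg h2, if_neg (by lia), Nat.add_assoc, Nat.sub_sub])
    (leftUnitor_naturality := fun {X Y} f => hom_ext_nat fun i (hi : i ≤ 0 + X.inner + 1) => by
      have h1 : Hom.nat (𝟙 (𝟙_ NarrowSimplex) ⊗ₘ f) i ≤ 0 + Y.inner + 1 :=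
        FinInterval.Hom.nat_le _ i
      rw [Hom.nat_comp, Hom.nat_comp, nat_leftUnitor _ (by simpa using h1),
        nat_leftUnitor _ (by simpa using hi), nat_tensorHom _ _ hi]
      split_ifs with h
      · obtain rfl : i = 0 := by simpa using h
        simp [Hom.nat_zero]
      · simp)
    (rightUnitor_naturality := fun {X Y} f => hom_ext_nat fun i (hi : i ≤ X.inner + 0 + 1) => by
      have h1 : Hom.nat (f ⊗ₘ 𝟙 (𝟙_ NarrowSimplex)) i ≤ Y.inner + 0 + 1 :=
        FinInterval.Hom.nat_le _ i
      rw [Hom.nat_comp, Hom.nat_comp, nat_rightUnitor _ (by simpa using h1),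
        nat_rightUnitor _ (by simpa using hi), nat_tensorHom _ _ hi]
      split_ifs with h
      · rfl
      · obtain rfl : i = X.inner + 1 := by lia
        rw [Hom.nat_last, Nat.add_sub_cancel_left, Hom.nat_id (by simp)])
    (pentagon := fun W X Y Z => hom_ext_nat
        fun i (hi : i ≤ W.inner + X.inner + Y.inner + Z.inner + 1) => by
      have e1 : Hom.nat ((α_ W X Y).hom ⊗ₘ 𝟙 Z) i = i := by
        rw [nat_tensorHom _ _ (by simpa using hi)]
        split_ifs with h
        · exact nat_associator _ _ _ (by simpa using h.le)
        · simp only [inner_tensorObj] at h ⊢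
          rw [Hom.nat_id (by lia)]
          lia
      have e2 : Hom.nat (𝟙 W ⊗ₘ (α_ X Y Z).hom) i = i := by
        rw [nat_tensorHom _ _ (by simp only [inner_tensorObj]; lia)]
        split_ifs with h
        · exact Hom.nat_id h.le
        · rw [nat_associator _ _ _ (by lia)]
          lia
      simp only [Hom.nat_comp]
      rw [e1, nat_associator W (X ⊗ Y) Z (by simp only [inner_tensorObj]; lia), e2,
        nat_associator (W ⊗ X) Y Z (by simpa using hi),
        nat_associator W X (Y ⊗ Z) (by simp only [inner_tensorObj]; lia)])
    (triangle := fun X Y => hom_ext_nat fun i (hi : i ≤ X.inner + 0 + Y.inner + 1) => by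
      rw [Hom.nat_comp, nat_associator _ _ _ (by simpa using hi),
        nat_tensorHom _ _ (by simp only [inner_tensorObj, inner_tensorUnit]; lia),
        nat_tensorHom _ _ (by simpa using hi)]
      simp only [inner_tensorObj, inner_tensorUnit, Nat.add_zero]
      split_ifs with h
      · rw [Hom.nat_id h.le, nat_rightUnitor _ h.le]
      · rw [nat_leftUnitor _ (by lia), Hom.nat_id (by lia)])

end NarrowSimplex

/-- A `k`-quiver on the set `S`: a family of `k`-modules indexed by `S × S`. -/
structure ModQuiver (S : Type u) (k : Type u) [CommRing k] where
  obj : S → S → ModuleCat.{u} k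

namespace ModQuiver

variable {S T : Type u} {k : Type u} [CommRing k]

/-- A morphism of quivers: a family of linear maps. -/
structure Hom (Q P : ModQuiver S k) where
  app : ∀ a b, Q.obj a b ⟶ P.obj a b

instance : Category (ModQuiver S k) where
  Hom := Hom
  id Q := ⟨fun a b => 𝟙 (Q.obj a b)⟩
  comp f g := ⟨fun a b => f.app a b ≫ g.app a b⟩

theorem hom_ext {Q P : ModQuiver S k} {f g : Q ⟶ P} (h : ∀ a b, f.app a b = g.app a b) :
    f = g := by
  obtain ⟨f⟩ := f
  obtain ⟨g⟩ := g
  exact congrArg Hom.mk (funext fun a => funext fun b => h a b)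

theorem hom_ext' {Q P : ModQuiver S k} {f g : Q ⟶ P}
    (h : ∀ a b, (f.app a b).hom = (g.app a b).hom) : f = g :=
  hom_ext fun a b => ModuleCat.hom_ext (h a b)

theorem comp_app_apply {Q P R : ModQuiver S k} (f : Q ⟶ P) (g : P ⟶ R) (a b : S)
    (x : Q.obj a b) : ((f ≫ g).app a b).hom x = (g.app a b).hom ((f.app a b).hom x) := rfl

theorem id_app_apply (Q : ModQuiver S k) (a b : S) (x : Q.obj a b) :
    (Hom.app (𝟙 Q) a b).hom x = x := rfl

/-- The tensor product `(Q ⊗ P)(a, b) = ⨁ c, Q(a, c) ⊗ P(c, b)`. -/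
noncomputable def tensorObj (Q P : ModQuiver S k) : ModQuiver S k :=
  ⟨fun a b => ModuleCat.of k (⨁ c, (Q.obj a c ⊗[k] P.obj c b))⟩

/-- The unit quiver: `k` on the diagonal and zero elsewhere, written as the free module on the
truth value of `a = b`. -/
noncomputable def tensorUnit (S : Type u) (k : Type u) [CommRing k] : ModQuiver S k :=
  ⟨fun a b => ModuleCat.of k (PLift (a = b) →₀ k)⟩

/-- The element `x ⊗ y` in the summand `Q(a, c) ⊗ P(c, b)` of `(Q ⊗ P)(a, b)`. -/
noncomputable def tmul (Q P : ModQuiver S k) (a c b : S) :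
    Q.obj a c →ₗ[k] P.obj c b →ₗ[k] (tensorObj Q P).obj a b :=
  open scoped Classical in
  (TensorProduct.mk k (Q.obj a c) (P.obj c b)).compr₂
    (DirectSum.lof k S (fun c => (Q.obj a c ⊗[k] P.obj c b)) c)

/-- The linear map out of `(Q ⊗ P)(a, b)` given by a family of bilinear maps. -/
noncomputable def tensorDesc {Q P : ModQuiver S k} {a b : S} {M : Type u} [AddCommGroup M]
    [Module k M] (f : ∀ c, Q.obj a c →ₗ[k] P.obj c b →ₗ[k] M) : (tensorObj Q P).obj a b →ₗ[k] M :=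
  open scoped Classical in
  DirectSum.toModule k S M (fun c => TensorProduct.lift (f c))

theorem tensorDesc_tmul {Q P : ModQuiver S k} {a b : S} {M : Type u} [AddCommGroup M]
    [Module k M] (f : ∀ c, Q.obj a c →ₗ[k] P.obj c b →ₗ[k] M) (c : S) (x : Q.obj a c)
    (y : P.obj c b) : tensorDesc f (tmul Q P a c b x y) = f c x y := by
  classical
  refine (DirectSum.toModule_lof (M := fun c => (Q.obj a c ⊗[k] P.obj c b)) k c
    (x ⊗ₜ[k] y)).trans ?_
  exact TensorProduct.lift.tmul x y

theorem tensor_ext {Q P : ModQuiver S k} {a b : S} {M : Type u} [AddCommGroup M]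
    [Module k M] {f g : (tensorObj Q P).obj a b →ₗ[k] M}
    (h : ∀ c x y, f (tmul Q P a c b x y) = g (tmul Q P a c b x y)) : f = g := by
  classical
  exact DirectSum.linearMap_ext k fun c => TensorProduct.ext' fun x y => h c x y

/-- The generator of the unit quiver at `a`. -/
noncomputable def one (a : S) : (tensorUnit S k).obj a a :=
  (Finsupp.single (PLift.up rfl) 1 : PLift (a = a) →₀ k)

/-- The linear map out of the unit quiver given by the images of the generators. -/
noncomputable def unitDesc {a b : S} {M : Type u} [AddCommGroup M]
    [Module k M] (m : a = b → M) : (tensorUnit S k).obj a b →ₗ[k] M :=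
  Finsupp.linearCombination k (fun h : PLift (a = b) => m h.down)

theorem unitDesc_one {a : S} {M : Type u} [AddCommGroup M]
    [Module k M] (m : a = a → M) : unitDesc m (one a : (tensorUnit S k).obj a a) = m rfl :=
  (Finsupp.linearCombination_single k 1 (PLift.up rfl)).trans (one_smul k _)

theorem unit_ext {a b : S} {M : Type u} [AddCommGroup M]
    [Module k M] {f g : (tensorUnit S k).obj a b →ₗ[k] M}
    (h : ∀ e : a = b, f (e ▸ one a) = g (e ▸ one a)) : f = g := by
  refine Finsupp.lhom_ext' fun ⟨e⟩ => LinearMap.ext_ring ?_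
  subst e
  exact h rfl

/-- The tensor product of morphisms. -/
noncomputable def tensorHom {Q P Q' P' : ModQuiver S k} (f : Q ⟶ Q') (g : P ⟶ P') :
    tensorObj Q P ⟶ tensorObj Q' P' :=
  ⟨fun a b => ModuleCat.ofHom
    (tensorDesc fun c => (tmul Q' P' a c b).compl₁₂ (f.app a c).hom (g.app c b).hom)⟩

theorem tensorHom_tmul {Q P Q' P' : ModQuiver S k} (f : Q ⟶ Q') (g : P ⟶ P')
    (a c b : S) (x : Q.obj a c) (y : P.obj c b) :
    ((tensorHom f g).app a b).hom (tmul Q P a c b x y) =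
      tmul Q' P' a c b ((f.app a c).hom x) ((g.app c b).hom y) :=
  tensorDesc_tmul _ _ _ _

/-- The associativity isomorphism `(x ⊗ y) ⊗ z ↦ x ⊗ (y ⊗ z)`. -/
noncomputable def assocHom (Q P R : ModQuiver S k) :
    tensorObj (tensorObj Q P) R ⟶ tensorObj Q (tensorObj P R) :=
  ⟨fun a b => ModuleCat.ofHom (tensorDesc fun d => tensorDesc fun c =>
    LinearMap.mk₂ k (fun x y => (tmul Q (tensorObj P R) a c b x).comp (tmul P R c d b y))
      (fun _ _ _ => by ext; simp) (fun _ _ _ => by ext; simp)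
      (fun _ _ _ => by ext; simp) (fun _ _ _ => by ext; simp))⟩

theorem assocHom_tmul (Q P R : ModQuiver S k) (a c d b : S) (x : Q.obj a c) (y : P.obj c d)
    (z : R.obj d b) :
    ((assocHom Q P R).app a b).hom (tmul (tensorObj Q P) R a d b (tmul Q P a c d x y) z) =
      tmul Q (tensorObj P R) a c b x (tmul P R c d b y z) :=
  (tensorDesc_tmul _ _ _ _).trans (LinearMap.congr_fun (tensorDesc_tmul _ _ _ _) z)

/-- The inverse `x ⊗ (y ⊗ z) ↦ (x ⊗ y) ⊗ z` of the associativity isomorphism. -/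
noncomputable def assocInv (Q P R : ModQuiver S k) :
    tensorObj Q (tensorObj P R) ⟶ tensorObj (tensorObj Q P) R :=
  ⟨fun a b => ModuleCat.ofHom (tensorDesc fun c => LinearMap.flip (tensorDesc fun d =>
    LinearMap.mk₂ k
      (fun y z => ((tmul (tensorObj Q P) R a d b).flip z).comp ((tmul Q P a c d).flip y))
      (fun _ _ _ => by ext; simp) (fun _ _ _ => by ext; simp)
      (fun _ _ _ => by ext; simp) (fun _ _ _ => by ext; simp)))⟩

theorem assocInv_tmul (Q P R : ModQuiver S k) (a c d b : S) (x : Q.obj a c) (y : P.obj c d)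
    (z : R.obj d b) :
    ((assocInv Q P R).app a b).hom (tmul Q (tensorObj P R) a c b x (tmul P R c d b y z)) =
      tmul (tensorObj Q P) R a d b (tmul Q P a c d x y) z :=
  (tensorDesc_tmul _ _ _ _).trans (LinearMap.congr_fun (tensorDesc_tmul _ _ _ _) x)

theorem tensor_ext₃ {Q P R : ModQuiver S k} {a b : S} {M : Type u} [AddCommGroup M]
    [Module k M] {f g : (tensorObj (tensorObj Q P) R).obj a b →ₗ[k] M}
    (h : ∀ c d x y z, f (tmul (tensorObj Q P) R a d b (tmul Q P a c d x y) z) =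
      g (tmul (tensorObj Q P) R a d b (tmul Q P a c d x y) z)) : f = g := by
  refine tensor_ext fun d w z => ?_
  have : f.comp ((tmul (tensorObj Q P) R a d b).flip z) =
      g.comp ((tmul (tensorObj Q P) R a d b).flip z) :=
    tensor_ext fun c x y => h c d x y z
  exact LinearMap.congr_fun this w

theorem tensor_ext₃' {Q P R : ModQuiver S k} {a b : S} {M : Type u} [AddCommGroup M]
    [Module k M] {f g : (tensorObj Q (tensorObj P R)).obj a b →ₗ[k] M}
    (h : ∀ c d x y z, f (tmul Q (tensorObj P R) a c b x (tmul P R c d b y z)) =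
      g (tmul Q (tensorObj P R) a c b x (tmul P R c d b y z))) : f = g := by
  refine tensor_ext fun c x w => ?_
  have : f.comp (tmul Q (tensorObj P R) a c b x) = g.comp (tmul Q (tensorObj P R) a c b x) :=
    tensor_ext fun d y z => h c d x y z
  exact LinearMap.congr_fun this w

theorem tensor_ext₄ {Q P R V : ModQuiver S k} {a b : S} {M : Type u} [AddCommGroup M]
    [Module k M] {f g : (tensorObj (tensorObj (tensorObj Q P) R) V).obj a b →ₗ[k] M}
    (h : ∀ c d e x y z w,
      f (tmul (tensorObj (tensorObj Q P) R) V a e b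
        (tmul (tensorObj Q P) R a d e (tmul Q P a c d x y) z) w) =
      g (tmul (tensorObj (tensorObj Q P) R) V a e b
        (tmul (tensorObj Q P) R a d e (tmul Q P a c d x y) z) w)) : f = g := by
  refine tensor_ext fun e v w => ?_
  have : f.comp ((tmul (tensorObj (tensorObj Q P) R) V a e b).flip w) =
      g.comp ((tmul (tensorObj (tensorObj Q P) R) V a e b).flip w) :=
    tensor_ext₃ fun c d x y z => h c d e x y z w
  exact LinearMap.congr_fun this v

/-- The left unit isomorphism. -/
noncomputable def leftUnitorHom (Q : ModQuiver S k) : tensorObj (tensorUnit S k) Q ⟶ Q :=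
  ⟨fun _ _ => ModuleCat.ofHom (tensorDesc fun _ => unitDesc fun h => h ▸ LinearMap.id)⟩

theorem leftUnitorHom_tmul (Q : ModQuiver S k) (a b : S) (x : Q.obj a b) :
    ((leftUnitorHom Q).app a b).hom (tmul (tensorUnit S k) Q a a b (one a) x) = x :=
  (tensorDesc_tmul _ _ _ _).trans (LinearMap.congr_fun (unitDesc_one _) x)

/-- The right unit isomorphism. -/
noncomputable def rightUnitorHom (Q : ModQuiver S k) : tensorObj Q (tensorUnit S k) ⟶ Q :=
  ⟨fun _ _ => ModuleCat.ofHom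
    (tensorDesc fun _ => LinearMap.flip (unitDesc fun h => h ▸ LinearMap.id))⟩

theorem rightUnitorHom_tmul (Q : ModQuiver S k) (a b : S) (x : Q.obj a b) :
    ((rightUnitorHom Q).app a b).hom (tmul Q (tensorUnit S k) a b b x (one b)) = x :=
  (tensorDesc_tmul _ _ _ _).trans (LinearMap.congr_fun (unitDesc_one _) x)

theorem tensor_ext_left {Q : ModQuiver S k} {a b : S} {M : Type u} [AddCommGroup M]
    [Module k M] {f g : (tensorObj (tensorUnit S k) Q).obj a b →ₗ[k] M}
    (h : ∀ x, f (tmul (tensorUnit S k) Q a a b (one a) x) =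
      g (tmul (tensorUnit S k) Q a a b (one a) x)) : f = g := by
  refine tensor_ext fun c w x => ?_
  have : f.comp ((tmul (tensorUnit S k) Q a c b).flip x) =
      g.comp ((tmul (tensorUnit S k) Q a c b).flip x) := by
    refine unit_ext fun e => ?_
    subst e
    exact h x
  exact LinearMap.congr_fun this w

theorem tensor_ext_right {Q : ModQuiver S k} {a b : S} {M : Type u} [AddCommGroup M]
    [Module k M] {f g : (tensorObj Q (tensorUnit S k)).obj a b →ₗ[k] M}
    (h : ∀ x, f (tmul Q (tensorUnit S k) a b b x (one b)) =
      g (tmul Q (tensorUnit S k) a b b x (one b))) : f = g := by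
  refine tensor_ext fun c x w => ?_
  have : ∀ e : c = b, f (tmul Q (tensorUnit S k) a c b x (e ▸ one c)) =
      g (tmul Q (tensorUnit S k) a c b x (e ▸ one c)) := by
    intro e
    subst e
    exact h x
  exact LinearMap.congr_fun (f := f.comp (tmul Q (tensorUnit S k) a c b x))
    (g := g.comp (tmul Q (tensorUnit S k) a c b x)) (unit_ext fun e => this e) w

noncomputable instance : MonoidalCategoryStruct (ModQuiver S k) where
  tensorObj := tensorObj
  tensorUnit := tensorUnit S k
  tensorHom f g := tensorHom f g
  whiskerLeft Q _ _ f := tensorHom (𝟙 Q) f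
  whiskerRight f Q := tensorHom f (𝟙 Q)
  associator Q P R :=
    { hom := assocHom Q P R
      inv := assocInv Q P R
      hom_inv_id := hom_ext' fun a b => tensor_ext₃ fun c d x y z => by
        rw [comp_app_apply, assocHom_tmul, assocInv_tmul]
        rfl
      inv_hom_id := hom_ext' fun a b => tensor_ext₃' fun c d x y z => by
        rw [comp_app_apply, assocInv_tmul, assocHom_tmul]
        rfl }
  leftUnitor Q :=
    { hom := leftUnitorHom Q
      inv := ⟨fun a b => ModuleCat.ofHom (tmul (tensorUnit S k) Q a a b (one a))⟩
      hom_inv_id := hom_ext' fun a b => tensor_ext_left fun x => by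
        rw [comp_app_apply, leftUnitorHom_tmul]
        rfl
      inv_hom_id := hom_ext' fun a b => LinearMap.ext fun x => leftUnitorHom_tmul Q a b x }
  rightUnitor Q :=
    { hom := rightUnitorHom Q
      inv := ⟨fun a b => ModuleCat.ofHom ((tmul Q (tensorUnit S k) a b b).flip (one b))⟩
      hom_inv_id := hom_ext' fun a b => tensor_ext_right fun x => by
        rw [comp_app_apply, rightUnitorHom_tmul]
        rfl
      inv_hom_id := hom_ext' fun a b => LinearMap.ext fun x => rightUnitorHom_tmul Q a b x }

noncomputable instance : MonoidalCategory (ModQuiver S k) :=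
  MonoidalCategory.ofTensorHom
    (id_tensorHom_id := fun Q P => hom_ext' fun a b =>
      tensor_ext fun c x y => tensorHom_tmul (𝟙 Q) (𝟙 P) a c b x y)
    (tensorHom_comp_tensorHom := fun f₁ f₂ g₁ g₂ => hom_ext' fun a b =>
      tensor_ext fun c x y => by
        change ((tensorHom g₁ g₂).app a b).hom (((tensorHom f₁ f₂).app a b).hom _) =
          ((tensorHom (f₁ ≫ g₁) (f₂ ≫ g₂)).app a b).hom _
        simp only [tensorHom_tmul, comp_app_apply])
    (associator_naturality := fun {X₁ X₂ X₃ Y₁ Y₂ Y₃} f₁ f₂ f₃ =>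
      hom_ext' fun a b => tensor_ext₃ fun c d x y z => by
        change ((assocHom Y₁ Y₂ Y₃).app a b).hom
            (((tensorHom (tensorHom f₁ f₂) f₃).app a b).hom _) =
          ((tensorHom f₁ (tensorHom f₂ f₃)).app a b).hom (((assocHom X₁ X₂ X₃).app a b).hom _)
        simp only [tensorHom_tmul, assocHom_tmul])
    (leftUnitor_naturality := fun {X Y} f => hom_ext' fun a b => tensor_ext_left fun x => by
        change ((leftUnitorHom Y).app a b).hom
            (((tensorHom (𝟙 (tensorUnit S k)) f).app a b).hom _) =
          (f.app a b).hom (((leftUnitorHom X).app a b).hom _)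
        simp only [tensorHom_tmul, leftUnitorHom_tmul, id_app_apply])
    (rightUnitor_naturality := fun {X Y} f => hom_ext' fun a b => tensor_ext_right fun x => by
        change ((rightUnitorHom Y).app a b).hom
            (((tensorHom f (𝟙 (tensorUnit S k))).app a b).hom _) =
          (f.app a b).hom (((rightUnitorHom X).app a b).hom _)
        simp only [tensorHom_tmul, rightUnitorHom_tmul, id_app_apply])
    (pentagon := fun W X Y Z => hom_ext' fun a b => tensor_ext₄ fun c d e x y z w => by
        change ((tensorHom (𝟙 W) (assocHom X Y Z)).app a b).hom
            (((assocHom W (tensorObj X Y) Z).app a b).hom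
              (((tensorHom (assocHom W X Y) (𝟙 Z)).app a b).hom _)) =
          ((assocHom W X (tensorObj Y Z)).app a b).hom
            (((assocHom (tensorObj W X) Y Z).app a b).hom _)
        simp only [tensorHom_tmul, assocHom_tmul, id_app_apply])
    (triangle := fun X Y => hom_ext' fun a b => tensor_ext fun d v z => by
        change ((tensorHom (𝟙 X) (leftUnitorHom Y)).app a b).hom
            (((assocHom X (tensorUnit S k) Y).app a b).hom
              (tmul (tensorObj X (tensorUnit S k)) Y a d b v z)) =
            ((tensorHom (rightUnitorHom X) (𝟙 Y)).app a b).hom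
              (tmul (tensorObj X (tensorUnit S k)) Y a d b v z)
        refine LinearMap.congr_fun (f := (((tensorHom (𝟙 X) (leftUnitorHom Y)).app a b).hom.comp
            (((assocHom X (tensorUnit S k) Y).app a b).hom.comp
              ((tmul (tensorObj X (tensorUnit S k)) Y a d b).flip z))))
            (g := ((tensorHom (rightUnitorHom X) (𝟙 Y)).app a b).hom.comp
              ((tmul (tensorObj X (tensorUnit S k)) Y a d b).flip z))
            (tensor_ext_right fun x => ?_) v
        simp only [LinearMap.comp_apply, LinearMap.flip_apply, tensorHom_tmul, assocHom_tmul,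
          leftUnitorHom_tmul, rightUnitorHom_tmul, id_app_apply])

/-- The inverse image `f^* Q (a, b) = Q (f a, f b)` of a quiver along a map of sets `f`. -/
abbrev pullObj (f : S → T) (Q : ModQuiver T k) : ModQuiver S k :=
  ⟨fun a b => Q.obj (f a) (f b)⟩

/-- The inverse image of a morphism of quivers. -/
def pullMap (f : S → T) {Q P : ModQuiver T k} (g : Q ⟶ P) : pullObj f Q ⟶ pullObj f P :=
  ⟨fun a b => g.app (f a) (f b)⟩

/-- The inverse image functor `f^*` along a map of sets `f`. -/
def pullback (k : Type u) [CommRing k] (f : S → T) : ModQuiver T k ⥤ ModQuiver S k where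
  obj Q := pullObj f Q
  map g := pullMap f g

/-- The unit of the inverse image functor: the generator at `a` is sent to the one at `f a`. -/
noncomputable def pullUnit (k : Type u) [CommRing k] (f : S → T) :
    tensorUnit S k ⟶ pullObj f (tensorUnit T k) :=
  ⟨fun a b => ModuleCat.ofHom (unitDesc (M := (tensorUnit T k).obj (f a) (f b)) fun h =>
    (Finsupp.single (PLift.up (congrArg f h)) 1 : PLift (f a = f b) →₀ k))⟩

/-- The multiplication of the inverse image functor: the summand at `c` is sent to the summand
at `f c`. -/
noncomputable def pullTensor (f : S → T) (Q P : ModQuiver T k) :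
    tensorObj (pullObj f Q) (pullObj f P) ⟶ pullObj f (tensorObj Q P) :=
  ⟨fun a b => ModuleCat.ofHom (tensorDesc (M := (tensorObj Q P).obj (f a) (f b))
    fun c => tmul Q P (f a) (f c) (f b))⟩

theorem pullUnit_one (f : S → T) (a : S) :
    ((pullUnit k f).app a a).hom (one a) = one (f a) :=
  unitDesc_one (a := a) (M := (tensorUnit T k).obj (f a) (f a)) fun h =>
    (Finsupp.single (PLift.up (congrArg f h)) 1 : PLift (f a = f a) →₀ k)

theorem pullTensor_tmul (f : S → T) (Q P : ModQuiver T k) (a c b : S)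
    (x : Q.obj (f a) (f c)) (y : P.obj (f c) (f b)) :
    ((pullTensor f Q P).app a b).hom (tmul (pullObj f Q) (pullObj f P) a c b x y) =
      tmul Q P (f a) (f c) (f b) x y :=
  tensorDesc_tmul (Q := pullObj f Q) (P := pullObj f P) (a := a) (b := b)
    (M := (tensorObj Q P).obj (f a) (f b)) _ c x y

theorem pullMap_apply (f : S → T) {Q P : ModQuiver T k} (g : Q ⟶ P) (a b : S)
    (x : Q.obj (f a) (f b)) :
    ((pullMap f g).app a b).hom x = (g.app (f a) (f b)).hom x := rfl

/-- The canonical lax monoidal structure on the inverse image functor. -/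
noncomputable instance (f : S → T) : (pullback k f).LaxMonoidal where
  ε := pullUnit k f
  μ := pullTensor f
  μ_natural_left {X Y} g X' := hom_ext' (Q := tensorObj (pullObj f X) (pullObj f X'))
      (P := pullObj f (tensorObj Y X')) fun a b => tensor_ext fun c x y => by
    change ((pullTensor f Y X').app a b).hom
        (((tensorHom (pullMap f g) (𝟙 (pullObj f X'))).app a b).hom _) =
      ((pullMap f (tensorHom g (𝟙 X'))).app a b).hom (((pullTensor f X X').app a b).hom _)
    rw [tensorHom_tmul, pullTensor_tmul, pullTensor_tmul, pullMap_apply, pullMap_apply,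
      tensorHom_tmul]
    rfl
  μ_natural_right {X Y} X' g := hom_ext' (Q := tensorObj (pullObj f X') (pullObj f X))
      (P := pullObj f (tensorObj X' Y)) fun a b => tensor_ext fun c x y => by
    change ((pullTensor f X' Y).app a b).hom
        (((tensorHom (𝟙 (pullObj f X')) (pullMap f g)).app a b).hom _) =
      ((pullMap f (tensorHom (𝟙 X') g)).app a b).hom (((pullTensor f X' X).app a b).hom _)
    rw [tensorHom_tmul, pullTensor_tmul, pullTensor_tmul, pullMap_apply, pullMap_apply,
      tensorHom_tmul]
    rfl
  associativity X Y Z := hom_ext'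
      (Q := tensorObj (tensorObj (pullObj f X) (pullObj f Y)) (pullObj f Z))
      (P := pullObj f (tensorObj X (tensorObj Y Z))) fun a b => tensor_ext₃ fun c d x y z => by
    change ((pullMap f (assocHom X Y Z)).app a b).hom
        (((pullTensor f (tensorObj X Y) Z).app a b).hom
          (((tensorHom (pullTensor f X Y) (𝟙 (pullObj f Z))).app a b).hom _)) =
      ((pullTensor f X (tensorObj Y Z)).app a b).hom
        (((tensorHom (𝟙 (pullObj f X)) (pullTensor f Y Z)).app a b).hom
          (((assocHom (pullObj f X) (pullObj f Y) (pullObj f Z)).app a b).hom _))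
    rw [assocHom_tmul, tensorHom_tmul, tensorHom_tmul, pullTensor_tmul, pullTensor_tmul,
      pullTensor_tmul, pullTensor_tmul, pullMap_apply]
    exact assocHom_tmul X Y Z _ _ _ _ _ _ _
  left_unitality X := hom_ext' (Q := tensorObj (tensorUnit S k) (pullObj f X))
      (P := pullObj f X) fun a b => tensor_ext_left fun x => by
    change ((leftUnitorHom (pullObj f X)).app a b).hom _ =
      ((pullMap f (leftUnitorHom X)).app a b).hom
        (((pullTensor f (tensorUnit T k) X).app a b).hom
          (((tensorHom (pullUnit k f) (𝟙 (pullObj f X))).app a b).hom _))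
    rw [leftUnitorHom_tmul, tensorHom_tmul, pullUnit_one, pullTensor_tmul, pullMap_apply]
    exact (leftUnitorHom_tmul X _ _ _).symm
  right_unitality X := hom_ext' (Q := tensorObj (pullObj f X) (tensorUnit S k))
      (P := pullObj f X) fun a b => tensor_ext_right fun x => by
    change ((rightUnitorHom (pullObj f X)).app a b).hom _ =
      ((pullMap f (rightUnitorHom X)).app a b).hom
        (((pullTensor f X (tensorUnit T k)).app a b).hom
          (((tensorHom (𝟙 (pullObj f X)) (pullUnit k f)).app a b).hom _))
    rw [rightUnitorHom_tmul, tensorHom_tmul, pullUnit_one, pullTensor_tmul, pullMap_apply]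
    exact (rightUnitorHom_tmul X _ _ _).symm

end ModQuiver

namespace ModQuiver

variable {S T U : Type u} {k : Type u} [CommRing k]

theorem pullUnit_comp (f : S → T) (g : T → U) :
    pullUnit k f ≫ pullMap f (pullUnit k g) = pullUnit k (g ∘ f) :=
  hom_ext' (P := pullObj (g ∘ f) (tensorUnit U k)) fun a b => unit_ext fun e => by
    subst e
    change ((pullMap f (pullUnit k g)).app a a).hom (((pullUnit k f).app a a).hom (one a)) =
      ((pullUnit k (g ∘ f)).app a a).hom (one a)
    rw [pullUnit_one, pullUnit_one, pullMap_apply, pullUnit_one]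
    rfl

theorem pullTensor_comp (f : S → T) (g : T → U) (Q P : ModQuiver U k) :
    pullTensor f (pullObj g Q) (pullObj g P) ≫ pullMap f (pullTensor g Q P) =
      pullTensor (g ∘ f) Q P :=
  hom_ext' (Q := tensorObj (pullObj f (pullObj g Q)) (pullObj f (pullObj g P)))
    (P := pullObj (g ∘ f) (tensorObj Q P)) fun a b => tensor_ext fun c x y => by
    change ((pullMap f (pullTensor g Q P)).app a b).hom
        (((pullTensor f (pullObj g Q) (pullObj g P)).app a b).hom _) =
      ((pullTensor (g ∘ f) Q P).app a b).hom _
    rw [pullTensor_tmul, pullMap_apply, pullTensor_tmul]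
    exact (pullTensor_tmul (g ∘ f) Q P a c b x y).symm

theorem pullUnit_id : pullUnit k (id : S → S) = 𝟙 (tensorUnit S k) :=
  hom_ext' (P := tensorUnit S k) fun a b => unit_ext fun e => by
    subst e
    exact pullUnit_one id a

theorem pullTensor_id (Q P : ModQuiver S k) :
    pullTensor id Q P = 𝟙 (tensorObj Q P) :=
  hom_ext' (P := tensorObj Q P) fun a b => tensor_ext fun c x y =>
    pullTensor_tmul id Q P a c b x y

theorem pullTensor_natural (f : S → T) {Q Q' P P' : ModQuiver T k} (g : Q ⟶ Q') (h : P ⟶ P') :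
    tensorHom (pullMap f g) (pullMap f h) ≫ pullTensor f Q' P' =
      pullTensor f Q P ≫ pullMap f (tensorHom g h) :=
  hom_ext' (Q := tensorObj (pullObj f Q) (pullObj f P)) (P := pullObj f (tensorObj Q' P'))
    fun a b => tensor_ext fun c x y => by
    change ((pullTensor f Q' P').app a b).hom
        (((tensorHom (pullMap f g) (pullMap f h)).app a b).hom _) =
      ((pullMap f (tensorHom g h)).app a b).hom (((pullTensor f Q P).app a b).hom _)
    rw [tensorHom_tmul, pullTensor_tmul, pullTensor_tmul, pullMap_apply, pullMap_apply,
      pullMap_apply, tensorHom_tmul]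

theorem tensorHom_comp {Q Q' Q'' P P' P'' : ModQuiver S k} (f : Q ⟶ Q') (f' : Q' ⟶ Q'')
    (g : P ⟶ P') (g' : P' ⟶ P'') :
    tensorHom (f ≫ f') (g ≫ g') = tensorHom f g ≫ tensorHom f' g' :=
  (tensorHom_comp_tensorHom f g f' g').symm

theorem tensorHom_id (Q P : ModQuiver S k) : tensorHom (𝟙 Q) (𝟙 P) = 𝟙 (tensorObj Q P) :=
  id_tensorHom_id Q P

end ModQuiver

/-- A Frobenius monoidal structure on a functor: a lax and a colax monoidal structure subject to
the two Frobenius laws. It is strongly unital: the unit comparison maps are mutually inverse. -/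
class FrobeniusMonoidal {C D : Type*} [Category* C] [Category* D] [MonoidalCategory C]
    [MonoidalCategory D] (F : C ⥤ D) extends F.LaxMonoidal, F.OplaxMonoidal where
  frobenius_left (A B C : C) :
    Functor.LaxMonoidal.μ F (A ⊗ B) C ≫ F.map (α_ A B C).hom ≫ Functor.OplaxMonoidal.δ F A (B ⊗ C) =
      Functor.OplaxMonoidal.δ F A B ▷ F.obj C ≫ (α_ (F.obj A) (F.obj B) (F.obj C)).hom ≫
        F.obj A ◁ Functor.LaxMonoidal.μ F B C
  frobenius_right (A B C : C) :
    Functor.LaxMonoidal.μ F A (B ⊗ C) ≫ F.map (α_ A B C).inv ≫ Functor.OplaxMonoidal.δ F (A ⊗ B) C =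
      F.obj A ◁ Functor.OplaxMonoidal.δ F B C ≫ (α_ (F.obj A) (F.obj B) (F.obj C)).inv ≫
        Functor.LaxMonoidal.μ F A B ▷ F.obj C
  unit_counit : Functor.LaxMonoidal.ε F ≫ Functor.OplaxMonoidal.η F = 𝟙 _
  counit_unit : Functor.OplaxMonoidal.η F ≫ Functor.LaxMonoidal.ε F = 𝟙 _

/-- A Frobenius templicial `k`-module: a set `base` with a strongly unital Frobenius monoidal
functor from finite intervals (contravariantly) to `k`-quivers on `base`. -/
structure FTemplicialModule (k : Type u) [CommRing k] where
  base : Type u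
  functor : FinIntervalᵒᵖ ⥤ ModQuiver base k
  frobenius : FrobeniusMonoidal functor

namespace FTemplicialModule

variable {k : Type u} [CommRing k]

noncomputable instance (X : FTemplicialModule k) : FrobeniusMonoidal X.functor := X.frobenius

/-- The quiver `X_I` at a finite interval `I`. -/
abbrev quiver (X : FTemplicialModule k) (I : FinInterval) : ModQuiver X.base k :=
  X.functor.obj (op I)

/-- The unit `ε : 1 ⟶ X_0`. -/
noncomputable def unit (X : FTemplicialModule k) :
    ModQuiver.tensorUnit X.base k ⟶ X.quiver (𝟙_ FinInterval) :=
  Functor.LaxMonoidal.ε X.functor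

/-- The counit `X_0 ⟶ 1`. -/
noncomputable def counit (X : FTemplicialModule k) :
    X.quiver (𝟙_ FinInterval) ⟶ ModQuiver.tensorUnit X.base k :=
  Functor.OplaxMonoidal.η X.functor

/-- The multiplication `Z^{I, J} : X_I ⊗ X_J ⟶ X_{I + J}`. -/
noncomputable def mult (X : FTemplicialModule k) (I J : FinInterval) :
    ModQuiver.tensorObj (X.quiver I) (X.quiver J) ⟶ X.quiver (I ⊗ J) :=
  Functor.LaxMonoidal.μ X.functor (op I) (op J)

/-- The comultiplication `μ_{I, J} : X_{I + J} ⟶ X_I ⊗ X_J`. -/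
noncomputable def comult (X : FTemplicialModule k) (I J : FinInterval) :
    X.quiver (I ⊗ J) ⟶ ModQuiver.tensorObj (X.quiver I) (X.quiver J) :=
  Functor.OplaxMonoidal.δ X.functor (op I) (op J)

/-- A morphism of Frobenius templicial modules: a map `f` on the bases and a natural transformation
`X ⟶ f^* Y` such that the adjoint transformation `f_! X ⟶ Y` is comonoidal and such that
`X ⟶ f^* Y` is monoidal. Comonoidality is expressed in terms of `X ⟶ f^* Y`, through the lax
structure of `f^*`, which is the mate of the colax structure of `f_!`. -/
structure Hom (X Y : FTemplicialModule k) where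
  base : X.base → Y.base
  app (I : FinInterval) : X.quiver I ⟶ ModQuiver.pullObj base (Y.quiver I)
  naturality {I J : FinInterval} (f : I ⟶ J) :
    X.functor.map f.op ≫ app I = app J ≫ ModQuiver.pullMap base (Y.functor.map f.op)
  map_counit : X.counit ≫ ModQuiver.pullUnit k base =
    app (𝟙_ FinInterval) ≫ ModQuiver.pullMap base Y.counit
  map_comult (I J : FinInterval) :
    X.comult I J ≫ ModQuiver.tensorHom (app I) (app J) ≫
      ModQuiver.pullTensor base (Y.quiver I) (Y.quiver J) =
    app (I ⊗ J) ≫ ModQuiver.pullMap base (Y.comult I J)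
  map_unit : X.unit ≫ app (𝟙_ FinInterval) =
    ModQuiver.pullUnit k base ≫ ModQuiver.pullMap base Y.unit
  map_mult (I J : FinInterval) :
    X.mult I J ≫ app (I ⊗ J) =
      ModQuiver.tensorHom (app I) (app J) ≫
        ModQuiver.pullTensor base (Y.quiver I) (Y.quiver J) ≫
          ModQuiver.pullMap base (Y.mult I J)

namespace Hom

variable {X Y Z : FTemplicialModule k}

theorem ext_app {f : X.base → Y.base}
    {α β : ∀ I, X.quiver I ⟶ ModQuiver.pullObj f (Y.quiver I)} {h₁ h₂ h₃ h₄ h₅}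
    {h₁' h₂' h₃' h₄' h₅'} (h : ∀ I a b, (α I).app a b = (β I).app a b) :
    (⟨f, α, h₁, h₂, h₃, h₄, h₅⟩ : Hom X Y) = ⟨f, β, h₁', h₂', h₃', h₄', h₅'⟩ := by
  obtain rfl : α = β := funext fun I => ModQuiver.hom_ext (h I)
  rfl

/-- The identity morphism. -/
def id (X : FTemplicialModule k) : Hom X X where
  base := _root_.id
  app I := 𝟙 (X.quiver I)
  naturality f := rfl
  map_counit := congrArg (X.counit ≫ ·) ModQuiver.pullUnit_id
  map_comult I J := by
    rw [ModQuiver.pullTensor_id, ModQuiver.tensorHom_id]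
    rfl
  map_unit := (Category.comp_id _).trans ((Category.id_comp _).symm.trans
    (congrArg (· ≫ X.unit) ModQuiver.pullUnit_id.symm))
  map_mult I J := by
    rw [ModQuiver.pullTensor_id, ModQuiver.tensorHom_id]
    rfl

/-- Composition of morphisms. -/
def comp (α : Hom X Y) (β : Hom Y Z) : Hom X Z where
  base := β.base ∘ α.base
  app I := α.app I ≫ ModQuiver.pullMap α.base (β.app I)
  naturality {I J} f :=
    (congrArg (· ≫ ModQuiver.pullMap α.base (β.app I)) (α.naturality f)).trans
      (congrArg (fun t => α.app J ≫ ModQuiver.pullMap α.base t) (β.naturality f))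
  map_counit := by
    rw [← ModQuiver.pullUnit_comp]
    exact (congrArg (· ≫ ModQuiver.pullMap α.base (ModQuiver.pullUnit k β.base))
      α.map_counit).trans
      (congrArg (fun t => α.app _ ≫ ModQuiver.pullMap α.base t) β.map_counit)
  map_comult I J := by
    rw [← ModQuiver.pullTensor_comp, ModQuiver.tensorHom_comp]
    refine (congrArg (fun t => (X.comult I J ≫ ModQuiver.tensorHom (α.app I) (α.app J)) ≫ t ≫
      ModQuiver.pullMap α.base (ModQuiver.pullTensor β.base (Z.quiver I) (Z.quiver J)))
      (ModQuiver.pullTensor_natural α.base (β.app I) (β.app J))).trans ?_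
    refine (congrArg (fun t => t ≫ ModQuiver.pullMap α.base
      (ModQuiver.tensorHom (β.app I) (β.app J) ≫
        ModQuiver.pullTensor β.base (Z.quiver I) (Z.quiver J))) (α.map_comult I J)).trans ?_
    exact congrArg (fun t => α.app (I ⊗ J) ≫ ModQuiver.pullMap α.base t) (β.map_comult I J)
  map_unit := by
    rw [← ModQuiver.pullUnit_comp]
    exact (congrArg (· ≫ ModQuiver.pullMap α.base (β.app (𝟙_ FinInterval)))
      α.map_unit).trans
      (congrArg (fun t => ModQuiver.pullUnit k α.base ≫ ModQuiver.pullMap α.base t) β.map_unit)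
  map_mult I J := by
    rw [← ModQuiver.pullTensor_comp, ModQuiver.tensorHom_comp]
    refine (congrArg (· ≫ ModQuiver.pullMap α.base (β.app (I ⊗ J))) (α.map_mult I J)).trans ?_
    refine (congrArg (fun t => (ModQuiver.tensorHom (α.app I) (α.app J) ≫
      ModQuiver.pullTensor α.base (Y.quiver I) (Y.quiver J)) ≫ ModQuiver.pullMap α.base t)
      (β.map_mult I J)).trans ?_
    exact (congrArg (fun t => ModQuiver.tensorHom (α.app I) (α.app J) ≫ t ≫
      ModQuiver.pullMap α.base (ModQuiver.pullTensor β.base (Z.quiver I) (Z.quiver J) ≫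
        ModQuiver.pullMap β.base (Z.mult I J)))
      (ModQuiver.pullTensor_natural α.base (β.app I) (β.app J))).symm

end Hom

noncomputable instance : Category (FTemplicialModule k) where
  Hom := Hom
  id := Hom.id
  comp := Hom.comp
  id_comp _ := Hom.ext_app fun _ _ _ => Category.id_comp _
  comp_id _ := Hom.ext_app fun _ _ _ => Category.comp_id _
  assoc _ _ _ := Hom.ext_app fun _ _ _ => Category.assoc _ _ _

end FTemplicialModule

/-- A small category enriched in a monoidal category `V`. -/
structure SmallEnrichedCat (V : Type*) [Category* V] [MonoidalCategory V] where
  Ob : Type u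
  enriched : EnrichedCategory V Ob

namespace SmallEnrichedCat

variable {V : Type*} [Category* V] [MonoidalCategory V]

instance (A : SmallEnrichedCat.{u} V) : EnrichedCategory V A.Ob := A.enriched

/-- The category of small `V`-enriched categories and `V`-enriched functors. -/
instance : Category (SmallEnrichedCat.{u} V) where
  Hom A B := EnrichedFunctor V A.Ob B.Ob
  id A := EnrichedFunctor.id V A.Ob
  comp F G := EnrichedFunctor.comp V F G
  id_comp _ := EnrichedFunctor.ext V (fun _ => rfl)
    (fun _ _ => (Category.comp_id _).trans (Category.id_comp _))
  comp_id _ := EnrichedFunctor.ext V (fun _ => rfl)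
    (fun _ _ => (Category.comp_id _).trans (Category.comp_id _))
  assoc _ _ _ := EnrichedFunctor.ext V (fun _ => rfl)
    (fun _ _ => (Category.comp_id _).trans (Category.assoc _ _ _))

/-- The underlying map on objects of an enriched functor. -/
def onOb {A B : SmallEnrichedCat.{u} V} (F : A ⟶ B) : A.Ob → B.Ob :=
  EnrichedFunctor.obj F

/-- The action of an enriched functor on hom-objects. -/
def onHom {A B : SmallEnrichedCat.{u} V} (F : A ⟶ B) (x y : A.Ob) :
    (x ⟶[V] y) ⟶ (onOb F x ⟶[V] onOb F y) :=
  EnrichedFunctor.map F x y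

end SmallEnrichedCat

/-- Narrow simplicial `k`-modules: contravariant functors from the narrow simplex category to
`k`-modules, with the Day convolution monoidal structure. -/
abbrev NarrowModule (k : Type u) [CommRing k] : Type (u + 1) :=
  DayFunctor NarrowSimplexᵒᵖ (ModuleCat.{u} k)

/-- The category of small dg-categories over `k` concentrated in non-negative homological degrees:
categories enriched in chain complexes indexed by `ℕ`, with the usual tensor product. -/
abbrev DGCat (k : Type u) [CommRing k] : Type (u + 1) :=
  SmallEnrichedCat.{u} (ChainComplex (ModuleCat.{u} k) ℕ)

namespace NarrowSimplex

/-- The coface map `δ_i` omitting the `i`-th inner vertex, for `0 ≤ i ≤ n`. -/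
def coface (n : ℕ) (i : Fin (n + 1)) : (⟨n⟩ : NarrowSimplex) ⟶ ⟨n + 1⟩ :=
  homMk _ _ (fun j => if j ≤ i.val then j else j + 1)
    (fun a b h _ => by split_ifs <;> lia) (by simp)
    (by have := i.isLt; simp only; split_ifs <;> lia)
    (fun a h _ => by split_ifs <;> lia)
    (fun a h => by simp only at h ⊢; split_ifs <;> lia)

/-- The codegeneracy map `σ_i` identifying the `i`-th and the next inner vertex,
for `0 ≤ i < n`. -/
def codegeneracy (n : ℕ) (i : Fin n) : (⟨n + 1⟩ : NarrowSimplex) ⟶ ⟨n⟩ :=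
  homMk _ _ (fun j => if j ≤ i.val + 1 then j else j - 1)
    (fun a b h _ => by split_ifs <;> lia) (by simp)
    (by have := i.isLt; simp only; split_ifs <;> lia)
    (fun a h _ => by split_ifs <;> lia)
    (fun a h => by have := i.isLt; simp only at h ⊢; split_ifs <;> lia)

end NarrowSimplex

namespace NarrowModule

variable {k : Type u} [CommRing k]

/-- The `k`-module in degree `n`, that is, the value at the narrow simplex with `n` inner vertices.
(The corresponding augmented simplicial module has this module in degree `n - 1`.) -/
abbrev deg (A : NarrowModule k) (n : ℕ) : ModuleCat.{u} k := A.functor.obj (op ⟨n⟩)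

/-- The face map `d_i`. -/
def face (A : NarrowModule k) (n : ℕ) (i : Fin (n + 1)) : A.deg (n + 1) →ₗ[k] A.deg n :=
  (A.functor.map (NarrowSimplex.coface n i).op).hom

/-- The degeneracy map `s_i`. -/
def degeneracy (A : NarrowModule k) (n : ℕ) (i : Fin n) : A.deg n →ₗ[k] A.deg (n + 1) :=
  (A.functor.map (NarrowSimplex.codegeneracy n i).op).hom

/-- The submodule generated by the degenerate elements. -/
def degenerate (A : NarrowModule k) : ∀ n, Submodule k (A.deg n)
  | 0 => ⊥
  | n + 1 => ⨆ i : Fin n, LinearMap.range (A.degeneracy n i)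

end NarrowModule

/-- Small categories enriched in narrow simplicial `k`-modules. -/
abbrev NarrowCat (k : Type u) [CommRing k] : Type (u + 1) :=
  SmallEnrichedCat.{u} (NarrowModule k)

namespace NarrowCat

variable {k : Type u} [CommRing k]

/-- The narrow simplicial module of morphisms. -/
noncomputable abbrev hom (A : NarrowCat k) (x y : A.Ob) : NarrowModule k := x ⟶[NarrowModule k] y

/-- The composition as a family of bilinear maps `A(x, y)_p × A(y, z)_q → A(x, z)_{p + q}`. -/
noncomputable def comp (A : NarrowCat k) (x y z : A.Ob) (p q : ℕ) :
    (A.hom x y).deg p →ₗ[k] (A.hom y z).deg q →ₗ[k] (A.hom x z).deg (p + q) :=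
  (TensorProduct.mk k ((A.hom x y).deg p) ((A.hom y z).deg q)).compr₂
    ((DayFunctor.η (A.hom x y) (A.hom y z)).app (op ⟨p⟩, op ⟨q⟩) ≫
      (eComp (NarrowModule k) x y z).natTrans.app (op ⟨p + q⟩)).hom

/-- The identity of `x` as an element of `A(x, x)_0`. -/
noncomputable def one (A : NarrowCat k) (x : A.Ob) : (A.hom x x).deg 0 :=
  (DayFunctor.ν NarrowSimplexᵒᵖ (ModuleCat.{u} k) ≫
    (eId (NarrowModule k) x).natTrans.app (op ⟨0⟩)).hom (1 : k)

/-- The action of an enriched functor on the degree `n` part of the modules of morphisms. -/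
noncomputable def onDeg {A B : NarrowCat k} (F : A ⟶ B) (x y : A.Ob) (n : ℕ) :
    (A.hom x y).deg n →ₗ[k]
      (B.hom (SmallEnrichedCat.onOb F x) (SmallEnrichedCat.onOb F y)).deg n :=
  ((SmallEnrichedCat.onHom F x y).natTrans.app (op ⟨n⟩)).hom

end NarrowCat

namespace DGCat

variable {k : Type u} [CommRing k]

/-- The complex of morphisms. -/
noncomputable abbrev hom (C : DGCat k) (x y : C.Ob) : ChainComplex (ModuleCat.{u} k) ℕ :=
  x ⟶[ChainComplex (ModuleCat.{u} k) ℕ] y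

/-- The composition as a family of bilinear maps `C(x, y)_p × C(y, z)_q → C(x, z)_{p + q}`. -/
noncomputable def comp (C : DGCat k) (x y z : C.Ob) (p q : ℕ) :
    (C.hom x y).X p →ₗ[k] (C.hom y z).X q →ₗ[k] (C.hom x z).X (p + q) :=
  (TensorProduct.mk k ((C.hom x y).X p) ((C.hom y z).X q)).compr₂
    (HomologicalComplex.ιTensorObj (C.hom x y) (C.hom y z) p q (p + q) rfl ≫
      (eComp (ChainComplex (ModuleCat.{u} k) ℕ) x y z).f (p + q)).hom

/-- The identity of `x` as an element of `C(x, x)_0`. -/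
noncomputable def one (C : DGCat k) (x : C.Ob) : (C.hom x x).X 0 :=
  ((HomologicalComplex.singleObjXSelf (ComplexShape.down ℕ) 0 (𝟙_ (ModuleCat.{u} k))).inv ≫
    (eId (ChainComplex (ModuleCat.{u} k) ℕ) x).f 0).hom (1 : k)

/-- The action of a dg-functor on the degree `n` part of the complexes of morphisms. -/
noncomputable def onDeg {C D : DGCat k} (F : C ⟶ D) (x y : C.Ob) (n : ℕ) :
    (C.hom x y).X n →ₗ[k]
      (D.hom (SmallEnrichedCat.onOb F x) (SmallEnrichedCat.onOb F y)).X n :=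
  ((SmallEnrichedCat.onHom F x y).f n).hom

end DGCat

namespace FTemplicialModule

variable {k : Type u} [CommRing k]

/-- The action of a map of finite intervals. -/
noncomputable def act (X : FTemplicialModule k) {I J : FinInterval} (f : I ⟶ J) (a b : X.base) :
    (X.quiver J).obj a b →ₗ[k] (X.quiver I).obj a b :=
  ((X.functor.map f.op).app a b).hom

/-- The joint kernel in `X_K(a, b)` of the comultiplications `μ_{I, J}` for all `I, J` of positive
length with `I + J = K`. -/
noncomputable def kernel (X : FTemplicialModule k) (K : FinInterval) (a b : X.base) :
    Submodule k ((X.quiver K).obj a b) :=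
  ⨅ (I : FinInterval) (J : FinInterval) (_ : 0 < I.len) (_ : 0 < J.len)
    (h : (I ⊗ J).len = K.len),
    LinearMap.ker (((X.comult I J).app a b).hom ∘ₗ X.act (FinInterval.castIso h).hom a b)

/-- The product `X_{p + 1}(a, b) × X_{q + 1}(b, c) → X_{p + q + 1}(a, c)`: the multiplication
followed by the inner face map omitting the vertex `p + 1`. -/
noncomputable def glue (X : FTemplicialModule k) (a b c : X.base) (p q : ℕ)
    (x : (X.quiver ⟨p + 1⟩).obj a b) (y : (X.quiver ⟨q + 1⟩).obj b c) :
    (X.quiver ⟨p + q + 1⟩).obj a c :=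
  X.act (FinInterval.glueCoface p q) a c (((X.mult ⟨p + 1⟩ ⟨q + 1⟩).app a c).hom
    (ModQuiver.tmul (X.quiver ⟨p + 1⟩) (X.quiver ⟨q + 1⟩) a b c x y))

/-- The degenerate `1`-simplex at `a`. -/
noncomputable def degenerateEdge (X : FTemplicialModule k) (a : X.base) :
    (X.quiver ⟨1⟩).obj a a :=
  X.act FinInterval.codegeneracyZero a a ((X.unit.app a a).hom (ModQuiver.one a))

end FTemplicialModule

/-- An identification of a functor `K` from Frobenius templicial modules to categories enriched in
narrow simplicial modules with the kernel functor: the objects of `K X` are the elements of the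
base of `X`, the module of morphisms in degree `n` is the joint kernel of the comultiplications in
`X_{n + 1}`, composition and identities are induced by `glue` and `degenerateEdge`, and a morphism
of Frobenius templicial modules acts by restriction. -/
structure KernelIdentification {k : Type u} [CommRing k] (K : FTemplicialModule k ⥤ NarrowCat k)
    where
  ob (X : FTemplicialModule k) : (K.obj X).Ob ≃ X.base
  incl (X : FTemplicialModule k) (a b : (K.obj X).Ob) (n : ℕ) :
    ((K.obj X).hom a b).deg n →ₗ[k] (X.quiver ⟨n + 1⟩).obj (ob X a) (ob X b)
  incl_injective (X : FTemplicialModule k) (a b : (K.obj X).Ob) (n : ℕ) :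
    Function.Injective (incl X a b n)
  range_incl (X : FTemplicialModule k) (a b : (K.obj X).Ob) (n : ℕ) :
    LinearMap.range (incl X a b n) = X.kernel ⟨n + 1⟩ (ob X a) (ob X b)
  incl_act (X : FTemplicialModule k) (a b : (K.obj X).Ob) {m n : ℕ}
    (f : (⟨m⟩ : NarrowSimplex) ⟶ ⟨n⟩) (x : ((K.obj X).hom a b).deg n) :
    incl X a b m ((((K.obj X).hom a b).functor.map f.op).hom x) =
      X.act (NarrowSimplex.inclusion.map f) _ _ (incl X a b n x)
  incl_comp (X : FTemplicialModule k) (a b c : (K.obj X).Ob) (p q : ℕ)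
    (x : ((K.obj X).hom a b).deg p) (y : ((K.obj X).hom b c).deg q) :
    incl X a c (p + q) ((K.obj X).comp a b c p q x y) =
      X.glue _ _ _ p q (incl X a b p x) (incl X b c q y)
  incl_one (X : FTemplicialModule k) (a : (K.obj X).Ob) :
    incl X a a 0 ((K.obj X).one a) = X.degenerateEdge (ob X a)
  ob_map {X Y : FTemplicialModule k} (f : X ⟶ Y) (a : (K.obj X).Ob) :
    ob Y (SmallEnrichedCat.onOb (K.map f) a) = f.base (ob X a)
  incl_map {X Y : FTemplicialModule k} (f : X ⟶ Y) (a b : (K.obj X).Ob) (n : ℕ)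
    (x : ((K.obj X).hom a b).deg n) :
    HEq (incl Y _ _ n (NarrowCat.onDeg (K.map f) a b n x))
      (((f.app ⟨n + 1⟩).app (ob X a) (ob X b)).hom (incl X a b n x))

/-- An identification of a functor `N` from categories enriched in narrow simplicial modules to
dg-categories with the augmented normalized chains functor applied to the modules of morphisms: the
objects are unchanged, morphisms in degree `n` are divided by the degenerate elements, the
differential is the alternating sum of the faces, and composition, identities and the action of
enriched functors are induced on the quotients. -/
structure NormalizedIdentification {k : Type u} [CommRing k] (N : NarrowCat k ⥤ DGCat k) where
  ob (A : NarrowCat k) : A.Ob ≃ (N.obj A).Ob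
  proj (A : NarrowCat k) (x y : A.Ob) (n : ℕ) :
    (A.hom x y).deg n →ₗ[k] ((N.obj A).hom (ob A x) (ob A y)).X n
  proj_surjective (A : NarrowCat k) (x y : A.Ob) (n : ℕ) : Function.Surjective (proj A x y n)
  ker_proj (A : NarrowCat k) (x y : A.Ob) (n : ℕ) :
    LinearMap.ker (proj A x y n) = (A.hom x y).degenerate n
  proj_d (A : NarrowCat k) (x y : A.Ob) (n : ℕ) (f : (A.hom x y).deg (n + 1)) :
    (((N.obj A).hom (ob A x) (ob A y)).d (n + 1) n).hom (proj A x y (n + 1) f) =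
      proj A x y n (∑ i : Fin (n + 1), (-1 : k) ^ (i : ℕ) • (A.hom x y).face n i f)
  proj_comp (A : NarrowCat k) (x y z : A.Ob) (p q : ℕ) (f : (A.hom x y).deg p)
    (g : (A.hom y z).deg q) :
    proj A x z (p + q) (A.comp x y z p q f g) =
      (N.obj A).comp _ _ _ p q (proj A x y p f) (proj A y z q g)
  proj_one (A : NarrowCat k) (x : A.Ob) : proj A x x 0 (A.one x) = (N.obj A).one (ob A x)
  ob_map {A B : NarrowCat k} (F : A ⟶ B) (x : A.Ob) :
    ob B (SmallEnrichedCat.onOb F x) = SmallEnrichedCat.onOb (N.map F) (ob A x)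
  proj_map {A B : NarrowCat k} (F : A ⟶ B) (x y : A.Ob) (n : ℕ) (f : (A.hom x y).deg n) :
    HEq (proj B _ _ n (NarrowCat.onDeg F x y n f))
      (DGCat.onDeg (N.map F) (ob A x) (ob A y) n (proj A x y n f))

/-!
Both equivalences are shown by exhibiting a functor that has the prescribed description and proving
that it is fully faithful and essentially surjective. All structures are first rewritten in terms of
elements: categories enriched in narrow simplicial modules and dg-categories become families of
modules with bilinear compositions (`NarrowCat.Data`, `DGCat.Data`), and a Frobenius templicial
module becomes a family of modules `X_n(a, b)` with an action of maps of intervals, bilinear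
products and comultiplications.

**Normalization.** For a complex `C`, the narrow simplicial module `DGModule.denormalized C` consists
of the chain maps from normalized chains of narrow simplices to `C`, written as families of elements
of `C` indexed by narrow maps. An element `x` of a narrow simplicial module gives the family
`f ↦ [f^* x]`, and this is an isomorphism (`NarrowModule.denormalizedEquiv`). Two elements are
therefore equal as soon as all their images have equal classes in normalized chains. The product is
compatible with all of this for a simple reason: a narrow map into `[p] ⋄ [q]` decomposes uniquely
as `u ⋄ v` (`NarrowSimplex.exists_isSplit`, `IsSplit.unique`), it is degenerate only if `u` or `v`
is, and its cofaces are those of `u` followed by those of `v`. Hence `(x y)(u ⋄ v) = x(u) y(v)`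
defines a composition of families, the boundary formula for it is the Leibniz rule, and dg-functors
between normalizations lift uniquely.

**Joint kernels, faithfulness.** The Frobenius relations show that `μ Z = id` and that the
projectors `Z μ` at different vertices are compatible with each other. Removing the components of an
element one vertex after the other, one finds that `X` is generated by the joint kernels of the
comultiplications (`FTemplicialModule.mem_of_kernel_le`), while a joint kernel meets the sum of the
images of the multiplications trivially. So morphisms are determined on joint kernels, a morphism
that is the identity on objects is bijective if it is bijective on joint kernels
(`bijective_of_bijective_kernel`), and any submodules of the joint kernels that generate `X` are
already the joint kernels (`kernel_le_of_generates`).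

**Joint kernels, the free module.** A category `A` enriched in narrow simplicial modules generates a
Frobenius templicial module `NarrowCat.free A`. Its `n`-simplices are spanned by pairs of a word
`x₁ ⋯ x_r` of composable morphisms, a letter of degree `m` occupying an interval of length `m + 1`,
and a map of intervals from `[n]` to the interval of the word. The relations are linearity in each
letter and three reductions of a letter: that of `f^* x` to `x`, that of a composite `x y` to the
word of `x` and `y`, and that of an identity to the empty word. The product concatenates words, and
the comultiplication cuts a word at an endpoint of a letter and is zero at other vertices; reductions
do not affect which vertices can be cut. The words with one letter generate and lie in the joint
kernels, so they are the joint kernels. They are a copy of `A`, because composing the letters of a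
word gives a retraction (`NarrowCat.Free.retraction`). This shows essential surjectivity. Finally,
a functor from `A` to the joint kernels of `Y` extends to `free A` by multiplying the images of the
letters in `Y` (`NarrowCat.KernelMap.lift`), and the map to `X` from the free module on its joint
kernels is bijective because it is so on joint kernels (`FTemplicialModule.counitDeg_bijective`).
Functors between categories of joint kernels therefore extend to morphisms, and the functor is full.
-/

/-! ### The Day convolution of narrow simplicial modules in terms of elements -/

namespace NarrowModule

variable {k : Type u} [CommRing k]

/-- The structure map of the Day convolution as a family of bilinear maps
`F_P × G_Q → (F ⊗ G)_{P ⋄ Q}`. -/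
noncomputable def tmul (F G : NarrowModule k) (P Q : NarrowSimplex) :
    F.functor.obj (op P) →ₗ[k] G.functor.obj (op Q) →ₗ[k] (F ⊗ G).functor.obj (op (P ⊗ Q)) :=
  (TensorProduct.mk k (F.functor.obj (op P)) (G.functor.obj (op Q))).compr₂
    ((DayFunctor.η F G).app (op P, op Q)).hom

theorem map_tmul (F G : NarrowModule k) {P Q P' Q' : NarrowSimplex} (f : P ⟶ P') (g : Q ⟶ Q')
    (x : F.functor.obj (op P')) (y : G.functor.obj (op Q')) :
    ((F ⊗ G).functor.map (f ⊗ₘ g).op).hom (tmul F G P' Q' x y) =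
      tmul F G P Q ((F.functor.map f.op).hom x) ((G.functor.map g.op).hom y) := by
  have := (DayFunctor.η F G).naturality
    (X := (op P', op Q')) (Y := (op P, op Q)) (Prod.mkHom f.op g.op)
  exact (LinearMap.congr_fun (congrArg ModuleCat.Hom.hom this) (x ⊗ₜ[k] y)).symm

open LawfulDayConvolutionMonoidalCategoryStruct in
/-- A linear map out of a value of the Day convolution is determined on the images of `tmul`. -/
theorem day_ext {F G : NarrowModule k} {R : NarrowSimplex} {M : Type u} [AddCommGroup M]
    [Module k M] {f g : (F ⊗ G).functor.obj (op R) →ₗ[k] M}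
    (h : ∀ (P Q : NarrowSimplex) (u : R ⟶ P ⊗ Q) (x : F.functor.obj (op P))
      (y : G.functor.obj (op Q)),
      f (((F ⊗ G).functor.map u.op).hom (tmul F G P Q x y)) =
        g (((F ⊗ G).functor.map u.op).hom (tmul F G P Q x y))) : f = g := by
  have := (isPointwiseLeftKanExtensionConvolutionExtensionUnit (C := NarrowSimplexᵒᵖ)
    (V := ModuleCat.{u} k) F G (op R)).hom_ext
    (W := ModuleCat.of k M) (f := ModuleCat.ofHom f) (f' := ModuleCat.ofHom g) (fun j => by
      obtain ⟨⟨⟨P⟩, ⟨Q⟩⟩, ⟨⟩, u⟩ := j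
      ext : 1
      exact TensorProduct.ext' fun x y => h P Q (Quiver.Hom.unop u) x y)
  exact congrArg ModuleCat.Hom.hom this

theorem tensorHom_tmul {F G F' G' : NarrowModule k} (φ : F ⟶ F') (ψ : G ⟶ G')
    (P Q : NarrowSimplex) (x : F.functor.obj (op P)) (y : G.functor.obj (op Q)) :
    ((φ ⊗ₘ ψ).natTrans.app (op (P ⊗ Q))).hom (tmul F G P Q x y) =
      tmul F' G' P Q ((φ.natTrans.app (op P)).hom x) ((ψ.natTrans.app (op Q)).hom y) := by
  have :=
    LawfulDayConvolutionMonoidalCategoryStruct.convolutionExtensionUnit_comp_ι_map_tensorHom_app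
    NarrowSimplexᵒᵖ (ModuleCat.{u} k) φ ψ (op P) (op Q)
  exact LinearMap.congr_fun (congrArg ModuleCat.Hom.hom this) (x ⊗ₜ[k] y)

theorem associator_tmul (F G H : NarrowModule k) (P Q R : NarrowSimplex)
    (x : F.functor.obj (op P)) (y : G.functor.obj (op Q)) (z : H.functor.obj (op R)) :
    ((α_ F G H).hom.natTrans.app (op ((P ⊗ Q) ⊗ R))).hom
        (tmul (F ⊗ G) H (P ⊗ Q) R (tmul F G P Q x y) z) =
      ((F ⊗ G ⊗ H).functor.map (α_ P Q R).hom.op).hom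
        (tmul F (G ⊗ H) P (Q ⊗ R) x (tmul G H Q R y z)) := by
  have := LawfulDayConvolutionMonoidalCategoryStruct.associator_hom_unit_unit
    (ModuleCat.{u} k) F G H (op P) (op Q) (op R)
  exact LinearMap.congr_fun (congrArg ModuleCat.Hom.hom this) ((x ⊗ₜ[k] y) ⊗ₜ[k] z)

/-- The generator of the unit of the Day convolution. -/
noncomputable def unitOne (k : Type u) [CommRing k] :
    (𝟙_ (NarrowModule k)).functor.obj (op (𝟙_ NarrowSimplex)) :=
  (DayFunctor.ν NarrowSimplexᵒᵖ (ModuleCat.{u} k)).hom (1 : k)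

theorem leftUnitor_tmul (F : NarrowModule k) (P : NarrowSimplex) (x : F.functor.obj (op P)) :
    ((λ_ F).hom.natTrans.app (op (𝟙_ NarrowSimplex ⊗ P))).hom
        (tmul (𝟙_ (NarrowModule k)) F (𝟙_ _) P (unitOne k) x) =
      (F.functor.map (λ_ P).hom.op).hom x := by
  have := LawfulDayConvolutionMonoidalCategoryStruct.leftUnitor_hom_unit_app
    (C := NarrowSimplexᵒᵖ) (ModuleCat.{u} k) F (op P)
  refine (LinearMap.congr_fun (congrArg ModuleCat.Hom.hom this) ((1 : k) ⊗ₜ[k] x)).trans ?_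
  exact congrArg (F.functor.map (λ_ P).hom.op).hom (one_smul k x)

theorem rightUnitor_tmul (F : NarrowModule k) (P : NarrowSimplex) (x : F.functor.obj (op P)) :
    ((ρ_ F).hom.natTrans.app (op (P ⊗ 𝟙_ NarrowSimplex))).hom
        (tmul F (𝟙_ (NarrowModule k)) P (𝟙_ _) x (unitOne k)) =
      (F.functor.map (ρ_ P).hom.op).hom x := by
  have := LawfulDayConvolutionMonoidalCategoryStruct.rightUnitor_hom_unit_app
    (C := NarrowSimplexᵒᵖ) (ModuleCat.{u} k) F (op P)
  refine (LinearMap.congr_fun (congrArg ModuleCat.Hom.hom this) (x ⊗ₜ[k] (1 : k))).trans ?_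
  exact congrArg (F.functor.map (ρ_ P).hom.op).hom (one_smul k x)

theorem natTrans_comp_apply {F G H : NarrowModule k} (φ : F ⟶ G) (ψ : G ⟶ H) (P : NarrowSimplex)
    (x : F.functor.obj (op P)) :
    ((φ ≫ ψ).natTrans.app (op P)).hom x =
      (ψ.natTrans.app (op P)).hom ((φ.natTrans.app (op P)).hom x) := rfl

theorem natTrans_map {F G : NarrowModule k} (φ : F ⟶ G) {P Q : NarrowSimplex} (f : P ⟶ Q)
    (x : F.functor.obj (op Q)) :
    (φ.natTrans.app (op P)).hom ((F.functor.map f.op).hom x) =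
      (G.functor.map f.op).hom ((φ.natTrans.app (op Q)).hom x) :=
  LinearMap.congr_fun (congrArg ModuleCat.Hom.hom (φ.natTrans.naturality f.op)) x

theorem functor_map_comp (F : NarrowModule k) {P Q R : NarrowSimplex} (f : P ⟶ Q) (g : Q ⟶ R)
    (x : F.functor.obj (op R)) :
    (F.functor.map (f ≫ g).op).hom x = (F.functor.map f.op).hom ((F.functor.map g.op).hom x) := by
  rw [op_comp, F.functor.map_comp]; rfl

theorem functor_map_id (F : NarrowModule k) {P : NarrowSimplex} (x : F.functor.obj (op P)) :
    (F.functor.map (𝟙 P).op).hom x = x := by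
  rw [op_id, F.functor.map_id]; rfl

theorem hom_ext {F G : NarrowModule k} {φ ψ : F ⟶ G}
    (h : ∀ n (x : F.deg n), (φ.natTrans.app (op ⟨n⟩)).hom x = (ψ.natTrans.app (op ⟨n⟩)).hom x) :
    φ = ψ := by
  refine DayFunctor.hom_ext (NatTrans.ext (funext fun P => ?_))
  exact ModuleCat.hom_ext (LinearMap.ext (h P.unop.inner))

theorem tensor_hom_ext {F G H : NarrowModule k} {φ ψ : F ⊗ G ⟶ H}
    (h : ∀ P Q x y, (φ.natTrans.app (op (P ⊗ Q))).hom (tmul F G P Q x y) =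
      (ψ.natTrans.app (op (P ⊗ Q))).hom (tmul F G P Q x y)) : φ = ψ := by
  refine hom_ext fun n x => LinearMap.congr_fun (day_ext fun P Q u x y => ?_) x
  rw [natTrans_map, natTrans_map, h]

/-- Morphisms out of a threefold Day convolution are determined on threefold products. -/
theorem tensor_hom_ext₃ {F G H K : NarrowModule k} {φ ψ : (F ⊗ G) ⊗ H ⟶ K}
    (h : ∀ P Q R x y z, (φ.natTrans.app (op ((P ⊗ Q) ⊗ R))).hom
        (tmul (F ⊗ G) H (P ⊗ Q) R (tmul F G P Q x y) z) =
      (ψ.natTrans.app (op ((P ⊗ Q) ⊗ R))).hom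
        (tmul (F ⊗ G) H (P ⊗ Q) R (tmul F G P Q x y) z)) : φ = ψ := by
  refine tensor_hom_ext fun S R w z => ?_
  refine LinearMap.congr_fun (f := (φ.natTrans.app (op (S ⊗ R))).hom ∘ₗ
      (tmul (F ⊗ G) H S R).flip z)
    (g := (ψ.natTrans.app (op (S ⊗ R))).hom ∘ₗ (tmul (F ⊗ G) H S R).flip z)
    (day_ext fun P Q u x y => ?_) w
  have := map_tmul (F ⊗ G) H u (𝟙 R) (tmul F G P Q x y) z
  rw [functor_map_id] at this
  simp only [LinearMap.comp_apply, LinearMap.flip_apply]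
  rw [← this, natTrans_map, natTrans_map, h]

theorem unit_hom_ext {F : NarrowModule k} {φ ψ : 𝟙_ (NarrowModule k) ⟶ F}
    (h : (φ.natTrans.app (op (𝟙_ NarrowSimplex))).hom (unitOne k) =
      (ψ.natTrans.app (op (𝟙_ NarrowSimplex))).hom (unitOne k)) : φ = ψ := by
  refine DayFunctor.unit_hom_ext (ModuleCat.hom_ext (LinearMap.ext_ring ?_))
  exact h

/-- The morphism out of a Day convolution given by a natural family of bilinear maps. -/
noncomputable def desc {F G H : NarrowModule k}
    (β : ∀ P Q : NarrowSimplex, F.functor.obj (op P) →ₗ[k] G.functor.obj (op Q) →ₗ[k]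
      H.functor.obj (op (P ⊗ Q)))
    (hβ : ∀ {P Q P' Q' : NarrowSimplex} (f : P ⟶ P') (g : Q ⟶ Q') x y,
      β P Q ((F.functor.map f.op).hom x) ((G.functor.map g.op).hom y) =
        (H.functor.map (f ⊗ₘ g).op).hom (β P' Q' x y)) : F ⊗ G ⟶ H :=
  DayFunctor.tensorDesc
    { app := fun PQ => ModuleCat.ofHom (TensorProduct.lift (β PQ.1.unop PQ.2.unop))
      naturality := fun _ _ f => ModuleCat.hom_ext (TensorProduct.ext' fun x y =>
        hβ f.1.unop f.2.unop x y) }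

theorem desc_tmul {F G H : NarrowModule k}
    (β : ∀ P Q : NarrowSimplex, F.functor.obj (op P) →ₗ[k] G.functor.obj (op Q) →ₗ[k]
      H.functor.obj (op (P ⊗ Q))) (hβ) (P Q : NarrowSimplex) (x : F.functor.obj (op P))
    (y : G.functor.obj (op Q)) :
    ((desc (H := H) β hβ).natTrans.app (op (P ⊗ Q))).hom (tmul F G P Q x y) = β P Q x y := by
  have := DayFunctor.η_comp_tensorDesc_app (F := F) (G := G) (H := H)
    { app := fun PQ => ModuleCat.ofHom (TensorProduct.lift (β PQ.1.unop PQ.2.unop))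
      naturality := fun _ _ f => ModuleCat.hom_ext (TensorProduct.ext' fun x y =>
        hβ f.1.unop f.2.unop x y) } (op P) (op Q)
  exact LinearMap.congr_fun (congrArg ModuleCat.Hom.hom this) (x ⊗ₜ[k] y)

/-- The morphism out of the unit given by an element of degree zero. -/
noncomputable def unitDesc {F : NarrowModule k} (x : F.functor.obj (op (𝟙_ NarrowSimplex))) :
    𝟙_ (NarrowModule k) ⟶ F :=
  DayFunctor.unitDesc (ModuleCat.ofHom (LinearMap.toSpanSingleton k _ x))

theorem unitDesc_one {F : NarrowModule k} (x : F.functor.obj (op (𝟙_ NarrowSimplex))) :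
    ((unitDesc x).natTrans.app (op (𝟙_ NarrowSimplex))).hom (unitOne k) = x := by
  have := DayFunctor.ν_comp_unitDesc (C := NarrowSimplexᵒᵖ) (F := F)
    (ModuleCat.ofHom (LinearMap.toSpanSingleton k _ x))
  refine (LinearMap.congr_fun (congrArg ModuleCat.Hom.hom this) (1 : k)).trans ?_
  exact one_smul k x

end NarrowModule

/-! ### Categories enriched in narrow simplicial modules in terms of elements -/

namespace NarrowSimplex

/-- The isomorphism between objects with equally many vertices, as a morphism. -/
def cast {m n : ℕ} (h : m = n) : (⟨m⟩ : NarrowSimplex) ⟶ ⟨n⟩ := (castIso h).hom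

/-- The product `f ⋄ g`, with source and target written as sums of numbers. -/
def join {p q p' q' : ℕ} (f : (⟨p⟩ : NarrowSimplex) ⟶ ⟨p'⟩) (g : (⟨q⟩ : NarrowSimplex) ⟶ ⟨q'⟩) :
    (⟨p + q⟩ : NarrowSimplex) ⟶ ⟨p' + q'⟩ := f ⊗ₘ g

theorem nat_cast {m n : ℕ} (h : m = n) {i : ℕ} (hi : i ≤ m + 1) : Hom.nat (cast h) i = i :=
  nat_castIso_hom _ hi

theorem nat_join {p q p' q' : ℕ} (f : (⟨p⟩ : NarrowSimplex) ⟶ ⟨p'⟩)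
    (g : (⟨q⟩ : NarrowSimplex) ⟶ ⟨q'⟩) {i : ℕ} (hi : i ≤ p + q + 1) :
    Hom.nat (join f g) i = if i < p + 1 then Hom.nat f i else p' + Hom.nat g (i - p) :=
  nat_tensorHom f g hi

end NarrowSimplex

namespace NarrowModule

variable {k : Type u} [CommRing k]

/-- The action of a morphism of narrow simplices. -/
def act (A : NarrowModule k) {m n : ℕ} (f : (⟨m⟩ : NarrowSimplex) ⟶ ⟨n⟩) :
    A.deg n →ₗ[k] A.deg m :=
  (A.functor.map f.op).hom

theorem act_comp (A : NarrowModule k) {l m n : ℕ} (f : (⟨l⟩ : NarrowSimplex) ⟶ ⟨m⟩)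
    (g : (⟨m⟩ : NarrowSimplex) ⟶ ⟨n⟩) (x : A.deg n) : A.act (f ≫ g) x = A.act f (A.act g x) :=
  A.functor_map_comp f g x

theorem act_id (A : NarrowModule k) {n : ℕ} (x : A.deg n) : A.act (𝟙 _) x = x :=
  A.functor_map_id x

theorem act_cast_rfl (A : NarrowModule k) {n : ℕ} (h : n = n) (x : A.deg n) :
    A.act (NarrowSimplex.cast h) x = x := by
  refine Eq.trans ?_ (A.act_id x)
  refine congrArg (A.act · x) (NarrowSimplex.hom_ext_nat fun i hi => ?_)
  rw [NarrowSimplex.nat_cast h hi, NarrowSimplex.Hom.nat_id hi]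

/-- Construct a narrow simplicial module from the modules in the single degrees. -/
def ofDeg (M : ℕ → ModuleCat.{u} k)
    (act : ∀ {m n : ℕ}, ((⟨m⟩ : NarrowSimplex) ⟶ ⟨n⟩) → (M n →ₗ[k] M m))
    (act_id : ∀ n x, act (𝟙 (⟨n⟩ : NarrowSimplex)) x = x)
    (act_comp : ∀ {l m n : ℕ} (f : (⟨l⟩ : NarrowSimplex) ⟶ ⟨m⟩) (g : (⟨m⟩ : NarrowSimplex) ⟶ ⟨n⟩)
      x, act (f ≫ g) x = act f (act g x)) : NarrowModule k :=
  ⟨{ obj := fun P => M P.unop.inner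
     map := fun f => ModuleCat.ofHom (act f.unop)
     map_id := fun P => ModuleCat.hom_ext (LinearMap.ext fun x => act_id P.unop.inner x)
     map_comp := fun f g => ModuleCat.hom_ext (LinearMap.ext fun x => act_comp g.unop f.unop x) }⟩

/-- Construct a morphism of narrow simplicial modules from the maps in the single degrees. -/
def homOfDeg {A B : NarrowModule k} (φ : ∀ n, A.deg n →ₗ[k] B.deg n)
    (h : ∀ {m n : ℕ} (f : (⟨m⟩ : NarrowSimplex) ⟶ ⟨n⟩) x, φ m (A.act f x) = B.act f (φ n x)) :
    A ⟶ B :=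
  ⟨{ app := fun P => ModuleCat.ofHom (φ P.unop.inner)
     naturality := fun _ _ f => ModuleCat.hom_ext (LinearMap.ext fun x => h f.unop x) }⟩

theorem isIso_homOfDeg {A B : NarrowModule k} (φ : ∀ n, A.deg n →ₗ[k] B.deg n) (h)
    (h' : ∀ n, Function.Bijective (φ n)) : IsIso (homOfDeg φ h) := by
  let e : ∀ n, A.deg n ≃ₗ[k] B.deg n := fun n => LinearEquiv.ofBijective (φ n) (h' n)
  refine ⟨homOfDeg (fun n => (e n).symm.toLinearMap) fun {m n} f x => ?_,
    hom_ext fun n x => (e n).symm_apply_apply x, hom_ext fun n x => (e n).apply_symm_apply x⟩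
  obtain ⟨y, rfl⟩ := (e n).surjective x
  refine (e m).injective ?_
  refine ((e m).apply_symm_apply _).trans (Eq.trans ?_ (h f _).symm)
  exact congrArg (fun t => (B.act f) (φ n t)) ((e n).symm_apply_apply y).symm

open LawfulDayConvolutionMonoidalCategoryStruct in
theorem unit_ext {R : NarrowSimplex} {M : Type u} [AddCommGroup M] [Module k M]
    {f g : (𝟙_ (NarrowModule k)).functor.obj (op R) →ₗ[k] M}
    (h : ∀ u : R ⟶ 𝟙_ NarrowSimplex,
      f (((𝟙_ (NarrowModule k)).functor.map u.op).hom (unitOne k)) =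
        g (((𝟙_ (NarrowModule k)).functor.map u.op).hom (unitOne k))) : f = g := by
  have := (isPointwiseLeftKanExtensionUnitUnit NarrowSimplexᵒᵖ (ModuleCat.{u} k)
    (NarrowModule k) (op R)).hom_ext
    (W := ModuleCat.of k M) (f := ModuleCat.ofHom f) (f' := ModuleCat.ofHom g) (fun j => by
      obtain ⟨⟨⟨⟩⟩, ⟨⟩, u⟩ := j
      ext : 1
      exact LinearMap.ext_ring (h (Quiver.Hom.unop u)))
  exact congrArg ModuleCat.Hom.hom this

theorem tensor_hom_ext_left {F G : NarrowModule k} {φ ψ : 𝟙_ (NarrowModule k) ⊗ F ⟶ G}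
    (h : ∀ P x, (φ.natTrans.app (op (𝟙_ _ ⊗ P))).hom (tmul _ F (𝟙_ _) P (unitOne k) x) =
      (ψ.natTrans.app (op (𝟙_ _ ⊗ P))).hom (tmul _ F (𝟙_ _) P (unitOne k) x)) : φ = ψ := by
  refine tensor_hom_ext fun S P w x => ?_
  refine LinearMap.congr_fun (f := (φ.natTrans.app (op (S ⊗ P))).hom ∘ₗ
      (tmul (𝟙_ (NarrowModule k)) F S P).flip x)
    (g := (ψ.natTrans.app (op (S ⊗ P))).hom ∘ₗ (tmul (𝟙_ (NarrowModule k)) F S P).flip x)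
    (unit_ext fun u => ?_) w
  have := map_tmul (𝟙_ (NarrowModule k)) F u (𝟙 P) (unitOne k) x
  rw [functor_map_id] at this
  simp only [LinearMap.comp_apply, LinearMap.flip_apply]
  rw [← this, natTrans_map, natTrans_map, h]

theorem tensor_hom_ext_right {F G : NarrowModule k} {φ ψ : F ⊗ 𝟙_ (NarrowModule k) ⟶ G}
    (h : ∀ P x, (φ.natTrans.app (op (P ⊗ 𝟙_ _))).hom (tmul F _ P (𝟙_ _) x (unitOne k)) =
      (ψ.natTrans.app (op (P ⊗ 𝟙_ _))).hom (tmul F _ P (𝟙_ _) x (unitOne k))) : φ = ψ := by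
  refine tensor_hom_ext fun P S x w => ?_
  refine LinearMap.congr_fun (f := (φ.natTrans.app (op (P ⊗ S))).hom ∘ₗ
      (tmul F (𝟙_ (NarrowModule k)) P S) x)
    (g := (ψ.natTrans.app (op (P ⊗ S))).hom ∘ₗ (tmul F (𝟙_ (NarrowModule k)) P S) x)
    (unit_ext fun u => ?_) w
  have := map_tmul F (𝟙_ (NarrowModule k)) (𝟙 P) u x (unitOne k)
  rw [functor_map_id] at this
  simp only [LinearMap.comp_apply]
  rw [← this, natTrans_map, natTrans_map, h]

end NarrowModule

namespace SmallEnrichedCat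

theorem functor_ext {V : Type*} [Category* V] [MonoidalCategory V] {A B : SmallEnrichedCat.{u} V}
    {F G : A ⟶ B} (h : ∀ x, onOb F x = onOb G x) (h' : ∀ x y, HEq (onHom F x y) (onHom G x y)) :
    F = G := by
  obtain ⟨f, φ, h1, h2⟩ : EnrichedFunctor V A.Ob B.Ob := F
  obtain ⟨g, ψ, h3, h4⟩ : EnrichedFunctor V A.Ob B.Ob := G
  obtain rfl : f = g := funext h
  obtain rfl : φ = ψ := funext fun x => funext fun y => eq_of_heq (h' x y)
  rfl

theorem comp_inv_eq_of_comp_eq {V : Type*} [Category* V] [MonoidalCategory V]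
    {X Y Z X' Y' Z' : V} {c : X ⊗ Y ⟶ Z} {c' : X' ⊗ Y' ⟶ Z'} {f : X ⟶ X'} {g : Y ⟶ Y'}
    {h : Z ⟶ Z'} [IsIso f] [IsIso g] [IsIso h] (e : c ≫ h = (f ⊗ₘ g) ≫ c') :
    c' ≫ inv h = (inv f ⊗ₘ inv g) ≫ c := by
  rw [IsIso.comp_inv_eq, Category.assoc, e, tensorHom_comp_tensorHom_assoc, IsIso.inv_hom_id,
    IsIso.inv_hom_id, id_tensorHom_id, Category.id_comp]

/-- An enriched functor that is the identity on objects and an isomorphism on objects of morphisms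
is an isomorphism. -/
theorem isIso_of_isIso_map {V : Type*} [Category* V] [MonoidalCategory V] {O : Type u}
    {a b : EnrichedCategory V O} (F : (⟨O, a⟩ : SmallEnrichedCat V) ⟶ ⟨O, b⟩)
    (h0 : ∀ x : O, onOb F x = x) (hF : ∀ x y : O, IsIso (onHom F x y)) : IsIso F := by
  obtain ⟨f, φ, h, h'⟩ : @EnrichedFunctor V _ _ O a O b := F
  obtain rfl : f = id := funext h0
  have hφ : ∀ x y : O, IsIso (φ x y) := hF
  refine ⟨(@EnrichedFunctor.mk V _ _ O b O a id (fun x y => inv (φ x y)) (fun x => ?_)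
    (fun x y z => ?_) : @EnrichedFunctor V _ _ O b O a), ?_, ?_⟩
  · rw [IsIso.comp_inv_eq]
    exact (h x).symm
  · exact comp_inv_eq_of_comp_eq (c := a.comp x y z) (c' := b.comp x y z) (f := φ x y)
      (g := φ y z) (h := φ x z) (h' x y z)
  · exact functor_ext (fun _ => rfl) fun x y => heq_of_eq (IsIso.hom_inv_id (φ x y))
  · exact functor_ext (fun _ => rfl) fun x y => heq_of_eq (IsIso.inv_hom_id (φ x y))

end SmallEnrichedCat

namespace NarrowCat

variable {k : Type u} [CommRing k]

theorem eComp_tmul (A : NarrowCat k) (x y z : A.Ob) (p q : ℕ) (f : (A.hom x y).deg p)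
    (g : (A.hom y z).deg q) :
    ((eComp (NarrowModule k) x y z).natTrans.app (op ⟨p + q⟩)).hom
      (NarrowModule.tmul (A.hom x y) (A.hom y z) ⟨p⟩ ⟨q⟩ f g) = A.comp x y z p q f g := rfl

theorem comp_act (A : NarrowCat k) {x y z : A.Ob} {p q p' q' : ℕ}
    (u : (⟨p⟩ : NarrowSimplex) ⟶ ⟨p'⟩) (v : (⟨q⟩ : NarrowSimplex) ⟶ ⟨q'⟩)
    (f : (A.hom x y).deg p') (g : (A.hom y z).deg q') :
    A.comp x y z p q ((A.hom x y).act u f) ((A.hom y z).act v g) =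
      (A.hom x z).act (NarrowSimplex.join u v) (A.comp x y z p' q' f g) := by
  rw [← eComp_tmul, ← eComp_tmul]
  have h1 := NarrowModule.map_tmul (A.hom x y) (A.hom y z) u v f g
  have h2 := NarrowModule.natTrans_map (eComp (NarrowModule k) x y z) (u ⊗ₘ v)
    (NarrowModule.tmul (A.hom x y) (A.hom y z) ⟨p'⟩ ⟨q'⟩ f g)
  exact (congrArg _ h1.symm).trans h2

/-- Associativity holds up to the identification of `p + (q + r)` with `p + q + r`. -/
theorem comp_assoc (A : NarrowCat k) {w x y z : A.Ob} {p q r : ℕ}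
    (f : (A.hom w x).deg p) (g : (A.hom x y).deg q) (h : (A.hom y z).deg r) :
    (A.hom w z).act (NarrowSimplex.cast (Nat.add_assoc p q r))
        (A.comp w x z p (q + r) f (A.comp x y z q r g h)) =
      A.comp w y z (p + q) r (A.comp w x y p q f g) h := by
  have h1 := congrArg (fun t => (t.natTrans.app (op ((⟨p⟩ ⊗ ⟨q⟩ : NarrowSimplex) ⊗ ⟨r⟩))).hom
    (NarrowModule.tmul (A.hom w x ⊗ A.hom x y) (A.hom y z) (⟨p⟩ ⊗ ⟨q⟩) ⟨r⟩
      (NarrowModule.tmul (A.hom w x) (A.hom x y) ⟨p⟩ ⟨q⟩ f g) h))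
        (e_assoc' (NarrowModule k) w x y z)
  simp only [NarrowModule.natTrans_comp_apply] at h1
  rw [NarrowModule.associator_tmul, NarrowModule.natTrans_map, NarrowModule.natTrans_map,
    ← id_tensorHom, ← tensorHom_id, NarrowModule.tensorHom_tmul, NarrowModule.tensorHom_tmul] at h1
  exact h1

theorem one_comp (A : NarrowCat k) {x y : A.Ob} {p : ℕ} (f : (A.hom x y).deg p) :
    A.comp x x y 0 p (A.one x) f =
      (A.hom x y).act (NarrowSimplex.cast (Nat.zero_add p)) f := by
  have h0 := (Iso.inv_comp_eq _).mp (e_id_comp (NarrowModule k) x y)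
  have h1 := congrArg (fun t => (t.natTrans.app (op (𝟙_ NarrowSimplex ⊗ ⟨p⟩))).hom
    (NarrowModule.tmul (𝟙_ (NarrowModule k)) (A.hom x y) (𝟙_ _) ⟨p⟩ (NarrowModule.unitOne k) f)) h0
  simp only [NarrowModule.natTrans_comp_apply] at h1
  rw [← tensorHom_id, NarrowModule.tensorHom_tmul] at h1
  rw [NarrowModule.leftUnitor_tmul] at h1
  exact h1

theorem comp_one (A : NarrowCat k) {x y : A.Ob} {p : ℕ} (f : (A.hom x y).deg p) :
    A.comp x y y p 0 f (A.one y) =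
      (A.hom x y).act (NarrowSimplex.cast (Nat.add_zero p)) f := by
  have h0 := (Iso.inv_comp_eq _).mp (e_comp_id (NarrowModule k) x y)
  have h1 := congrArg (fun t => (t.natTrans.app (op (⟨p⟩ ⊗ 𝟙_ NarrowSimplex))).hom
    (NarrowModule.tmul (A.hom x y) (𝟙_ (NarrowModule k)) ⟨p⟩ (𝟙_ _) f (NarrowModule.unitOne k))) h0
  simp only [NarrowModule.natTrans_comp_apply] at h1
  rw [← id_tensorHom, NarrowModule.tensorHom_tmul] at h1
  rw [NarrowModule.rightUnitor_tmul] at h1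
  exact h1

/-- The data of a category enriched in narrow simplicial modules in terms of elements. -/
structure Data (k : Type u) [CommRing k] where
  Ob : Type u
  H : Ob → Ob → NarrowModule k
  comp : ∀ x y z p q, (H x y).deg p →ₗ[k] (H y z).deg q →ₗ[k] (H x z).deg (p + q)
  one : ∀ x, (H x x).deg 0
  comp_act : ∀ {x y z : Ob} {p q p' q' : ℕ} (u : (⟨p⟩ : NarrowSimplex) ⟶ ⟨p'⟩)
    (v : (⟨q⟩ : NarrowSimplex) ⟶ ⟨q'⟩) (f : (H x y).deg p') (g : (H y z).deg q'),
    comp x y z p q ((H x y).act u f) ((H y z).act v g) =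
      (H x z).act (NarrowSimplex.join u v) (comp x y z p' q' f g)
  comp_assoc : ∀ {w x y z : Ob} {p q r : ℕ} (f : (H w x).deg p) (g : (H x y).deg q)
    (h : (H y z).deg r),
    (H w z).act (NarrowSimplex.cast (Nat.add_assoc p q r))
        (comp w x z p (q + r) f (comp x y z q r g h)) =
      comp w y z (p + q) r (comp w x y p q f g) h
  one_comp : ∀ {x y : Ob} {p : ℕ} (f : (H x y).deg p),
    comp x x y 0 p (one x) f = (H x y).act (NarrowSimplex.cast (Nat.zero_add p)) f
  comp_one : ∀ {x y : Ob} {p : ℕ} (f : (H x y).deg p),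
    comp x y y p 0 f (one y) = (H x y).act (NarrowSimplex.cast (Nat.add_zero p)) f

namespace Data

variable (D : Data k)

/-- The composition as a morphism out of the Day convolution. -/
noncomputable def compHom (x y z : D.Ob) : D.H x y ⊗ D.H y z ⟶ D.H x z :=
  NarrowModule.desc (fun P Q => D.comp x y z P.inner Q.inner) (fun f g a b => D.comp_act f g a b)

theorem compHom_tmul (x y z : D.Ob) (P Q : NarrowSimplex) (a : (D.H x y).functor.obj (op P)) (b) :
    ((D.compHom x y z).natTrans.app (op (P ⊗ Q))).hom
      (NarrowModule.tmul (D.H x y) (D.H y z) P Q a b) = D.comp x y z P.inner Q.inner a b :=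
  NarrowModule.desc_tmul _ _ _ _ _ _

/-- The enriched category given by a `Data`. -/
noncomputable def toCat : NarrowCat k where
  Ob := D.Ob
  enriched :=
    { Hom := D.H
      id := fun x => NarrowModule.unitDesc (F := D.H x x) (D.one x)
      comp := D.compHom
      id_comp := fun x y => by
        rw [Iso.inv_comp_eq, Category.comp_id]
        refine NarrowModule.tensor_hom_ext_left fun P a => ?_
        rw [NarrowModule.natTrans_comp_apply, NarrowModule.leftUnitor_tmul, ← tensorHom_id,
          NarrowModule.tensorHom_tmul, NarrowModule.unitDesc_one, compHom_tmul]
        exact D.one_comp a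
      comp_id := fun x y => by
        rw [Iso.inv_comp_eq, Category.comp_id]
        refine NarrowModule.tensor_hom_ext_right fun P a => ?_
        rw [NarrowModule.natTrans_comp_apply, NarrowModule.rightUnitor_tmul, ← id_tensorHom,
          NarrowModule.tensorHom_tmul, NarrowModule.unitDesc_one, compHom_tmul]
        exact D.comp_one a
      assoc := fun w x y z => by
        rw [Iso.inv_comp_eq]
        refine NarrowModule.tensor_hom_ext₃ fun P Q R a b c => ?_
        simp only [NarrowModule.natTrans_comp_apply]
        rw [NarrowModule.associator_tmul, NarrowModule.natTrans_map, NarrowModule.natTrans_map,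
          ← id_tensorHom, ← tensorHom_id, NarrowModule.tensorHom_tmul,
          NarrowModule.tensorHom_tmul, compHom_tmul, compHom_tmul]
        erw [compHom_tmul, compHom_tmul]
        exact (D.comp_assoc a b c).symm }

theorem toCat_comp (x y z : D.Ob) (p q : ℕ) : D.toCat.comp x y z p q = D.comp x y z p q :=
  LinearMap.ext fun f => LinearMap.ext fun g => D.compHom_tmul x y z ⟨p⟩ ⟨q⟩ f g

theorem toCat_one (x : D.Ob) : D.toCat.one x = D.one x :=
  NarrowModule.unitDesc_one (F := D.H x x) _

end Data

variable {A B C : NarrowCat k}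

theorem onDeg_act (F : A ⟶ B) (x y : A.Ob) {m n : ℕ} (f : (⟨m⟩ : NarrowSimplex) ⟶ ⟨n⟩)
    (a : (A.hom x y).deg n) :
    onDeg F x y m ((A.hom x y).act f a) = (B.hom _ _).act f (onDeg F x y n a) :=
  NarrowModule.natTrans_map _ f a

theorem onDeg_one (F : A ⟶ B) (x : A.Ob) : onDeg F x x 0 (A.one x) = B.one _ :=
  congrArg (fun t => (t.natTrans.app (op (𝟙_ NarrowSimplex))).hom (NarrowModule.unitOne k))
    (EnrichedFunctor.map_id (V := NarrowModule k) (C := A.Ob) (D := B.Ob) (self := F) x)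

theorem onDeg_comp (F : A ⟶ B) (x y z : A.Ob) (p q : ℕ) (f : (A.hom x y).deg p)
    (g : (A.hom y z).deg q) :
    onDeg F x z (p + q) (A.comp x y z p q f g) =
      B.comp _ _ _ p q (onDeg F x y p f) (onDeg F y z q g) := by
  have h1 := congrArg (fun t => (t.natTrans.app (op (⟨p⟩ ⊗ ⟨q⟩ : NarrowSimplex))).hom
    (NarrowModule.tmul (A.hom x y) (A.hom y z) ⟨p⟩ ⟨q⟩ f g))
    (EnrichedFunctor.map_comp (V := NarrowModule k) (C := A.Ob) (D := B.Ob) (self := F) x y z)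
  simp only [NarrowModule.natTrans_comp_apply] at h1
  rw [NarrowModule.tensorHom_tmul] at h1
  exact h1

/-- Construct an enriched functor from maps in the single degrees. -/
noncomputable def homMk (ob : A.Ob → B.Ob)
    (φ : ∀ x y n, (A.hom x y).deg n →ₗ[k] (B.hom (ob x) (ob y)).deg n)
    (act : ∀ x y {m n : ℕ} (f : (⟨m⟩ : NarrowSimplex) ⟶ ⟨n⟩) a,
      φ x y m ((A.hom x y).act f a) = (B.hom _ _).act f (φ x y n a))
    (one : ∀ x, φ x x 0 (A.one x) = B.one (ob x))
    (comp : ∀ x y z p q f g, φ x z (p + q) (A.comp x y z p q f g) =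
      B.comp _ _ _ p q (φ x y p f) (φ y z q g)) : A ⟶ B :=
  show EnrichedFunctor (NarrowModule k) A.Ob B.Ob from
  { obj := ob
    map := fun x y => NarrowModule.homOfDeg (φ x y) (act x y)
    map_id := fun x => NarrowModule.unit_hom_ext (one x)
    map_comp := fun x y z => NarrowModule.tensor_hom_ext fun P Q a b => by
      simp only [NarrowModule.natTrans_comp_apply]
      rw [NarrowModule.tensorHom_tmul]
      exact comp x y z P.inner Q.inner a b }

/-- Enriched functors are equal if they agree on objects and on elements of the modules of
morphisms; the comparison of elements is heterogeneous, as their types involve the images of the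
objects. -/
theorem functor_ext {F G : A ⟶ B} (h : ∀ x, SmallEnrichedCat.onOb F x = SmallEnrichedCat.onOb G x)
    (h' : ∀ x y n a, HEq (onDeg F x y n a) (onDeg G x y n a)) : F = G := by
  obtain ⟨f, φ, h1, h2⟩ : EnrichedFunctor (NarrowModule k) A.Ob B.Ob := F
  obtain ⟨g, ψ, h3, h4⟩ : EnrichedFunctor (NarrowModule k) A.Ob B.Ob := G
  obtain rfl : f = g := funext h
  obtain rfl : φ = ψ := funext fun x => funext fun y => NarrowModule.hom_ext fun n a =>
    eq_of_heq (h' x y n a)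
  rfl

/-- An enriched functor that is the identity on objects and bijective on modules of morphisms is
an isomorphism. -/
theorem isIso_homMk_id {O : Type u} {a b : EnrichedCategory (NarrowModule k) O}
    (φ : ∀ x y n, (NarrowCat.hom ⟨O, a⟩ x y).deg n →ₗ[k] (NarrowCat.hom ⟨O, b⟩ x y).deg n)
    (act one comp) (h : ∀ x y n, Function.Bijective (φ x y n)) :
    IsIso (homMk (A := ⟨O, a⟩) (B := ⟨O, b⟩) id φ act one comp) :=
  SmallEnrichedCat.isIso_of_isIso_map _ (fun _ => rfl) fun x y =>
    NarrowModule.isIso_homOfDeg (φ x y) (act x y) (h x y)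

/-- Construct an enriched functor from maps of `Data`. -/
noncomputable def Data.homMk (D D' : Data k) (ob : D.Ob → D'.Ob)
    (φ : ∀ x y n, (D.H x y).deg n →ₗ[k] (D'.H (ob x) (ob y)).deg n)
    (act : ∀ x y {m n : ℕ} (f : (⟨m⟩ : NarrowSimplex) ⟶ ⟨n⟩) a,
      φ x y m ((D.H x y).act f a) = (D'.H _ _).act f (φ x y n a))
    (one : ∀ x, φ x x 0 (D.one x) = D'.one (ob x))
    (comp : ∀ x y z p q f g, φ x z (p + q) (D.comp x y z p q f g) =
      D'.comp _ _ _ p q (φ x y p f) (φ y z q g)) : D.toCat ⟶ D'.toCat :=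
  NarrowCat.homMk (A := D.toCat) (B := D'.toCat) ob φ act
    (fun x => (congrArg (φ x x 0) (D.toCat_one x)).trans
      ((one x).trans (D'.toCat_one (ob x)).symm))
    (fun x y z p q f g => (congrArg (fun t => φ x z (p + q) (t f g))
      (D.toCat_comp x y z p q)).trans ((comp x y z p q f g).trans
        (congrArg (fun t => t (φ x y p f) (φ y z q g)) (D'.toCat_comp _ _ _ p q).symm)))

end NarrowCat

/-! ### Complexes in terms of elements -/

namespace DGModule

variable {k : Type u} [CommRing k]

/-- Complexes of modules in non-negative homological degrees. -/
abbrev _root_.DGModule (k : Type u) [CommRing k] : Type (u + 1) := ChainComplex (ModuleCat.{u} k) ℕ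

/-- A family of bilinear maps `K_p × L_q → M_n`, `p + q = n`. -/
abbrev Pairing (K L M : DGModule k) : Type u :=
  ∀ p q n : ℕ, p + q = n → (K.X p →ₗ[k] L.X q →ₗ[k] M.X n)

/-- The terms `d x · y` of the Leibniz rule, which are zero for `x` of degree zero. -/
def Pairing.left {K L M : DGModule k} (β : Pairing K L M) :
    ∀ p q n : ℕ, p + q = n + 1 → K.X p → L.X q → M.X n
  | 0, _, _, _, _, _ => 0
  | p + 1, q, n, h, x, y => β p q n (by lia) ((K.d (p + 1) p).hom x) y

/-- The terms `x · d y` of the Leibniz rule, which are zero for `y` of degree zero. -/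
def Pairing.right {K L M : DGModule k} (β : Pairing K L M) :
    ∀ p q n : ℕ, p + q = n + 1 → K.X p → L.X q → M.X n
  | _, 0, _, _, _, _ => 0
  | p, q + 1, n, h, x, y => β p q n (by lia) x ((L.d (q + 1) q).hom y)

/-- The Leibniz rule for a family of bilinear maps. -/
def Pairing.Leibniz {K L M : DGModule k} (β : Pairing K L M) : Prop :=
  ∀ p q n h x y, (M.d (n + 1) n).hom (β p q (n + 1) h x y) =
    β.left p q n h x y + (-1 : k) ^ p • β.right p q n h x y

/-- The universal pairing `K_p × L_q → (K ⊗ L)_n`. -/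
noncomputable def tmul (K L : DGModule k) : Pairing K L (K ⊗ L) := fun p q n h =>
  (TensorProduct.mk k (K.X p) (L.X q)).compr₂ (HomologicalComplex.ιTensorObj K L p q n h).hom

theorem tensor_ext {K L : DGModule k} {n : ℕ} {M : Type u} [AddCommGroup M]
    [Module k M] {f g : (K ⊗ L).X n →ₗ[k] M}
    (h : ∀ p q e x y, f (tmul K L p q n e x y) = g (tmul K L p q n e x y)) : f = g := by
  have : (ModuleCat.ofHom f : (K ⊗ L).X n ⟶ ModuleCat.of k M) = ModuleCat.ofHom g := by
    refine HomologicalComplex.mapBifunctor.hom_ext fun p q e => ?_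
    exact ModuleCat.hom_ext (TensorProduct.ext' fun x y => h p q e x y)
  exact congrArg ModuleCat.Hom.hom this

theorem hom_ext {K L : DGModule k} {φ ψ : K ⟶ L} (h : ∀ n x, (φ.f n).hom x = (ψ.f n).hom x) :
    φ = ψ :=
  HomologicalComplex.hom_ext _ _ fun n => ModuleCat.hom_ext (LinearMap.ext (h n))

theorem comp_f_apply {K L M : DGModule k} (φ : K ⟶ L) (ψ : L ⟶ M) (n : ℕ) (x : K.X n) :
    ((φ ≫ ψ).f n).hom x = (ψ.f n).hom ((φ.f n).hom x) := rfl

theorem f_d {K L : DGModule k} (φ : K ⟶ L) (m n : ℕ) (x : K.X m) :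
    (L.d m n).hom ((φ.f m).hom x) = (φ.f n).hom ((K.d m n).hom x) :=
  LinearMap.congr_fun (congrArg ModuleCat.Hom.hom (φ.comm m n)) x

theorem tensor_hom_ext {K L M : DGModule k} {φ ψ : K ⊗ L ⟶ M}
    (h : ∀ p q n e x y, (φ.f n).hom (tmul K L p q n e x y) =
      (ψ.f n).hom (tmul K L p q n e x y)) : φ = ψ :=
  hom_ext fun n x => LinearMap.congr_fun (tensor_ext fun p q e x y => h p q n e x y) x

theorem tensor_hom_ext₃ {K L M N : DGModule k} {φ ψ : (K ⊗ L) ⊗ M ⟶ N}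
    (h : ∀ p q m r n e e' x y z, (φ.f n).hom (tmul (K ⊗ L) M m r n e' (tmul K L p q m e x y) z) =
      (ψ.f n).hom (tmul (K ⊗ L) M m r n e' (tmul K L p q m e x y) z)) : φ = ψ :=
  tensor_hom_ext fun m r n e' w z =>
    LinearMap.congr_fun (f := (φ.f n).hom ∘ₗ (tmul (K ⊗ L) M m r n e').flip z)
      (g := (ψ.f n).hom ∘ₗ (tmul (K ⊗ L) M m r n e').flip z)
      (tensor_ext fun p q e x y => h p q m r n e e' x y z) w

theorem tensorHom_tmul {K L K' L' : DGModule k} (φ : K ⟶ K') (ψ : L ⟶ L') (p q n : ℕ)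
    (h : p + q = n) (x : K.X p) (y : L.X q) :
    ((φ ⊗ₘ ψ).f n).hom (tmul K L p q n h x y) =
      tmul K' L' p q n h ((φ.f p).hom x) ((ψ.f q).hom y) :=
  LinearMap.congr_fun (congrArg ModuleCat.Hom.hom
    (HomologicalComplex.ι_mapBifunctorMap φ ψ (curriedTensor (ModuleCat.{u} k))
      (ComplexShape.down ℕ) p q n h)) (x ⊗ₜ[k] y)

theorem associator_tmul (K L M : DGModule k) (p q m r m' n : ℕ) (e : p + q = m) (e' : m + r = n)
    (e₂ : q + r = m') (e₂' : p + m' = n) (x : K.X p) (y : L.X q) (z : M.X r) :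
    ((α_ K L M).hom.f n).hom (tmul (K ⊗ L) M m r n e' (tmul K L p q m e x y) z) =
      tmul K (L ⊗ M) p m' n e₂' x (tmul L M q r m' e₂ y z) := by
  have h1 : p + q + r = n := by lia
  have h2 := HomologicalComplex.ι_mapBifunctorAssociatorX_hom
    (curriedAssociatorNatIso (ModuleCat.{u} k)) K L M (ComplexShape.down ℕ) (ComplexShape.down ℕ)
    (ComplexShape.down ℕ) p q r n h1
  rw [HomologicalComplex.mapBifunctor₁₂.ι_eq _ _ _ _ _ _ _ _ _ _ m _ e e',
    HomologicalComplex.mapBifunctor₂₃.ι_eq _ _ _ _ _ _ _ _ _ _ _ m' _ e₂ e₂', Category.assoc] at h2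
  have h3 : (HomologicalComplex.ιTensorObj K L p q m e ▷ M.X r) ≫
      HomologicalComplex.ιTensorObj (K ⊗ L) M m r n e' ≫ (α_ K L M).hom.f n =
    (α_ _ _ _).hom ≫ (K.X p ◁ HomologicalComplex.ιTensorObj L M q r m' e₂) ≫
      HomologicalComplex.ιTensorObj K (L ⊗ M) p m' n e₂' := h2
  exact LinearMap.congr_fun (congrArg ModuleCat.Hom.hom h3) ((x ⊗ₜ[k] y) ⊗ₜ[k] z)

/-- The generator of the unit complex. -/
noncomputable def unitOne (k : Type u) [CommRing k] : (𝟙_ (DGModule k)).X 0 :=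
  (HomologicalComplex.singleObjXSelf (ComplexShape.down ℕ) 0 (𝟙_ (ModuleCat.{u} k))).inv.hom
    (1 : k)

theorem leftUnitor_inv_apply (K : DGModule k) (n : ℕ) (x : K.X n) :
    ((λ_ K).inv.f n).hom x = tmul (𝟙_ (DGModule k)) K 0 n n (zero_add n) (unitOne k) x := by
  have h : (λ_ K).inv.f n = (λ_ (K.X n)).inv ≫
      ((HomologicalComplex.singleObjXSelf (ComplexShape.down ℕ) 0
        (𝟙_ (ModuleCat.{u} k))).inv ▷ K.X n) ≫
      HomologicalComplex.ιTensorObj (𝟙_ (DGModule k)) K 0 n n (zero_add n) :=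
    HomologicalComplex.leftUnitor'_inv K n
  rw [h]
  rfl

theorem rightUnitor_inv_apply (K : DGModule k) (n : ℕ) (x : K.X n) :
    ((ρ_ K).inv.f n).hom x = tmul K (𝟙_ (DGModule k)) n 0 n (add_zero n) x (unitOne k) := by
  have h : (ρ_ K).inv.f n = (ρ_ (K.X n)).inv ≫
      (K.X n ◁ (HomologicalComplex.singleObjXSelf (ComplexShape.down ℕ) 0
        (𝟙_ (ModuleCat.{u} k))).inv) ≫
      HomologicalComplex.ιTensorObj K (𝟙_ (DGModule k)) n 0 n (add_zero n) :=
    HomologicalComplex.rightUnitor'_inv K n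
  rw [h]
  rfl

theorem unit_hom_ext {K : DGModule k} {φ ψ : 𝟙_ (DGModule k) ⟶ K}
    (h : (φ.f 0).hom (unitOne k) = (ψ.f 0).hom (unitOne k)) : φ = ψ := by
  refine HomologicalComplex.from_single_hom_ext ?_
  rw [← cancel_epi (HomologicalComplex.singleObjXSelf (ComplexShape.down ℕ) 0
    (𝟙_ (ModuleCat.{u} k))).inv]
  exact ModuleCat.hom_ext (LinearMap.ext_ring h)

/-- The morphism out of the unit complex given by an element of degree zero. -/
noncomputable def unitDesc {K : DGModule k} (x : K.X 0) : 𝟙_ (DGModule k) ⟶ K :=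
  HomologicalComplex.mkHomFromSingle (ModuleCat.ofHom (LinearMap.toSpanSingleton k (K.X 0) x))
    (fun n hn => absurd hn (by simp))

theorem unitDesc_one {K : DGModule k} (x : K.X 0) : ((unitDesc x).f 0).hom (unitOne k) = x := by
  have := HomologicalComplex.mkHomFromSingle_f (K := K) (A := 𝟙_ (ModuleCat.{u} k)) (j := 0)
    (ModuleCat.ofHom (LinearMap.toSpanSingleton k (K.X 0) x))
    (fun n hn => absurd hn (by simp))
  rw [← Iso.inv_comp_eq] at this
  exact (LinearMap.congr_fun (congrArg ModuleCat.Hom.hom this) (1 : k)).trans (one_smul k x)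

theorem ιTensorObj_d₁ (K L : DGModule k) (p q n : ℕ) (h : p + q = n + 1) (x : K.X p) (y : L.X q) :
    (HomologicalComplex.mapBifunctor.d₁ K L (curriedTensor (ModuleCat.{u} k))
      (ComplexShape.down ℕ) p q n).hom (x ⊗ₜ[k] y) = (tmul K L).left p q n h x y := by
  cases p with
  | zero =>
    rw [HomologicalComplex.mapBifunctor.d₁_eq_zero]
    · rfl
    · simp
  | succ p =>
    rw [HomologicalComplex.mapBifunctor.d₁_eq K L _ _ (i₁ := p + 1) (i₁' := p) (by simp) q n
      (show p + q = n by lia)]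
    exact one_smul ℤˣ _

theorem ιTensorObj_d₂ (K L : DGModule k) (p q n : ℕ) (h : p + q = n + 1) (x : K.X p) (y : L.X q) :
    (HomologicalComplex.mapBifunctor.d₂ K L (curriedTensor (ModuleCat.{u} k))
      (ComplexShape.down ℕ) p q n).hom (x ⊗ₜ[k] y) =
        (-1 : k) ^ p • (tmul K L).right p q n h x y := by
  cases q with
  | zero =>
    rw [HomologicalComplex.mapBifunctor.d₂_eq_zero]
    · exact (smul_zero _).symm
    · simp
  | succ q =>
    rw [HomologicalComplex.mapBifunctor.d₂_eq K L _ _ p (i₂ := q + 1) (i₂' := q) (by simp) n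
      (show p + q = n by lia)]
    have h1 : ComplexShape.ε₂ (ComplexShape.down ℕ) (ComplexShape.down ℕ) (ComplexShape.down ℕ)
        (p, q + 1) = (-1) ^ p := rfl
    rw [h1]
    have h2 : ∀ w : (K ⊗ L).X n, ((-1 : ℤˣ) ^ p) • w = (-1 : k) ^ p • w := fun w => by
      rcases Nat.even_or_odd p with e | e
      · rw [e.neg_one_pow, e.neg_one_pow, one_smul, one_smul]
      · rw [e.neg_one_pow, e.neg_one_pow, neg_smul, one_smul]
        exact (neg_smul (1 : ℤ) w).trans (congrArg Neg.neg (one_smul ℤ w))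
    exact h2 _

theorem tmul_leibniz (K L : DGModule k) : (tmul K L).Leibniz := by
  intro p q n h x y
  have h1 : HomologicalComplex.ιTensorObj K L p q (n + 1) h ≫ (K ⊗ L).d (n + 1) n =
      HomologicalComplex.mapBifunctor.d₁ K L (curriedTensor (ModuleCat.{u} k))
        (ComplexShape.down ℕ) p q n + HomologicalComplex.mapBifunctor.d₂ K L
          (curriedTensor (ModuleCat.{u} k)) (ComplexShape.down ℕ) p q n := by
    have := HomologicalComplex.mapBifunctor.d_eq K L (curriedTensor (ModuleCat.{u} k))
      (ComplexShape.down ℕ) (n + 1) n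
    refine (congrArg (HomologicalComplex.ιTensorObj K L p q (n + 1) h ≫ ·) this).trans ?_
    rw [Preadditive.comp_add, HomologicalComplex.mapBifunctor.ι_D₁,
      HomologicalComplex.mapBifunctor.ι_D₂]
  refine (LinearMap.congr_fun (congrArg ModuleCat.Hom.hom h1) (x ⊗ₜ[k] y)).trans ?_
  exact congrArg₂ (· + ·) (ιTensorObj_d₁ K L p q n h x y) (ιTensorObj_d₂ K L p q n h x y)

/-- A family of linear maps that carries a pairing to another one respects the first terms of the
Leibniz rule; no compatibility with differentials is involved. -/
theorem Pairing.map_left {K L M N : DGModule k} (β : Pairing K L M) (γ : Pairing K L N)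
    (φ : ∀ n, M.X n →ₗ[k] N.X n) (h : ∀ p q n e x y, φ n (β p q n e x y) = γ p q n e x y)
    (p q n : ℕ) (e : p + q = n + 1) (x : K.X p) (y : L.X q) :
    φ n (β.left p q n e x y) = γ.left p q n e x y := by
  cases p with
  | zero => exact map_zero _
  | succ p => exact h _ _ _ _ _ _

theorem Pairing.map_right {K L M N : DGModule k} (β : Pairing K L M) (γ : Pairing K L N)
    (φ : ∀ n, M.X n →ₗ[k] N.X n) (h : ∀ p q n e x y, φ n (β p q n e x y) = γ p q n e x y)
    (p q n : ℕ) (e : p + q = n + 1) (x : K.X p) (y : L.X q) :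
    φ n (β.right p q n e x y) = γ.right p q n e x y := by
  cases q with
  | zero => exact map_zero _
  | succ q => exact h _ _ _ _ _ _

/-- The degree `n` part of the linear map out of a tensor product given by a pairing. -/
noncomputable def descDeg {K L M : DGModule k} (β : Pairing K L M) (n : ℕ) :
    (K ⊗ L).X n ⟶ M.X n :=
  HomologicalComplex.mapBifunctorDesc (K₁ := K) (K₂ := L) (F := curriedTensor (ModuleCat.{u} k))
    (c := ComplexShape.down ℕ) fun p q h => ModuleCat.ofHom (TensorProduct.lift (β p q n h))

theorem descDeg_tmul {K L M : DGModule k} (β : Pairing K L M) (p q n : ℕ)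
    (h : p + q = n) (x : K.X p) (y : L.X q) :
    (descDeg β n).hom (tmul K L p q n h x y) = β p q n h x y :=
  LinearMap.congr_fun (congrArg ModuleCat.Hom.hom (HomologicalComplex.ι_mapBifunctorDesc
    (K₁ := K) (K₂ := L) (F := curriedTensor (ModuleCat.{u} k)) (c := ComplexShape.down ℕ)
    (fun p q h => ModuleCat.ofHom (TensorProduct.lift (β p q n h))) p q h)) (x ⊗ₜ[k] y)

/-- The morphism out of a tensor product given by a pairing that satisfies the Leibniz rule. -/
noncomputable def desc {K L M : DGModule k} (β : Pairing K L M) (hβ : β.Leibniz) : K ⊗ L ⟶ M where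
  f n := descDeg β n
  comm' := by
    rintro _ n rfl
    refine ModuleCat.hom_ext (tensor_ext fun p q e x y => ?_)
    change (M.d (n + 1) n).hom ((descDeg β (n + 1)).hom (tmul K L p q (n + 1) e x y)) =
      (descDeg β n).hom (((K ⊗ L).d (n + 1) n).hom (tmul K L p q (n + 1) e x y))
    rw [descDeg_tmul, hβ, tmul_leibniz, map_add, map_smul,
      Pairing.map_left (tmul K L) β (fun n => (descDeg β n).hom) (descDeg_tmul β),
      Pairing.map_right (tmul K L) β (fun n => (descDeg β n).hom) (descDeg_tmul β)]

theorem desc_tmul {K L M : DGModule k} (β : Pairing K L M) (hβ : β.Leibniz) (p q n : ℕ)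
    (h : p + q = n) (x : K.X p) (y : L.X q) :
    ((desc β hβ).f n).hom (tmul K L p q n h x y) = β p q n h x y :=
  descDeg_tmul β p q n h x y

end DGModule

/-! ### Dg-categories in terms of elements -/

namespace DGModule

variable {k : Type u} [CommRing k]

theorem isIso_of_bijective {K L : DGModule k} (φ : K ⟶ L)
    (h : ∀ n, Function.Bijective (φ.f n).hom) : IsIso φ := by
  have : ∀ n, IsIso (φ.f n) := fun n => (ConcreteCategory.isIso_iff_bijective (φ.f n)).mpr (h n)
  exact HomologicalComplex.Hom.isIso_of_components φ

/-- Construct a chain map from its components. -/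
def homOfDeg {K L : DGModule k} (φ : ∀ n, K.X n →ₗ[k] L.X n)
    (h : ∀ n x, (L.d (n + 1) n).hom (φ (n + 1) x) = φ n ((K.d (n + 1) n).hom x)) : K ⟶ L where
  f n := ModuleCat.ofHom (φ n)
  comm' := by
    rintro _ n rfl
    exact ModuleCat.hom_ext (LinearMap.ext fun x => h n x)

end DGModule

namespace DGCat

variable {k : Type u} [CommRing k]

/-- The composition of a dg-category, with an arbitrary name for the degree of the result. -/
noncomputable def pairing (C : DGCat k) (x y z : C.Ob) :
    DGModule.Pairing (C.hom x y) (C.hom y z) (C.hom x z) := fun p q n h =>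
  (DGModule.tmul (C.hom x y) (C.hom y z) p q n h).compr₂ ((eComp (DGModule k) x y z).f n).hom

theorem eComp_tmul (C : DGCat k) (x y z : C.Ob) (p q n : ℕ) (h : p + q = n)
    (f : (C.hom x y).X p) (g : (C.hom y z).X q) :
    ((eComp (DGModule k) x y z).f n).hom (DGModule.tmul (C.hom x y) (C.hom y z) p q n h f g) =
      C.pairing x y z p q n h f g := rfl

theorem comp_eq_pairing (C : DGCat k) (x y z : C.Ob) (p q : ℕ) :
    C.comp x y z p q = C.pairing x y z p q (p + q) rfl := rfl

theorem pairing_leibniz (C : DGCat k) (x y z : C.Ob) : (C.pairing x y z).Leibniz := by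
  intro p q n h f g
  rw [← eComp_tmul, DGModule.f_d, DGModule.tmul_leibniz, map_add, map_smul,
    DGModule.Pairing.map_left _ (C.pairing x y z)
      (fun n => ((eComp (DGModule k) x y z).f n).hom) (C.eComp_tmul x y z),
    DGModule.Pairing.map_right _ (C.pairing x y z)
      (fun n => ((eComp (DGModule k) x y z).f n).hom) (C.eComp_tmul x y z)]

theorem pairing_assoc (C : DGCat k) {w x y z : C.Ob} {p q m r m' n : ℕ} (e : p + q = m)
    (e' : m + r = n) (e₂ : q + r = m') (e₂' : p + m' = n) (f : (C.hom w x).X p)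
    (g : (C.hom x y).X q) (h : (C.hom y z).X r) :
    C.pairing w y z m r n e' (C.pairing w x y p q m e f g) h =
      C.pairing w x z p m' n e₂' f (C.pairing x y z q r m' e₂ g h) := by
  have h1 := congrArg (fun t => (t.f n).hom
    (DGModule.tmul (C.hom w x ⊗ C.hom x y) (C.hom y z) m r n e'
      (DGModule.tmul (C.hom w x) (C.hom x y) p q m e f g) h)) (e_assoc' (DGModule k) w x y z)
  simp only [DGModule.comp_f_apply] at h1
  rw [DGModule.associator_tmul _ _ _ p q m r m' n e e' e₂ e₂', ← id_tensorHom, ← tensorHom_id,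
    DGModule.tensorHom_tmul, DGModule.tensorHom_tmul] at h1
  exact h1.symm

theorem one_pairing (C : DGCat k) {x y : C.Ob} {n : ℕ} (f : (C.hom x y).X n) :
    C.pairing x x y 0 n n (zero_add n) (C.one x) f = f := by
  have h1 := congrArg (fun t => (t.f n).hom f) (e_id_comp (DGModule k) x y)
  simp only [DGModule.comp_f_apply] at h1
  rw [DGModule.leftUnitor_inv_apply, ← tensorHom_id, DGModule.tensorHom_tmul] at h1
  exact h1

theorem pairing_one (C : DGCat k) {x y : C.Ob} {n : ℕ} (f : (C.hom x y).X n) :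
    C.pairing x y y n 0 n (add_zero n) f (C.one y) = f := by
  have h1 := congrArg (fun t => (t.f n).hom f) (e_comp_id (DGModule k) x y)
  simp only [DGModule.comp_f_apply] at h1
  rw [DGModule.rightUnitor_inv_apply, ← id_tensorHom, DGModule.tensorHom_tmul] at h1
  exact h1

/-- The data of a dg-category in terms of elements. -/
structure Data (k : Type u) [CommRing k] where
  Ob : Type u
  H : Ob → Ob → DGModule k
  comp : ∀ x y z, DGModule.Pairing (H x y) (H y z) (H x z)
  one : ∀ x, (H x x).X 0
  leibniz : ∀ x y z, (comp x y z).Leibniz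
  assoc : ∀ {w x y z : Ob} {p q m r m' n : ℕ} (e : p + q = m) (e' : m + r = n) (e₂ : q + r = m')
    (e₂' : p + m' = n) (f : (H w x).X p) (g : (H x y).X q) (h : (H y z).X r),
    comp w y z m r n e' (comp w x y p q m e f g) h =
      comp w x z p m' n e₂' f (comp x y z q r m' e₂ g h)
  one_comp : ∀ {x y : Ob} {n : ℕ} (f : (H x y).X n), comp x x y 0 n n (zero_add n) (one x) f = f
  comp_one : ∀ {x y : Ob} {n : ℕ} (f : (H x y).X n), comp x y y n 0 n (add_zero n) f (one y) = f

namespace Data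

variable (D : Data k)

/-- The composition as a morphism out of the tensor product. -/
noncomputable def compHom (x y z : D.Ob) : D.H x y ⊗ D.H y z ⟶ D.H x z :=
  DGModule.desc (D.comp x y z) (D.leibniz x y z)

theorem compHom_tmul (x y z : D.Ob) (p q n : ℕ) (e : p + q = n) (f : (D.H x y).X p)
    (g : (D.H y z).X q) :
    ((D.compHom x y z).f n).hom (DGModule.tmul (D.H x y) (D.H y z) p q n e f g) =
      D.comp x y z p q n e f g :=
  DGModule.desc_tmul _ _ _ _ _ _ _ _

/-- The dg-category given by a `Data`. -/
noncomputable def toCat : DGCat k where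
  Ob := D.Ob
  enriched :=
    { Hom := D.H
      id := fun x => DGModule.unitDesc (K := D.H x x) (D.one x)
      comp := D.compHom
      id_comp := fun x y => DGModule.hom_ext fun n f => by
        simp only [DGModule.comp_f_apply]
        rw [DGModule.leftUnitor_inv_apply, ← tensorHom_id, DGModule.tensorHom_tmul,
          DGModule.unitDesc_one, compHom_tmul]
        exact D.one_comp f
      comp_id := fun x y => DGModule.hom_ext fun n f => by
        simp only [DGModule.comp_f_apply]
        rw [DGModule.rightUnitor_inv_apply, ← id_tensorHom, DGModule.tensorHom_tmul,
          DGModule.unitDesc_one, compHom_tmul]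
        exact D.comp_one f
      assoc := fun w x y z => by
        rw [Iso.inv_comp_eq]
        refine DGModule.tensor_hom_ext₃ fun p q m r n e e' f g h => ?_
        simp only [DGModule.comp_f_apply]
        rw [DGModule.associator_tmul _ _ _ p q m r (q + r) n e e' rfl (by lia),
          ← id_tensorHom, ← tensorHom_id, DGModule.tensorHom_tmul, DGModule.tensorHom_tmul,
          compHom_tmul, compHom_tmul, compHom_tmul, compHom_tmul]
        exact D.assoc _ _ _ _ f g h }

theorem toCat_pairing (x y z : D.Ob) (p q n : ℕ) (h : p + q = n) :
    D.toCat.pairing x y z p q n h = D.comp x y z p q n h :=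
  LinearMap.ext fun f => LinearMap.ext fun g => D.compHom_tmul x y z p q n h f g

theorem toCat_one (x : D.Ob) : D.toCat.one x = D.one x :=
  DGModule.unitDesc_one (K := D.H x x) _

end Data

variable {A B C : DGCat k}

theorem onDeg_d (F : A ⟶ B) (x y : A.Ob) (m n : ℕ) (f : (A.hom x y).X m) :
    ((B.hom _ _).d m n).hom (onDeg F x y m f) = onDeg F x y n (((A.hom x y).d m n).hom f) :=
  DGModule.f_d _ m n f

theorem onDeg_one (F : A ⟶ B) (x : A.Ob) : onDeg F x x 0 (A.one x) = B.one _ :=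
  congrArg (fun t => (t.f 0).hom (DGModule.unitOne k))
    (EnrichedFunctor.map_id (V := DGModule k) (C := A.Ob) (D := B.Ob) (self := F) x)

theorem onDeg_pairing (F : A ⟶ B) (x y z : A.Ob) (p q n : ℕ) (h : p + q = n)
    (f : (A.hom x y).X p) (g : (A.hom y z).X q) :
    onDeg F x z n (A.pairing x y z p q n h f g) =
      B.pairing _ _ _ p q n h (onDeg F x y p f) (onDeg F y z q g) := by
  have h1 := congrArg (fun t => (t.f n).hom
    (DGModule.tmul (A.hom x y) (A.hom y z) p q n h f g))
    (EnrichedFunctor.map_comp (V := DGModule k) (C := A.Ob) (D := B.Ob) (self := F) x y z)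
  simp only [DGModule.comp_f_apply] at h1
  rw [DGModule.tensorHom_tmul] at h1
  exact h1

/-- Construct a dg-functor from maps in the single degrees. -/
noncomputable def homMk (ob : A.Ob → B.Ob)
    (φ : ∀ x y n, (A.hom x y).X n →ₗ[k] (B.hom (ob x) (ob y)).X n)
    (d : ∀ x y n f, ((B.hom (ob x) (ob y)).d (n + 1) n).hom (φ x y (n + 1) f) =
      φ x y n (((A.hom x y).d (n + 1) n).hom f))
    (one : ∀ x, φ x x 0 (A.one x) = B.one (ob x))
    (comp : ∀ x y z p q n h f g, φ x z n (A.pairing x y z p q n h f g) =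
      B.pairing _ _ _ p q n h (φ x y p f) (φ y z q g)) : A ⟶ B :=
  show EnrichedFunctor (DGModule k) A.Ob B.Ob from
  { obj := ob
    map := fun x y => DGModule.homOfDeg (φ x y) (d x y)
    map_id := fun x => DGModule.unit_hom_ext (one x)
    map_comp := fun x y z => DGModule.tensor_hom_ext fun p q n h f g => by
      simp only [DGModule.comp_f_apply]
      rw [DGModule.tensorHom_tmul]
      exact comp x y z p q n h f g }

theorem functor_ext {F G : A ⟶ B} (h : ∀ x, SmallEnrichedCat.onOb F x = SmallEnrichedCat.onOb G x)
    (h' : ∀ x y n f, HEq (onDeg F x y n f) (onDeg G x y n f)) : F = G := by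
  obtain ⟨f, φ, h1, h2⟩ : EnrichedFunctor (DGModule k) A.Ob B.Ob := F
  obtain ⟨g, ψ, h3, h4⟩ : EnrichedFunctor (DGModule k) A.Ob B.Ob := G
  obtain rfl : f = g := funext h
  obtain rfl : φ = ψ := funext fun x => funext fun y => DGModule.hom_ext fun n a =>
    eq_of_heq (h' x y n a)
  rfl

/-- A dg-functor that is the identity on objects and bijective on modules of morphisms is an
isomorphism. -/
theorem isIso_homMk_id {O : Type u} {a b : EnrichedCategory (DGModule k) O}
    (φ : ∀ x y n, (DGCat.hom ⟨O, a⟩ x y).X n →ₗ[k] (DGCat.hom ⟨O, b⟩ x y).X n)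
    (d one comp) (h : ∀ x y n, Function.Bijective (φ x y n)) :
    IsIso (homMk (A := ⟨O, a⟩) (B := ⟨O, b⟩) id φ d one comp) :=
  SmallEnrichedCat.isIso_of_isIso_map _ (fun _ => rfl) fun x y =>
    DGModule.isIso_of_bijective (DGModule.homOfDeg (φ x y) (d x y)) (h x y)

/-- Construct a dg-functor from maps of `Data`. -/
noncomputable def Data.homMk (D D' : Data k) (ob : D.Ob → D'.Ob)
    (φ : ∀ x y n, (D.H x y).X n →ₗ[k] (D'.H (ob x) (ob y)).X n)
    (d : ∀ x y n f, ((D'.H (ob x) (ob y)).d (n + 1) n).hom (φ x y (n + 1) f) =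
      φ x y n (((D.H x y).d (n + 1) n).hom f))
    (one : ∀ x, φ x x 0 (D.one x) = D'.one (ob x))
    (comp : ∀ x y z p q n h f g, φ x z n (D.comp x y z p q n h f g) =
      D'.comp _ _ _ p q n h (φ x y p f) (φ y z q g)) : D.toCat ⟶ D'.toCat :=
  DGCat.homMk (A := D.toCat) (B := D'.toCat) ob φ d
    (fun x => (congrArg (φ x x 0) (D.toCat_one x)).trans
      ((one x).trans (D'.toCat_one (ob x)).symm))
    (fun x y z p q n h f g => (congrArg (fun t => φ x z n (t f g))
      (D.toCat_pairing x y z p q n h)).trans ((comp x y z p q n h f g).trans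
        (congrArg (fun t => t (φ x y p f) (φ y z q g)) (D'.toCat_pairing _ _ _ p q n h).symm)))

end DGCat

/-! ### Degenerate maps and decompositions of narrow simplices -/

namespace NarrowSimplex

theorem nat_coface (n : ℕ) (i : Fin (n + 1)) {v : ℕ} (hv : v ≤ n + 1) :
    Hom.nat (coface n i) v = if v ≤ i.val then v else v + 1 :=
  nat_homMk (p := ⟨n⟩) (q := ⟨n + 1⟩) _ _ _ _ _ _ hv

theorem nat_codegeneracy (n : ℕ) (i : Fin n) {v : ℕ} (hv : v ≤ n + 2) :
    Hom.nat (codegeneracy n i) v = if v ≤ i.val + 1 then v else v - 1 :=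
  nat_homMk (p := ⟨n + 1⟩) (q := ⟨n⟩) _ _ _ _ _ _ hv

theorem Hom.nat_le {m n : ℕ} (f : (⟨m⟩ : NarrowSimplex) ⟶ ⟨n⟩) (v : ℕ) : Hom.nat f v ≤ n + 1 :=
  FinInterval.Hom.nat_le _ v

theorem Hom.nat_le_inner {m n : ℕ} (f : (⟨m⟩ : NarrowSimplex) ⟶ ⟨n⟩) {v : ℕ} (hv : v ≤ m) :
    Hom.nat f v ≤ n :=
  Nat.le_of_lt_succ (Hom.nat_lt f (Nat.lt_succ_of_le hv))

theorem Hom.nat_last' {m n : ℕ} (f : (⟨m⟩ : NarrowSimplex) ⟶ ⟨n⟩) : Hom.nat f (m + 1) = n + 1 :=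
  Hom.nat_last f

/-- A map is degenerate if it identifies two consecutive inner vertices; a narrow map is injective
precisely if it is not degenerate. -/
def IsDegenerate {m n : ℕ} (f : (⟨m⟩ : NarrowSimplex) ⟶ ⟨n⟩) : Prop :=
  ∃ j, j + 2 ≤ m ∧ Hom.nat f (j + 1) = Hom.nat f (j + 2)

theorem IsDegenerate.comp {l m n : ℕ} {f : (⟨l⟩ : NarrowSimplex) ⟶ ⟨m⟩} (h : IsDegenerate f)
    (g : (⟨m⟩ : NarrowSimplex) ⟶ ⟨n⟩) : IsDegenerate (f ≫ g) := by
  obtain ⟨j, hj, h⟩ := h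
  exact ⟨j, hj, by rw [Hom.nat_comp, Hom.nat_comp, h]⟩

theorem codegeneracy_coface_comp {m n : ℕ} (f : (⟨m + 1⟩ : NarrowSimplex) ⟶ ⟨n⟩) (j : Fin m)
    (h : Hom.nat f (j + 1) = Hom.nat f (j + 2)) :
    codegeneracy m j ≫ coface m j.castSucc ≫ f = f := by
  refine hom_ext_nat fun v (hv : v ≤ m + 2) => ?_
  have hj := j.isLt
  rw [Hom.nat_comp, Hom.nat_comp, nat_codegeneracy _ _ hv,
    nat_coface _ _ (by split_ifs <;> lia), Fin.val_castSucc]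
  by_cases h1 : v = j + 1
  · subst h1
    rw [if_pos le_rfl, if_neg (by lia), h]
  · congr 1
    split_ifs <;> lia

theorem IsDegenerate.exists_codegeneracy {m n : ℕ} {f : (⟨m + 1⟩ : NarrowSimplex) ⟶ ⟨n⟩}
    (h : IsDegenerate f) : ∃ (j : Fin m) (g : _), f = codegeneracy m j ≫ g := by
  obtain ⟨j, hj, h⟩ := h
  exact ⟨⟨j, by lia⟩, _, (codegeneracy_coface_comp f ⟨j, by lia⟩ h).symm⟩

/-- A map that misses an inner vertex factors through the corresponding coface map. -/
theorem exists_comp_coface {m n : ℕ} (f : (⟨m⟩ : NarrowSimplex) ⟶ ⟨n + 1⟩) (i : Fin (n + 1))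
    (h : ∀ v ≤ m, Hom.nat f v ≠ i + 1) :
    ∃ g : (⟨m⟩ : NarrowSimplex) ⟶ ⟨n⟩, f = g ≫ coface n i := by
  have hi := i.isLt
  have h : ∀ v ≤ m + 1, Hom.nat f v ≠ i + 1 := fun v hv => by
    rcases hv.eq_or_lt with rfl | hv
    · rw [Hom.nat_last']
      lia
    · exact h v (by lia)
  refine ⟨homMk _ _ (fun v => if Hom.nat f v ≤ i then Hom.nat f v else Hom.nat f v - 1)
    (fun a b hab _ => ?_) ?_ ?_ (fun a ha hb => ?_) (fun a ha => ?_),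
    hom_ext_nat fun v (hv : v ≤ m + 1) => ?_⟩
  · have := Hom.nat_mono f hab
    split_ifs <;> lia
  · simp [Hom.nat_zero]
  · have := Hom.nat_last' f
    dsimp only
    rw [this, if_neg (by lia)]
    lia
  · have h1 := Hom.nat_pos f ha
    have h2 := h a hb
    split_ifs <;> lia
  · have h1 := Hom.nat_le_inner f (v := a) (by simpa [Nat.lt_succ_iff] using ha)
    dsimp only
    split_ifs <;> lia
  · have h1 := Hom.nat_le f v
    have h2 := h v hv
    rw [Hom.nat_comp, nat_homMk _ _ _ _ _ _ hv, nat_coface _ _ (by split_ifs <;> lia)]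
    split_ifs <;> lia

theorem nat_lt_of_not_isDegenerate {m n : ℕ} {f : (⟨m⟩ : NarrowSimplex) ⟶ ⟨n⟩}
    (h : ¬ IsDegenerate f) {v : ℕ} (hv : v < m) : Hom.nat f v < Hom.nat f (v + 1) := by
  obtain _ | v := v
  · rw [Hom.nat_zero]
    exact Hom.nat_pos f (by lia)
  · refine lt_of_le_of_ne (Hom.nat_mono f (by lia)) fun h2 => h ⟨v, by lia, h2⟩

/-- An injective map is an identity or factors through a coface map. -/
theorem eq_id_or_exists_coface {m n : ℕ} (f : (⟨m⟩ : NarrowSimplex) ⟶ ⟨n⟩)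
    (h : ¬ IsDegenerate f) :
    (∃ e : m = n, f = cast e) ∨
      ∃ (n' : ℕ) (e : n' + 1 = n) (i : Fin (n' + 1)) (g : _), f = g ≫ coface n' i ≫ cast e := by
  have key : ∀ v, 0 < v → v ≤ n → (∀ a ≤ m, Hom.nat f a ≠ v) →
      ∃ (n' : ℕ) (e : n' + 1 = n) (i : Fin (n' + 1)) (g : _), f = g ≫ coface n' i ≫ cast e := by
    intro v h1 h2 h3
    obtain _ | n := n
    · lia
    obtain ⟨g, hg⟩ := exists_comp_coface f ⟨v - 1, by lia⟩ fun a ha => by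
      have := h3 a ha
      simp only
      lia
    refine ⟨n, rfl, ⟨v - 1, by lia⟩, g, hom_ext_nat fun a ha => ?_⟩
    have h4 : Hom.nat f a ≤ n + 2 := Hom.nat_le f a
    rw [hg] at h4 ⊢
    rw [← Category.assoc, Hom.nat_comp (g ≫ _) (cast _), nat_cast _ h4]
  by_cases h1 : ∀ v ≤ m, Hom.nat f v = v
  · have hmn := Hom.nat_le_inner f le_rfl
    rw [h1 m le_rfl] at hmn
    rcases hmn.eq_or_lt with rfl | hlt
    · refine Or.inl ⟨rfl, hom_ext_nat fun v (hv : v ≤ m + 1) => ?_⟩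
      rw [nat_cast _ hv]
      rcases hv.eq_or_lt with rfl | hv
      · exact Hom.nat_last' f
      · exact h1 v (by lia)
    · exact Or.inr (key (m + 1) (by lia) hlt fun a ha => by rw [h1 a ha]; lia)
  · push Not at h1
    classical
    obtain ⟨h2, h3⟩ := Nat.find_spec h1
    set v := Nat.find h1 with hv
    have h4 : ∀ a < v, Hom.nat f a = a := fun a ha => by
      have := Nat.find_min h1 ha
      push Not at this
      exact this (by lia)
    have h5 : 0 < v := by
      by_contra h5
      obtain h5 : v = 0 := by lia
      rw [h5] at h3
      exact h3 (Hom.nat_zero f)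
    have h6 : v < Hom.nat f v := by
      have h7 := nat_lt_of_not_isDegenerate h (v := v - 1) (by lia)
      rw [h4 _ (by lia), Nat.sub_add_cancel h5] at h7
      lia
    refine Or.inr (key v h5 (by have := Hom.nat_le_inner f h2; lia) fun a ha => ?_)
    rcases Nat.lt_or_ge a v with h7 | h7
    · rw [h4 a h7]
      lia
    · have := Hom.nat_mono f h7
      lia

/-- The alternating sum of the faces of a degenerate element is degenerate: the two faces that
undo the degeneracy cancel. -/
theorem sum_coface_mem {k M : Type*} [CommRing k] [AddCommGroup M] [Module k M]
    (S : Submodule k M) {m n : ℕ} (c : ((⟨m⟩ : NarrowSimplex) ⟶ ⟨n⟩) → M)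
    (hc : ∀ g, IsDegenerate g → c g ∈ S) (f : (⟨m + 1⟩ : NarrowSimplex) ⟶ ⟨n⟩)
    (hf : IsDegenerate f) : ∑ i : Fin (m + 1), (-1 : k) ^ (i : ℕ) • c (coface m i ≫ f) ∈ S := by
  obtain ⟨j, hj, h⟩ := hf
  set a : Fin (m + 1) := ⟨j, by lia⟩
  set b : Fin (m + 1) := ⟨j + 1, by lia⟩
  have hab : a ≠ b := fun h => by simpa [a, b] using congrArg Fin.val h
  have hcan : coface m a ≫ f = coface m b ≫ f := by
    refine hom_ext_nat fun v (hv : v ≤ m + 1) => ?_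
    rw [Hom.nat_comp, Hom.nat_comp, nat_coface _ _ hv, nat_coface _ _ hv]
    simp only [a, b]
    by_cases h1 : v = j + 1
    · subst h1
      rw [if_neg (by lia), if_pos le_rfl, h]
    · congr 1
      split_ifs <;> lia
  rw [← Finset.add_sum_erase _ _ (Finset.mem_univ a),
    ← Finset.add_sum_erase _ _ (Finset.mem_erase.mpr ⟨hab.symm, Finset.mem_univ b⟩), ← add_assoc,
    hcan]
  have h0 : (-1 : k) ^ (a : ℕ) • c (coface m b ≫ f) + (-1 : k) ^ (b : ℕ) • c (coface m b ≫ f) =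
      0 := by
    rw [← add_smul]
    simp [a, b, pow_succ]
  rw [h0, zero_add]
  refine S.sum_mem fun i hi => S.smul_mem _ (hc _ ?_)
  simp only [Finset.mem_erase, ne_eq, Finset.mem_univ, and_true, Fin.ext_iff, a, b] at hi
  have hi2 := i.isLt
  rcases Nat.lt_or_ge i.val j with h1 | h1
  · refine ⟨j - 1, by lia, ?_⟩
    rw [Hom.nat_comp, Hom.nat_comp, nat_coface _ _ (by lia), nat_coface _ _ (by lia),
      if_neg (by lia), if_neg (by lia), show j - 1 + 2 = j - 1 + 1 + 1 by rfl,
      show j - 1 + 1 + 1 = j + 1 by lia, h]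
  · refine ⟨j, by lia, ?_⟩
    rw [Hom.nat_comp, Hom.nat_comp, nat_coface _ _ (by lia), nat_coface _ _ (by lia),
      if_pos (by lia), if_pos (by lia), h]

/-- The simplicial identity for cofaces, with `i ≤ j`. -/
theorem coface_comp_coface {n : ℕ} {i j : ℕ} (h : i ≤ j) (hj : j < n + 1) :
    coface n ⟨j, hj⟩ ≫ coface (n + 1) ⟨i, by lia⟩ =
      coface n ⟨i, by lia⟩ ≫ coface (n + 1) ⟨j + 1, by lia⟩ := by
  refine hom_ext_nat fun v (hv : v ≤ n + 1) => ?_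
  rw [Hom.nat_comp, Hom.nat_comp, nat_coface _ _ hv, nat_coface _ _ hv,
    nat_coface _ _ (by split_ifs <;> lia), nat_coface _ _ (by split_ifs <;> lia)]
  dsimp only
  split_ifs <;> lia

/-- The map `f` decomposes as the product `u ⋄ v`. -/
structure IsSplit {m n m₁ m₂ p q : ℕ} (f : (⟨m⟩ : NarrowSimplex) ⟶ ⟨n⟩)
    (u : (⟨m₁⟩ : NarrowSimplex) ⟶ ⟨p⟩) (v : (⟨m₂⟩ : NarrowSimplex) ⟶ ⟨q⟩) : Prop where
  source : m₁ + m₂ = m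
  target : p + q = n
  nat_eq : ∀ i ≤ m + 1, Hom.nat f i = if i ≤ m₁ then Hom.nat u i else p + Hom.nat v (i - m₁)

theorem isSplit_join {m₁ m₂ p q : ℕ} (u : (⟨m₁⟩ : NarrowSimplex) ⟶ ⟨p⟩)
    (v : (⟨m₂⟩ : NarrowSimplex) ⟶ ⟨q⟩) : IsSplit (join u v) u v :=
  ⟨rfl, rfl, fun i hi => by simp only [nat_join u v hi, Nat.lt_succ_iff]⟩

theorem isSplit_cast_join {m m₁ m₂ n p q : ℕ} (h : m = m₁ + m₂) (h' : p + q = n)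
    (u : (⟨m₁⟩ : NarrowSimplex) ⟶ ⟨p⟩) (v : (⟨m₂⟩ : NarrowSimplex) ⟶ ⟨q⟩) :
    IsSplit (cast h ≫ join u v ≫ cast h') u v := by
  subst h h'
  refine ⟨rfl, rfl, fun i hi => ?_⟩
  rw [Hom.nat_comp, Hom.nat_comp, nat_cast _ hi, nat_cast _ (Hom.nat_le _ _), nat_join u v hi]
  simp only [Nat.lt_succ_iff]

/-- Every map decomposes along a given decomposition of its target. -/
theorem exists_isSplit {m n p q : ℕ} (f : (⟨m⟩ : NarrowSimplex) ⟶ ⟨n⟩) (h : p + q = n) :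
    ∃ (m₁ m₂ : ℕ) (u : (⟨m₁⟩ : NarrowSimplex) ⟶ ⟨p⟩) (v : (⟨m₂⟩ : NarrowSimplex) ⟶ ⟨q⟩),
      IsSplit f u v := by
  set c := Nat.findGreatest (fun i => Hom.nat f i ≤ p) m with hc
  have hcm : c ≤ m := Nat.findGreatest_le m
  have hcp : Hom.nat f c ≤ p := Nat.findGreatest_spec (P := fun i => Hom.nat f i ≤ p)
    (Nat.zero_le m) (by rw [Hom.nat_zero]; exact Nat.zero_le p)
  have hcl : ∀ i, i ≤ c → Hom.nat f i ≤ p := fun i hi => (Hom.nat_mono f hi).trans hcp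
  have hcg : ∀ i, c < i → p < Hom.nat f i := fun i hi => by
    rcases Nat.lt_or_ge m i with h1 | h1
    · have := Hom.nat_mono f (i := m + 1) (j := i) h1
      rw [Hom.nat_last'] at this
      lia
    · have := Nat.findGreatest_is_greatest hi h1
      lia
  refine ⟨c, m - c,
    homMk _ _ (fun i => if i ≤ c then Hom.nat f i else p + 1) (fun a b hab _ => ?_) ?_ ?_
      (fun a ha hb => ?_) (fun a ha => ?_),
    homMk _ _ (fun i => Hom.nat f (i + c) - p) (fun a b hab _ => ?_) ?_ ?_
      (fun a ha hb => ?_) (fun a ha => ?_), by lia, h, fun i hi => ?_⟩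
  · have := Hom.nat_mono f hab
    have := hcl a
    split_ifs <;> lia
  · simp [Hom.nat_zero]
  · simp
  · have := Hom.nat_pos f ha
    split_ifs <;> lia
  · have h1 : a ≤ c := by simpa [Nat.lt_succ_iff] using ha
    have := hcl a h1
    dsimp only
    rw [if_pos h1]
    lia
  · exact Nat.sub_le_sub_right (Hom.nat_mono f (by lia)) _
  · rw [Nat.zero_add]
    lia
  · dsimp only
    rw [show m - c + 1 + c = m + 1 by lia, Hom.nat_last']
    lia
  · have := hcg (a + c) (by lia)
    lia
  · have := Hom.nat_le_inner f (v := a + c) (by dsimp only at ha; lia)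
    dsimp only
    lia
  · by_cases h1 : i ≤ c
    · rw [if_pos h1, nat_homMk _ _ _ _ _ _ (by dsimp only; lia), if_pos h1]
    · have := hcg i (by lia)
      rw [if_neg h1, nat_homMk _ _ _ _ _ _ (by dsimp only; lia), Nat.sub_add_cancel (by lia)]
      lia

namespace IsSplit

variable {l m n l₁ l₂ m₁ m₂ p q : ℕ} {f : (⟨m⟩ : NarrowSimplex) ⟶ ⟨n⟩}
  {u : (⟨m₁⟩ : NarrowSimplex) ⟶ ⟨p⟩} {v : (⟨m₂⟩ : NarrowSimplex) ⟶ ⟨q⟩}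

theorem left_le (h : IsSplit f u v) {i : ℕ} (hi : i ≤ m₁) : Hom.nat f i ≤ p := by
  rw [h.nat_eq i (by have := h.source; lia), if_pos hi]
  exact Hom.nat_le_inner u hi

theorem lt_right (h : IsSplit f u v) {i : ℕ} (hi : m₁ < i) (hi' : i ≤ m + 1) : p < Hom.nat f i := by
  rw [h.nat_eq i hi', if_neg (by lia)]
  have := Hom.nat_pos v (i := i - m₁) (by lia)
  lia

theorem unique (h : IsSplit f u v) {l₁ l₂ : ℕ} {u' : (⟨l₁⟩ : NarrowSimplex) ⟶ ⟨p⟩}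
    {v' : (⟨l₂⟩ : NarrowSimplex) ⟶ ⟨q⟩} (h' : IsSplit f u' v') :
    l₁ = m₁ ∧ l₂ = m₂ ∧ HEq u' u ∧ HEq v' v := by
  have e1 := h.source
  have e2 := h'.source
  have e : l₁ = m₁ := by
    by_contra hne
    rcases Nat.lt_or_gt_of_ne hne with h1 | h1
    · have h2 := h.left_le h1
      have h3 := h'.lt_right (i := l₁ + 1) (by lia) (by lia)
      lia
    · have h2 := h'.left_le h1
      have h3 := h.lt_right (i := m₁ + 1) (by lia) (by lia)
      lia
  subst e
  obtain rfl : l₂ = m₂ := by lia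
  refine ⟨rfl, rfl, heq_of_eq (hom_ext_nat fun i (hi : i ≤ l₁ + 1) => ?_),
    heq_of_eq (hom_ext_nat fun i (hi : i ≤ l₂ + 1) => ?_)⟩
  · rcases Nat.lt_or_ge l₁ i with h1 | h1
    · obtain rfl : i = l₁ + 1 := by lia
      rw [Hom.nat_last', Hom.nat_last']
    · have h2 := h.nat_eq i (by lia)
      have h3 := h'.nat_eq i (by lia)
      rw [if_pos h1] at h2 h3
      rw [← h2, ← h3]
  · obtain _ | i := i
    · rw [Hom.nat_zero, Hom.nat_zero]
    · have h2 := h.nat_eq (i + 1 + l₁) (by lia)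
      have h3 := h'.nat_eq (i + 1 + l₁) (by lia)
      rw [if_neg (by lia), Nat.add_sub_cancel] at h2 h3
      lia

theorem comp (h : IsSplit f u v) {g : (⟨l⟩ : NarrowSimplex) ⟶ ⟨m⟩}
    {u' : (⟨l₁⟩ : NarrowSimplex) ⟶ ⟨m₁⟩} {v' : (⟨l₂⟩ : NarrowSimplex) ⟶ ⟨m₂⟩}
    (h' : IsSplit g u' v') : IsSplit (g ≫ f) (u' ≫ u) (v' ≫ v) := by
  refine ⟨h'.source, h.target, fun i hi => ?_⟩
  rw [Hom.nat_comp, h.nat_eq _ (Hom.nat_le _ _), Hom.nat_comp, Hom.nat_comp]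
  by_cases h1 : i ≤ l₁
  · rw [if_pos (h'.left_le h1), if_pos h1, h'.nat_eq i hi, if_pos h1]
  · have := h'.lt_right (i := i) (by lia) hi
    rw [if_neg (by lia), if_neg h1, h'.nat_eq i hi, if_neg h1, Nat.add_sub_cancel_left]

theorem id (m₁ m₂ : ℕ) :
    IsSplit (𝟙 (⟨m₁ + m₂⟩ : NarrowSimplex)) (𝟙 (⟨m₁⟩ : NarrowSimplex))
      (𝟙 (⟨m₂⟩ : NarrowSimplex)) := by
  refine ⟨rfl, rfl, fun i hi => ?_⟩
  rw [Hom.nat_id hi]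
  split_ifs with h
  · rw [Hom.nat_id (by dsimp only; lia)]
  · rw [Hom.nat_id (by dsimp only; lia)]
    lia

theorem coface_left {u : (⟨m₁ + 1⟩ : NarrowSimplex) ⟶ ⟨p⟩}
    {f : (⟨m + 1⟩ : NarrowSimplex) ⟶ ⟨n⟩} (h : IsSplit f u v)
    (i : Fin (m₁ + 1)) (i' : Fin (m + 1)) (hi : i'.val = i.val) :
    IsSplit (coface m i' ≫ f) (coface m₁ i ≫ u) v := by
  have e := h.source
  have := i.isLt
  refine ⟨by lia, h.target, fun a ha => ?_⟩
  rw [Hom.nat_comp, nat_coface _ _ ha, h.nat_eq _ (by split_ifs <;> lia)]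
  by_cases h1 : a ≤ m₁
  · rw [if_pos (by split_ifs <;> lia), if_pos h1, Hom.nat_comp, nat_coface _ _ (by lia), hi]
  · rw [if_neg (by split_ifs <;> lia), if_neg h1, if_neg (by lia)]
    congr 2
    lia

theorem coface_right {v : (⟨m₂ + 1⟩ : NarrowSimplex) ⟶ ⟨q⟩}
    {f : (⟨m + 1⟩ : NarrowSimplex) ⟶ ⟨n⟩} (h : IsSplit f u v)
    (i : Fin (m₂ + 1)) (i' : Fin (m + 1)) (hi : i'.val = m₁ + i.val) :
    IsSplit (coface m i' ≫ f) u (coface m₂ i ≫ v) := by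
  have e := h.source
  refine ⟨by lia, h.target, fun a ha => ?_⟩
  rw [Hom.nat_comp, nat_coface _ _ ha, h.nat_eq _ (by split_ifs <;> lia)]
  by_cases h1 : a ≤ m₁
  · rw [if_pos (by split_ifs <;> lia), if_pos h1, if_pos (by lia)]
  · rw [if_neg (by split_ifs <;> lia), if_neg h1, Hom.nat_comp, nat_coface _ _ (by lia)]
    congr 2
    split_ifs <;> lia

theorem isDegenerate (h : IsSplit f u v) (hf : IsDegenerate f) :
    IsDegenerate u ∨ IsDegenerate v := by
  obtain ⟨j, hj, hf⟩ := hf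
  have e := h.source
  rcases Nat.lt_or_ge (j + 1) m₁ with h1 | h1
  · rw [h.nat_eq _ (by lia), h.nat_eq _ (by lia), if_pos (by lia), if_pos (by lia)] at hf
    exact Or.inl ⟨j, by lia, hf⟩
  rcases h1.eq_or_lt with h1 | h1
  · have h2 := h.left_le h1.ge
    have h3 := h.lt_right (i := j + 2) (by lia) (by lia)
    lia
  · rw [h.nat_eq _ (by lia), h.nat_eq _ (by lia), if_neg (by lia), if_neg (by lia)] at hf
    refine Or.inr ⟨j - m₁, by lia, ?_⟩
    rw [show j - m₁ + 1 = j + 1 - m₁ by lia, show j - m₁ + 2 = j + 2 - m₁ by lia]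
    lia

theorem isDegenerate_of_left (h : IsSplit f u v) (hu : IsDegenerate u) : IsDegenerate f := by
  obtain ⟨j, hj, hu⟩ := hu
  have e := h.source
  refine ⟨j, by lia, ?_⟩
  rw [h.nat_eq _ (by lia), h.nat_eq _ (by lia), if_pos (by lia), if_pos (by lia), hu]

theorem isDegenerate_of_right (h : IsSplit f u v) (hv : IsDegenerate v) : IsDegenerate f := by
  obtain ⟨j, hj, hv⟩ := hv
  have e := h.source
  refine ⟨m₁ + j, by lia, ?_⟩
  rw [h.nat_eq _ (by lia), h.nat_eq _ (by lia), if_neg (by lia), if_neg (by lia),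
    show m₁ + j + 1 - m₁ = j + 1 by lia, show m₁ + j + 2 - m₁ = j + 2 by lia, hv]

theorem assoc {m₃ r a b : ℕ} {f' : (⟨a⟩ : NarrowSimplex) ⟶ ⟨b⟩} (h : IsSplit f u v)
    {w : (⟨m₃⟩ : NarrowSimplex) ⟶ ⟨r⟩} (h' : IsSplit f' f w) {c d : ℕ}
    {g : (⟨c⟩ : NarrowSimplex) ⟶ ⟨d⟩} (hg : IsSplit g v w) : IsSplit f' u g := by
  have e1 := h.source
  have e2 := h.target
  have e3 := h'.source
  have e4 := h'.target
  have e5 := hg.source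
  have e6 := hg.target
  refine ⟨by lia, by lia, fun i hi => ?_⟩
  rw [h'.nat_eq i hi]
  by_cases h1 : i ≤ m₁
  · rw [if_pos (by lia), if_pos h1, h.nat_eq i (by lia), if_pos h1]
  · rw [if_neg h1, hg.nat_eq _ (by lia)]
    by_cases h2 : i ≤ m
    · rw [if_pos h2, if_pos (by lia), h.nat_eq i (by lia), if_neg h1]
    · rw [if_neg h2, if_neg (by lia), show i - m₁ - m₂ = i - m by lia]
      lia

end IsSplit

theorem eq_zero_of_hom_zero {m : ℕ} (f : (⟨m⟩ : NarrowSimplex) ⟶ ⟨0⟩) : m = 0 := by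
  by_contra h
  have h1 := Hom.nat_pos f (i := 1) (by lia)
  have h2 := Hom.nat_le_inner f (v := 1) (by lia)
  lia

theorem isSplit_id_left {m n : ℕ} (f : (⟨m⟩ : NarrowSimplex) ⟶ ⟨n⟩) :
    IsSplit f (𝟙 (⟨0⟩ : NarrowSimplex)) f := by
  refine ⟨by lia, by lia, fun i hi => ?_⟩
  split_ifs with h
  · obtain rfl : i = 0 := by lia
    rw [Hom.nat_zero, Hom.nat_zero]
  · simp

theorem isSplit_id_right {m n : ℕ} (f : (⟨m⟩ : NarrowSimplex) ⟶ ⟨n⟩) :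
    IsSplit f f (𝟙 (⟨0⟩ : NarrowSimplex)) := by
  refine ⟨by lia, by lia, fun i hi => ?_⟩
  split_ifs with h
  · rfl
  · obtain rfl : i = m + 1 := by lia
    rw [Hom.nat_last', Nat.add_sub_cancel_left, Hom.nat_id le_rfl]

end NarrowSimplex

/-! ### Normalized chains -/

/-- An alternating sum over `a + b` indices, divided into the first `a` and the last `b` ones. -/
theorem alternating_sum_split {k M : Type*} [CommRing k] [AddCommGroup M] [Module k M] {a b n : ℕ}
    (h : a + b = n) (F : Fin n → M) :
    ∑ i : Fin n, (-1 : k) ^ (i : ℕ) • F i =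
      ∑ i : Fin a, (-1 : k) ^ (i : ℕ) • F ⟨i, by have := i.isLt; lia⟩ +
        (-1 : k) ^ a • ∑ i : Fin b, (-1 : k) ^ (i : ℕ) • F ⟨a + i, by have := i.isLt; lia⟩ := by
  subst h
  rw [Fin.sum_univ_add, Finset.smul_sum]
  refine congrArg₂ (· + ·) rfl (Finset.sum_congr rfl fun i _ => ?_)
  rw [Fin.val_natAdd, pow_add, mul_smul]
  rfl

/-- The bilinear map induced on quotients. -/
def Submodule.mapQ₂ {k M N P : Type*} [CommRing k] [AddCommGroup M] [Module k M] [AddCommGroup N]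
    [Module k N] [AddCommGroup P] [Module k P] (S : Submodule k M) (T : Submodule k N)
    (U : Submodule k P) (β : M →ₗ[k] N →ₗ[k] P) (hS : ∀ x ∈ S, ∀ y, β x y ∈ U)
    (hT : ∀ x, ∀ y ∈ T, β x y ∈ U) : (M ⧸ S) →ₗ[k] (N ⧸ T) →ₗ[k] (P ⧸ U) :=
  (T.liftQ (S.liftQ (β.compr₂ U.mkQ) fun x hx => by
      ext y
      exact (Submodule.Quotient.mk_eq_zero U).mpr (hS x hx y)).flip fun y hy => by
    ext x
    exact (Submodule.Quotient.mk_eq_zero U).mpr (hT x y hy)).flip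

namespace NarrowModule

open NarrowSimplex

variable {k : Type u} [CommRing k] (A : NarrowModule k)

theorem degeneracy_eq_act (n : ℕ) (i : Fin n) : A.degeneracy n i = A.act (codegeneracy n i) := rfl

theorem act_mem_degenerate {m n : ℕ} {f : (⟨m⟩ : NarrowSimplex) ⟶ ⟨n⟩} (hf : IsDegenerate f)
    (x : A.deg n) : A.act f x ∈ A.degenerate m := by
  obtain _ | m := m
  · obtain ⟨j, hj, -⟩ := hf
    lia
  obtain ⟨j, g, rfl⟩ := hf.exists_codegeneracy
  rw [act_comp]
  exact Submodule.mem_iSup_of_mem j ⟨_, rfl⟩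

theorem isDegenerate_codegeneracy (n : ℕ) (i : Fin n) : IsDegenerate (codegeneracy n i) := by
  have := i.isLt
  refine ⟨i, by lia, ?_⟩
  rw [nat_codegeneracy _ _ (by lia), nat_codegeneracy _ _ (by lia), if_pos le_rfl, if_neg (by lia)]
  lia

/-- To check that degenerate elements lie in a submodule, it suffices to consider the images under
degenerate maps. -/
theorem degenerate_le {n : ℕ} {S : Submodule k (A.deg n)}
    (h : ∀ (m : ℕ) (f : (⟨n⟩ : NarrowSimplex) ⟶ ⟨m⟩), IsDegenerate f → ∀ x, A.act f x ∈ S) :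
    A.degenerate n ≤ S := by
  obtain _ | n := n
  · exact bot_le
  · refine iSup_le fun i => ?_
    rintro _ ⟨x, rfl⟩
    exact h n _ (isDegenerate_codegeneracy n i) x

theorem map_mem_degenerate {B : NarrowModule k} {n : ℕ} (φ : ∀ n, A.deg n →ₗ[k] B.deg n)
    (h : ∀ {m n : ℕ} (f : (⟨m⟩ : NarrowSimplex) ⟶ ⟨n⟩) x, φ m (A.act f x) = B.act f (φ n x))
    {x : A.deg n} (hx : x ∈ A.degenerate n) : φ n x ∈ B.degenerate n := by
  refine A.degenerate_le (S := (B.degenerate n).comap (φ n)) (fun m f hf y => ?_) hx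
  rw [Submodule.mem_comap, h]
  exact B.act_mem_degenerate hf _

/-- The alternating sum of the faces. -/
def boundary (n : ℕ) : A.deg (n + 1) →ₗ[k] A.deg n :=
  ∑ i : Fin (n + 1), (-1 : k) ^ (i : ℕ) • A.act (coface n i)

theorem boundary_apply (n : ℕ) (x : A.deg (n + 1)) :
    A.boundary n x = ∑ i : Fin (n + 1), (-1 : k) ^ (i : ℕ) • A.act (coface n i) x := by
  simp [boundary]

/-- The terms cancel in pairs by the identity for iterated cofaces. -/
theorem boundary_boundary (n : ℕ) (x : A.deg (n + 2)) :
    A.boundary n (A.boundary (n + 1) x) = 0 := by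
  simp only [boundary_apply, map_sum, map_smul, Finset.smul_sum, smul_smul, ← act_comp, ← pow_add]
  rw [← Finset.sum_product']
  refine Finset.sum_involution (fun a _ => if h : a.2.val < a.1.val
    then (⟨a.2.val, by lia⟩, ⟨a.1.val - 1, by have := a.1.isLt; lia⟩)
    else (⟨a.2.val + 1, by have := a.2.isLt; lia⟩, ⟨a.1.val, by have := a.2.isLt; lia⟩))
    ?_ ?_ (fun _ _ => Finset.mem_univ _) ?_
  · rintro ⟨⟨j, hj⟩, ⟨i, hi⟩⟩ -
    dsimp only
    split_ifs with h
    · obtain ⟨j, rfl⟩ : ∃ j', j = j' + 1 := ⟨j - 1, by lia⟩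
      simp only [Nat.add_sub_cancel]
      rw [coface_comp_coface (n := n) (i := i) (j := j) (by lia) (by lia), ← add_smul,
        add_right_comm, pow_succ, add_comm j i]
      simp
    · rw [coface_comp_coface (n := n) (i := j) (j := i) (by lia) (by lia), ← add_smul,
        add_right_comm, pow_succ, add_comm j i]
      simp
  · rintro ⟨⟨j, hj⟩, ⟨i, hi⟩⟩ - -
    dsimp only
    split_ifs with h <;> simp only [ne_eq, Prod.mk.injEq, Fin.mk.injEq] <;> lia
  · rintro ⟨⟨j, hj⟩, ⟨i, hi⟩⟩ -
    by_cases h : i < j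
    · simp only [h, dite_true]
      rw [dif_neg (by lia)]
      simp only [Prod.mk.injEq, Fin.mk.injEq, and_true]
      lia
    · simp only [h, dite_false]
      rw [dif_pos (by lia)]
      simp

theorem boundary_mem_degenerate {n : ℕ} {x : A.deg (n + 1)} (hx : x ∈ A.degenerate (n + 1)) :
    A.boundary n x ∈ A.degenerate n := by
  refine A.degenerate_le (S := (A.degenerate n).comap (A.boundary n)) (fun m f hf y => ?_) hx
  rw [Submodule.mem_comap, boundary_apply]
  simp only [← act_comp]
  exact sum_coface_mem _ (fun g => A.act g y) (fun g hg => A.act_mem_degenerate hg y) f hf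

/-- The endomorphism of `[n + 2]` sending the inner vertex `j + 2` to `j + 1` and fixing all
others. -/
def collapse (n : ℕ) (j : Fin n) : (⟨n + 1⟩ : NarrowSimplex) ⟶ ⟨n + 1⟩ :=
  codegeneracy n j ≫ coface n j.succ

theorem nat_collapse (n : ℕ) (j : Fin n) {v : ℕ} (hv : v ≤ n + 2) :
    Hom.nat (collapse n j) v = if v = j.val + 2 then j.val + 1 else v := by
  rw [collapse, Hom.nat_comp, nat_codegeneracy _ _ hv, nat_coface _ _ (by split_ifs <;> lia),
    Fin.val_succ]
  split_ifs <;> lia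

theorem isDegenerate_collapse (n : ℕ) (j : Fin n) : IsDegenerate (collapse n j) :=
  (isDegenerate_codegeneracy n j).comp _

theorem act_mem_range_degeneracy {m n : ℕ} (f : (⟨m + 1⟩ : NarrowSimplex) ⟶ ⟨n⟩) (j : Fin m)
    (h : Hom.nat f (j + 1) = Hom.nat f (j + 2)) (x : A.deg n) :
    A.act f x ∈ LinearMap.range (A.degeneracy m j) := by
  rw [← codegeneracy_coface_comp f j h, act_comp]
  exact ⟨_, rfl⟩

/-- A degenerate element is zero as soon as its faces are zero. Subtracting `s_j d_{j+1} x = 0`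
from a sum of elements `s_i y_i`, `i ≤ j`, removes the summand with `i = j`. -/
theorem eq_zero_of_mem_degenerate {n : ℕ} {x : A.deg (n + 1)} (hx : x ∈ A.degenerate (n + 1))
    (h : ∀ i, A.act (coface n i) x = 0) : x = 0 := by
  have key : ∀ t ≤ n, x ∈ ⨆ (i : Fin n) (_ : i.val < t), LinearMap.range (A.degeneracy n i) →
      x = 0 := by
    intro t
    induction t with
    | zero => intro _ hx; simpa using hx
    | succ t ih =>
      intro ht hx
      have hle : ⨆ (i : Fin n) (_ : i.val < t + 1), LinearMap.range (A.degeneracy n i) ≤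
          (⨆ (i : Fin n) (_ : i.val < t), LinearMap.range (A.degeneracy n i)) ⊔
            LinearMap.range (A.degeneracy n ⟨t, by lia⟩) := by
        refine iSup₂_le fun i hi => ?_
        rcases (Nat.lt_succ_iff.mp hi).eq_or_lt with hi | hi
        · obtain rfl : i = ⟨t, by lia⟩ := Fin.ext hi
          exact le_sup_right
        · exact le_sup_of_le_left
            (le_iSup₂_of_le (f := fun (i : Fin n) (_ : i.val < t) => _) i hi le_rfl)
      obtain ⟨a, ha, b, hb, rfl⟩ := Submodule.mem_sup.mp (hle hx)
      obtain ⟨b, rfl⟩ := hb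
      refine ih (by lia) ?_
      set e := collapse n ⟨t, by lia⟩ with he
      have h0 : A.act e (a + A.degeneracy n ⟨t, by lia⟩ b) = 0 := by
        rw [he, collapse, act_comp, h, map_zero]
      have h1 : A.act e (A.degeneracy n ⟨t, by lia⟩ b) = A.degeneracy n ⟨t, by lia⟩ b := by
        rw [degeneracy_eq_act, ← act_comp]
        refine congrArg (A.act · b) (hom_ext_nat fun v (hv : v ≤ n + 2) => ?_)
        rw [Hom.nat_comp, he, nat_collapse _ _ hv, nat_codegeneracy _ _ hv,
          nat_codegeneracy _ _ (by dsimp only; split_ifs <;> lia)]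
        dsimp only
        split_ifs <;> lia
      have h2 : A.act e a ∈ ⨆ (i : Fin n) (_ : i.val < t), LinearMap.range (A.degeneracy n i) := by
        have : (⨆ (i : Fin n) (_ : i.val < t), LinearMap.range (A.degeneracy n i)) ≤
            (⨆ (i : Fin n) (_ : i.val < t), LinearMap.range (A.degeneracy n i)).comap
              (A.act e) := by
          refine iSup₂_le fun i hi => ?_
          rintro _ ⟨y, rfl⟩
          refine Submodule.mem_iSup_of_mem i (Submodule.mem_iSup_of_mem hi ?_)
          rw [degeneracy_eq_act, ← act_comp]
          refine A.act_mem_range_degeneracy _ i ?_ y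
          rw [Hom.nat_comp, Hom.nat_comp, he, nat_collapse _ _ (by lia), nat_collapse _ _ (by lia),
            nat_codegeneracy _ _ (by dsimp only; split_ifs <;> lia),
            nat_codegeneracy _ _ (by dsimp only; split_ifs <;> lia)]
          dsimp only
          split_ifs <;> lia
        exact this ha
      rw [map_add, h1] at h0
      rw [show a + A.degeneracy n ⟨t, by lia⟩ b = a - A.act e a by
        rw [eq_neg_of_add_eq_zero_right h0]; abel]
      exact Submodule.sub_mem _ ha h2
  refine key n le_rfl ?_
  rwa [iSup_congr fun i : Fin n => iSup_pos i.isLt]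

/-- Every element can be modified by degenerate elements so that all its faces but the first one
are zero. -/
theorem exists_sub_mem_degenerate {n : ℕ} (x : A.deg (n + 1)) :
    ∃ y, x - y ∈ A.degenerate (n + 1) ∧ ∀ i, i ≠ 0 → A.act (coface n i) y = 0 := by
  have key : ∀ t ≤ n, ∃ y, x - y ∈ A.degenerate (n + 1) ∧
      ∀ i : Fin (n + 1), n - t < i.val → A.act (coface n i) y = 0 := by
    intro t
    induction t with
    | zero => exact fun _ => ⟨x, by simp, fun i hi => by have := i.isLt; lia⟩
    | succ t ih =>
      intro ht
      obtain ⟨y, hy, h⟩ := ih (by lia)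
      set j : Fin n := ⟨n - (t + 1), by lia⟩ with hj
      refine ⟨y - A.act (collapse n j) y, ?_, fun i hi => ?_⟩
      · rw [sub_sub_eq_add_sub, add_sub_right_comm]
        exact Submodule.add_mem _ hy (A.act_mem_degenerate (isDegenerate_collapse n j) y)
      · rw [map_sub, ← act_comp]
        rcases Nat.lt_or_ge (n - t) i.val with h1 | h1
        · obtain ⟨g, hg⟩ := exists_comp_coface (coface n i ≫ collapse n j) i fun v hv => by
            rw [Hom.nat_comp, nat_coface _ _ (by lia),
              nat_collapse _ _ (by split_ifs <;> lia), hj]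
            dsimp only
            split_ifs <;> lia
          rw [hg, act_comp, h i h1, map_zero, sub_zero]
        · refine sub_eq_zero.mpr (congrArg (A.act · y) (hom_ext_nat fun v (hv : v ≤ n + 1) => ?_))
          rw [Hom.nat_comp, nat_coface _ _ (by lia), nat_collapse _ _ (by split_ifs <;> lia), hj]
          dsimp only
          split_ifs <;> lia
  obtain ⟨y, hy, h⟩ := key n le_rfl
  exact ⟨y, hy, fun i hi => h i (by
    rw [Nat.sub_self]
    exact Nat.pos_of_ne_zero fun h0 => hi (Fin.ext h0))⟩

/-- The differential of the normalized chain complex. -/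
noncomputable def normalizedD (n : ℕ) :
    ModuleCat.of k (A.deg (n + 1) ⧸ A.degenerate (n + 1)) ⟶
      ModuleCat.of k (A.deg n ⧸ A.degenerate n) :=
  ModuleCat.ofHom ((A.degenerate (n + 1)).mapQ (A.degenerate n) (A.boundary n)
    fun _ hx => A.boundary_mem_degenerate hx)

/-- The normalized chain complex: elements modulo degenerate elements, with the differential
induced by the alternating sum of the faces. -/
noncomputable def normalized : DGModule k :=
  ChainComplex.of (fun n => ModuleCat.of k (A.deg n ⧸ A.degenerate n))
    A.normalizedD
    (fun n => by
      refine ModuleCat.hom_ext (Submodule.linearMap_qext _ (LinearMap.ext fun x => ?_))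
      exact congrArg (Submodule.Quotient.mk (p := A.degenerate n)) (A.boundary_boundary n x))

/-- The class of an element in the normalized chain complex. -/
noncomputable def toNormalized (n : ℕ) : A.deg n →ₗ[k] A.normalized.X n := (A.degenerate n).mkQ

theorem toNormalized_surjective (n : ℕ) : Function.Surjective (A.toNormalized n) :=
  Submodule.mkQ_surjective _

theorem ker_toNormalized (n : ℕ) : LinearMap.ker (A.toNormalized n) = A.degenerate n :=
  Submodule.ker_mkQ _

theorem toNormalized_eq_zero {n : ℕ} {x : A.deg n} :
    A.toNormalized n x = 0 ↔ x ∈ A.degenerate n :=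
  Submodule.Quotient.mk_eq_zero _

theorem normalized_d (n : ℕ) (x : A.deg (n + 1)) :
    (A.normalized.d (n + 1) n).hom (A.toNormalized (n + 1) x) =
      A.toNormalized n (A.boundary n x) := by
  have h := ChainComplex.of_d (fun n => ModuleCat.of k (A.deg n ⧸ A.degenerate n)) A.normalizedD n
  exact LinearMap.congr_fun (congrArg ModuleCat.Hom.hom h) (Submodule.Quotient.mk x)

end NarrowModule

namespace NarrowCat

open NarrowSimplex

variable {k : Type u} [CommRing k] (A : NarrowCat k)

/-- The composition of a category enriched in narrow simplicial modules, with an arbitrary name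
for the degree of the result. -/
noncomputable def mul (x y z : A.Ob) (p q n : ℕ) (h : p + q = n) :
    (A.hom x y).deg p →ₗ[k] (A.hom y z).deg q →ₗ[k] (A.hom x z).deg n :=
  (A.comp x y z p q).compr₂ ((A.hom x z).act (cast h.symm))

theorem mul_eq_comp (x y z : A.Ob) (p q : ℕ) (h : p + q = p + q) (f : (A.hom x y).deg p)
    (g : (A.hom y z).deg q) : A.mul x y z p q (p + q) h f g = A.comp x y z p q f g :=
  (A.hom x z).act_cast_rfl _ _

variable {A} in
theorem act_mul {x y z : A.Ob} {m n m₁ m₂ p q : ℕ} {u : (⟨m₁⟩ : NarrowSimplex) ⟶ ⟨p⟩}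
    {v : (⟨m₂⟩ : NarrowSimplex) ⟶ ⟨q⟩} {f : (⟨m⟩ : NarrowSimplex) ⟶ ⟨n⟩} (hf : IsSplit f u v)
    (a : (A.hom x y).deg p) (b : (A.hom y z).deg q) :
    (A.hom x z).act f (A.mul x y z p q n hf.target a b) =
      A.mul x y z m₁ m₂ m hf.source ((A.hom x y).act u a) ((A.hom y z).act v b) := by
  obtain ⟨rfl, rfl, h⟩ := hf
  rw [mul_eq_comp, mul_eq_comp, comp_act]
  refine congrArg ((A.hom x z).act · _) (hom_ext_nat fun i hi => ?_)
  rw [nat_join u v hi, h i hi]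
  simp only [Nat.lt_succ_iff]

theorem mul_assoc {w x y z : A.Ob} {p q m r m' n : ℕ} (e : p + q = m)
    (e' : m + r = n) (e₂ : q + r = m') (e₂' : p + m' = n) (f : (A.hom w x).deg p)
    (g : (A.hom x y).deg q) (h : (A.hom y z).deg r) :
    A.mul w y z m r n e' (A.mul w x y p q m e f g) h =
      A.mul w x z p m' n e₂' f (A.mul x y z q r m' e₂ g h) := by
  subst e e' e₂
  rw [mul_eq_comp, mul_eq_comp, mul_eq_comp, ← A.comp_assoc]
  rfl

theorem one_mul {x y : A.Ob} {n : ℕ} (f : (A.hom x y).deg n) :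
    A.mul x x y 0 n n (zero_add n) (A.one x) f = f := by
  refine (congrArg ((A.hom x y).act _) (A.one_comp f)).trans ?_
  rw [← NarrowModule.act_comp]
  refine Eq.trans (congrArg ((A.hom x y).act · f) (hom_ext_nat fun i hi => ?_))
    ((A.hom x y).act_id f)
  rw [Hom.nat_comp, nat_cast _ hi, nat_cast _ (by simpa using hi), Hom.nat_id hi]

theorem mul_one {x y : A.Ob} {n : ℕ} (f : (A.hom x y).deg n) :
    A.mul x y y n 0 n (add_zero n) f (A.one y) = f := by
  refine (congrArg ((A.hom x y).act _) (A.comp_one f)).trans ?_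
  rw [← NarrowModule.act_comp]
  refine Eq.trans (congrArg ((A.hom x y).act · f) (hom_ext_nat fun i hi => ?_))
    ((A.hom x y).act_id f)
  rw [Hom.nat_comp, nat_cast _ hi, nat_cast _ (by simpa using hi), Hom.nat_id hi]

theorem mul_mem_degenerate_left {x y z : A.Ob} {p q n : ℕ} (h : p + q = n)
    {a : (A.hom x y).deg p} (ha : a ∈ (A.hom x y).degenerate p) (b : (A.hom y z).deg q) :
    A.mul x y z p q n h a b ∈ (A.hom x z).degenerate n := by
  refine (A.hom x y).degenerate_le (S := ((A.hom x z).degenerate n).comap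
    ((A.mul x y z p q n h).flip b)) (fun m f hf c => ?_) ha
  have hs := isSplit_cast_join h.symm rfl f (𝟙 (⟨q⟩ : NarrowSimplex))
  have := act_mul hs c b
  rw [NarrowModule.act_id] at this
  rw [Submodule.mem_comap, LinearMap.flip_apply, ← this]
  exact (A.hom x z).act_mem_degenerate (hs.isDegenerate_of_left hf) _

theorem mul_mem_degenerate_right {x y z : A.Ob} {p q n : ℕ} (h : p + q = n)
    (a : (A.hom x y).deg p) {b : (A.hom y z).deg q} (hb : b ∈ (A.hom y z).degenerate q) :
    A.mul x y z p q n h a b ∈ (A.hom x z).degenerate n := by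
  refine (A.hom y z).degenerate_le (S := ((A.hom x z).degenerate n).comap
    (A.mul x y z p q n h a)) (fun m f hf c => ?_) hb
  have hs := isSplit_cast_join h.symm rfl (𝟙 (⟨p⟩ : NarrowSimplex)) f
  have := act_mul hs a c
  rw [NarrowModule.act_id] at this
  rw [Submodule.mem_comap, ← this]
  exact (A.hom x z).act_mem_degenerate (hs.isDegenerate_of_right hf) _

theorem isSplit_id {p q n : ℕ} (h : p + q = n) :
    IsSplit (𝟙 (⟨n⟩ : NarrowSimplex)) (𝟙 (⟨p⟩ : NarrowSimplex)) (𝟙 (⟨q⟩ : NarrowSimplex)) := by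
  subst h
  exact IsSplit.id p q

/-- The composition on the normalized chain complexes. -/
noncomputable def normalizedPairing (x y z : A.Ob) :
    DGModule.Pairing (A.hom x y).normalized (A.hom y z).normalized (A.hom x z).normalized :=
  fun p q n h => Submodule.mapQ₂ ((A.hom x y).degenerate p) ((A.hom y z).degenerate q)
    ((A.hom x z).degenerate n) (A.mul x y z p q n h)
    (fun _ ha b => A.mul_mem_degenerate_left h ha b)
    (fun a _ hb => A.mul_mem_degenerate_right h a hb)

theorem normalizedPairing_apply (x y z : A.Ob) (p q n : ℕ) (h : p + q = n) (a : (A.hom x y).deg p)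
    (b : (A.hom y z).deg q) :
    A.normalizedPairing x y z p q n h ((A.hom x y).toNormalized p a)
      ((A.hom y z).toNormalized q b) = (A.hom x z).toNormalized n (A.mul x y z p q n h a b) := rfl

theorem normalizedPairing_leibniz (x y z : A.Ob) : (A.normalizedPairing x y z).Leibniz := by
  intro p q n h a b
  obtain ⟨a, rfl⟩ := (A.hom x y).toNormalized_surjective p a
  obtain ⟨b, rfl⟩ := (A.hom y z).toNormalized_surjective q b
  rw [normalizedPairing_apply, NarrowModule.normalized_d, NarrowModule.boundary_apply,
    alternating_sum_split h, map_add, map_smul]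
  congr 1
  · obtain _ | p := p
    · simp [DGModule.Pairing.left]
    · rw [DGModule.Pairing.left, NarrowModule.normalized_d, normalizedPairing_apply,
        NarrowModule.boundary_apply, map_sum (A.mul x y z p q n _), LinearMap.sum_apply]
      refine congrArg _ (Finset.sum_congr rfl fun i _ => ?_)
      have hs := (isSplit_id h).coface_left i ⟨i, by have := i.isLt; lia⟩ rfl
      rw [Category.comp_id, Category.comp_id] at hs
      have := act_mul hs a b
      rw [NarrowModule.act_id] at this
      rw [this, map_smul, LinearMap.smul_apply]
  · congr 1
    obtain _ | q := q
    · simp [DGModule.Pairing.right]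
    · rw [DGModule.Pairing.right, NarrowModule.normalized_d, normalizedPairing_apply,
        NarrowModule.boundary_apply, map_sum (A.mul x y z p q n _ a)]
      refine congrArg _ (Finset.sum_congr rfl fun i _ => ?_)
      have hs := (isSplit_id h).coface_right i ⟨p + i, by have := i.isLt; lia⟩ rfl
      rw [Category.comp_id, Category.comp_id] at hs
      have := act_mul hs a b
      rw [NarrowModule.act_id] at this
      rw [this, map_smul]

/-- The data of the dg-category of normalized chains. -/
noncomputable def normalizedData : DGCat.Data k where
  Ob := A.Ob
  H x y := (A.hom x y).normalized
  comp := A.normalizedPairing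
  one x := (A.hom x x).toNormalized 0 (A.one x)
  leibniz := A.normalizedPairing_leibniz
  assoc {w x y z p q m r m' n} e e' e₂ e₂' f g h := by
    obtain ⟨f, rfl⟩ := (A.hom w x).toNormalized_surjective p f
    obtain ⟨g, rfl⟩ := (A.hom x y).toNormalized_surjective q g
    obtain ⟨h, rfl⟩ := (A.hom y z).toNormalized_surjective r h
    simp only [normalizedPairing_apply, A.mul_assoc e e' e₂ e₂']
  one_comp {x y n} f := by
    obtain ⟨f, rfl⟩ := (A.hom x y).toNormalized_surjective n f
    rw [normalizedPairing_apply, one_mul]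
  comp_one {x y n} f := by
    obtain ⟨f, rfl⟩ := (A.hom x y).toNormalized_surjective n f
    rw [normalizedPairing_apply, mul_one]

variable {A} {B C : NarrowCat k}

theorem onDeg_mul (F : A ⟶ B) (x y z : A.Ob) (p q n : ℕ) (h : p + q = n) (f : (A.hom x y).deg p)
    (g : (A.hom y z).deg q) :
    onDeg F x z n (A.mul x y z p q n h f g) =
      B.mul _ _ _ p q n h (onDeg F x y p f) (onDeg F y z q g) := by
  subst h
  rw [mul_eq_comp, mul_eq_comp, onDeg_comp]

theorem onDeg_boundary (F : A ⟶ B) (x y : A.Ob) (n : ℕ) (f : (A.hom x y).deg (n + 1)) :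
    onDeg F x y n ((A.hom x y).boundary n f) = (B.hom _ _).boundary n (onDeg F x y (n + 1) f) := by
  rw [NarrowModule.boundary_apply, NarrowModule.boundary_apply, map_sum]
  simp only [map_smul, onDeg_act]

/-- The map induced by an enriched functor on normalized chains. -/
noncomputable def onNormalized (F : A ⟶ B) (x y : A.Ob) (n : ℕ) :
    (A.hom x y).normalized.X n →ₗ[k] (B.hom (SmallEnrichedCat.onOb F x)
      (SmallEnrichedCat.onOb F y)).normalized.X n :=
  ((A.hom x y).degenerate n).mapQ ((B.hom _ _).degenerate n) (onDeg F x y n) fun _ ha =>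
    (A.hom x y).map_mem_degenerate (onDeg F x y) (onDeg_act F x y) ha

/-- The dg-functor induced by an enriched functor on normalized chains. -/
noncomputable def mapNormalized (F : A ⟶ B) : A.normalizedData.toCat ⟶ B.normalizedData.toCat :=
  DGCat.Data.homMk A.normalizedData B.normalizedData
    (SmallEnrichedCat.onOb (A := A) (B := B) F) (fun x y n => onNormalized (A := A) F x y n)
    (fun x y n f => by
      obtain ⟨f, rfl⟩ := (A.hom x y).toNormalized_surjective (n + 1) f
      refine ((B.hom _ _).normalized_d n _).trans (Eq.trans (congrArg _ ?_)
        (congrArg (onNormalized (A := A) F x y n) ((A.hom x y).normalized_d n f).symm))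
      exact (onDeg_boundary F x y n f).symm)
    (fun x => congrArg ((B.hom _ _).toNormalized 0) (onDeg_one F x))
    (fun x y z p q n h f g => by
      obtain ⟨f, rfl⟩ := (A.hom x y).toNormalized_surjective p f
      obtain ⟨g, rfl⟩ := (A.hom y z).toNormalized_surjective q g
      exact congrArg ((B.hom _ _).toNormalized n) (onDeg_mul F x y z p q n h f g))

theorem onDeg_mapNormalized (F : A ⟶ B) (x y : A.Ob) (n : ℕ) (a : (A.hom x y).deg n) :
    DGCat.onDeg (mapNormalized F) x y n ((A.hom x y).toNormalized n a) =
      (B.hom _ _).toNormalized n (onDeg F x y n a) := rfl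

/-- The normalized chains functor on categories enriched in narrow simplicial modules. -/
noncomputable def normalization (k : Type u) [CommRing k] : NarrowCat k ⥤ DGCat k where
  obj A := A.normalizedData.toCat
  map F := mapNormalized F
  map_id A := DGCat.functor_ext (fun _ => rfl) fun x y n f => heq_of_eq <| by
    obtain ⟨f, rfl⟩ := (A.hom x y).toNormalized_surjective n f
    exact onDeg_mapNormalized (𝟙 A) x y n f
  map_comp {A B C} F G := DGCat.functor_ext (fun _ => rfl) fun x y n f => heq_of_eq <| by
    obtain ⟨f, rfl⟩ := (A.hom x y).toNormalized_surjective n f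
    exact (onDeg_mapNormalized (F ≫ G) x y n f).trans
      ((onDeg_mapNormalized G _ _ n (onDeg F x y n f)).symm.trans
        (congrArg (DGCat.onDeg (mapNormalized G) _ _ n) (onDeg_mapNormalized F x y n f).symm))

/-- The normalization functor is the normalized chains functor in the sense of the definition. -/
noncomputable def normalizedIdentification (k : Type u) [CommRing k] :
    NormalizedIdentification (normalization k) where
  ob A := Equiv.refl _
  proj A x y n := (A.hom x y).toNormalized n
  proj_surjective A x y := (A.hom x y).toNormalized_surjective
  ker_proj A x y := (A.hom x y).ker_toNormalized
  proj_d A x y n f := ((A.hom x y).normalized_d n f).trans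
    (congrArg ((A.hom x y).toNormalized n) ((A.hom x y).boundary_apply n f))
  proj_comp A x y z p q f g := by
    rw [DGCat.comp_eq_pairing]
    refine Eq.trans ?_ (LinearMap.congr_fun₂
      (A.normalizedData.toCat_pairing x y z p q (p + q) rfl) _ _).symm
    exact congrArg ((A.hom x z).toNormalized (p + q)) (A.mul_eq_comp x y z p q rfl f g).symm
  proj_one A x := (A.normalizedData.toCat_one x).symm
  ob_map F x := rfl
  proj_map F x y n f := HEq.rfl

end NarrowCat

/-! ### The Dold–Kan correspondence for narrow simplicial modules -/

namespace NarrowSimplex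

theorem le_of_not_isDegenerate {m n : ℕ} {f : (⟨m⟩ : NarrowSimplex) ⟶ ⟨n⟩}
    (h : ¬ IsDegenerate f) {v : ℕ} (hv : v ≤ m) : v ≤ Hom.nat f v := by
  induction v with
  | zero => exact Nat.zero_le _
  | succ v ih =>
    have h1 := ih (by lia)
    have h2 := nat_lt_of_not_isDegenerate h (v := v) (by lia)
    lia

theorem eq_id_of_not_isDegenerate {n : ℕ} {f : (⟨n⟩ : NarrowSimplex) ⟶ ⟨n⟩}
    (h : ¬ IsDegenerate f) : f = 𝟙 _ := by
  have key : ∀ t v, v + t = n → Hom.nat f v ≤ v := by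
    intro t
    induction t with
    | zero =>
      rintro v rfl
      exact Hom.nat_le_inner f le_rfl
    | succ t ih =>
      intro v hv
      have h1 := ih (v + 1) (by lia)
      have h2 := nat_lt_of_not_isDegenerate h (v := v) (by lia)
      lia
  refine hom_ext_nat fun v (hv : v ≤ n + 1) => ?_
  rw [Hom.nat_id hv]
  rcases hv.eq_or_lt with rfl | hv
  · exact Hom.nat_last' f
  · have h1 := key (n - v) v (by lia)
    have h2 := le_of_not_isDegenerate h (v := v) (by lia)
    lia

variable {m n m₁ m₂ p q : ℕ} {f : (⟨m⟩ : NarrowSimplex) ⟶ ⟨n⟩}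
  {u : (⟨m₁⟩ : NarrowSimplex) ⟶ ⟨p⟩} {v : (⟨m₂⟩ : NarrowSimplex) ⟶ ⟨q⟩}

theorem cast_rfl (h : n = n) : cast h = 𝟙 (⟨n⟩ : NarrowSimplex) :=
  hom_ext_nat fun i hi => by rw [nat_cast h hi, Hom.nat_id hi]

theorem IsSplit.comp_cast (h : IsSplit f u v) {n' : ℕ} (e : n = n') :
    IsSplit (f ≫ NarrowSimplex.cast e) u v := by
  subst e
  rwa [cast_rfl, Category.comp_id]

theorem IsSplit.of_comp_cast {n' : ℕ} (e : n = n')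
    (h : IsSplit (f ≫ NarrowSimplex.cast e) u v) : IsSplit f u v := by
  subst e
  rwa [cast_rfl, Category.comp_id] at h

end NarrowSimplex

namespace DGModule

open NarrowSimplex

variable {k : Type u} [CommRing k] (C : DGModule k)

/-- The chain maps from the normalized chains of the narrow simplex `[n + 1]` to `C`, written as
families of elements of `C` indexed by the narrow maps into `[n + 1]`. -/
def families (n : ℕ) : Submodule k (∀ m, ((⟨m⟩ : NarrowSimplex) ⟶ ⟨n⟩) → C.X m) where
  carrier := {c | (∀ m f, IsDegenerate f → c m f = 0) ∧ ∀ m (f : (⟨m + 1⟩ : NarrowSimplex) ⟶ ⟨n⟩),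
    (C.d (m + 1) m).hom (c (m + 1) f) =
      ∑ i : Fin (m + 1), (-1 : k) ^ (i : ℕ) • c m (coface m i ≫ f)}
  add_mem' {a b} ha hb := ⟨fun m f hf => by simp [ha.1 m f hf, hb.1 m f hf], fun m f => by
    simp [ha.2 m f, hb.2 m f, Finset.sum_add_distrib]⟩
  zero_mem' := ⟨fun _ _ _ => rfl, fun m f => by simp⟩
  smul_mem' r a ha := ⟨fun m f hf => by simp [ha.1 m f hf], fun m f => by
    simp [ha.2 m f, Finset.smul_sum, smul_comm r]⟩

/-- The narrow simplicial module of a chain complex, inverse to normalization. -/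
noncomputable def denormalized : NarrowModule k :=
  NarrowModule.ofDeg (fun n => ModuleCat.of k (C.families n))
    (fun {m n} φ =>
      { toFun := fun c => ⟨fun l f => c.1 l (f ≫ φ), fun l f hf => c.2.1 l _ (hf.comp φ),
          fun l f => by simpa only [Category.assoc] using c.2.2 l (f ≫ φ)⟩
        map_add' := fun _ _ => rfl
        map_smul' := fun _ _ => rfl })
    (fun n c => Subtype.ext (funext fun l => funext fun f => congrArg (c.1 l) (Category.comp_id f)))
    (fun f g c => Subtype.ext (funext fun l => funext fun h =>
      congrArg (c.1 l) (Category.assoc h f g).symm))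

/-- The value of a family at a map. -/
noncomputable def eval {m n : ℕ} (f : (⟨m⟩ : NarrowSimplex) ⟶ ⟨n⟩) :
    C.denormalized.deg n →ₗ[k] C.X m where
  toFun c := c.1 m f
  map_add' _ _ := rfl
  map_smul' _ _ := rfl

variable {C}

theorem denormalized_ext {n : ℕ} {c c' : C.denormalized.deg n}
    (h : ∀ m (f : (⟨m⟩ : NarrowSimplex) ⟶ ⟨n⟩), C.eval f c = C.eval f c') : c = c' :=
  Subtype.ext (funext fun m => funext fun f => h m f)

/-- Construct an element of the narrow simplicial module of a chain complex. -/
noncomputable def mkFamily {n : ℕ} (c : ∀ m, ((⟨m⟩ : NarrowSimplex) ⟶ ⟨n⟩) → C.X m)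
    (h : c ∈ C.families n) : C.denormalized.deg n := ⟨c, h⟩

theorem eval_mkFamily {m n : ℕ} (c : ∀ m, ((⟨m⟩ : NarrowSimplex) ⟶ ⟨n⟩) → C.X m)
    (h : c ∈ C.families n) (f : (⟨m⟩ : NarrowSimplex) ⟶ ⟨n⟩) :
    C.eval f (mkFamily c h) = c m f := rfl

theorem eval_act {l m n : ℕ} (f : (⟨l⟩ : NarrowSimplex) ⟶ ⟨m⟩) (φ : (⟨m⟩ : NarrowSimplex) ⟶ ⟨n⟩)
    (c : C.denormalized.deg n) : C.eval f (C.denormalized.act φ c) = C.eval (f ≫ φ) c := rfl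

theorem eval_of_isDegenerate {m n : ℕ} {f : (⟨m⟩ : NarrowSimplex) ⟶ ⟨n⟩} (hf : IsDegenerate f)
    (c : C.denormalized.deg n) : C.eval f c = 0 :=
  c.2.1 m f hf

theorem d_eval {m n : ℕ} (f : (⟨m + 1⟩ : NarrowSimplex) ⟶ ⟨n⟩) (c : C.denormalized.deg n) :
    (C.d (m + 1) m).hom (C.eval f c) =
      ∑ i : Fin (m + 1), (-1 : k) ^ (i : ℕ) • C.eval (coface m i ≫ f) c :=
  c.2.2 m f

/-- A family is determined by its value at the identity and its faces, since every other
nondegenerate map factors through a coface. -/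
theorem eq_zero_of_faces {n : ℕ} {c : C.denormalized.deg (n + 1)} (h : C.eval (𝟙 _) c = 0)
    (h' : ∀ i, C.denormalized.act (coface n i) c = 0) : c = 0 := by
  refine denormalized_ext fun m f => ?_
  rw [map_zero]
  by_cases hf : IsDegenerate f
  · exact eval_of_isDegenerate hf c
  rcases eq_id_or_exists_coface f hf with ⟨rfl, rfl⟩ | ⟨n', e, i, g, rfl⟩
  · rwa [cast_rfl]
  · obtain rfl : n' = n := by lia
    rw [cast_rfl, Category.comp_id, ← eval_act, h', map_zero]

theorem eval_id_of_mem_degenerate {n : ℕ} {c : C.denormalized.deg n}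
    (hc : c ∈ C.denormalized.degenerate n) : C.eval (𝟙 _) c = 0 := by
  refine C.denormalized.degenerate_le (S := LinearMap.ker (C.eval (𝟙 _))) (fun m f hf x => ?_) hc
  rw [LinearMap.mem_ker, eval_act, Category.id_comp]
  exact eval_of_isDegenerate hf x

/-- The degenerate families are those that vanish at the identity. A family that vanishes there is,
modulo degenerate ones, a family `y` all of whose faces but the first are zero; the first face is
then zero by the boundary formula, and so is `y`. -/
theorem mem_degenerate_iff {n : ℕ} {c : C.denormalized.deg n} :
    c ∈ C.denormalized.degenerate n ↔ C.eval (𝟙 _) c = 0 := by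
  refine ⟨eval_id_of_mem_degenerate, fun hc => ?_⟩
  obtain _ | n := n
  · have : c = 0 := denormalized_ext fun m f => by
      obtain rfl := eq_zero_of_hom_zero f
      rw [map_zero, ← hc, eq_id_of_not_isDegenerate (f := f) fun ⟨j, hj, _⟩ => by lia]
    rw [this]
    exact Submodule.zero_mem _
  obtain ⟨y, hy, hy'⟩ := C.denormalized.exists_sub_mem_degenerate c
  have h1 : C.eval (𝟙 _) y = 0 := by
    have := eval_id_of_mem_degenerate hy
    rw [map_sub, hc, zero_sub, neg_eq_zero] at this
    exact this
  have h2 : C.denormalized.act (coface n 0) y = 0 := by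
    have h3 : C.eval (𝟙 _) (C.denormalized.act (coface n 0) y) = 0 := by
      have h4 := d_eval (𝟙 _) y
      rw [h1, map_zero, Fin.sum_univ_succ] at h4
      rw [Finset.sum_eq_zero fun i _ => ?_] at h4
      · simpa [eval_act] using h4.symm
      · rw [Category.comp_id, ← Category.id_comp (coface n i.succ), ← eval_act,
          hy' _ (Fin.succ_ne_zero i), map_zero, smul_zero]
    obtain _ | n := n
    · refine denormalized_ext fun m f => ?_
      obtain rfl := eq_zero_of_hom_zero f
      rw [eq_id_of_not_isDegenerate (f := f) fun ⟨j, hj, _⟩ => by lia, h3, map_zero]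
    · refine eq_zero_of_faces h3 fun i => ?_
      rw [← NarrowModule.act_comp]
      have h5 := coface_comp_coface (n := n) (i := 0) (j := i) (Nat.zero_le _) i.isLt
      rw [show (0 : Fin (n + 1 + 1)) = ⟨0, by lia⟩ from rfl, h5, NarrowModule.act_comp,
        hy' _ fun h => absurd (congrArg Fin.val h) (Nat.succ_ne_zero _), map_zero]
  have h6 : y = 0 := eq_zero_of_faces h1 fun i => by
    by_cases hi : i = 0
    · rw [hi, h2]
    · exact hy' i hi
  rwa [h6, sub_zero] at hy

/-- A family with value `x` at the identity: it has the value `d x` at the first coface and is zero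
at all other maps. -/
theorem exists_eval_id {n : ℕ} (x : C.X n) : ∃ c : C.denormalized.deg n, C.eval (𝟙 _) c = x := by
  classical
  -- `P` singles out the identity, `Q` the first coface; other maps between the same simplices and
  -- maps between simplices of other dimensions get the value zero
  let P : ∀ m, ((⟨m⟩ : NarrowSimplex) ⟶ ⟨n⟩) → Prop := fun m f => ∀ v ≤ m, Hom.nat f v = v
  let Q : ∀ m, ((⟨m⟩ : NarrowSimplex) ⟶ ⟨n⟩) → Prop := fun m f =>
    ∀ v, 1 ≤ v → v ≤ m → Hom.nat f v = v + 1
  let X : ∀ m, C.X m := Pi.single n x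
  let Y : ∀ m, C.X m := Pi.single (n - 1) ((C.d n (n - 1)).hom x)
  have hX : X n = x := Pi.single_eq_same _ _
  have hX' : ∀ m, m ≠ n → X m = 0 := fun m hm => Pi.single_eq_of_ne hm _
  have hY : Y (n - 1) = (C.d n (n - 1)).hom x := Pi.single_eq_same _ _
  have hY' : ∀ m, m + 1 ≠ n → Y m = 0 := fun m hm => by
    by_cases h : m = n - 1
    · obtain rfl : n = 0 := by lia
      subst h
      rw [hY, C.shape _ _ (by simp)]
      rfl
    · exact Pi.single_eq_of_ne h _
  let c : ∀ m, ((⟨m⟩ : NarrowSimplex) ⟶ ⟨n⟩) → C.X m := fun m f =>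
    (if P m f then X m else 0) + (if Q m f then Y m else 0)
  have hP : ∀ m f, IsDegenerate f → ¬ P m f := by
    rintro m f ⟨j, hj, h⟩ hP
    rw [hP _ (by lia), hP _ (by lia)] at h
    lia
  have hQ : ∀ m f, IsDegenerate f → ¬ Q m f := by
    rintro m f ⟨j, hj, h⟩ hQ
    rw [hQ _ (by lia) (by lia), hQ _ (by lia) (by lia)] at h
    lia
  have hc : ∀ m f, IsDegenerate f → c m f = 0 := fun m f hf => by
    simp only [c]
    rw [if_neg (hP m f hf), if_neg (hQ m f hf), add_zero]
  refine ⟨mkFamily c ⟨hc, fun m f => ?_⟩, ?_⟩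
  · by_cases hf : IsDegenerate f
    · rw [hc _ f hf, map_zero]
      have := sum_coface_mem (k := k) ⊥ (c m)
        (fun g hg => (Submodule.mem_bot k).mpr (hc m g hg)) f hf
      exact ((Submodule.mem_bot k).mp this).symm
    · have hmn := (le_of_not_isDegenerate hf le_rfl).trans (Hom.nat_le_inner f le_rfl)
      rcases hmn.eq_or_lt with rfl | hmn
      · obtain rfl := eq_id_of_not_isDegenerate hf
        have h1 : c (m + 1) (𝟙 _) = x := by
          simp only [c]
          rw [if_pos fun v hv => Hom.nat_id (Nat.le_succ_of_le hv), hX, hY' _ (by lia), ite_self,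
            add_zero]
        have h2 : ∀ i, c m (coface m i ≫ 𝟙 _) = if i = 0 then (C.d (m + 1) m).hom x else 0 := by
          intro i
          simp only [c]
          rw [hX' m (by lia), ite_self, zero_add, Category.comp_id]
          have h3 : Q m (coface m i) ↔ i = 0 := by
            constructor
            · intro h
              by_contra hi
              have hi' : i.val ≠ 0 := fun h => hi (Fin.ext h)
              have h4 := h 1 le_rfl (by have := i.isLt; lia)
              rw [nat_coface _ _ (by lia), if_pos (by lia)] at h4
              lia
            · rintro rfl v hv hv'
              rw [nat_coface _ _ (by lia), if_neg (by simp only [Fin.val_zero]; lia)]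
          simp only [h3]
          exact if_congr Iff.rfl hY rfl
        rw [h1, Finset.sum_eq_single 0]
        · rw [h2, if_pos rfl]
          simp
        · intro i _ hi
          rw [h2, if_neg hi, smul_zero]
        · simp
      · have h1 : ∀ g, c m g = 0 := fun g => by
          simp only [c]
          rw [hX' m (by lia), hY' m (by lia), ite_self, ite_self, add_zero]
        rw [Finset.sum_eq_zero fun i _ => by rw [h1, smul_zero]]
        simp only [c]
        rw [hX' (m + 1) (by lia), ite_self, zero_add]
        split_ifs
        · by_cases h2 : m + 1 = n - 1
          · have h3 : (C.d (n - 1) m).hom (Y (n - 1)) = 0 := by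
              rw [hY]
              exact LinearMap.congr_fun (congrArg ModuleCat.Hom.hom (C.d_comp_d n (n - 1) m)) x
            rwa [← h2] at h3
          · rw [hY' _ (by lia), map_zero]
        · exact map_zero _
  · refine (eval_mkFamily _ _ _).trans ?_
    simp only [c]
    rw [if_pos fun v hv => Hom.nat_id (Nat.le_succ_of_le hv), hX]
    rw [hY' _ (by lia), ite_self, add_zero]

end DGModule

namespace NarrowModule

open NarrowSimplex DGModule

variable {k : Type u} [CommRing k] (A : NarrowModule k)

/-- The unit of the Dold–Kan correspondence. -/
noncomputable def toDenormalized (n : ℕ) : A.deg n →ₗ[k] A.normalized.denormalized.deg n where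
  toFun x := mkFamily (fun m f => A.toNormalized m (A.act f x))
    ⟨fun m f hf => A.toNormalized_eq_zero.mpr (A.act_mem_degenerate hf x), fun m f => by
      rw [normalized_d, boundary_apply, map_sum]
      simp only [map_smul, act_comp]⟩
  map_add' x y := denormalized_ext fun m f =>
    (congrArg (A.toNormalized m) (map_add (A.act f) x y)).trans (map_add _ _ _)
  map_smul' r x := denormalized_ext fun m f =>
    (congrArg (A.toNormalized m) (map_smul (A.act f) r x)).trans (map_smul _ _ _)

theorem eval_toDenormalized {m n : ℕ} (f : (⟨m⟩ : NarrowSimplex) ⟶ ⟨n⟩) (x : A.deg n) :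
    A.normalized.eval f (A.toDenormalized n x) = A.toNormalized m (A.act f x) := rfl

theorem toDenormalized_act {m n : ℕ} (f : (⟨m⟩ : NarrowSimplex) ⟶ ⟨n⟩) (x : A.deg n) :
    A.toDenormalized m (A.act f x) = A.normalized.denormalized.act f (A.toDenormalized n x) :=
  denormalized_ext fun l g => by
    rw [eval_act, eval_toDenormalized, eval_toDenormalized, act_comp]

/-- An element of the kernel is degenerate, and its faces are zero by induction. -/
theorem toDenormalized_injective (n : ℕ) : Function.Injective (A.toDenormalized n) := by
  rw [injective_iff_map_eq_zero]
  induction n with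
  | zero =>
    intro x hx
    have h := A.eval_toDenormalized (𝟙 _) x
    rw [hx, map_zero, act_id] at h
    exact (Submodule.mem_bot k).mp (A.toNormalized_eq_zero.mp h.symm)
  | succ n ih =>
    intro x hx
    have h := A.eval_toDenormalized (𝟙 _) x
    rw [hx, map_zero, act_id] at h
    refine A.eq_zero_of_mem_degenerate (A.toNormalized_eq_zero.mp h.symm) fun i => ih _ ?_
    rw [toDenormalized_act, hx, map_zero]

/-- A family agrees with the image of an element modulo degenerate families, which come from lower
degrees. -/
theorem toDenormalized_surjective (n : ℕ) : Function.Surjective (A.toDenormalized n) := by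
  have key : ∀ n, A.normalized.denormalized.degenerate n ≤ LinearMap.range (A.toDenormalized n) →
      Function.Surjective (A.toDenormalized n) := by
    intro n h c
    obtain ⟨x, hx⟩ := A.toNormalized_surjective n (A.normalized.eval (𝟙 _) c)
    have h1 : c - A.toDenormalized n x ∈ A.normalized.denormalized.degenerate n := by
      rw [mem_degenerate_iff, map_sub, eval_toDenormalized, act_id, hx, sub_self]
    obtain ⟨y, hy⟩ := h h1
    exact ⟨x + y, by rw [map_add, hy, add_sub_cancel]⟩
  induction n with
  | zero => exact key 0 bot_le
  | succ n ih =>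
    refine key _ (iSup_le fun i => ?_)
    rintro _ ⟨c, rfl⟩
    obtain ⟨x, rfl⟩ := ih c
    exact ⟨_, A.toDenormalized_act _ x⟩

/-- The unit of the Dold–Kan correspondence as an equivalence. -/
noncomputable def denormalizedEquiv (n : ℕ) :
    A.deg n ≃ₗ[k] A.normalized.denormalized.deg n :=
  LinearEquiv.ofBijective (A.toDenormalized n)
    ⟨A.toDenormalized_injective n, A.toDenormalized_surjective n⟩

/-- An element is determined by the classes of its images in the normalized chains. All identities
between elements of a narrow simplicial module can thus be checked in normalized chains. -/
theorem eq_of_toNormalized_act {n : ℕ} {x y : A.deg n}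
    (h : ∀ m (f : (⟨m⟩ : NarrowSimplex) ⟶ ⟨n⟩),
      A.toNormalized m (A.act f x) = A.toNormalized m (A.act f y)) : x = y :=
  A.toDenormalized_injective n (denormalized_ext h)

end NarrowModule

/-! ### Normalization is an equivalence -/

namespace DGCat

open NarrowSimplex DGModule

variable {k : Type u} [CommRing k] (C : DGCat k)

/-- The product of two families, evaluated at `f` by decomposing `f` along `p + q`. The
decomposition is unique, so that its choice does not matter. -/
noncomputable def mulFun (x y z : C.Ob) {p q n : ℕ} (h : p + q = n)
    (c : (denormalized (C.hom x y)).deg p) (c' : (denormalized (C.hom y z)).deg q) (m : ℕ)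
    (f : (⟨m⟩ : NarrowSimplex) ⟶ ⟨n⟩) : (C.hom x z).X m :=
  C.pairing x y z _ _ m (exists_isSplit f h).choose_spec.choose_spec.choose_spec.choose_spec.source
    (eval (C.hom x y) (exists_isSplit f h).choose_spec.choose_spec.choose c)
    (eval (C.hom y z) (exists_isSplit f h).choose_spec.choose_spec.choose_spec.choose c')

theorem mulFun_eq (x y z : C.Ob) {m n m₁ m₂ p q : ℕ} (h : p + q = n)
    (c : (denormalized (C.hom x y)).deg p) (c' : (denormalized (C.hom y z)).deg q)
    {f : (⟨m⟩ : NarrowSimplex) ⟶ ⟨n⟩} {u : (⟨m₁⟩ : NarrowSimplex) ⟶ ⟨p⟩}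
    {v : (⟨m₂⟩ : NarrowSimplex) ⟶ ⟨q⟩} (hf : IsSplit f u v) :
    C.mulFun x y z h c c' m f =
      C.pairing x y z m₁ m₂ m hf.source (eval (C.hom x y) u c) (eval (C.hom y z) v c') := by
  have key : ∀ {l₁ l₂ : ℕ} {u' : (⟨l₁⟩ : NarrowSimplex) ⟶ ⟨p⟩} {v' : (⟨l₂⟩ : NarrowSimplex) ⟶ ⟨q⟩}
      (hf' : IsSplit f u' v'), C.pairing x y z l₁ l₂ m hf'.source (eval (C.hom x y) u' c)
        (eval (C.hom y z) v' c') =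
      C.pairing x y z m₁ m₂ m hf.source (eval (C.hom x y) u c) (eval (C.hom y z) v c') := by
    intro l₁ l₂ u' v' hf'
    obtain ⟨rfl, rfl, hu, hv⟩ := hf.unique hf'
    obtain rfl := eq_of_heq hu
    obtain rfl := eq_of_heq hv
    rfl
  exact key (exists_isSplit f h).choose_spec.choose_spec.choose_spec.choose_spec

/-- The boundary formula for a product is the Leibniz rule: the cofaces of `f` are those of its two
parts. -/
theorem mulFun_mem (x y z : C.Ob) {p q n : ℕ} (h : p + q = n)
    (c : (denormalized (C.hom x y)).deg p) (c' : (denormalized (C.hom y z)).deg q) :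
    C.mulFun x y z h c c' ∈ families (C.hom x z) n := by
  refine ⟨fun m f hf => ?_, fun m f => ?_⟩
  · obtain ⟨m₁, m₂, u, v, hs⟩ := exists_isSplit f h
    rw [C.mulFun_eq x y z h c c' hs]
    rcases hs.isDegenerate hf with hu | hv
    · rw [eval_of_isDegenerate hu, map_zero, LinearMap.zero_apply]
    · rw [eval_of_isDegenerate hv, map_zero]
  · obtain ⟨m₁, m₂, u, v, hs⟩ := exists_isSplit f h
    rw [C.mulFun_eq x y z h c c' hs, C.pairing_leibniz, alternating_sum_split hs.source]
    congr 1
    · obtain _ | m₁ := m₁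
      · simp [Pairing.left]
      · rw [Pairing.left, d_eval, map_sum, LinearMap.sum_apply]
        refine Finset.sum_congr rfl fun i _ => ?_
        rw [C.mulFun_eq x y z h c c' (hs.coface_left i ⟨i, _⟩ rfl), map_smul, LinearMap.smul_apply]
    · congr 1
      obtain _ | m₂ := m₂
      · simp [Pairing.right]
      · rw [Pairing.right, d_eval, map_sum]
        refine Finset.sum_congr rfl fun i _ => ?_
        rw [C.mulFun_eq x y z h c c' (hs.coface_right i ⟨m₁ + i, _⟩ rfl), map_smul]

/-- The composition on the narrow simplicial modules of a dg-category. -/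
noncomputable def denormalizedComp (x y z : C.Ob) (p q : ℕ) :
    (denormalized (C.hom x y)).deg p →ₗ[k] (denormalized (C.hom y z)).deg q →ₗ[k]
      (denormalized (C.hom x z)).deg (p + q) :=
  LinearMap.mk₂ k (fun c c' => mkFamily (C.mulFun x y z rfl c c') (C.mulFun_mem x y z rfl c c'))
    (fun c₁ c₂ c' => denormalized_ext fun m f => by
      rw [map_add, eval_mkFamily, eval_mkFamily, eval_mkFamily, mulFun, map_add, map_add]
      rfl)
    (fun r c c' => denormalized_ext fun m f => by
      rw [map_smul, eval_mkFamily, eval_mkFamily, mulFun, map_smul, map_smul]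
      rfl)
    (fun c c₁ c₂ => denormalized_ext fun m f => by
      rw [map_add, eval_mkFamily, eval_mkFamily, eval_mkFamily, mulFun, map_add, map_add]
      rfl)
    (fun r c c' => denormalized_ext fun m f => by
      rw [map_smul, eval_mkFamily, eval_mkFamily, mulFun, map_smul, map_smul]
      rfl)

theorem eval_denormalizedComp (x y z : C.Ob) {m m₁ m₂ p q : ℕ}
    {f : (⟨m⟩ : NarrowSimplex) ⟶ ⟨p + q⟩} {u : (⟨m₁⟩ : NarrowSimplex) ⟶ ⟨p⟩}
    {v : (⟨m₂⟩ : NarrowSimplex) ⟶ ⟨q⟩} (hf : IsSplit f u v)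
    (c : (denormalized (C.hom x y)).deg p) (c' : (denormalized (C.hom y z)).deg q) :
    eval (C.hom x z) f (C.denormalizedComp x y z p q c c') =
      C.pairing x y z m₁ m₂ m hf.source (eval (C.hom x y) u c) (eval (C.hom y z) v c') :=
  C.mulFun_eq x y z rfl c c' hf

/-- The identity of `x`, as a family indexed by the narrow maps into the smallest simplex; there is
only one of them. -/
noncomputable def denormalizedOne (x : C.Ob) : (denormalized (C.hom x x)).deg 0 :=
  (exists_eval_id (C.one x)).choose

theorem eval_denormalizedOne (x : C.Ob) : eval (C.hom x x) (𝟙 _) (C.denormalizedOne x) = C.one x :=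
  (exists_eval_id (C.one x)).choose_spec

/-- The data of the category enriched in narrow simplicial modules associated with a
dg-category. -/
noncomputable def denormalizedData : NarrowCat.Data k where
  Ob := C.Ob
  H x y := (denormalized (C.hom x y))
  comp := C.denormalizedComp
  one := C.denormalizedOne
  comp_act {x y z p q p' q'} u v c c' := denormalized_ext fun m f => by
    obtain ⟨m₁, m₂, a, b, hs⟩ := exists_isSplit f (rfl : p + q = p + q)
    rw [eval_act, C.eval_denormalizedComp x y z hs,
      C.eval_denormalizedComp x y z ((isSplit_join u v).comp hs), eval_act, eval_act]
  comp_assoc {w x y z p q r} f g h := denormalized_ext fun m φ => by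
    obtain ⟨m₁, m₂, a, b, hs⟩ := exists_isSplit φ (rfl : p + q + r = p + q + r)
    obtain ⟨m₃, m₄, a', b', hs'⟩ := exists_isSplit a (rfl : p + q = p + q)
    have hs₂ := isSplit_cast_join (m := m₄ + m₂) rfl rfl b' b
    have hs₃ := (hs'.assoc hs hs₂).comp_cast (Nat.add_assoc p q r)
    rw [eval_act, C.eval_denormalizedComp w x z hs₃, C.eval_denormalizedComp x y z hs₂,
      C.eval_denormalizedComp w y z hs, C.eval_denormalizedComp w x y hs']
    exact (C.pairing_assoc _ _ _ _ _ _ _).symm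
  one_comp {x y p} f := denormalized_ext fun m φ => by
    rw [C.eval_denormalizedComp x x y ((isSplit_id_left _).of_comp_cast (Nat.zero_add p)),
      eval_denormalizedOne, eval_act]
    exact C.one_pairing _
  comp_one {x y p} f := denormalized_ext fun m φ => by
    rw [C.eval_denormalizedComp x y y ((isSplit_id_right _).of_comp_cast (Nat.add_zero p)),
      eval_denormalizedOne, eval_act]
    exact C.pairing_one _

theorem onDeg_heq_of_eq {C D : DGCat k} {F G : C ⟶ D} (h : F = G) (x y : C.Ob) (n : ℕ)
    (f : (C.hom x y).X n) : HEq (onDeg F x y n f) (onDeg G x y n f) := by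
  subst h
  rfl

theorem onDeg_mem_families {C D : DGCat k} (F : C ⟶ D) (x y : C.Ob) {n : ℕ}
    (c : (denormalized (C.hom x y)).deg n) :
    (fun m f => onDeg F x y m (eval (C.hom x y) f c)) ∈ families (D.hom _ _) n := by
  refine ⟨fun m f hf => ?_, fun m f => ?_⟩
  · exact (congrArg (onDeg F x y m) (eval_of_isDegenerate hf c)).trans (map_zero _)
  · rw [onDeg_d, d_eval, map_sum]
    simp only [map_smul]

/-- The map induced by a dg-functor on denormalizations. -/
noncomputable def onDenormalized {C D : DGCat k} (F : C ⟶ D) (x y : C.Ob) (n : ℕ) :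
    (denormalized (C.hom x y)).deg n →ₗ[k] (denormalized (D.hom (SmallEnrichedCat.onOb F x)
      (SmallEnrichedCat.onOb F y))).deg n where
  toFun c := mkFamily _ (onDeg_mem_families F x y c)
  map_add' c c' := denormalized_ext fun m f =>
    (congrArg (onDeg F x y m) (map_add (eval (C.hom x y) f) c c')).trans (map_add _ _ _)
  map_smul' r c := denormalized_ext fun m f =>
    (congrArg (onDeg F x y m) (map_smul (eval (C.hom x y) f) r c)).trans (map_smul _ _ _)

/-- The counit of the Dold–Kan correspondence: the value of a family at the identity. -/
noncomputable def counitDeg (x y : C.Ob) (n : ℕ) :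
    (denormalized (C.hom x y)).normalized.X n →ₗ[k] (C.hom x y).X n :=
  ((denormalized (C.hom x y)).degenerate n).liftQ (eval (C.hom x y) (𝟙 _)) fun _ h =>
    eval_id_of_mem_degenerate h

theorem counitDeg_apply (x y : C.Ob) (n : ℕ) (c : (denormalized (C.hom x y)).deg n) :
    C.counitDeg x y n ((denormalized (C.hom x y)).toNormalized n c) =
      eval (C.hom x y) (𝟙 _) c := rfl

/-- The normalized chains of a denormalization are the original complex, as degenerate families are
those that vanish at the identity. -/
theorem counitDeg_bijective (x y : C.Ob) (n : ℕ) : Function.Bijective (C.counitDeg x y n) := by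
  constructor
  · rw [injective_iff_map_eq_zero]
    intro c hc
    obtain ⟨c, rfl⟩ := (denormalized (C.hom x y)).toNormalized_surjective n c
    rw [counitDeg_apply] at hc
    exact (NarrowModule.toNormalized_eq_zero _).mpr (mem_degenerate_iff.mpr hc)
  · intro f
    obtain ⟨c, rfl⟩ := exists_eval_id f
    exact ⟨_, C.counitDeg_apply x y n c⟩

theorem eval_id_boundary (x y : C.Ob) (n : ℕ) (c : (denormalized (C.hom x y)).deg (n + 1)) :
    eval (C.hom x y) (𝟙 _) ((denormalized (C.hom x y)).boundary n c) =
      ((C.hom x y).d (n + 1) n).hom (eval (C.hom x y) (𝟙 _) c) := by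
  rw [d_eval, NarrowModule.boundary_apply, map_sum]
  simp only [map_smul, eval_act, Category.id_comp, Category.comp_id]

end DGCat

namespace NarrowCat

open NarrowSimplex DGModule

variable {k : Type u} [CommRing k]

/-- The normalization of the denormalization of a dg-category is isomorphic to it. -/
noncomputable def counit (C : DGCat k) :
    (normalization k).obj C.denormalizedData.toCat ⟶ (⟨C.Ob, C.enriched⟩ : DGCat k) :=
  DGCat.homMk (A := C.denormalizedData.toCat.normalizedData.toCat) (B := ⟨C.Ob, C.enriched⟩)
    id (fun x y n => C.counitDeg x y n)
    (fun x y n c => by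
      obtain ⟨c, rfl⟩ := (denormalized (C.hom x y)).toNormalized_surjective (n + 1) c
      exact ((C.eval_id_boundary x y n c).symm.trans (congrArg (C.counitDeg x y n)
        ((denormalized (C.hom x y)).normalized_d n c).symm)))
    (fun x => by
      refine (congrArg (C.counitDeg x x 0)
        (C.denormalizedData.toCat.normalizedData.toCat_one x)).trans ?_
      exact (congrArg (eval (C.hom x x) (𝟙 _)) (C.denormalizedData.toCat_one x)).trans
        (C.eval_denormalizedOne x))
    (fun x y z p q n h c c' => by
      obtain ⟨c, rfl⟩ := (denormalized (C.hom x y)).toNormalized_surjective p c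
      obtain ⟨c', rfl⟩ := (denormalized (C.hom y z)).toNormalized_surjective q c'
      subst h
      refine (congrArg (C.counitDeg x z (p + q)) (LinearMap.congr_fun₂
        (C.denormalizedData.toCat.normalizedData.toCat_pairing x y z p q _ rfl) _ _)).trans ?_
      refine (congrArg (eval (C.hom x z) (𝟙 _))
        (C.denormalizedData.toCat.mul_eq_comp x y z p q rfl c c')).trans ?_
      refine (congrArg (fun t => eval (C.hom x z) (𝟙 _) (t c c'))
        (C.denormalizedData.toCat_comp x y z p q)).trans ?_
      exact C.eval_denormalizedComp x y z (isSplit_id rfl) c c')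

theorem isIso_counit (C : DGCat k) : IsIso (counit C) :=
  DGCat.isIso_homMk_id (a := C.denormalizedData.toCat.normalizedData.toCat.enriched)
    (b := C.enriched)
    _ _ _ _ C.counitDeg_bijective

theorem heq_of_toNormalized_act {B : NarrowCat k} {x x' y y' : B.Ob} (hx : x = x') (hy : y = y')
    {n : ℕ} {a : (B.hom x y).deg n} {b : (B.hom x' y').deg n}
    (h : ∀ m (f : (⟨m⟩ : NarrowSimplex) ⟶ ⟨n⟩),
      HEq ((B.hom x y).toNormalized m ((B.hom x y).act f a))
        ((B.hom x' y').toNormalized m ((B.hom x' y').act f b))) : HEq a b := by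
  subst hx hy
  exact heq_of_eq ((B.hom x y).eq_of_toNormalized_act fun m f => eq_of_heq (h m f))

/-- Elements are determined by the classes of their images under all narrow maps. -/
instance : (normalization k).Faithful where
  map_injective {A B F G} h := by
    have h0 : ∀ x, SmallEnrichedCat.onOb F x = SmallEnrichedCat.onOb G x := fun x =>
      congrArg (fun H : (normalization k).obj A ⟶ (normalization k).obj B =>
        SmallEnrichedCat.onOb H x) h
    refine functor_ext h0 fun x y n a => heq_of_toNormalized_act (h0 x) (h0 y) fun m f => ?_
    rw [← onDeg_act, ← onDeg_act]
    exact DGCat.onDeg_heq_of_eq h x y m ((A.hom x y).toNormalized m ((A.hom x y).act f a))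

variable {A B : NarrowCat k} (G : (normalization k).obj A ⟶ (normalization k).obj B)

/-- The map on objects underlying a dg-functor between normalizations. -/
noncomputable def liftOb (x : A.Ob) : B.Ob :=
  SmallEnrichedCat.onOb (A := (normalization k).obj A) (B := (normalization k).obj B) G x

/-- The unique lift of a map of normalizations to the original modules of morphisms. -/
noncomputable def liftDeg (x y : A.Ob) (n : ℕ) :
    (A.hom x y).deg n →ₗ[k] (B.hom (liftOb G x) (liftOb G y)).deg n :=
  ((B.hom (liftOb G x) (liftOb G y)).denormalizedEquiv n).symm.toLinearMap ∘ₗ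
    (show (A.hom x y).normalized.denormalized.deg n →ₗ[k] _ from
      DGCat.onDenormalized (C := A.normalizedData.toCat) (D := B.normalizedData.toCat) G x y n) ∘ₗ
    (A.hom x y).toDenormalized n

/-- The action of a dg-functor on classes in normalized chains. -/
noncomputable def onClass (x y : A.Ob) (n : ℕ) :
    (A.hom x y).normalized.X n →ₗ[k] (B.hom (liftOb G x) (liftOb G y)).normalized.X n :=
  DGCat.onDeg (C := A.normalizedData.toCat) (D := B.normalizedData.toCat) G x y n

theorem toNormalized_act_liftDeg (x y : A.Ob) {m n : ℕ} (f : (⟨m⟩ : NarrowSimplex) ⟶ ⟨n⟩)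
    (a : (A.hom x y).deg n) :
    (B.hom _ _).toNormalized m ((B.hom _ _).act f (liftDeg G x y n a)) =
      onClass G x y m ((A.hom x y).toNormalized m ((A.hom x y).act f a)) := by
  rw [← NarrowModule.eval_toDenormalized]
  exact congrArg ((B.hom _ _).normalized.eval f)
    (((B.hom (liftOb G x) (liftOb G y)).denormalizedEquiv n).apply_symm_apply _)

theorem toNormalized_liftDeg (x y : A.Ob) {n : ℕ} (a : (A.hom x y).deg n) :
    (B.hom _ _).toNormalized n (liftDeg G x y n a) =
      onClass G x y n ((A.hom x y).toNormalized n a) := by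
  have h := toNormalized_act_liftDeg G x y (𝟙 _) a
  rwa [NarrowModule.act_id, NarrowModule.act_id] at h

theorem onClass_one (x : A.Ob) :
    onClass G x x 0 ((A.hom x x).toNormalized 0 (A.one x)) =
      (B.hom _ _).toNormalized 0 (B.one (liftOb G x)) := by
  refine (congrArg (onClass G x x 0) (A.normalizedData.toCat_one x).symm).trans ?_
  exact (DGCat.onDeg_one (A := A.normalizedData.toCat) (B := B.normalizedData.toCat) G x).trans
    (B.normalizedData.toCat_one _)

theorem onClass_mul (x y z : A.Ob) (p q n : ℕ) (h : p + q = n) (f : (A.hom x y).deg p)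
    (g : (A.hom y z).deg q) :
    onClass G x z n ((A.hom x z).toNormalized n (A.mul x y z p q n h f g)) =
      B.normalizedPairing _ _ _ p q n h (onClass G x y p ((A.hom x y).toNormalized p f))
        (onClass G y z q ((A.hom y z).toNormalized q g)) := by
  refine (congrArg (fun t => onClass G x z n (t ((A.hom x y).toNormalized p f)
    ((A.hom y z).toNormalized q g))) (A.normalizedData.toCat_pairing x y z p q n h).symm).trans ?_
  refine (DGCat.onDeg_pairing (A := A.normalizedData.toCat) (B := B.normalizedData.toCat) G x y z
    p q n h _ _).trans ?_
  exact congrArg (fun t => t (onClass G x y p ((A.hom x y).toNormalized p f))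
    (onClass G y z q ((A.hom y z).toNormalized q g))) (B.normalizedData.toCat_pairing _ _ _ p q n h)

/-- The unique lift of a dg-functor between normalizations. -/
noncomputable def lift : A ⟶ B :=
  homMk (liftOb G) (liftDeg G)
    (fun x y {m n} f a => NarrowModule.eq_of_toNormalized_act _ fun l g => by
      rw [toNormalized_act_liftDeg, ← NarrowModule.act_comp, ← NarrowModule.act_comp,
        toNormalized_act_liftDeg])
    (fun x => NarrowModule.eq_of_toNormalized_act _ fun l g => by
      obtain rfl := eq_zero_of_hom_zero g
      rw [eq_id_of_not_isDegenerate (f := g) fun ⟨j, hj, _⟩ => by lia, NarrowModule.act_id,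
        NarrowModule.act_id, toNormalized_liftDeg, onClass_one])
    (fun x y z p q f g => NarrowModule.eq_of_toNormalized_act _ fun l φ => by
      obtain ⟨m₁, m₂, u, v, hs⟩ := exists_isSplit φ (rfl : p + q = p + q)
      rw [toNormalized_act_liftDeg, ← mul_eq_comp A x y z p q rfl, ← mul_eq_comp B _ _ _ p q rfl,
        act_mul hs, act_mul hs, onClass_mul, ← toNormalized_act_liftDeg,
        ← toNormalized_act_liftDeg, normalizedPairing_apply])

instance : (normalization k).Full where
  map_surjective {A B} G := ⟨lift G, DGCat.functor_ext (fun _ => rfl) fun x y n f => heq_of_eq <| by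
    obtain ⟨f, rfl⟩ := (A.hom x y).toNormalized_surjective n f
    exact (onDeg_mapNormalized (lift G) x y n f).trans (toNormalized_liftDeg G x y f)⟩

instance : (normalization k).EssSurj where
  mem_essImage C := ⟨C.denormalizedData.toCat, ⟨by
    have := isIso_counit C
    exact asIso (counit C)⟩⟩

instance : (normalization k).IsEquivalence where

end NarrowCat

/-! ### Frobenius templicial modules in terms of elements -/

namespace FinInterval

/-- The map between intervals of equal length. -/
def cast {m n : ℕ} (h : m = n) : (⟨m⟩ : FinInterval) ⟶ ⟨n⟩ :=
  (castIso (m := ⟨m⟩) (n := ⟨n⟩) h).hom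

theorem nat_cast {m n : ℕ} (h : m = n) {i : ℕ} (hi : i ≤ m) : Hom.nat (cast h) i = i :=
  nat_castIso_hom (m := ⟨m⟩) (n := ⟨n⟩) h hi

theorem cast_rfl {n : ℕ} (h : n = n) : cast h = 𝟙 (⟨n⟩ : FinInterval) :=
  hom_ext_nat fun i hi => by rw [nat_cast h hi, Hom.nat_id _ hi]

theorem Hom.nat_self {m n : ℕ} (f : (⟨m⟩ : FinInterval) ⟶ ⟨n⟩) : Hom.nat f m = n :=
  Hom.nat_of_len_le f le_rfl

/-- The map `f` is the sum of `u` and `v`. -/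
structure IsSum {m n m₁ m₂ p q : ℕ} (f : (⟨m⟩ : FinInterval) ⟶ ⟨n⟩)
    (u : (⟨m₁⟩ : FinInterval) ⟶ ⟨p⟩) (v : (⟨m₂⟩ : FinInterval) ⟶ ⟨q⟩) : Prop where
  source : m₁ + m₂ = m
  target : p + q = n
  nat_eq : ∀ i ≤ m, Hom.nat f i = if i ≤ m₁ then Hom.nat u i else p + Hom.nat v (i - m₁)

theorem IsSum.eq_tensorHom {m₁ m₂ p q : ℕ} {f : (⟨m₁ + m₂⟩ : FinInterval) ⟶ ⟨p + q⟩}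
    {u : (⟨m₁⟩ : FinInterval) ⟶ ⟨p⟩} {v : (⟨m₂⟩ : FinInterval) ⟶ ⟨q⟩} (h : IsSum f u v) :
    f = u ⊗ₘ v :=
  hom_ext_nat fun i hi => (h.nat_eq i hi).trans (nat_tensorHom' u v hi).symm

/-- The sum of two maps, between intervals with arbitrarily named lengths. -/
def sum {m n m₁ m₂ p q : ℕ} (h : m₁ + m₂ = m) (h' : p + q = n)
    (u : (⟨m₁⟩ : FinInterval) ⟶ ⟨p⟩) (v : (⟨m₂⟩ : FinInterval) ⟶ ⟨q⟩) :
    (⟨m⟩ : FinInterval) ⟶ ⟨n⟩ :=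
  cast h.symm ≫ (show (⟨m₁ + m₂⟩ : FinInterval) ⟶ ⟨p + q⟩ from u ⊗ₘ v) ≫ cast h'

theorem isSum_sum {m n m₁ m₂ p q : ℕ} (h : m₁ + m₂ = m) (h' : p + q = n)
    (u : (⟨m₁⟩ : FinInterval) ⟶ ⟨p⟩) (v : (⟨m₂⟩ : FinInterval) ⟶ ⟨q⟩) :
    IsSum (sum h h' u v) u v := by
  subst h h'
  refine ⟨rfl, rfl, fun i hi => ?_⟩
  rw [sum, cast_rfl, cast_rfl, Category.id_comp, Category.comp_id]
  exact nat_tensorHom' u v hi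

/-- A map decomposes at every vertex of its source. -/
theorem exists_isSum {m n m₁ m₂ : ℕ} (f : (⟨m⟩ : FinInterval) ⟶ ⟨n⟩) (h : m₁ + m₂ = m) :
    ∃ (q : ℕ) (u : (⟨m₁⟩ : FinInterval) ⟶ ⟨Hom.nat f m₁⟩) (v : (⟨m₂⟩ : FinInterval) ⟶ ⟨q⟩),
      IsSum f u v := by
  have h1 : Hom.nat f m₁ ≤ n := Hom.nat_le f m₁
  refine ⟨n - Hom.nat f m₁, homMk _ _ (Hom.nat f) (fun i j hij _ => Hom.nat_mono f hij)
    (Hom.nat_zero f) rfl, homMk _ _ (fun i => Hom.nat f (m₁ + i) - Hom.nat f m₁)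
    (fun i j hij _ => Nat.sub_le_sub_right (Hom.nat_mono f (by lia)) _) (by simp) ?_, h, by lia,
    fun i hi => ?_⟩
  · dsimp only
    rw [h, Hom.nat_self]
  · split_ifs with hi'
    · rw [nat_homMk _ _ _ _ hi']
    · have := Hom.nat_mono f (i := m₁) (j := i) (by lia)
      rw [nat_homMk _ _ _ _ (by dsimp only; lia), show m₁ + (i - m₁) = i by lia]
      lia

end FinInterval

namespace FTemplicialModule

open FinInterval

variable {k : Type u} [CommRing k] (X : FTemplicialModule k)

/-- The module of `n`-simplices from `a` to `b`. -/
abbrev deg (n : ℕ) (a b : X.base) : ModuleCat.{u} k := (X.quiver ⟨n⟩).obj a b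

theorem act_comp {I J K : FinInterval} (f : I ⟶ J) (g : J ⟶ K) (a b : X.base)
    (x : (X.quiver K).obj a b) : X.act (f ≫ g) a b x = X.act f a b (X.act g a b x) := by
  have := X.functor.map_comp g.op f.op
  exact LinearMap.congr_fun (congrArg (fun t => (ModQuiver.Hom.app t a b).hom) this) x

theorem act_id {I : FinInterval} (a b : X.base) (x : (X.quiver I).obj a b) :
    X.act (𝟙 I) a b x = x :=
  LinearMap.congr_fun (congrArg (fun t => (ModQuiver.Hom.app t a b).hom)
    (X.functor.map_id (op I))) x

theorem act_cast_rfl {n : ℕ} (h : n = n) (a b : X.base) (x : X.deg n a b) :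
    X.act (cast h) a b x = x := by
  rw [FinInterval.cast_rfl, act_id]

theorem act_inv_act_hom {I J : FinInterval} (e : I ≅ J) (a b : X.base) (x : (X.quiver I).obj a b) :
    X.act e.hom a b (X.act e.inv a b x) = x := by
  rw [← act_comp, Iso.hom_inv_id, act_id]

/-- The bilinear multiplication `X_p(a, c) × X_q(c, b) → X_n(a, b)` for `p + q = n`. -/
noncomputable def mul (a c b : X.base) (p q n : ℕ) (h : p + q = n) :
    X.deg p a c →ₗ[k] X.deg q c b →ₗ[k] X.deg n a b :=
  (ModQuiver.tmul (X.quiver ⟨p⟩) (X.quiver ⟨q⟩) a c b).compr₂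
    (X.act (cast h.symm) a b ∘ₗ ((X.mult ⟨p⟩ ⟨q⟩).app a b).hom)

/-- The linear map `(X_p ⊗ X_q)(a, b) → X_n(a, b)` induced by the multiplication. -/
noncomputable def mulMap (a b : X.base) (p q n : ℕ) (h : p + q = n) :
    (ModQuiver.tensorObj (X.quiver ⟨p⟩) (X.quiver ⟨q⟩)).obj a b →ₗ[k] X.deg n a b :=
  X.act (cast h.symm) a b ∘ₗ ((X.mult ⟨p⟩ ⟨q⟩).app a b).hom

/-- The comultiplication `X_n(a, b) → (X_p ⊗ X_q)(a, b)` for `p + q = n`. -/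
noncomputable def comul (a b : X.base) (p q n : ℕ) (h : p + q = n) :
    X.deg n a b →ₗ[k] (ModQuiver.tensorObj (X.quiver ⟨p⟩) (X.quiver ⟨q⟩)).obj a b :=
  ((X.comult ⟨p⟩ ⟨q⟩).app a b).hom ∘ₗ X.act (cast h) a b

/-- The unit element of `X_0(a, a)`. -/
noncomputable def one (a : X.base) : X.deg 0 a a := (X.unit.app a a).hom (ModQuiver.one a)

/-- The simple tensor `x ⊗ y` in `(X_p ⊗ X_q)(a, b)`. -/
noncomputable abbrev tmul (a c b : X.base) (p q : ℕ) (x : X.deg p a c) (y : X.deg q c b) :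
    (ModQuiver.tensorObj (X.quiver ⟨p⟩) (X.quiver ⟨q⟩)).obj a b :=
  ModQuiver.tmul (X.quiver ⟨p⟩) (X.quiver ⟨q⟩) a c b x y

theorem mulMap_tmul (a c b : X.base) (p q n : ℕ) (h : p + q = n) (x : X.deg p a c)
    (y : X.deg q c b) : X.mulMap a b p q n h (X.tmul a c b p q x y) = X.mul a c b p q n h x y := rfl

theorem act_mul {a c b : X.base} {m n m₁ m₂ p q : ℕ} {f : (⟨m⟩ : FinInterval) ⟶ ⟨n⟩}
    {u : (⟨m₁⟩ : FinInterval) ⟶ ⟨p⟩} {v : (⟨m₂⟩ : FinInterval) ⟶ ⟨q⟩} (hf : IsSum f u v)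
    (x : X.deg p a c) (y : X.deg q c b) :
    X.act f a b (X.mul a c b p q n hf.target x y) =
      X.mul a c b m₁ m₂ m hf.source (X.act u a c x) (X.act v c b y) := by
  obtain ⟨rfl, rfl, h⟩ := hf
  obtain rfl := IsSum.eq_tensorHom (f := f) (u := u) (v := v) ⟨rfl, rfl, h⟩
  change X.act _ a b (X.act _ a b _) = X.act _ a b _
  rw [act_cast_rfl, act_cast_rfl]
  have h1 := Functor.LaxMonoidal.μ_natural X.functor u.op v.op
  have h2 := congrArg (fun t => (ModQuiver.Hom.app t a b).hom
    (X.tmul a c b p q x y)) h1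
  refine h2.symm.trans ?_
  exact congrArg ((X.mult ⟨m₁⟩ ⟨m₂⟩).app a b).hom (ModQuiver.tensorHom_tmul _ _ a c b x y)

/-- The map induced by two maps of intervals on a tensor product of quivers. -/
noncomputable def actTensor {m₁ m₂ p q : ℕ} (u : (⟨m₁⟩ : FinInterval) ⟶ ⟨p⟩)
    (v : (⟨m₂⟩ : FinInterval) ⟶ ⟨q⟩) (a b : X.base) :
    (ModQuiver.tensorObj (X.quiver ⟨p⟩) (X.quiver ⟨q⟩)).obj a b →ₗ[k]
      (ModQuiver.tensorObj (X.quiver ⟨m₁⟩) (X.quiver ⟨m₂⟩)).obj a b :=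
  ((ModQuiver.tensorHom (X.functor.map u.op) (X.functor.map v.op)).app a b).hom

theorem actTensor_tmul {m₁ m₂ p q : ℕ} (u : (⟨m₁⟩ : FinInterval) ⟶ ⟨p⟩)
    (v : (⟨m₂⟩ : FinInterval) ⟶ ⟨q⟩) (a c b : X.base) (x : X.deg p a c) (y : X.deg q c b) :
    X.actTensor u v a b (X.tmul a c b p q x y) =
      X.tmul a c b m₁ m₂ (X.act u a c x) (X.act v c b y) :=
  ModQuiver.tensorHom_tmul _ _ a c b x y

theorem comul_act {a b : X.base} {m n m₁ m₂ p q : ℕ} {f : (⟨m⟩ : FinInterval) ⟶ ⟨n⟩}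
    {u : (⟨m₁⟩ : FinInterval) ⟶ ⟨p⟩} {v : (⟨m₂⟩ : FinInterval) ⟶ ⟨q⟩} (hf : IsSum f u v)
    (x : X.deg n a b) :
    X.comul a b m₁ m₂ m hf.source (X.act f a b x) =
      X.actTensor u v a b (X.comul a b p q n hf.target x) := by
  obtain ⟨rfl, rfl, h⟩ := hf
  obtain rfl := IsSum.eq_tensorHom (f := f) (u := u) (v := v) ⟨rfl, rfl, h⟩
  change ((X.comult _ _).app a b).hom (X.act _ a b _) =
    X.actTensor u v a b (((X.comult _ _).app a b).hom (X.act _ a b _))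
  rw [act_cast_rfl, act_cast_rfl]
  have h1 := Functor.OplaxMonoidal.δ_natural X.functor u.op v.op
  exact (congrArg (fun t => (ModQuiver.Hom.app t a b).hom x) h1).symm

theorem mul_assoc {a b c d : X.base} {p q m r m' n : ℕ} (e : p + q = m)
    (e' : m + r = n) (e₂ : q + r = m') (e₂' : p + m' = n) (x : X.deg p a b)
    (y : X.deg q b c) (z : X.deg r c d) :
    X.mul a c d m r n e' (X.mul a b c p q m e x y) z =
      X.mul a b d p m' n e₂' x (X.mul b c d q r m' e₂ y z) := by
  subst e e₂ e'
  change X.act _ a d (((X.mult _ _).app a d).hom (ModQuiver.tmul _ _ a c d (X.act _ a c _) z)) =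
    X.act _ a d (((X.mult _ _).app a d).hom (ModQuiver.tmul _ _ a b d x (X.act _ b d _)))
  rw [act_cast_rfl, act_cast_rfl, act_cast_rfl]
  have h1 := Functor.LaxMonoidal.associativity X.functor (op ⟨p⟩) (op ⟨q⟩) (op ⟨r⟩)
  have h2 := congrArg (fun t => (ModQuiver.Hom.app t a d).hom
    (ModQuiver.tmul (ModQuiver.tensorObj (X.quiver ⟨p⟩) (X.quiver ⟨q⟩)) (X.quiver ⟨r⟩) a c d
      (X.tmul a b c p q x y) z)) h1
  refine (act_inv_act_hom X (α_ ⟨p⟩ ⟨q⟩ ⟨r⟩) a d _).symm.trans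
    (congrArg (X.act (α_ ⟨p⟩ ⟨q⟩ ⟨r⟩).hom a d) ?_)
  refine Eq.trans (congrArg (fun t => X.act (α_ ⟨p⟩ ⟨q⟩ ⟨r⟩).inv a d
    (((X.mult (⟨p⟩ ⊗ ⟨q⟩) ⟨r⟩).app a d).hom t)) (ModQuiver.tensorHom_tmul (X.mult ⟨p⟩ ⟨q⟩)
      (𝟙 (X.quiver ⟨r⟩)) a c d (X.tmul a b c p q x y) z).symm) (h2.trans ?_)
  exact congrArg ((X.mult ⟨p⟩ (⟨q⟩ ⊗ ⟨r⟩)).app a d).hom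
    ((congrArg ((ModQuiver.tensorHom (𝟙 (X.quiver ⟨p⟩)) (X.mult ⟨q⟩ ⟨r⟩)).app a d).hom
      (ModQuiver.assocHom_tmul (X.quiver ⟨p⟩) (X.quiver ⟨q⟩) (X.quiver ⟨r⟩) a b c d x y z)).trans
      (ModQuiver.tensorHom_tmul (𝟙 (X.quiver ⟨p⟩)) (X.mult ⟨q⟩ ⟨r⟩) a b d x _))

theorem one_mul {a b : X.base} {n : ℕ} (x : X.deg n a b) :
    X.mul a a b 0 n n (zero_add n) (X.one a) x = x := by
  have h1 := Functor.LaxMonoidal.left_unitality X.functor (op ⟨n⟩)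
  have h2 := congrArg (fun t => (ModQuiver.Hom.app t a b).hom
    (ModQuiver.tmul (ModQuiver.tensorUnit X.base k) (X.quiver ⟨n⟩) a a b (ModQuiver.one a) x)) h1
  have h3 := (ModQuiver.leftUnitorHom_tmul (X.quiver ⟨n⟩) a b x).symm.trans h2
  refine Eq.trans ?_ h3.symm
  exact congrArg (fun t => X.act (λ_ (⟨n⟩ : FinInterval)).inv a b
    (((X.mult ⟨0⟩ ⟨n⟩).app a b).hom t)) (ModQuiver.tensorHom_tmul X.unit (𝟙 (X.quiver ⟨n⟩)) a a b
      (ModQuiver.one a) x).symm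

theorem mul_one {a b : X.base} {n : ℕ} (x : X.deg n a b) :
    X.mul a b b n 0 n (add_zero n) x (X.one b) = x := by
  have h1 := Functor.LaxMonoidal.right_unitality X.functor (op ⟨n⟩)
  have h2 := congrArg (fun t => (ModQuiver.Hom.app t a b).hom
    (ModQuiver.tmul (X.quiver ⟨n⟩) (ModQuiver.tensorUnit X.base k) a b b x (ModQuiver.one b))) h1
  have h3 := (ModQuiver.rightUnitorHom_tmul (X.quiver ⟨n⟩) a b x).symm.trans h2
  refine Eq.trans ?_ h3.symm
  exact congrArg (fun t => X.act (ρ_ (⟨n⟩ : FinInterval)).inv a b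
    (((X.mult ⟨n⟩ ⟨0⟩).app a b).hom t)) (ModQuiver.tensorHom_tmul (𝟙 (X.quiver ⟨n⟩)) X.unit a b b
      x (ModQuiver.one b)).symm

/-- The map `x ⊗ x' ↦ x ⊗ (x' y)`. -/
noncomputable def mulRight (a c b : X.base) (p q r s : ℕ) (h : q + r = s) (y : X.deg r c b) :
    (ModQuiver.tensorObj (X.quiver ⟨p⟩) (X.quiver ⟨q⟩)).obj a c →ₗ[k]
      (ModQuiver.tensorObj (X.quiver ⟨p⟩) (X.quiver ⟨s⟩)).obj a b :=
  ModQuiver.tensorDesc fun d => (ModQuiver.tmul (X.quiver ⟨p⟩) (X.quiver ⟨s⟩) a d b).compl₂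
    ((X.mul d c b q r s h).flip y)

theorem mulRight_tmul {a c b d : X.base} {p q r s : ℕ} (h : q + r = s) (y : X.deg r c b)
    (x : X.deg p a d) (x' : X.deg q d c) :
    X.mulRight a c b p q r s h y (X.tmul a d c p q x x') =
      X.tmul a d b p s x (X.mul d c b q r s h x' y) :=
  ModQuiver.tensorDesc_tmul _ _ _ _

/-- The map `y' ⊗ y ↦ (x y') ⊗ y`. -/
noncomputable def mulLeft (a c b : X.base) (p q r s : ℕ) (h : p + q = s) (x : X.deg p a c) :
    (ModQuiver.tensorObj (X.quiver ⟨q⟩) (X.quiver ⟨r⟩)).obj c b →ₗ[k]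
      (ModQuiver.tensorObj (X.quiver ⟨s⟩) (X.quiver ⟨r⟩)).obj a b :=
  ModQuiver.tensorDesc fun d => (ModQuiver.tmul (X.quiver ⟨s⟩) (X.quiver ⟨r⟩) a d b) ∘ₗ
    X.mul a c d p q s h x

theorem mulLeft_tmul {a c b d : X.base} {p q r s : ℕ} (h : p + q = s) (x : X.deg p a c)
    (y' : X.deg q c d) (y : X.deg r d b) :
    X.mulLeft a c b p q r s h x (X.tmul c d b q r y' y) =
      X.tmul a d b s r (X.mul a c d p q s h x y') y :=
  ModQuiver.tensorDesc_tmul _ _ _ _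

/-- The first Frobenius relation for elements. -/
theorem comul_mul_right {a c b : X.base} {p q r m s n : ℕ} (e : p + q = m) (e' : m + r = n)
    (e₂ : q + r = s) (e₂' : p + s = n) (x : X.deg m a c) (y : X.deg r c b) :
    X.comul a b p s n e₂' (X.mul a c b m r n e' x y) =
      X.mulRight a c b p q r s e₂ y (X.comul a c p q m e x) := by
  subst e e₂ e'
  have h1 := FrobeniusMonoidal.frobenius_left (F := X.functor) (op ⟨p⟩) (op ⟨q⟩) (op ⟨r⟩)
  have h2 := congrArg (fun t => (ModQuiver.Hom.app t a b).hom
    (ModQuiver.tmul (X.quiver ⟨p + q⟩) (X.quiver ⟨r⟩) a c b x y)) h1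
  change ((X.comult _ _).app a b).hom (X.act _ a b (X.act _ a b _)) =
    X.mulRight a c b p q r (q + r) rfl y (((X.comult _ _).app a c).hom (X.act _ a c x))
  rw [act_cast_rfl, act_cast_rfl]
  refine h2.trans ?_
  refine (congrArg (fun t => ((ModQuiver.tensorHom (𝟙 (X.quiver ⟨p⟩)) (X.mult ⟨q⟩ ⟨r⟩)).app a b).hom
    (((ModQuiver.assocHom (X.quiver ⟨p⟩) (X.quiver ⟨q⟩) (X.quiver ⟨r⟩)).app a b).hom t))
    (ModQuiver.tensorHom_tmul (X.comult ⟨p⟩ ⟨q⟩) (𝟙 (X.quiver ⟨r⟩)) a c b x y)).trans ?_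
  refine LinearMap.congr_fun
    (f := ((ModQuiver.tensorHom (𝟙 (X.quiver ⟨p⟩)) (X.mult ⟨q⟩ ⟨r⟩)).app a b).hom ∘ₗ
      ((ModQuiver.assocHom (X.quiver ⟨p⟩) (X.quiver ⟨q⟩) (X.quiver ⟨r⟩)).app a b).hom ∘ₗ
      (ModQuiver.tmul (ModQuiver.tensorObj (X.quiver ⟨p⟩) (X.quiver ⟨q⟩))
        (X.quiver ⟨r⟩) a c b).flip y)
    (ModQuiver.tensor_ext fun d u v => ?_) (((X.comult ⟨p⟩ ⟨q⟩).app a c).hom x)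
  rw [mulRight_tmul]
  refine (congrArg ((ModQuiver.tensorHom (𝟙 (X.quiver ⟨p⟩)) (X.mult ⟨q⟩ ⟨r⟩)).app a b).hom
    (ModQuiver.assocHom_tmul (X.quiver ⟨p⟩) (X.quiver ⟨q⟩) (X.quiver ⟨r⟩) a d c b u v y)).trans ?_
  refine (ModQuiver.tensorHom_tmul (𝟙 (X.quiver ⟨p⟩)) (X.mult ⟨q⟩ ⟨r⟩) a d b u _).trans ?_
  exact congrArg (X.tmul a d b p (q + r) u) (X.act_cast_rfl _ d b _).symm

/-- The second Frobenius relation for elements. -/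
theorem comul_mul_left {a c b : X.base} {p q r m s n : ℕ} (e : q + r = m) (e' : p + m = n)
    (e₂ : p + q = s) (e₂' : s + r = n) (x : X.deg p a c) (y : X.deg m c b) :
    X.comul a b s r n e₂' (X.mul a c b p m n e' x y) =
      X.mulLeft a c b p q r s e₂ x (X.comul c b q r m e y) := by
  subst e e₂ e₂'
  have h1 := FrobeniusMonoidal.frobenius_right (F := X.functor) (op ⟨p⟩) (op ⟨q⟩) (op ⟨r⟩)
  have h2 := congrArg (fun t => (ModQuiver.Hom.app t a b).hom
    (ModQuiver.tmul (X.quiver ⟨p⟩) (X.quiver ⟨q + r⟩) a c b x y)) h1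
  change ((X.comult _ _).app a b).hom (X.act _ a b (X.act _ a b _)) =
    X.mulLeft a c b p q r (p + q) rfl x (((X.comult _ _).app c b).hom (X.act _ c b y))
  rw [act_cast_rfl, act_cast_rfl]
  refine h2.trans ?_
  refine (congrArg (fun t => ((ModQuiver.tensorHom (X.mult ⟨p⟩ ⟨q⟩) (𝟙 (X.quiver ⟨r⟩))).app a b).hom
    (((ModQuiver.assocInv (X.quiver ⟨p⟩) (X.quiver ⟨q⟩) (X.quiver ⟨r⟩)).app a b).hom t))
    (ModQuiver.tensorHom_tmul (𝟙 (X.quiver ⟨p⟩)) (X.comult ⟨q⟩ ⟨r⟩) a c b x y)).trans ?_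
  refine LinearMap.congr_fun
    (f := ((ModQuiver.tensorHom (X.mult ⟨p⟩ ⟨q⟩) (𝟙 (X.quiver ⟨r⟩))).app a b).hom ∘ₗ
      ((ModQuiver.assocInv (X.quiver ⟨p⟩) (X.quiver ⟨q⟩) (X.quiver ⟨r⟩)).app a b).hom ∘ₗ
      (ModQuiver.tmul (X.quiver ⟨p⟩) (ModQuiver.tensorObj (X.quiver ⟨q⟩) (X.quiver ⟨r⟩)) a c b) x)
    (ModQuiver.tensor_ext fun d u v => ?_) (((X.comult ⟨q⟩ ⟨r⟩).app c b).hom y)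
  rw [mulLeft_tmul]
  refine (congrArg ((ModQuiver.tensorHom (X.mult ⟨p⟩ ⟨q⟩) (𝟙 (X.quiver ⟨r⟩))).app a b).hom
    (ModQuiver.assocInv_tmul (X.quiver ⟨p⟩) (X.quiver ⟨q⟩) (X.quiver ⟨r⟩) a c d b x u v)).trans ?_
  refine (ModQuiver.tensorHom_tmul (X.mult ⟨p⟩ ⟨q⟩) (𝟙 (X.quiver ⟨r⟩)) a d b _ v).trans ?_
  exact congrArg (fun t => X.tmul a d b (p + q) r t v) (X.act_cast_rfl _ a d _).symm

theorem one_counit (a b : X.base) (x : X.deg 0 a b) :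
    (X.unit.app a b).hom ((X.counit.app a b).hom x) = x :=
  congrArg (fun t => (ModQuiver.Hom.app t a b).hom x)
    (FrobeniusMonoidal.counit_unit (F := X.functor))

theorem counit_one (a : X.base) : (X.counit.app a a).hom (X.one a) = ModQuiver.one a :=
  congrArg (fun t => (ModQuiver.Hom.app t a a).hom (ModQuiver.one a))
    (FrobeniusMonoidal.unit_counit (F := X.functor))

/-- The counit on the second tensor factor is inverted by the unit. -/
theorem comul_zero_right {a b : X.base} {n : ℕ} (x : X.deg n a b) :
    X.comul a b n 0 n (add_zero n) x = X.tmul a b b n 0 x (X.one b) := by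
  have h1 := Functor.OplaxMonoidal.right_unitality X.functor (op ⟨n⟩)
  have h2 := congrArg (fun t => ((ModQuiver.tensorHom (𝟙 (X.quiver ⟨n⟩)) X.unit).app a b).hom
    ((ModQuiver.Hom.app t a b).hom x)) h1
  have h3 : ModQuiver.tensorHom (𝟙 (X.quiver ⟨n⟩)) X.counit ≫
      ModQuiver.tensorHom (𝟙 (X.quiver ⟨n⟩)) X.unit = 𝟙 _ := by
    rw [← ModQuiver.tensorHom_comp, Category.comp_id]
    exact (congrArg (ModQuiver.tensorHom (𝟙 (X.quiver ⟨n⟩)))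
      (FrobeniusMonoidal.counit_unit (F := X.functor))).trans (ModQuiver.tensorHom_id _ _)
  have h4 := congrArg (fun t => (ModQuiver.Hom.app t a b).hom (X.comul a b n 0 n (add_zero n) x)) h3
  refine h4.symm.trans (h2.symm.trans ?_)
  exact ModQuiver.tensorHom_tmul (𝟙 (X.quiver ⟨n⟩)) X.unit a b b x (ModQuiver.one b)

/-- The comultiplication is a retraction of the multiplication. -/
theorem comul_mul {a c b : X.base} {p q n : ℕ} (h : p + q = n) (x : X.deg p a c)
    (y : X.deg q c b) :
    X.comul a b p q n h (X.mul a c b p q n h x y) = X.tmul a c b p q x y := by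
  rw [X.comul_mul_right (add_zero p) h (zero_add q) h, comul_zero_right, mulRight_tmul, one_mul]

theorem comul_mulMap {a b : X.base} {p q n : ℕ} (h : p + q = n)
    (ξ : (ModQuiver.tensorObj (X.quiver ⟨p⟩) (X.quiver ⟨q⟩)).obj a b) :
    X.comul a b p q n h (X.mulMap a b p q n h ξ) = ξ :=
  LinearMap.congr_fun (f := X.comul a b p q n h ∘ₗ X.mulMap a b p q n h) (g := LinearMap.id)
    (ModQuiver.tensor_ext fun _ x y => X.comul_mul h x y) ξ

end FTemplicialModule

/-! ### Joint kernels of the comultiplications -/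

/-- The map of intervals underlying a map of narrow simplices. -/
def NarrowSimplex.interval {p q : ℕ} (u : (⟨p⟩ : NarrowSimplex) ⟶ ⟨q⟩) :
    (⟨p + 1⟩ : FinInterval) ⟶ ⟨q + 1⟩ :=
  u.toInterval

theorem NarrowSimplex.nat_interval {p q : ℕ} (u : (⟨p⟩ : NarrowSimplex) ⟶ ⟨q⟩) (i : ℕ) :
    FinInterval.Hom.nat (NarrowSimplex.interval u) i = NarrowSimplex.Hom.nat u i := rfl

namespace FTemplicialModule

open FinInterval

variable {k : Type u} [CommRing k] (X : FTemplicialModule k)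

theorem mem_kernel {n : ℕ} {a b : X.base} {x : X.deg n a b} :
    x ∈ X.kernel ⟨n⟩ a b ↔
      ∀ p q, 0 < p → 0 < q → ∀ h : p + q = n, X.comul a b p q n h x = 0 := by
  simp only [kernel, Submodule.mem_iInf, LinearMap.mem_ker]
  exact ⟨fun H p q hp hq h => H ⟨p⟩ ⟨q⟩ hp hq h, fun H I J hI hJ h => H I.len J.len hI hJ h⟩

/-- Joint kernels are preserved by maps that send no inner vertex to an endpoint. -/
theorem act_mem_kernel {m n : ℕ} {a b : X.base} (f : (⟨m⟩ : FinInterval) ⟶ ⟨n⟩)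
    (hf : ∀ i, 0 < i → i < m → 0 < Hom.nat f i ∧ Hom.nat f i < n) {x : X.deg n a b}
    (hx : x ∈ X.kernel ⟨n⟩ a b) : X.act f a b x ∈ X.kernel ⟨m⟩ a b := by
  rw [mem_kernel] at hx ⊢
  intro p q hp hq h
  obtain ⟨r, u, v, hs⟩ := exists_isSum f h
  have h1 := hf p hp (by lia)
  have h2 := hs.target
  rw [X.comul_act hs, hx _ _ h1.1 (by lia), map_zero]

/-- The bilinear map underlying `glue`. -/
noncomputable def glueMap (a b c : X.base) (p q : ℕ) :
    X.deg (p + 1) a b →ₗ[k] X.deg (q + 1) b c →ₗ[k] X.deg (p + q + 1) a c :=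
  (X.mul a b c (p + 1) (q + 1) (p + 1 + (q + 1)) rfl).compr₂ (X.act (glueCoface p q) a c)

theorem glue_eq_glueMap {a b c : X.base} {p q : ℕ} (x : X.deg (p + 1) a b)
    (y : X.deg (q + 1) b c) : X.glue a b c p q x y = X.glueMap a b c p q x y :=
  congrArg (X.act (glueCoface p q) a c) (X.act_cast_rfl _ a c _).symm

theorem glueMap_apply {a b c : X.base} {p q : ℕ} (x : X.deg (p + 1) a b) (y : X.deg (q + 1) b c) :
    X.glueMap a b c p q x y = X.act (glueCoface p q) a c
      (X.mul a b c (p + 1) (q + 1) (p + 1 + (q + 1)) rfl x y) := rfl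

theorem nat_glueCoface (p q : ℕ) {i : ℕ} (h : i ≤ p + q + 1) :
    Hom.nat (glueCoface p q) i = if i ≤ p then i else i + 1 :=
  nat_homMk _ _ _ _ h

theorem nat_codegeneracyZero {i : ℕ} : Hom.nat codegeneracyZero i = 0 :=
  Nat.le_zero.1 (Hom.nat_le codegeneracyZero i)

/-- By the Frobenius relations, the comultiplications of a product of elements of joint kernels
vanish except at the vertex where the factors meet, which gluing omits. -/
theorem glueMap_mem_kernel {a b c : X.base} {p q : ℕ} {x : X.deg (p + 1) a b}
    (hx : x ∈ X.kernel ⟨p + 1⟩ a b) {y : X.deg (q + 1) b c} (hy : y ∈ X.kernel ⟨q + 1⟩ b c) :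
    X.glueMap a b c p q x y ∈ X.kernel ⟨p + q + 1⟩ a c := by
  rw [mem_kernel] at hx hy ⊢
  intro r s hr hs h
  obtain ⟨t, u, v, hsum⟩ := exists_isSum (glueCoface p q) h
  have h2 : Hom.nat (glueCoface p q) r + t = p + 1 + (q + 1) := hsum.target
  have h1 := nat_glueCoface p q (i := r) (by lia)
  rw [glueMap_apply]
  refine (X.comul_act hsum _).trans ?_
  -- the cut vertex differs from the vertex at which `x` and `y` are glued
  rw [show X.comul a c (Hom.nat (glueCoface p q) r) t _ h2
    (X.mul a b c (p + 1) (q + 1) (p + 1 + (q + 1)) rfl x y) = 0 from ?_, map_zero]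
  split_ifs at h1 with h3
  · rw [X.comul_mul_right (q := p + 1 - r) (by lia) rfl (by lia), hx _ _ (by lia) (by lia),
      map_zero]
  · rw [X.comul_mul_left (q := Hom.nat (glueCoface p q) r - (p + 1)) (by lia) rfl (by lia),
      hy _ _ (by lia) (by lia), map_zero]

theorem degenerateEdge_mem_kernel (a : X.base) : X.degenerateEdge a ∈ X.kernel ⟨1⟩ a a :=
  (X.mem_kernel (n := 1)).2 fun p q hp hq h => by lia

theorem glueMap_act {a b c : X.base} {p q p' q' : ℕ} (u : (⟨p⟩ : NarrowSimplex) ⟶ ⟨p'⟩)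
    (v : (⟨q⟩ : NarrowSimplex) ⟶ ⟨q'⟩) (x : X.deg (p' + 1) a b) (y : X.deg (q' + 1) b c) :
    X.glueMap a b c p q (X.act (NarrowSimplex.interval u) a b x)
        (X.act (NarrowSimplex.interval v) b c y) =
      X.act (NarrowSimplex.interval (NarrowSimplex.join u v)) a c (X.glueMap a b c p' q' x y) := by
  have hs : IsSum (sum rfl rfl (NarrowSimplex.interval u) (NarrowSimplex.interval v))
    (NarrowSimplex.interval u) (NarrowSimplex.interval v) :=
    isSum_sum (m := p + 1 + (q + 1)) (n := p' + 1 + (q' + 1)) rfl rfl _ _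
  rw [glueMap_apply, glueMap_apply]
  refine (congrArg (X.act (glueCoface p q) a c) (X.act_mul hs x y).symm).trans ?_
  rw [← X.act_comp]
  refine Eq.trans ?_ (X.act_comp _ _ a c _)
  refine congrArg (fun t => X.act t a c _) (hom_ext_nat fun i hi => ?_)
  have hi : i ≤ p + q + 1 := hi
  have h1 := NarrowSimplex.nat_join u v hi
  have h3 : NarrowSimplex.Hom.nat (NarrowSimplex.join u v) i ≤ p' + q' + 1 := Hom.nat_le _ i
  rw [Hom.nat_comp, Hom.nat_comp, nat_glueCoface p q hi]
  refine Eq.trans ?_ (nat_glueCoface p' q' h3).symm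
  rw [h1, hs.nat_eq _ (by split_ifs <;> lia)]
  split_ifs with h4 h5 h6 h7 h8 h9 h10 <;> try lia
  · rfl
  · have := NarrowSimplex.Hom.nat_lt u (i := i) (by lia)
    lia
  · have := NarrowSimplex.Hom.nat_pos v (i := i - p) (by lia)
    lia
  · rw [show i + 1 - (p + 1) = i - p by lia]
    change p' + 1 + NarrowSimplex.Hom.nat v (i - p) = _
    lia

theorem glueMap_assoc {a b c d : X.base} {p q r : ℕ} (x : X.deg (p + 1) a b)
    (y : X.deg (q + 1) b c) (z : X.deg (r + 1) c d) :
    X.act (NarrowSimplex.interval (NarrowSimplex.cast (Nat.add_assoc p q r))) a d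
      (X.glueMap a b d p (q + r) x (X.glueMap b c d q r y z)) =
        X.glueMap a c d (p + q) r (X.glueMap a b c p q x y) z := by
  have hs1 : IsSum (sum (m := p + 1 + (q + r + 1)) (n := p + 1 + (q + 1 + (r + 1))) rfl rfl
    (𝟙 (⟨p + 1⟩ : FinInterval)) (glueCoface q r)) (𝟙 (⟨p + 1⟩ : FinInterval)) (glueCoface q r) :=
      isSum_sum _ _ _ _
  have hs2 : IsSum (sum (m := p + q + 1 + (r + 1)) (n := p + 1 + (q + 1 + (r + 1)))
    rfl (Nat.add_assoc _ _ _) (glueCoface p q)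
    (𝟙 (⟨r + 1⟩ : FinInterval))) (glueCoface p q) (𝟙 (⟨r + 1⟩ : FinInterval)) := isSum_sum _ _ _ _
  have e1 := X.act_mul hs1 x (X.mul b c d (q + 1) (r + 1) _ rfl y z)
  have e2 := X.act_mul hs2 (X.mul a b c (p + 1) (q + 1) _ rfl x y) z
  rw [X.act_id] at e1 e2
  rw [X.glueMap_apply, X.glueMap_apply, X.glueMap_apply, X.glueMap_apply]
  refine (congrArg (fun t => X.act _ a d (X.act (glueCoface p (q + r)) a d t)) e1.symm).trans ?_
  refine Eq.trans ?_ (congrArg (X.act (glueCoface (p + q) r) a d) e2)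
  rw [← X.act_comp, ← X.act_comp]
  refine Eq.trans ?_ (X.act_comp _ _ a d _)
  rw [X.mul_assoc rfl (Nat.add_assoc _ _ _) rfl rfl]
  refine congrArg (fun t => X.act t a d _) (hom_ext_nat fun i hi => ?_)
  have hi : i ≤ p + q + r + 1 := hi
  have h1 : Hom.nat (NarrowSimplex.interval (NarrowSimplex.cast (Nat.add_assoc p q r))) i = i :=
    NarrowSimplex.nat_cast _ hi
  rw [Hom.nat_comp, Hom.nat_comp, Hom.nat_comp, h1, nat_glueCoface (p + q) r hi]
  rw [nat_glueCoface p (q + r) (by lia), hs1.nat_eq _ (by split_ifs <;> lia),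
    hs2.nat_eq _ (by split_ifs <;> lia)]
  by_cases h2 : i ≤ p
  · rw [if_pos h2, if_pos (by lia), if_pos (by lia), if_pos (by lia),
      nat_glueCoface p q (by lia), if_pos h2, Hom.nat_id _ (by dsimp only; lia)]
  · rw [if_neg h2, if_neg (by lia), nat_glueCoface q r (by lia)]
    by_cases h3 : i ≤ p + q
    · rw [if_pos (by lia), if_pos h3, if_pos (by lia), nat_glueCoface p q (by lia), if_neg h2]
      lia
    · rw [if_neg (by lia), if_neg h3, if_neg (by lia), Hom.nat_id _ (by dsimp only; lia)]
      lia

theorem glueMap_degenerateEdge_left {a b : X.base} {p : ℕ} (x : X.deg (p + 1) a b) :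
    X.glueMap a a b 0 p (X.degenerateEdge a) x =
      X.act (NarrowSimplex.interval (NarrowSimplex.cast (Nat.zero_add p))) a b x := by
  have hs : IsSum (sum (m := 0 + 1 + (p + 1)) (n := p + 1) rfl (zero_add _)
    (show (⟨1⟩ : FinInterval) ⟶ ⟨0⟩ from codegeneracyZero) (𝟙 (⟨p + 1⟩ : FinInterval)))
    (show (⟨1⟩ : FinInterval) ⟶ ⟨0⟩ from codegeneracyZero) (𝟙 (⟨p + 1⟩ : FinInterval)) :=
      isSum_sum _ _ _ _
  have e := X.act_mul hs (X.one a) x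
  rw [X.act_id, X.one_mul] at e
  refine (congrArg (X.act (glueCoface 0 p) a b) e.symm).trans ?_
  rw [← X.act_comp]
  refine congrArg (fun t => X.act t a b _) (hom_ext_nat fun i hi => ?_)
  have hi : i ≤ 0 + p + 1 := hi
  refine Eq.trans ?_ (NarrowSimplex.nat_cast (Nat.zero_add p) hi).symm
  rw [Hom.nat_comp, nat_glueCoface 0 p hi, hs.nat_eq _ (by split_ifs <;> lia)]
  by_cases h : i ≤ 0
  · rw [if_pos h, if_pos (by lia)]
    obtain rfl : i = 0 := by lia
    exact Hom.nat_zero _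
  · rw [if_neg h, if_neg (by lia), Hom.nat_id _ (by dsimp only; lia)]
    lia

theorem glueMap_degenerateEdge_right {a b : X.base} {p : ℕ} (x : X.deg (p + 1) a b) :
    X.glueMap a b b p 0 x (X.degenerateEdge b) =
      X.act (NarrowSimplex.interval (NarrowSimplex.cast (Nat.add_zero p))) a b x := by
  have hs : IsSum (sum (m := p + 1 + (0 + 1)) (n := p + 1) rfl (add_zero _)
    (𝟙 (⟨p + 1⟩ : FinInterval))
    (show (⟨1⟩ : FinInterval) ⟶ ⟨0⟩ from codegeneracyZero))
    (𝟙 (⟨p + 1⟩ : FinInterval)) (show (⟨1⟩ : FinInterval) ⟶ ⟨0⟩ from codegeneracyZero) :=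
      isSum_sum _ _ _ _
  have e := X.act_mul hs x (X.one b)
  rw [X.act_id, X.mul_one] at e
  refine (congrArg (X.act (glueCoface p 0) a b) e.symm).trans ?_
  rw [← X.act_comp]
  refine congrArg (fun t => X.act t a b _) (hom_ext_nat fun i hi => ?_)
  have hi : i ≤ p + 0 + 1 := hi
  refine Eq.trans ?_ (NarrowSimplex.nat_cast (Nat.add_zero p) hi).symm
  rw [Hom.nat_comp, nat_glueCoface p 0 hi, hs.nat_eq _ (by split_ifs <;> lia)]
  by_cases h : i ≤ p
  · rw [if_pos h, if_pos (by lia), Hom.nat_id _ (by dsimp only; lia)]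
  · rw [if_neg h, if_neg (by lia)]
    refine (congrArg (p + 1 + ·) (nat_codegeneracyZero (i := i + 1 - (p + 1)))).trans ?_
    lia

end FTemplicialModule

/-! ### Morphisms and the functor of joint kernels -/

namespace FTemplicialModule

open FinInterval

variable {k : Type u} [CommRing k] {X Y W : FTemplicialModule k}

namespace Hom

/-- The action of a morphism on `n`-simplices. -/
noncomputable def onDeg (F : X ⟶ Y) (n : ℕ) (a b : X.base) :
    X.deg n a b →ₗ[k] Y.deg n (F.base a) (F.base b) :=
  ((F.app ⟨n⟩).app a b).hom

theorem onDeg_act (F : X ⟶ Y) {m n : ℕ} (f : (⟨m⟩ : FinInterval) ⟶ ⟨n⟩) (a b : X.base)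
    (x : X.deg n a b) :
    onDeg F m a b (X.act f a b x) = Y.act f (F.base a) (F.base b) (onDeg F n a b x) :=
  congrArg (fun t => (ModQuiver.Hom.app t a b).hom x) (F.naturality f)

theorem onDeg_one (F : X ⟶ Y) (a : X.base) :
    onDeg F 0 a a (X.one a) = Y.one (F.base a) := by
  have h := congrArg (fun t => (ModQuiver.Hom.app t a a).hom (ModQuiver.one a)) F.map_unit
  exact h.trans (congrArg (Y.unit.app (F.base a) (F.base a)).hom
    (ModQuiver.pullUnit_one F.base a))

theorem onDeg_mul (F : X ⟶ Y) (a c b : X.base) (p q n : ℕ) (h : p + q = n) (x : X.deg p a c)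
    (y : X.deg q c b) :
    onDeg F n a b (X.mul a c b p q n h x y) =
      Y.mul (F.base a) (F.base c) (F.base b) p q n h (onDeg F p a c x) (onDeg F q c b y) := by
  subst h
  have h := congrArg (fun t => (ModQuiver.Hom.app t a b).hom (X.tmul a c b p q x y))
    (F.map_mult ⟨p⟩ ⟨q⟩)
  refine (onDeg_act F _ a b _).trans ?_
  refine congrArg (Y.act (FinInterval.cast rfl) (F.base a) (F.base b)) (h.trans ?_)
  refine congrArg ((Y.mult ⟨p⟩ ⟨q⟩).app (F.base a) (F.base b)).hom ?_
  refine (congrArg ((ModQuiver.pullTensor F.base (Y.quiver ⟨p⟩) (Y.quiver ⟨q⟩)).app a b).hom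
    (ModQuiver.tensorHom_tmul (F.app ⟨p⟩) (F.app ⟨q⟩) a c b x y)).trans ?_
  exact ModQuiver.pullTensor_tmul F.base (Y.quiver ⟨p⟩) (Y.quiver ⟨q⟩) a c b _ _

end Hom

/-- The map on tensor products of quivers given by a map `f` of the bases and maps of modules over
it. -/
noncomputable def tensorMap {f : X.base → Y.base}
    (φ : ∀ n a b, X.deg n a b →ₗ[k] Y.deg n (f a) (f b)) (p q : ℕ) (a b : X.base) :
    (ModQuiver.tensorObj (X.quiver ⟨p⟩) (X.quiver ⟨q⟩)).obj a b →ₗ[k]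
      (ModQuiver.tensorObj (Y.quiver ⟨p⟩) (Y.quiver ⟨q⟩)).obj (f a) (f b) :=
  ModQuiver.tensorDesc (Q := X.quiver ⟨p⟩) (P := X.quiver ⟨q⟩) (a := a) (b := b)
    fun c => (ModQuiver.tmul (Y.quiver ⟨p⟩) (Y.quiver ⟨q⟩) (f a) (f c) (f b)).compl₁₂
      (φ p a c) (φ q c b)

theorem tensorMap_tmul {f : X.base → Y.base}
    (φ : ∀ n a b, X.deg n a b →ₗ[k] Y.deg n (f a) (f b)) (p q : ℕ) (a c b : X.base)
    (x : X.deg p a c) (y : X.deg q c b) :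
    tensorMap φ p q a b (X.tmul a c b p q x y) =
      Y.tmul (f a) (f c) (f b) p q (φ p a c x) (φ q c b y) :=
  ModQuiver.tensorDesc_tmul (Q := X.quiver ⟨p⟩) (P := X.quiver ⟨q⟩) (a := a) (b := b) _ c x y

namespace Hom

theorem comul_onDeg (F : X ⟶ Y) (a b : X.base) (p q n : ℕ) (h : p + q = n) (x : X.deg n a b) :
    Y.comul (F.base a) (F.base b) p q n h (onDeg F n a b x) =
      tensorMap (onDeg F) p q a b (X.comul a b p q n h x) := by
  have h1 := congrArg (fun t => (ModQuiver.Hom.app t a b).hom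
    (X.act (FinInterval.cast h) a b x)) (F.map_comult ⟨p⟩ ⟨q⟩)
  refine (congrArg ((Y.comult ⟨p⟩ ⟨q⟩).app (F.base a) (F.base b)).hom
    (onDeg_act F (FinInterval.cast h) a b x)).symm.trans (h1.symm.trans ?_)
  refine LinearMap.congr_fun (f := ((ModQuiver.pullTensor F.base (Y.quiver ⟨p⟩)
    (Y.quiver ⟨q⟩)).app a b).hom ∘ₗ ((ModQuiver.tensorHom (F.app ⟨p⟩) (F.app ⟨q⟩)).app a b).hom)
    (g := tensorMap (onDeg F) p q a b) (ModQuiver.tensor_ext fun c y z => ?_) _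
  refine Eq.trans ?_ (tensorMap_tmul (onDeg F) p q a c b y z).symm
  refine (congrArg ((ModQuiver.pullTensor F.base (Y.quiver ⟨p⟩) (Y.quiver ⟨q⟩)).app a b).hom
    (ModQuiver.tensorHom_tmul (F.app ⟨p⟩) (F.app ⟨q⟩) a c b y z)).trans ?_
  exact ModQuiver.pullTensor_tmul F.base (Y.quiver ⟨p⟩) (Y.quiver ⟨q⟩) a c b _ _

/-- Construct a morphism of Frobenius templicial modules from maps in the single degrees. -/
noncomputable def ofDeg (f : X.base → Y.base)
    (φ : ∀ n a b, X.deg n a b →ₗ[k] Y.deg n (f a) (f b))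
    (act : ∀ {m n : ℕ} (g : (⟨m⟩ : FinInterval) ⟶ ⟨n⟩) a b (x : X.deg n a b),
      φ m a b (X.act g a b x) = Y.act g (f a) (f b) (φ n a b x))
    (one : ∀ a, φ 0 a a (X.one a) = Y.one (f a))
    (mul : ∀ a c b p q (x : X.deg p a c) (y : X.deg q c b),
      φ (p + q) a b (X.mul a c b p q (p + q) rfl x y) =
        Y.mul (f a) (f c) (f b) p q (p + q) rfl (φ p a c x) (φ q c b y))
    (comul : ∀ a b p q (x : X.deg (p + q) a b),
      Y.comul (f a) (f b) p q (p + q) rfl (φ (p + q) a b x) =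
        tensorMap φ p q a b (X.comul a b p q (p + q) rfl x)) : X ⟶ Y where
  base := f
  app I := ⟨fun a b => ModuleCat.ofHom (φ I.len a b)⟩
  naturality g := ModQuiver.hom_ext' fun a b => LinearMap.ext fun x => act g a b x
  map_unit := ModQuiver.hom_ext' fun a b => ModQuiver.unit_ext fun e => by
    subst e
    exact (one a).trans (congrArg (Y.unit.app (f a) (f a)).hom (ModQuiver.pullUnit_one f a)).symm
  map_counit := by
    -- the counits are inverse to the units, with which `φ` is compatible
    have h1 : X.unit ≫ X.counit = 𝟙 _ := FrobeniusMonoidal.unit_counit (F := X.functor)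
    have h2 : X.counit ≫ X.unit = 𝟙 _ := FrobeniusMonoidal.counit_unit (F := X.functor)
    refine ModQuiver.hom_ext' fun a b => LinearMap.ext fun x => ?_
    obtain ⟨y, rfl⟩ : ∃ y, (X.unit.app a b).hom y = x :=
      ⟨(X.counit.app a b).hom x, X.one_counit a b x⟩
    refine LinearMap.congr_fun (f := ((ModQuiver.pullUnit k f).app a b).hom ∘ₗ
      (X.counit.app a b).hom ∘ₗ (X.unit.app a b).hom) (g := (Y.counit.app (f a) (f b)).hom ∘ₗ
      φ 0 a b ∘ₗ (X.unit.app a b).hom) (ModQuiver.unit_ext fun e => ?_) y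
    subst e
    refine (congrArg ((ModQuiver.pullUnit k f).app a a).hom (X.counit_one a)).trans ?_
    refine (ModQuiver.pullUnit_one f a).trans ?_
    exact ((congrArg (Y.counit.app (f a) (f a)).hom (one a)).trans (Y.counit_one (f a))).symm
  map_mult I J := ModQuiver.hom_ext' fun a b => ModQuiver.tensor_ext fun c x y => by
    have h := mul a c b I.len J.len x y
    have h1 : φ (I.len + J.len) a b (((X.mult I J).app a b).hom
        (X.tmul a c b I.len J.len x y)) = ((Y.mult I J).app (f a) (f b)).hom
        (Y.tmul (f a) (f c) (f b) I.len J.len (φ _ a c x) (φ _ c b y)) :=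
      (congrArg (φ (I.len + J.len) a b) (X.act_cast_rfl rfl a b _)).symm.trans
        (h.trans (Y.act_cast_rfl rfl (f a) (f b) _))
    refine h1.trans (congrArg ((Y.mult I J).app (f a) (f b)).hom ?_)
    refine Eq.trans ?_ (congrArg ((ModQuiver.pullTensor f (Y.quiver I) (Y.quiver J)).app a b).hom
      (ModQuiver.tensorHom_tmul (P' := ModQuiver.pullObj f (Y.quiver J))
        (Q' := ModQuiver.pullObj f (Y.quiver I)) _ _ a c b x y)).symm
    exact (ModQuiver.pullTensor_tmul f (Y.quiver I) (Y.quiver J) a c b _ _).symm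
  map_comult I J := ModQuiver.hom_ext' fun a b => LinearMap.ext fun x => by
    have h := comul a b I.len J.len x
    have h1 : ((Y.comult I J).app (f a) (f b)).hom (φ (I.len + J.len) a b x) =
        tensorMap φ I.len J.len a b (((X.comult I J).app a b).hom x) :=
      (congrArg ((Y.comult I J).app (f a) (f b)).hom
        (Y.act_cast_rfl rfl (f a) (f b) (φ (I.len + J.len) a b x))).symm.trans
        (h.trans (congrArg (fun t => tensorMap φ I.len J.len a b (((X.comult I J).app a b).hom t))
          (X.act_cast_rfl rfl a b x)))
    refine Eq.trans ?_ h1.symm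
    refine LinearMap.congr_fun (f := ((ModQuiver.pullTensor f (Y.quiver I) (Y.quiver J)).app
      a b).hom
      ∘ₗ ((ModQuiver.tensorHom (P' := ModQuiver.pullObj f (Y.quiver J))
        (Q' := ModQuiver.pullObj f (Y.quiver I)) _ _).app a b).hom)
      (g := tensorMap φ I.len J.len a b) (ModQuiver.tensor_ext fun c y z => ?_) _
    refine Eq.trans ?_ (tensorMap_tmul φ I.len J.len a c b y z).symm
    refine (congrArg ((ModQuiver.pullTensor f (Y.quiver I) (Y.quiver J)).app a b).hom
      (ModQuiver.tensorHom_tmul (P' := ModQuiver.pullObj f (Y.quiver J))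
        (Q' := ModQuiver.pullObj f (Y.quiver I)) _ _ a c b y z)).trans ?_
    exact ModQuiver.pullTensor_tmul f (Y.quiver I) (Y.quiver J) a c b _ _

theorem ext_onDeg {F G : X ⟶ Y} (h : ∀ a, F.base a = G.base a)
    (h' : ∀ n a b x, HEq (onDeg F n a b x) (onDeg G n a b x)) : F = G := by
  obtain ⟨f, α, h1, h2, h3, h4, h5⟩ : Hom X Y := F
  obtain ⟨g, β, h1', h2', h3', h4', h5'⟩ : Hom X Y := G
  obtain rfl : f = g := funext h
  exact ext_app fun I a b => ModuleCat.hom_ext (LinearMap.ext fun x =>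
    eq_of_heq (h' I.len a b x))

theorem mem_kernel_onDeg (F : X ⟶ Y) {n : ℕ} {a b : X.base} {x : X.deg n a b}
    (hx : x ∈ X.kernel ⟨n⟩ a b) :
    onDeg F n a b x ∈ Y.kernel ⟨n⟩ (F.base a) (F.base b) := by
  rw [mem_kernel] at hx ⊢
  intro p q hp hq h
  rw [comul_onDeg, hx p q hp hq h, map_zero]

end Hom

variable (X)

theorem act_interval_mem_kernel {m n : ℕ} {a b : X.base} (f : (⟨m⟩ : NarrowSimplex) ⟶ ⟨n⟩)
    {x : X.deg (n + 1) a b} (hx : x ∈ X.kernel ⟨n + 1⟩ a b) :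
    X.act (NarrowSimplex.interval f) a b x ∈ X.kernel ⟨m + 1⟩ a b :=
  X.act_mem_kernel _ (fun _ h h' => ⟨NarrowSimplex.Hom.nat_pos f h, NarrowSimplex.Hom.nat_lt f h'⟩)
    hx

/-- The narrow simplicial module formed by the joint kernels of the comultiplications. -/
noncomputable def kernelModule (a b : X.base) : NarrowModule k :=
  NarrowModule.ofDeg (fun n => ModuleCat.of k (X.kernel ⟨n + 1⟩ a b))
    (fun f => (X.act (NarrowSimplex.interval f) a b).restrict
      fun _ hx => X.act_interval_mem_kernel f hx)
    (fun _ x => Subtype.ext (X.act_id a b x.1))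
    (fun f g x => Subtype.ext
      (X.act_comp (NarrowSimplex.interval f) (NarrowSimplex.interval g) a b x.1))

/-- The inclusion of the joint kernel. -/
noncomputable def kernelIncl (a b : X.base) (n : ℕ) :
    (X.kernelModule a b).deg n →ₗ[k] X.deg (n + 1) a b :=
  (X.kernel ⟨n + 1⟩ a b).subtype

/-- An element of the joint kernel as an element of the narrow simplicial module. -/
def kernelMk {a b : X.base} {n : ℕ} (x : X.deg (n + 1) a b) (hx : x ∈ X.kernel ⟨n + 1⟩ a b) :
    (X.kernelModule a b).deg n :=
  (⟨x, hx⟩ : X.kernel ⟨n + 1⟩ a b)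

theorem kernelIncl_mk {a b : X.base} {n : ℕ} (x : X.deg (n + 1) a b) (hx) :
    X.kernelIncl a b n (X.kernelMk x hx) = x := rfl

theorem kernelIncl_injective (a b : X.base) (n : ℕ) : Function.Injective (X.kernelIncl a b n) :=
  Subtype.val_injective

theorem kernelIncl_mem {a b : X.base} {n : ℕ} (x : (X.kernelModule a b).deg n) :
    X.kernelIncl a b n x ∈ X.kernel ⟨n + 1⟩ a b :=
  (show X.kernel ⟨n + 1⟩ a b from x).2

theorem range_kernelIncl (a b : X.base) (n : ℕ) :
    LinearMap.range (X.kernelIncl a b n) = X.kernel ⟨n + 1⟩ a b :=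
  Submodule.range_subtype _

theorem kernelIncl_act {a b : X.base} {m n : ℕ} (f : (⟨m⟩ : NarrowSimplex) ⟶ ⟨n⟩)
    (x : (X.kernelModule a b).deg n) :
    X.kernelIncl a b m ((X.kernelModule a b).act f x) =
      X.act (NarrowSimplex.interval f) a b (X.kernelIncl a b n x) := rfl

/-- The composition of the joint kernels, given by `glue`. -/
noncomputable def kernelComp (a b c : X.base) (p q : ℕ) :
    (X.kernelModule a b).deg p →ₗ[k] (X.kernelModule b c).deg q →ₗ[k]
      (X.kernelModule a c).deg (p + q) :=
  LinearMap.mk₂ k (fun x y => X.kernelMk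
      (X.glueMap a b c p q (X.kernelIncl a b p x) (X.kernelIncl b c q y))
      (X.glueMap_mem_kernel (X.kernelIncl_mem x) (X.kernelIncl_mem y)))
    (fun _ _ _ => X.kernelIncl_injective _ _ _ (by simp only [map_add, kernelIncl_mk,
      LinearMap.add_apply]))
    (fun _ _ _ => X.kernelIncl_injective _ _ _ (by simp only [map_smul, kernelIncl_mk,
      LinearMap.smul_apply]))
    (fun _ _ _ => X.kernelIncl_injective _ _ _ (by simp only [map_add, kernelIncl_mk]))
    (fun _ _ _ => X.kernelIncl_injective _ _ _ (by simp only [map_smul, kernelIncl_mk]))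

/-- The enriched category of joint kernels. -/
noncomputable def kernelData : NarrowCat.Data k where
  Ob := X.base
  H := X.kernelModule
  comp := X.kernelComp
  one a := X.kernelMk (X.degenerateEdge a) (X.degenerateEdge_mem_kernel a)
  comp_act u v _ _ := X.kernelIncl_injective _ _ _ (X.glueMap_act u v _ _)
  comp_assoc _ _ _ := X.kernelIncl_injective _ _ _ (X.glueMap_assoc _ _ _)
  one_comp _ := X.kernelIncl_injective _ _ _ (X.glueMap_degenerateEdge_left _)
  comp_one _ := X.kernelIncl_injective _ _ _ (X.glueMap_degenerateEdge_right _)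

variable {X}

/-- The restriction of a morphism to the joint kernels. -/
noncomputable def kernelMap (F : X ⟶ Y) (a b : X.base) (n : ℕ) :
    (X.kernelModule a b).deg n →ₗ[k] (Y.kernelModule (F.base a) (F.base b)).deg n :=
  (Hom.onDeg F (n + 1) a b).restrict (p := X.kernel ⟨n + 1⟩ a b)
    (q := Y.kernel ⟨n + 1⟩ (F.base a) (F.base b)) fun _ hx => Hom.mem_kernel_onDeg F hx

variable (k) in
/-- The functor of joint kernels. -/
noncomputable def kernelFunctor : FTemplicialModule k ⥤ NarrowCat k where
  obj X := X.kernelData.toCat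
  map {X Y} F := NarrowCat.Data.homMk X.kernelData Y.kernelData F.base (kernelMap F)
    (fun a b _ _ _ _ => Y.kernelIncl_injective _ _ _ (Hom.onDeg_act F _ a b _))
    (fun a => Y.kernelIncl_injective _ _ _
      ((Hom.onDeg_act F _ a a _).trans (congrArg (Y.act _ _ _) (Hom.onDeg_one F a))))
    (fun a _ c _ _ _ _ => Y.kernelIncl_injective _ _ _
      ((Hom.onDeg_act F _ a c _).trans (congrArg (Y.act _ _ _)
        (Hom.onDeg_mul F _ _ _ _ _ _ _ _ _))))
  map_id _ := NarrowCat.functor_ext (fun _ => rfl) fun _ _ _ _ => HEq.rfl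
  map_comp _ _ := NarrowCat.functor_ext (fun _ => rfl) fun _ _ _ _ => HEq.rfl

/-- The functor of joint kernels is the one described by `KernelIdentification`. -/
noncomputable def kernelIdentification : KernelIdentification (kernelFunctor k) where
  ob X := Equiv.refl X.base
  incl X := X.kernelIncl
  incl_injective X := X.kernelIncl_injective
  range_incl X := X.range_kernelIncl
  incl_act X _ _ _ _ f x := X.kernelIncl_act f x
  incl_comp X a b c p q x y :=
    (congrArg (fun t => X.kernelIncl a c (p + q) (t x y)) (X.kernelData.toCat_comp a b c p q)).trans
      (X.glue_eq_glueMap _ _).symm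
  incl_one X a := congrArg (X.kernelIncl a a 0) (X.kernelData.toCat_one a)
  ob_map _ _ := rfl
  incl_map _ _ _ _ _ := HEq.rfl

end FTemplicialModule

/-! ### Generation by joint kernels -/

namespace FTemplicialModule

open FinInterval

variable {k : Type u} [CommRing k] (X : FTemplicialModule k)

/-- The projector `Z μ` at a vertex commutes with the comultiplication at an earlier vertex. -/
theorem comul_mulMap_comul_eq_zero {a b : X.base} {p q t s n : ℕ} (h : p + q = n) (h' : t + s = n)
    (hlt : t < p) {x : X.deg n a b} (hx : X.comul a b t s n h' x = 0) :
    X.comul a b t s n h' (X.mulMap a b p q n h (X.comul a b p q n h x)) = 0 := by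
  obtain ⟨r, rfl⟩ : ∃ r, t + r = p := ⟨p - t, by lia⟩
  obtain rfl : s = r + q := by lia
  subst h
  have h1 := FrobeniusMonoidal.frobenius_left (F := X.functor) (op ⟨t⟩) (op ⟨r⟩) (op ⟨q⟩)
  have h2 := Functor.OplaxMonoidal.associativity X.functor (op ⟨t⟩) (op ⟨r⟩) (op ⟨q⟩)
  have h3 := congrArg (fun f => (ModQuiver.Hom.app f a b).hom
    (((X.comult ⟨t + r⟩ ⟨q⟩).app a b).hom x)) h1
  have h4 := congrArg (fun f => (ModQuiver.Hom.app f a b).hom x) h2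
  change ((X.comult _ _).app a b).hom (X.act _ a b (X.act _ a b (((X.mult _ _).app a b).hom
    (((X.comult _ _).app a b).hom (X.act _ a b x))))) = 0
  rw [act_cast_rfl, act_cast_rfl]
  refine h3.trans ((congrArg ((X.quiver ⟨t⟩ ◁ Functor.LaxMonoidal.μ X.functor (op ⟨r⟩)
    (op ⟨q⟩)).app a b).hom h4).trans ?_)
  exact (congrArg (fun z => ((X.quiver ⟨t⟩ ◁ Functor.LaxMonoidal.μ X.functor (op ⟨r⟩)
    (op ⟨q⟩)).app a b).hom (((X.quiver ⟨t⟩ ◁ Functor.OplaxMonoidal.δ X.functor (op ⟨r⟩)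
    (op ⟨q⟩)).app a b).hom z)) hx).trans (by rw [map_zero, map_zero])

theorem mulMap_mem {S : ∀ n a b, Submodule k (X.deg n a b)} {a b : X.base} {p q n : ℕ}
    (h : p + q = n) (hS : ∀ c, ∀ x ∈ S p a c, ∀ y ∈ S q c b, X.mul a c b p q n h x y ∈ S n a b)
    (hp : ∀ c x, x ∈ S p a c) (hq : ∀ c x, x ∈ S q c b)
    (ξ : (ModQuiver.tensorObj (X.quiver ⟨p⟩) (X.quiver ⟨q⟩)).obj a b) :
    X.mulMap a b p q n h ξ ∈ S n a b := by
  rw [← Submodule.Quotient.mk_eq_zero]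
  exact LinearMap.congr_fun (f := (S n a b).mkQ ∘ₗ X.mulMap a b p q n h) (g := 0)
    (ModQuiver.tensor_ext fun c x y => (Submodule.Quotient.mk_eq_zero _).2
      (hS c x (hp c x) y (hq c y))) ξ

/-- Every element of degree zero is in the span of the unit elements. -/
theorem mem_of_one_mem {S : ∀ a b, Submodule k (X.deg 0 a b)} (hS : ∀ a, X.one a ∈ S a a)
    (a b : X.base) (x : X.deg 0 a b) : x ∈ S a b := by
  rw [← X.one_counit a b x, ← Submodule.Quotient.mk_eq_zero]
  refine LinearMap.congr_fun (f := (S a b).mkQ ∘ₗ (X.unit.app a b).hom) (g := 0)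
    (ModQuiver.unit_ext fun e => ?_) _
  subst e
  exact (Submodule.Quotient.mk_eq_zero _).2 (hS a)

/-- A Frobenius templicial module is generated by the joint kernels of the comultiplications: the
components of an element at the inner vertices are removed by the projectors `Z μ`. -/
theorem mem_of_kernel_le {S : ∀ n a b, Submodule k (X.deg n a b)} (hone : ∀ a, X.one a ∈ S 0 a a)
    (hker : ∀ n a b, X.kernel ⟨n + 1⟩ a b ≤ S (n + 1) a b)
    (hmul : ∀ a c b p q n (h : p + q = n), 0 < p → 0 < q →
      ∀ x ∈ S p a c, ∀ y ∈ S q c b, X.mul a c b p q n h x y ∈ S n a b)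
    (n : ℕ) (a b : X.base) (x : X.deg n a b) : x ∈ S n a b := by
  induction n using Nat.strong_induction_on generalizing a b with
  | _ n ih =>
    obtain rfl | hn := Nat.eq_zero_or_pos n
    · exact X.mem_of_one_mem hone a b x
    -- the claim for elements whose comultiplications at the vertices before `j` vanish
    have key : ∀ d j, 0 < j → j + d = n → ∀ x : X.deg n a b,
        (∀ p q, 0 < p → p < j → ∀ h : p + q = n, X.comul a b p q n h x = 0) → x ∈ S n a b := by
      intro d
      induction d with
      | zero =>
        intro j hj hjn x hx
        obtain ⟨m, rfl⟩ : ∃ m, n = m + 1 := ⟨n - 1, by lia⟩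
        exact hker m a b ((X.mem_kernel).2 fun p q hp hq h => hx p q hp (by lia) h)
      | succ d ihd =>
        intro j hj hjn x hx
        set y := X.mulMap a b j (d + 1) n hjn (X.comul a b j (d + 1) n hjn x) with hy
        have hyS : y ∈ S n a b :=
          X.mulMap_mem hjn (fun c => hmul a c b j (d + 1) n hjn hj (by lia))
            (fun c => ih j (by lia) a c) (fun c => ih (d + 1) (by lia) c b) _
        have hxy : x - y ∈ S n a b := by
          refine ihd (j + 1) (by lia) (by lia) _ fun p q hp hpj h => ?_
          rw [map_sub, sub_eq_zero]
          obtain rfl | hpj := (Nat.lt_succ_iff.1 hpj).eq_or_lt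
          · obtain rfl : q = d + 1 := by lia
            rw [hy, comul_mulMap]
          · rw [hx p q hp hpj h, hy, X.comul_mulMap_comul_eq_zero hjn h hpj (hx p q hp hpj h)]
        simpa using add_mem hxy hyS
    exact key (n - 1) 1 one_pos (by lia) x fun p q hp hp1 h => by lia

/-- Products at a vertex are preserved by the projectors at earlier vertices. -/
theorem mulMap_comul_mul {a c b : X.base} {p q t s r n : ℕ} (h : p + q = n) (h' : t + s = n)
    (hr : t + r = p) (x : X.deg p a c) (y : X.deg q c b) :
    X.mulMap a b t s n h' (X.comul a b t s n h' (X.mul a c b p q n h x y)) =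
      X.mul a c b p q n h (X.mulMap a c t r p hr (X.comul a c t r p hr x)) y := by
  have hs : r + q = s := by lia
  rw [X.comul_mul_right hr h hs h']
  refine LinearMap.congr_fun
    (f := X.mulMap a b t s n h' ∘ₗ X.mulRight a c b t r q s hs y)
    (g := (X.mul a c b p q n h).flip y ∘ₗ X.mulMap a c t r p hr)
    (ModQuiver.tensor_ext fun d u v => ?_) _
  change X.mulMap a b t s n h' (X.mulRight a c b t r q s hs y (X.tmul a d c t r u v)) =
    X.mul a c b p q n h (X.mul a d c t r p hr u v) y
  rw [mulRight_tmul, mulMap_tmul, X.mul_assoc hr h hs h']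

/-- The image of the multiplication at the inner vertex `p` of `[n]`. -/
noncomputable def decomposable (n : ℕ) (a b : X.base) (p : ℕ) : Submodule k (X.deg n a b) :=
  ⨆ (q : ℕ) (h : p + q = n), LinearMap.range (X.mulMap a b p q n h)

theorem mul_mem_decomposable {a c b : X.base} {p q n : ℕ} (h : p + q = n) (x : X.deg p a c)
    (y : X.deg q c b) : X.mul a c b p q n h x y ∈ X.decomposable n a b p :=
  Submodule.mem_iSup_of_mem q (Submodule.mem_iSup_of_mem h ⟨X.tmul a c b p q x y, rfl⟩)

theorem decomposable_le {a b : X.base} {p n : ℕ} {S : Submodule k (X.deg n a b)}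
    (hS : ∀ q (h : p + q = n) c x y, X.mul a c b p q n h x y ∈ S) :
    X.decomposable n a b p ≤ S := by
  refine iSup_le fun q => iSup_le fun h => ?_
  rw [← Submodule.ker_mkQ S, LinearMap.range_le_ker_iff]
  exact ModQuiver.tensor_ext fun c x y => (Submodule.Quotient.mk_eq_zero _).2 (hS q h c x y)

/-- A joint kernel meets the sum of the images of the multiplications trivially. -/
theorem eq_zero_of_mem_kernel_of_decomposable {a b : X.base} {n : ℕ} {x : X.deg n a b}
    (hx : x ∈ X.kernel ⟨n⟩ a b)
    (hx' : x ∈ ⨆ (p : ℕ) (_ : 0 < p) (_ : p < n), X.decomposable n a b p) : x = 0 := by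
  rw [mem_kernel] at hx
  -- the products at the vertices before `j` are removed from `x`, one vertex after the other
  have key : ∀ d j, 0 < j → n ≤ j + d →
      (x ∈ ⨆ (p : ℕ) (_ : j ≤ p) (_ : p < n), X.decomposable n a b p) → x = 0 := by
    intro d
    induction d with
    | zero =>
      intro j _ hjn hxj
      rw [← Submodule.mem_bot k]
      refine SetLike.le_def.1 (iSup_le fun p => iSup_le fun h1 => iSup_le fun h2 => ?_) hxj
      lia
    | succ d ih =>
      intro j hj hjn hxj
      by_cases hjn' : j < n
      · refine ih (j + 1) (by lia) (by lia) ?_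
        obtain ⟨q, hq⟩ : ∃ q, j + q = n := ⟨n - j, by lia⟩
        -- the complement of the projector at `j` fixes `x` and kills the products at `j`
        let E : X.deg n a b →ₗ[k] X.deg n a b :=
          LinearMap.id - X.mulMap a b j q n hq ∘ₗ X.comul a b j q n hq
        have hE : E x = x := by
          change x - X.mulMap a b j q n hq (X.comul a b j q n hq x) = x
          rw [hx j q hj (by lia), map_zero, sub_zero]
        rw [← hE]
        refine (Submodule.mem_comap (f := E)).1 (SetLike.le_def.1 (iSup_le fun p =>
          iSup_le fun h1 => iSup_le fun h2 => X.decomposable_le fun q' h c u v => ?_) hxj)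
        rw [Submodule.mem_comap]
        change X.mul a c b p q' n h u v - X.mulMap a b j q n hq (X.comul a b j q n hq
          (X.mul a c b p q' n h u v)) ∈ _
        obtain rfl | h1 := h1.eq_or_lt
        · obtain rfl : q = q' := by lia
          rw [comul_mul, mulMap_tmul, sub_self]
          exact zero_mem _
        · refine Submodule.mem_iSup_of_mem p (Submodule.mem_iSup_of_mem h1
            (Submodule.mem_iSup_of_mem h2 (sub_mem (X.mul_mem_decomposable h u v) ?_)))
          rw [X.mulMap_comul_mul h hq (r := p - j) (by lia)]
          exact X.mul_mem_decomposable h _ v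
      · exact ih (j + 1) (by lia) (by lia) (by
          refine SetLike.le_def.1 (iSup_le fun p => iSup_le fun h1 => iSup_le fun h2 => ?_) hxj
          lia)
  exact key n 1 one_pos (by lia) hx'

/-- A family of submodules of the joint kernels that generates a Frobenius templicial module
consists of the whole joint kernels. -/
theorem kernel_le_of_generates {B : ∀ n a b, Submodule k (X.deg (n + 1) a b)}
    (hB : ∀ n a b, B n a b ≤ X.kernel ⟨n + 1⟩ a b)
    (hgen : ∀ S : ∀ n a b, Submodule k (X.deg n a b), (∀ a, X.one a ∈ S 0 a a) →
      (∀ n a b, B n a b ≤ S (n + 1) a b) →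
      (∀ a c b p q n (h : p + q = n), ∀ x ∈ S p a c, ∀ y ∈ S q c b,
        X.mul a c b p q n h x y ∈ S n a b) → ∀ n a b x, x ∈ S n a b) (n : ℕ) (a b : X.base) :
    X.kernel ⟨n + 1⟩ a b ≤ B n a b := by
  intro x hx
  -- in positive degrees, `B` and the products `D` span a system closed under multiplication
  let D : ∀ n a b, Submodule k (X.deg n a b) := fun n a b =>
    ⨆ (p : ℕ) (_ : 0 < p) (_ : p < n), X.decomposable n a b p
  let S : ∀ n a b, Submodule k (X.deg n a b) := fun n =>
    match n with
    | 0 => fun _ _ => ⊤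
    | n + 1 => fun a b => B n a b ⊔ D (n + 1) a b
  have h1 : x ∈ S (n + 1) a b := by
    refine hgen S (fun _ => trivial) (fun _ _ _ => le_sup_left) ?_ _ a b x
    intro a c b p q n h x hx y hy
    obtain rfl | hp := Nat.eq_zero_or_pos p
    · -- elements of degree zero are combinations of unit elements
      obtain rfl : q = n := by lia
      have h2 := X.mem_of_one_mem (S := fun a c =>
        ⨅ y : S q c b, (S q a b).comap ((X.mul a c b 0 q q h).flip y.1)) (fun c =>
          (Submodule.mem_iInf _).2 fun y => by
            change X.mul c c b 0 q q h (X.one c) y.1 ∈ S q c b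
            rw [X.one_mul]
            exact y.2) a c x
      exact (Submodule.mem_iInf _).1 h2 ⟨y, hy⟩
    obtain rfl | hq := Nat.eq_zero_or_pos q
    · obtain rfl : p = n := by lia
      have h2 := X.mem_of_one_mem (S := fun c b =>
        ⨅ x : S p a c, (S p a b).comap (X.mul a c b p 0 p h x.1)) (fun c =>
          (Submodule.mem_iInf _).2 fun x => by
            change X.mul a c c p 0 p h x.1 (X.one c) ∈ S p a c
            rw [X.mul_one]
            exact x.2) c b y
      exact (Submodule.mem_iInf _).1 h2 ⟨x, hx⟩
    obtain ⟨m, rfl⟩ : ∃ m, n = m + 1 := ⟨n - 1, by lia⟩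
    exact Submodule.mem_sup_right (Submodule.mem_iSup_of_mem p (Submodule.mem_iSup_of_mem hp
      (Submodule.mem_iSup_of_mem (by lia) (X.mul_mem_decomposable h x y))))
  obtain ⟨u, hu, v, hv, rfl⟩ := Submodule.mem_sup.1 h1
  have hv' : v ∈ X.kernel ⟨n + 1⟩ a b := by
    simpa using sub_mem hx (hB n a b hu)
  rw [X.eq_zero_of_mem_kernel_of_decomposable hv' hv, add_zero]
  exact hu

/-- Morphisms that agree on the joint kernels agree, because these generate. -/
instance : (kernelFunctor k).Faithful where
  map_injective {X Y F G} h := by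
    have h1 : ∀ a, F.base a = G.base a := fun a =>
      congrArg (fun H : X.kernelData.toCat ⟶ Y.kernelData.toCat => SmallEnrichedCat.onOb H a) h
    have h2 : ∀ a b n (x : (X.kernelModule a b).deg n), HEq (kernelMap F a b n x)
        (kernelMap G a b n x) := fun a b n x =>
      congr_arg_heq (fun H : X.kernelData.toCat ⟶ Y.kernelData.toCat => NarrowCat.onDeg H a b n x) h
    obtain ⟨f, α, e1, e2, e3, e4, e5⟩ : Hom X Y := F
    obtain ⟨g, β, e1', e2', e3', e4', e5'⟩ : Hom X Y := G
    obtain rfl : f = g := funext h1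
    let F' : X ⟶ Y := ⟨f, α, e1, e2, e3, e4, e5⟩
    let G' : X ⟶ Y := ⟨f, β, e1', e2', e3', e4', e5'⟩
    refine Hom.ext_onDeg (fun _ => rfl) fun n a b x => heq_of_eq ?_
    refine X.mem_of_kernel_le (S := fun n a b => LinearMap.eqLocus (Hom.onDeg F' n a b)
      (Hom.onDeg G' n a b)) (fun a => ?_) (fun n a b x hx => ?_)
      (fun a c b p q n h _ _ x hx y hy => ?_) n a b x
    · exact (Hom.onDeg_one F' a).trans (Hom.onDeg_one G' a).symm
    · exact congrArg (Y.kernelIncl _ _ n) (eq_of_heq (h2 a b n (X.kernelMk x hx)))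
    · refine (Hom.onDeg_mul F' a c b p q n h x y).trans (Eq.trans ?_
        (Hom.onDeg_mul G' a c b p q n h x y).symm)
      have hx : Hom.onDeg F' p a c x = Hom.onDeg G' p a c x := hx
      have hy : Hom.onDeg F' q c b y = Hom.onDeg G' q c b y := hy
      exact congrArg₂ (fun u v => Y.mul _ _ _ p q n h u v) hx hy

end FTemplicialModule

/-! ### Bijectivity is detected on joint kernels -/

namespace FTemplicialModule

open FinInterval

variable {k : Type u} [CommRing k] {S : Type u} {F₁ F₂ : FinIntervalᵒᵖ ⥤ ModQuiver S k}
  {r₁ : FrobeniusMonoidal F₁} {r₂ : FrobeniusMonoidal F₂}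

section

variable (φ : ∀ n a b, (mk S F₁ r₁).deg n a b →ₗ[k] (mk S F₂ r₂).deg n a b)

theorem tensorMap_injective {p q : ℕ} (hp : ∀ a b, Function.Bijective (φ p a b))
    (hq : ∀ a b, Function.Bijective (φ q a b)) (a b : S) :
    Function.Injective (tensorMap (X := mk S F₁ r₁) (Y := mk S F₂ r₂) (f := id) φ p q a b) := by
  let ep := fun a b => LinearEquiv.ofBijective (φ p a b) (hp a b)
  let eq := fun a b => LinearEquiv.ofBijective (φ q a b) (hq a b)
  let g : (ModQuiver.tensorObj ((mk S F₂ r₂).quiver ⟨p⟩) ((mk S F₂ r₂).quiver ⟨q⟩)).obj a b →ₗ[k]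
      (ModQuiver.tensorObj ((mk S F₁ r₁).quiver ⟨p⟩) ((mk S F₁ r₁).quiver ⟨q⟩)).obj a b :=
    ModQuiver.tensorDesc fun c => (ModQuiver.tmul ((mk S F₁ r₁).quiver ⟨p⟩)
      ((mk S F₁ r₁).quiver ⟨q⟩) a c b).compl₁₂ (ep a c).symm.toLinearMap (eq c b).symm.toLinearMap
  refine Function.LeftInverse.injective (g := g) fun ξ => ?_
  refine LinearMap.congr_fun (f := g ∘ₗ tensorMap (X := mk S F₁ r₁) (Y := mk S F₂ r₂)
    (f := id) φ p q a b) (g := LinearMap.id) (ModQuiver.tensor_ext fun c x y => ?_) ξ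
  refine (congrArg g (tensorMap_tmul (X := mk S F₁ r₁) (Y := mk S F₂ r₂) (f := id) φ p q a c b
    x y)).trans ((ModQuiver.tensorDesc_tmul _ _ _ _).trans ?_)
  exact congrArg₂ (fun u v => (mk S F₁ r₁).tmul a c b p q u v) ((ep a c).symm_apply_apply x)
    ((eq c b).symm_apply_apply y)

variable (act : ∀ {m n : ℕ} (g : (⟨m⟩ : FinInterval) ⟶ ⟨n⟩) (a b : S) x,
    φ m a b ((mk S F₁ r₁).act g a b x) = (mk S F₂ r₂).act g a b (φ n a b x))
  (one : ∀ a, φ 0 a a ((mk S F₁ r₁).one a) = (mk S F₂ r₂).one a)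
  (mul : ∀ (a c b : S) p q x y, φ (p + q) a b ((mk S F₁ r₁).mul a c b p q (p + q) rfl x y) =
    (mk S F₂ r₂).mul a c b p q (p + q) rfl (φ p a c x) (φ q c b y))
  (comul : ∀ (a b : S) p q x, (mk S F₂ r₂).comul a b p q (p + q) rfl (φ (p + q) a b x) =
    tensorMap (X := mk S F₁ r₁) (Y := mk S F₂ r₂) (f := id) φ p q a b
      ((mk S F₁ r₁).comul a b p q (p + q) rfl x))

include one mul in
/-- The image of a morphism that contains the joint kernels is everything, as these generate. -/
theorem surjective_of_kernel_le_range
    (hsurj : ∀ n (a b : S), ∀ y ∈ (mk S F₂ r₂).kernel ⟨n + 1⟩ a b, ∃ x, φ (n + 1) a b x = y)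
    (n : ℕ) (a b : S) : Function.Surjective (φ n a b) := fun y =>
  (mk S F₂ r₂).mem_of_kernel_le (S := fun n a b => LinearMap.range (φ n a b))
    (fun a => ⟨_, one a⟩) (fun n a b y hy => hsurj n a b y hy)
    (fun a c b p q n h _ _ => by
      rintro _ ⟨x, rfl⟩ _ ⟨y, rfl⟩
      subst h
      exact ⟨_, mul a c b p q x y⟩) n a b y

include act one mul comul in
/-- A morphism that is the identity on the base and bijective on the joint kernels is bijective. It
is compatible with the comultiplications, so that inductively the kernel in degree `n` lies in the
joint kernel. -/
theorem bijective_of_bijective_kernel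
    (hinj : ∀ n (a b : S), ∀ x ∈ (mk S F₁ r₁).kernel ⟨n + 1⟩ a b, φ (n + 1) a b x = 0 → x = 0)
    (hsurj : ∀ n (a b : S), ∀ y ∈ (mk S F₂ r₂).kernel ⟨n + 1⟩ a b, ∃ x, φ (n + 1) a b x = y)
    (n : ℕ) (a b : S) : Function.Bijective (φ n a b) := by
  have hs := surjective_of_kernel_le_range φ one mul hsurj
  refine ⟨?_, hs n a b⟩
  induction n using Nat.strong_induction_on generalizing a b with
  | _ n ih =>
    rw [injective_iff_map_eq_zero]
    intro x hx
    obtain rfl | hn := Nat.eq_zero_or_pos n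
    · -- in degree zero the counits are inverse to the units
      have h1 := (Hom.ofDeg (X := mk S F₁ r₁) (Y := mk S F₂ r₂) id φ act one mul comul).map_counit
      have h2 := congrArg (fun t => (ModQuiver.Hom.app t a b).hom x) h1
      have h3 := congrArg (fun t => (ModQuiver.Hom.app t a b).hom
        (((mk S F₁ r₁).counit.app a b).hom x)) (ModQuiver.pullUnit_id (S := S) (k := k))
      have h4 : ((mk S F₁ r₁).counit.app a b).hom x = 0 :=
        h3.symm.trans (h2.trans ((congrArg ((mk S F₂ r₂).counit.app a b).hom hx).trans
          (map_zero _)))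
      exact ((mk S F₁ r₁).one_counit a b x).symm.trans
        ((congrArg ((mk S F₁ r₁).unit.app a b).hom h4).trans (map_zero _))
    · obtain ⟨m, rfl⟩ : ∃ m, n = m + 1 := ⟨n - 1, by lia⟩
      refine hinj m a b x ((mem_kernel _).2 fun p q hp hq h => ?_) hx
      refine tensorMap_injective φ (p := p) (q := q) (fun a b => ⟨ih p (by lia) a b, hs p a b⟩)
        (fun a b => ⟨ih q (by lia) a b, hs q a b⟩) a b ?_
      rw [map_zero]
      have h5 : ∀ n (h : p + q = n) (x : (mk S F₁ r₁).deg n a b), φ n a b x = 0 →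
          tensorMap (X := mk S F₁ r₁) (Y := mk S F₂ r₂) (f := id) φ p q a b
            ((mk S F₁ r₁).comul a b p q n h x) = 0 := by
        rintro n rfl x hx
        exact (comul a b p q x).symm.trans
          ((congrArg ((mk S F₂ r₂).comul a b p q (p + q) rfl) hx).trans (map_zero _))
      exact h5 _ h x hx

end

end FTemplicialModule

/-! ### Frobenius templicial modules from quivers indexed by numbers -/

namespace FTemplicialModule

open FinInterval

/-- The data of a Frobenius templicial module, with quivers indexed by the length of the
intervals. -/
structure Data (k : Type u) [CommRing k] where
  base : Type u
  Q : ℕ → ModQuiver base k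
  act {m n : ℕ} : ((⟨m⟩ : FinInterval) ⟶ ⟨n⟩) → (Q n ⟶ Q m)
  act_id (n : ℕ) : act (𝟙 (⟨n⟩ : FinInterval)) = 𝟙 (Q n)
  act_comp {l m n : ℕ} (f : (⟨l⟩ : FinInterval) ⟶ ⟨m⟩) (g : (⟨m⟩ : FinInterval) ⟶ ⟨n⟩) :
    act (f ≫ g) = act g ≫ act f
  unit : ModQuiver.tensorUnit base k ⟶ Q 0
  counit : Q 0 ⟶ ModQuiver.tensorUnit base k
  mult (p q : ℕ) : ModQuiver.tensorObj (Q p) (Q q) ⟶ Q (p + q)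
  comult (p q : ℕ) : Q (p + q) ⟶ ModQuiver.tensorObj (Q p) (Q q)
  mult_natural {p q p' q' : ℕ} (u : (⟨p⟩ : FinInterval) ⟶ ⟨p'⟩)
    (v : (⟨q⟩ : FinInterval) ⟶ ⟨q'⟩) :
    ModQuiver.tensorHom (act u) (act v) ≫ mult p q = mult p' q' ≫ act (FinInterval.sum rfl rfl u v)
  mult_assoc (p q r : ℕ) :
    ModQuiver.tensorHom (mult p q) (𝟙 (Q r)) ≫ mult (p + q) r ≫
      act (FinInterval.cast (Nat.add_assoc p q r).symm) =
      ModQuiver.assocHom (Q p) (Q q) (Q r) ≫ ModQuiver.tensorHom (𝟙 (Q p)) (mult q r) ≫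
        mult p (q + r)
  unit_mult (p : ℕ) : ModQuiver.leftUnitorHom (Q p) =
    ModQuiver.tensorHom unit (𝟙 (Q p)) ≫ mult 0 p ≫ act (FinInterval.cast (Nat.zero_add p).symm)
  mult_unit (p : ℕ) : ModQuiver.rightUnitorHom (Q p) =
    ModQuiver.tensorHom (𝟙 (Q p)) unit ≫ mult p 0 ≫ act (FinInterval.cast (Nat.add_zero p).symm)
  comult_natural {p q p' q' : ℕ} (u : (⟨p⟩ : FinInterval) ⟶ ⟨p'⟩)
    (v : (⟨q⟩ : FinInterval) ⟶ ⟨q'⟩) :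
    comult p' q' ≫ ModQuiver.tensorHom (act u) (act v) = act (FinInterval.sum rfl rfl u v) ≫
      comult p q
  comult_assoc (p q r : ℕ) :
    comult (p + q) r ≫ ModQuiver.tensorHom (comult p q) (𝟙 (Q r)) ≫
      ModQuiver.assocHom (Q p) (Q q) (Q r) =
      act (FinInterval.cast (Nat.add_assoc p q r).symm) ≫ comult p (q + r) ≫
        ModQuiver.tensorHom (𝟙 (Q p)) (comult q r)
  counit_comult (p : ℕ) : act (FinInterval.cast (Nat.zero_add p)) ≫ comult 0 p ≫
    ModQuiver.tensorHom counit (𝟙 (Q p)) ≫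
    ModQuiver.leftUnitorHom (Q p) = 𝟙 (Q p)
  comult_counit (p : ℕ) : act (FinInterval.cast (Nat.add_zero p)) ≫ comult p 0 ≫
    ModQuiver.tensorHom (𝟙 (Q p)) counit ≫
    ModQuiver.rightUnitorHom (Q p) = 𝟙 (Q p)
  frobenius_left (p q r : ℕ) :
    mult (p + q) r ≫ act (FinInterval.cast (Nat.add_assoc p q r).symm) ≫ comult p (q + r) =
      ModQuiver.tensorHom (comult p q) (𝟙 (Q r)) ≫ ModQuiver.assocHom (Q p) (Q q) (Q r) ≫
        ModQuiver.tensorHom (𝟙 (Q p)) (mult q r)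
  frobenius_right (p q r : ℕ) :
    mult p (q + r) ≫ act (FinInterval.cast (Nat.add_assoc p q r)) ≫ comult (p + q) r =
      ModQuiver.tensorHom (𝟙 (Q p)) (comult q r) ≫ ModQuiver.assocInv (Q p) (Q q) (Q r) ≫
        ModQuiver.tensorHom (mult p q) (𝟙 (Q r))
  unit_counit : unit ≫ counit = 𝟙 _
  counit_unit : counit ≫ unit = 𝟙 _

namespace Data

variable {k : Type u} [CommRing k] (D : Data k)

theorem sum_rfl {p q p' q' : ℕ} (u : (⟨p⟩ : FinInterval) ⟶ ⟨p'⟩)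
    (v : (⟨q⟩ : FinInterval) ⟶ ⟨q'⟩) : FinInterval.sum rfl rfl u v = u ⊗ₘ v :=
  (isSum_sum rfl rfl u v).eq_tensorHom

/-- The functor underlying the Frobenius templicial module. -/
def functor : FinIntervalᵒᵖ ⥤ ModQuiver D.base k where
  obj I := D.Q I.unop.len
  map f := D.act f.unop
  map_id _ := D.act_id _
  map_comp _ _ := D.act_comp _ _

theorem mult_natural' {p q p' q' : ℕ} (u : (⟨p⟩ : FinInterval) ⟶ ⟨p'⟩)
    (v : (⟨q⟩ : FinInterval) ⟶ ⟨q'⟩) :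
    ModQuiver.tensorHom (D.act u) (D.act v) ≫ D.mult p q = D.mult p' q' ≫ D.act (u ⊗ₘ v) :=
  sum_rfl u v ▸ D.mult_natural u v

theorem comult_natural' {p q p' q' : ℕ} (u : (⟨p⟩ : FinInterval) ⟶ ⟨p'⟩)
    (v : (⟨q⟩ : FinInterval) ⟶ ⟨q'⟩) :
    D.comult p' q' ≫ ModQuiver.tensorHom (D.act u) (D.act v) = D.act (u ⊗ₘ v) ≫ D.comult p q :=
  sum_rfl u v ▸ D.comult_natural u v

noncomputable instance : D.functor.LaxMonoidal where
  ε := D.unit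
  μ I J := D.mult I.unop.len J.unop.len
  μ_natural_left {I J} f I' := by
    have h := D.mult_natural' f.unop (𝟙 (⟨I'.unop.len⟩ : FinInterval))
    rw [D.act_id] at h
    exact h
  μ_natural_right {I J} I' f := by
    have h := D.mult_natural' (𝟙 (⟨I'.unop.len⟩ : FinInterval)) f.unop
    rw [D.act_id] at h
    exact h
  associativity I J K := D.mult_assoc I.unop.len J.unop.len K.unop.len
  left_unitality I := D.unit_mult I.unop.len
  right_unitality I := D.mult_unit I.unop.len

noncomputable instance : D.functor.OplaxMonoidal where
  η := D.counit
  δ I J := D.comult I.unop.len J.unop.len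
  δ_natural_left {I J} f I' := by
    have h := D.comult_natural' f.unop (𝟙 (⟨I'.unop.len⟩ : FinInterval))
    rw [D.act_id] at h
    exact h
  δ_natural_right {I J} I' f := by
    have h := D.comult_natural' (𝟙 (⟨I'.unop.len⟩ : FinInterval)) f.unop
    rw [D.act_id] at h
    exact h
  oplax_associativity I J K := D.comult_assoc I.unop.len J.unop.len K.unop.len
  oplax_left_unitality I := by
    have h := D.counit_comult I.unop.len
    refine (Category.id_comp _).symm.trans ((Iso.eq_comp_inv (λ_ (D.functor.obj I))).2 ?_).symm
    exact (Category.assoc _ _ _).trans ((congrArg (D.act _ ≫ ·) (Category.assoc _ _ _)).trans h)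
  oplax_right_unitality I := by
    have h := D.comult_counit I.unop.len
    refine (Category.id_comp _).symm.trans ((Iso.eq_comp_inv (ρ_ (D.functor.obj I))).2 ?_).symm
    exact (Category.assoc _ _ _).trans ((congrArg (D.act _ ≫ ·) (Category.assoc _ _ _)).trans h)

noncomputable instance : FrobeniusMonoidal D.functor where
  frobenius_left I J K := D.frobenius_left I.unop.len J.unop.len K.unop.len
  frobenius_right I J K := D.frobenius_right I.unop.len J.unop.len K.unop.len
  unit_counit := D.unit_counit
  counit_unit := D.counit_unit

/-- The Frobenius templicial module given by its data. -/
noncomputable def toModule : FTemplicialModule k := ⟨D.base, D.functor, inferInstance⟩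

end Data

end FTemplicialModule

/-! ### Words in an enriched category and their reductions -/

namespace NarrowCat

variable {k : Type u} [CommRing k] (A : NarrowCat k)

/-- A composable sequence of morphisms of arbitrary degrees. -/
inductive Word : A.Ob → A.Ob → Type u
  | nil (a : A.Ob) : Word a a
  | cons {a c b : A.Ob} (n : ℕ) (x : (A.hom a c).deg n) (w : Word c b) : Word a b

variable {A}

namespace Word

variable {a b c d e : A.Ob}

/-- The word with a single letter. -/
abbrev letter (n : ℕ) (x : (A.hom a b).deg n) : A.Word a b := cons n x (nil b)

/-- The length of a word; a letter of degree `n` contributes an interval of length `n + 1`. -/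
def len {a b : A.Ob} : A.Word a b → ℕ
  | nil _ => 0
  | cons n _ w => n + 1 + len w

/-- Concatenation of words. -/
def append {a c b : A.Ob} : A.Word a c → A.Word c b → A.Word a b
  | nil _, w => w
  | cons n x u, w => cons n x (append u w)

@[simp] theorem len_nil : (nil a : A.Word a a).len = 0 := rfl

@[simp] theorem len_cons (n : ℕ) (x : (A.hom a c).deg n) (w : A.Word c b) :
    (cons n x w).len = n + 1 + w.len := rfl

@[simp] theorem nil_append (w : A.Word a b) : (nil a).append w = w := rfl

@[simp] theorem cons_append (n : ℕ) (x : (A.hom a c).deg n) (u : A.Word c d) (w : A.Word d b) :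
    (cons n x u).append w = cons n x (u.append w) := rfl

@[simp] theorem append_nil (w : A.Word a b) : w.append (nil b) = w := by
  induction w with
  | nil => rfl
  | cons n x w ih => rw [cons_append, ih]

@[simp] theorem append_assoc (u : A.Word a c) (v : A.Word c d) (w : A.Word d b) :
    (u.append v).append w = u.append (v.append w) := by
  induction u with
  | nil => rfl
  | cons n x u ih => rw [cons_append, cons_append, cons_append, ih]

@[simp] theorem len_append (u : A.Word a c) (v : A.Word c b) :
    (u.append v).len = u.len + v.len := by
  induction u with
  | nil => simp
  | cons n x u ih => rw [cons_append, len_cons, ih, len_cons]; lia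

/-- The decomposition of a word at a vertex, if the vertex is an endpoint of a letter. -/
def split {a b : A.Ob} : A.Word a b → ℕ → Option (Σ c : A.Ob, A.Word a c × A.Word c b)
  | w, 0 => some ⟨a, nil a, w⟩
  | nil _, _ + 1 => none
  | cons n x w, t + 1 =>
    if t < n then none else (split w (t - n)).map fun s => ⟨s.1, cons n x s.2.1, s.2.2⟩

@[simp] theorem split_zero (w : A.Word a b) : w.split 0 = some ⟨a, nil a, w⟩ := by
  cases w <;> rfl

theorem split_nil_of_pos {t : ℕ} (h : 0 < t) : (nil a : A.Word a a).split t = none := by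
  cases t with
  | zero => lia
  | succ t => rfl

theorem split_cons_of_le {n t : ℕ} (x : (A.hom a c).deg n) (w : A.Word c b) (h : 0 < t)
    (h' : t ≤ n) : (cons n x w).split t = none := by
  cases t with
  | zero => lia
  | succ t => exact if_pos h'

theorem split_cons_add {n : ℕ} (x : (A.hom a c).deg n) (w : A.Word c b) (t : ℕ) :
    (cons n x w).split (n + 1 + t) =
      (w.split t).map fun s => ⟨s.1, cons n x s.2.1, s.2.2⟩ := by
  rw [show n + 1 + t = n + t + 1 by lia]
  refine (if_neg (by lia)).trans ?_
  rw [Nat.add_sub_cancel_left]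

theorem split_append_add (u : A.Word a c) (w : A.Word c b) (t : ℕ) :
    (u.append w).split (u.len + t) =
      (w.split t).map fun s => ⟨s.1, u.append s.2.1, s.2.2⟩ := by
  induction u with
  | nil => simp
  | cons n x u ih =>
    rw [cons_append, len_cons, Nat.add_assoc, split_cons_add, ih, Option.map_map]
    rfl

theorem split_append_of_le (u : A.Word a c) (w : A.Word c b) {t : ℕ} (h : t ≤ u.len) :
    (u.append w).split t = (u.split t).map fun s => ⟨s.1, s.2.1, s.2.2.append w⟩ := by
  induction u generalizing t with
  | nil a =>
    obtain rfl : t = 0 := by simpa using h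
    simp
  | cons n x u ih =>
    obtain rfl | h1 := Nat.eq_zero_or_pos t
    · simp
    by_cases h2 : t ≤ n
    · rw [cons_append, split_cons_of_le _ _ h1 h2, split_cons_of_le _ _ h1 h2]
      rfl
    · obtain ⟨s, rfl⟩ : ∃ s, t = n + 1 + s := ⟨t - (n + 1), by lia⟩
      rw [cons_append, split_cons_add, split_cons_add, ih w (by rw [len_cons] at h; lia),
        Option.map_map, Option.map_map]
      rfl

theorem eq_append_of_split {w : A.Word a b} {t : ℕ} {u : A.Word a c} {v : A.Word c b}
    (h : w.split t = some ⟨c, u, v⟩) : w = u.append v ∧ u.len = t := by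
  induction w generalizing t with
  | nil a =>
    obtain rfl | h1 := Nat.eq_zero_or_pos t
    · rw [split_zero] at h
      cases h
      exact ⟨rfl, rfl⟩
    · rw [split_nil_of_pos h1] at h
      cases h
  | cons n x w ih =>
    obtain rfl | h1 := Nat.eq_zero_or_pos t
    · rw [split_zero] at h
      cases h
      exact ⟨rfl, rfl⟩
    by_cases h2 : t ≤ n
    · rw [split_cons_of_le _ _ h1 h2] at h
      cases h
    · obtain ⟨s, rfl⟩ : ∃ s, t = n + 1 + s := ⟨t - (n + 1), by lia⟩
      rw [split_cons_add, Option.map_eq_some_iff] at h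
      obtain ⟨⟨c', u', v'⟩, h3, h4⟩ := h
      cases h4
      obtain ⟨rfl, rfl⟩ := ih h3
      exact ⟨rfl, rfl⟩

theorem split_append_len (u : A.Word a c) (v : A.Word c b) :
    (u.append v).split u.len = some ⟨c, u, v⟩ := by
  have h := split_append_add u v 0
  rw [split_zero, Nat.add_zero] at h
  simpa using h

theorem split_len (w : A.Word a b) : w.split w.len = some ⟨b, w, nil b⟩ := by
  have h := split_append_len w (nil b)
  rwa [append_nil] at h

variable (A) in
/-- The elementary reductions: a letter `z` of degree `m` is replaced by a word `s`, of which it is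
the value under a map of vertices `φ : [m + 1] → [s.len]`. -/
inductive Red : ∀ {a b : A.Ob} {m : ℕ}, (A.hom a b).deg m → A.Word a b → (ℕ → ℕ) → Prop
  | act {a b : A.Ob} {m n : ℕ} (f : (⟨m⟩ : NarrowSimplex) ⟶ ⟨n⟩) (x : (A.hom a b).deg n) :
    Red ((A.hom a b).act f x) (letter n x) (NarrowSimplex.Hom.nat f)
  | comp {a c b : A.Ob} {p q : ℕ} (x : (A.hom a c).deg p) (y : (A.hom c b).deg q) :
    Red (A.comp a c b p q x y) (cons p x (letter q y)) (fun i => if i ≤ p then i else i + 1)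
  | one (a : A.Ob) : Red (A.one a) (nil a) (fun _ => 0)

namespace Red

variable {m : ℕ} {z : (A.hom a b).deg m} {s : A.Word a b} {φ : ℕ → ℕ}

theorem zero (h : Red A z s φ) : φ 0 = 0 := by
  cases h with
  | act f x => exact NarrowSimplex.Hom.nat_zero f
  | comp x y => simp
  | one => rfl

theorem last (h : Red A z s φ) : φ (m + 1) = s.len := by
  cases h with
  | act f x => rw [NarrowSimplex.Hom.nat_last]; rfl
  | comp x y => simp only [len_cons, len_nil]; split_ifs <;> lia
  | one => rfl

theorem mono (h : Red A z s φ) : Monotone φ := fun i j hij => by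
  cases h with
  | act f x => exact NarrowSimplex.Hom.nat_mono f hij
  | comp x y => dsimp only; split_ifs <;> lia
  | one => exact le_rfl

theorem le_len (h : Red A z s φ) {i : ℕ} (hi : i ≤ m + 1) : φ i ≤ s.len :=
  (h.mono hi).trans h.last.le

/-- The inner vertices of a letter are not mapped to endpoints of letters. -/
theorem split_eq_none (h : Red A z s φ) {i : ℕ} (h0 : 0 < i) (hi : i ≤ m) :
    s.split (φ i) = none := by
  cases h with
  | act f x =>
    have := NarrowSimplex.Hom.nat_lt f (i := i) (by dsimp only; lia)
    exact split_cons_of_le _ _ (NarrowSimplex.Hom.nat_pos f h0) (by dsimp only at this; lia)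
  | @comp c _ p q x y =>
    dsimp only
    split_ifs with h1
    · exact split_cons_of_le _ _ h0 h1
    · obtain ⟨j, rfl⟩ : ∃ j, i = p + j := ⟨i - p, by lia⟩
      rw [show p + j + 1 = p + 1 + j by lia, split_cons_add,
        split_cons_of_le y _ (by lia) (by lia)]
      rfl
  | one => lia

end Red

/-- The map of vertices induced by a reduction, with map of vertices `φ : [m + 1] → [t]`, of a
letter that is preceded by a word of length `l` and followed by an arbitrary word. -/
def contextMap (l m t : ℕ) (φ : ℕ → ℕ) (i : ℕ) : ℕ :=
  if i ≤ l then i else if i ≤ l + m + 1 then l + φ (i - l) else i - (l + m + 1) + (l + t)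

theorem contextMap_of_le {l m t : ℕ} {φ : ℕ → ℕ} {i : ℕ} (h : i ≤ l) :
    contextMap l m t φ i = i :=
  if_pos h

theorem Red.contextMap_add {m : ℕ} {z : (A.hom a b).deg m} {s : A.Word a b} {φ : ℕ → ℕ}
    (h : Red A z s φ) (l : ℕ) {i : ℕ} (hi : i ≤ m + 1) :
    contextMap l m s.len φ (l + i) = l + φ i := by
  unfold contextMap
  have h0 := h.zero
  split_ifs with h1 h2
  · obtain rfl : i = 0 := by lia
    lia
  · rw [Nat.add_sub_cancel_left]
  · lia

theorem Red.contextMap_add_add {m : ℕ} {z : (A.hom a b).deg m} {s : A.Word a b} {φ : ℕ → ℕ}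
    (h : Red A z s φ) (l j : ℕ) :
    contextMap l m s.len φ (l + (m + 1) + j) = l + s.len + j := by
  obtain rfl | hj := Nat.eq_zero_or_pos j
  · exact (h.contextMap_add l le_rfl).trans (congrArg (l + ·) h.last)
  · unfold contextMap
    rw [if_neg (by lia), if_neg (by lia)]
    lia

theorem Red.contextMap_mono {m : ℕ} {z : (A.hom a b).deg m} {s : A.Word a b} {φ : ℕ → ℕ}
    (h : Red A z s φ) (l : ℕ) : Monotone (contextMap l m s.len φ) := fun i j hij => by
  have h1 := h.last
  unfold contextMap
  split_ifs with h2 h3 h4 h5 h6 h7 h8 h9 <;> try lia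
  · have := h.mono (Nat.sub_le_sub_right hij l)
    lia
  · have := h.le_len (i := i - l) (by lia)
    lia

/-- Compatibility of the map induced by a reduction with a shift of the vertices. -/
theorem contextMap_shift {l l' m t : ℕ} {φ : ℕ → ℕ} (i : ℕ) :
    contextMap (l' + l) m t φ (l' + i) = l' + contextMap l m t φ i := by
  unfold contextMap
  split_ifs <;> try lia
  · rw [show l' + i - (l' + l) = i - l by lia]
    lia

end Word

end NarrowCat

/-! ### Simplices of the free Frobenius templicial module -/

namespace NarrowCat

open Word

variable {k : Type u} [CommRing k] {A : NarrowCat k}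

/-- The vertex maps `[n] ⟶ [l]` of finite intervals, extended by constant functions. -/
structure IsVertexMap (n l : ℕ) (g : ℕ → ℕ) : Prop where
  zero : g 0 = 0
  mono : Monotone g
  last : ∀ i, n ≤ i → g i = l

theorem IsVertexMap.le {n l : ℕ} {g : ℕ → ℕ} (h : IsVertexMap n l g) (i : ℕ) : g i ≤ l := by
  rw [← h.last (max n i) (le_max_left _ _)]
  exact h.mono (le_max_right _ _)

theorem IsVertexMap.comp_nat {m n l : ℕ} {g : ℕ → ℕ} (h : IsVertexMap n l g)
    (f : (⟨m⟩ : FinInterval) ⟶ ⟨n⟩) : IsVertexMap m l fun i => g (FinInterval.Hom.nat f i) where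
  zero := by rw [FinInterval.Hom.nat_zero, h.zero]
  mono := fun _ _ hij => h.mono (FinInterval.Hom.nat_mono f hij)
  last := fun i hi => h.last _ (FinInterval.Hom.nat_of_len_le f hi).ge

/-- The sum of two vertex maps. -/
def glueVertex (p l : ℕ) (g g' : ℕ → ℕ) (i : ℕ) : ℕ := if i ≤ p then g i else l + g' (i - p)

theorem glueVertex_of_le {p l : ℕ} {g g' : ℕ → ℕ} {i : ℕ} (h : i ≤ p) :
    glueVertex p l g g' i = g i := if_pos h

theorem glueVertex_add {p l : ℕ} {g g' : ℕ → ℕ} (h : g p = l) (h' : g' 0 = 0) (j : ℕ) :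
    glueVertex p l g g' (p + j) = l + g' j := by
  obtain rfl | hj := Nat.eq_zero_or_pos j
  · rw [Nat.add_zero, glueVertex_of_le le_rfl, h, h', Nat.add_zero]
  · rw [glueVertex, if_neg (by lia), Nat.add_sub_cancel_left]

theorem IsVertexMap.glue {p q l l' : ℕ} {g g' : ℕ → ℕ} (h : IsVertexMap p l g)
    (h' : IsVertexMap q l' g') : IsVertexMap (p + q) (l + l') (glueVertex p l g g') where
  zero := (glueVertex_of_le (Nat.zero_le p)).trans h.zero
  mono := fun i j hij => by
    unfold glueVertex
    split_ifs with h1 h2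
    · exact h.mono hij
    · have := h.le i
      lia
    · lia
    · have := h'.mono (Nat.sub_le_sub_right hij p)
      lia
  last := fun i hi => by
    obtain ⟨j, rfl⟩ : ∃ j, i = p + j := ⟨i - p, by lia⟩
    rw [glueVertex_add (h.last p le_rfl) h'.zero, h'.last j (by lia)]

/-- The restriction of a vertex map to an initial interval. -/
theorem IsVertexMap.left {n l p : ℕ} {g : ℕ → ℕ} (h : IsVertexMap n l g) :
    IsVertexMap p (g p) fun i => g (min i p) where
  zero := by rw [Nat.zero_min, h.zero]
  mono := fun i j hij => h.mono (min_le_min_right p hij)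
  last := fun i hi => by rw [min_eq_right hi]

/-- The restriction of a vertex map to a final interval. -/
theorem IsVertexMap.right {n l p q : ℕ} {g : ℕ → ℕ} (h : IsVertexMap n l g) (hn : n ≤ p + q) :
    IsVertexMap q (l - g p) fun j => g (p + j) - g p where
  zero := Nat.sub_self _
  mono := fun i j hij => Nat.sub_le_sub_right (h.mono (by lia)) _
  last := fun i hi => by rw [h.last (p + i) (by lia)]

theorem IsVertexMap.contextMap {n r : ℕ} {c d : A.Ob} {m : ℕ} {z : (A.hom c d).deg m}
    {s : A.Word c d} {φ g : ℕ → ℕ} (h : Red A z s φ) {l : ℕ}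
    (hg : IsVertexMap n (l + (m + 1 + r)) g) :
    IsVertexMap n (l + (s.len + r)) fun i => contextMap l m s.len φ (g i) where
  zero := (contextMap_of_le (hg.zero.le.trans (Nat.zero_le l))).trans hg.zero
  mono := fun _ _ hij => h.contextMap_mono l (hg.mono hij)
  last := fun i hi => by
    rw [hg.last i hi, ← Nat.add_assoc, h.contextMap_add_add, Nat.add_assoc]

/-- The generators in degree `n`: a word `w` together with a vertex map `[n] ⟶ [w.len]`. -/
structure Gen (n : ℕ) (a b : A.Ob) : Type u where
  word : A.Word a b
  map : ℕ → ℕ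
  isVertexMap : IsVertexMap n word.len map

open scoped Classical in
/-- The element of the free module on the generators given by a word and a vertex map. -/
noncomputable def preOf (k : Type u) [CommRing k] {A : NarrowCat k} (n : ℕ) {a b : A.Ob}
    (w : A.Word a b) (g : ℕ → ℕ) : Gen n a b →₀ k :=
  if h : IsVertexMap n w.len g then Finsupp.single ⟨w, g, h⟩ 1 else 0

/-- The relations between generators: they are linear in each letter and invariant under
reductions. -/
inductive Rel (n : ℕ) (a b : A.Ob) : (Gen n a b →₀ k) → Prop
  | lin {c d : A.Ob} {m : ℕ} (u : A.Word a c) (x y : (A.hom c d).deg m) (r : k) (v : A.Word d b)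
      (g : ℕ → ℕ) (hg : IsVertexMap n (u.len + (m + 1 + v.len)) g) :
      Rel n a b (preOf k n (u.append (cons m (x + r • y) v)) g -
        (preOf k n (u.append (cons m x v)) g + r • preOf k n (u.append (cons m y v)) g))
  | red {c d : A.Ob} {m : ℕ} {z : (A.hom c d).deg m} {s : A.Word c d} {φ : ℕ → ℕ} (h : Red A z s φ)
      (u : A.Word a c) (v : A.Word d b) (g : ℕ → ℕ)
      (hg : IsVertexMap n (u.len + (m + 1 + v.len)) g) :
      Rel n a b (preOf k n (u.append (cons m z v)) g -
        preOf k n (u.append (s.append v)) fun i => contextMap u.len m s.len φ (g i))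

/-- The module of `n`-simplices of the Frobenius templicial module freely generated by `A`. -/
def Free (n : ℕ) (a b : A.Ob) : Type u :=
  (Gen n a b →₀ k) ⧸ Submodule.span k {r | Rel n a b r}

noncomputable instance (n : ℕ) (a b : A.Ob) : AddCommGroup (Free n a b) :=
  inferInstanceAs (AddCommGroup ((Gen n a b →₀ k) ⧸ Submodule.span k {r | Rel n a b r}))

noncomputable instance (n : ℕ) (a b : A.Ob) : Module k (Free n a b) :=
  inferInstanceAs (Module k ((Gen n a b →₀ k) ⧸ Submodule.span k {r | Rel n a b r}))

namespace Free

variable {a b c d : A.Ob} {n : ℕ}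

/-- The simplex given by a word and a vertex map; it is zero if the map of natural numbers is not a
vertex map. -/
noncomputable def of (n : ℕ) (w : A.Word a b) (g : ℕ → ℕ) : Free n a b :=
  Submodule.Quotient.mk (preOf k n w g)

theorem of_lin {m : ℕ} (u : A.Word a c) (x y : (A.hom c d).deg m) (r : k) (v : A.Word d b)
    {g : ℕ → ℕ} (hg : IsVertexMap n (u.len + (m + 1 + v.len)) g) :
    of n (u.append (cons m (x + r • y) v)) g =
      of n (u.append (cons m x v)) g + r • of n (u.append (cons m y v)) g :=
  (Submodule.Quotient.eq _).2 (Submodule.subset_span (Rel.lin u x y r v g hg))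

theorem of_red {m : ℕ} {z : (A.hom c d).deg m} {s : A.Word c d} {φ : ℕ → ℕ} (h : Red A z s φ)
    (u : A.Word a c) (v : A.Word d b) {g : ℕ → ℕ}
    (hg : IsVertexMap n (u.len + (m + 1 + v.len)) g) :
    of n (u.append (cons m z v)) g =
      of n (u.append (s.append v)) fun i => contextMap u.len m s.len φ (g i) :=
  (Submodule.Quotient.eq _).2 (Submodule.subset_span (Rel.red h u v g hg))

section

variable {M : Type*} [AddCommGroup M] [Module k M]

/-- Linear maps that agree on the generators are equal. -/
theorem ext {f g : Free n a b →ₗ[k] M}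
    (h : ∀ (w : A.Word a b) v, IsVertexMap n w.len v → f (of n w v) = g (of n w v)) : f = g := by
  refine Submodule.linearMap_qext _ (Finsupp.lhom_ext' fun w => LinearMap.ext_ring ?_)
  have := h w.word w.map w.isVertexMap
  rw [of, preOf, dif_pos w.isVertexMap] at this
  exact this

/-- The linear map given by its values on the generators. -/
noncomputable def desc (F : A.Word a b → (ℕ → ℕ) → M)
    (lin : ∀ (c d : A.Ob) m (u : A.Word a c) (x y : (A.hom c d).deg m) (r : k) (v : A.Word d b)
      (g : ℕ → ℕ), IsVertexMap n (u.len + (m + 1 + v.len)) g →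
      F (u.append (cons m (x + r • y) v)) g =
        F (u.append (cons m x v)) g + r • F (u.append (cons m y v)) g)
    (red : ∀ (c d : A.Ob) m (z : (A.hom c d).deg m) s φ, Red A z s φ → ∀ (u : A.Word a c)
      (v : A.Word d b) (g : ℕ → ℕ), IsVertexMap n (u.len + (m + 1 + v.len)) g →
      F (u.append (cons m z v)) g =
        F (u.append (s.append v)) fun i => contextMap u.len m s.len φ (g i)) :
    Free n a b →ₗ[k] M :=
  Submodule.liftQ _ (Finsupp.linearCombination k fun w => F w.word w.map) (by
    have key : ∀ w g, IsVertexMap n w.len g →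
        Finsupp.linearCombination k (fun w : Gen n a b => F w.word w.map) (preOf k n w g) =
          F w g := fun w g h => by
      rw [preOf, dif_pos h, Finsupp.linearCombination_single, one_smul]
    rw [Submodule.span_le]
    rintro _ (⟨u, x, y, r, v, g, hg⟩ | ⟨h, u, v, g, hg⟩)
    · rw [SetLike.mem_coe, LinearMap.mem_ker, map_sub, map_add, map_smul,
        key _ _ (by simpa using hg),
        key _ _ (by simpa using hg), key _ _ (by simpa using hg), lin _ _ _ _ _ _ _ _ _ hg,
          sub_self]
    · rw [SetLike.mem_coe, LinearMap.mem_ker, map_sub, key _ _ (by simpa using hg),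
        key _ _ (by simpa using hg.contextMap h), red _ _ _ _ _ _ h _ _ _ hg, sub_self])

theorem desc_of {F : A.Word a b → (ℕ → ℕ) → M} {lin red} {w : A.Word a b} {g : ℕ → ℕ}
    (h : IsVertexMap n w.len g) : desc (n := n) F lin red (of n w g) = F w g := by
  refine (Submodule.liftQ_apply _ _ _).trans ?_
  rw [preOf, dif_pos h, Finsupp.linearCombination_single, one_smul]

end

/-- The action of a map of intervals: precomposition of the vertex maps. -/
noncomputable def act {m n : ℕ} (f : (⟨m⟩ : FinInterval) ⟶ ⟨n⟩) (a b : A.Ob) :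
    Free n a b →ₗ[k] Free m a b :=
  desc (fun w g => of m w fun i => g (FinInterval.Hom.nat f i))
    (fun _ _ _ u x y r v _ hg => of_lin u x y r v (hg.comp_nat f))
    (fun _ _ _ _ _ _ h u v _ hg => of_red h u v (hg.comp_nat f))

theorem act_of {m n : ℕ} (f : (⟨m⟩ : FinInterval) ⟶ ⟨n⟩) {w : A.Word a b} {g : ℕ → ℕ}
    (h : IsVertexMap n w.len g) :
    act f a b (of n w g) = of m w fun i => g (FinInterval.Hom.nat f i) :=
  desc_of h

/-- The product of a generator with a simplex: concatenation of words. -/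
noncomputable def mulOf (p q : ℕ) {a c : A.Ob} (b : A.Ob) (w : A.Word a c) (g : ℕ → ℕ)
    (hg : IsVertexMap p w.len g) : Free q c b →ₗ[k] Free (p + q) a b :=
  desc (fun w' g' => of (p + q) (w.append w') (glueVertex p w.len g g'))
    (fun c d m u x y r v g' hg' => by
      have h := hg.glue hg'
      rw [← append_assoc, ← append_assoc, ← append_assoc]
      exact of_lin _ x y r v (by rw [len_append]; simpa only [Nat.add_assoc] using h))
    (fun c d m z s φ h u v g' hg' => by
      have h' := hg.glue hg'
      rw [← append_assoc, ← append_assoc]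
      refine (of_red h _ v (by rw [len_append]; simpa only [Nat.add_assoc] using h')).trans
        (congrArg (of (p + q) _) (funext fun i => ?_))
      rw [len_append]
      by_cases hi : i ≤ p
      · rw [glueVertex_of_le hi, glueVertex_of_le hi,
          contextMap_of_le ((hg.le i).trans (Nat.le_add_right _ _))]
      · rw [glueVertex, glueVertex, if_neg hi, if_neg hi, contextMap_shift])

theorem mulOf_of {p q : ℕ} {w : A.Word a c} {w' : A.Word c b} {g g' : ℕ → ℕ}
    (hg : IsVertexMap p w.len g) (hg' : IsVertexMap q w'.len g') :
    mulOf p q b w g hg (of q w' g') = of (p + q) (w.append w') (glueVertex p w.len g g') :=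
  desc_of hg'

open scoped Classical in
/-- The multiplication: concatenation of words. -/
noncomputable def mul (a c b : A.Ob) (p q : ℕ) :
    Free p a c →ₗ[k] Free q c b →ₗ[k] Free (p + q) a b :=
  desc (fun w g => if hg : IsVertexMap p w.len g then mulOf p q b w g hg else 0)
    (fun c d m u x y r v g hg => by
      rw [dif_pos (by simpa using hg), dif_pos (by simpa using hg), dif_pos (by simpa using hg)]
      refine ext fun w' g' hg' => ?_
      rw [LinearMap.add_apply, LinearMap.smul_apply, mulOf_of _ hg', mulOf_of _ hg',
        mulOf_of _ hg', append_assoc, append_assoc, append_assoc, len_append, len_append,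
        len_append, len_cons, len_cons, len_cons]
      have h := hg.glue hg'
      exact of_lin u x y r (v.append w') (by rw [len_append]; simpa only [Nat.add_assoc] using h))
    (fun c d m z s φ h u v g hg => by
      have hg2 := hg.contextMap h
      rw [dif_pos (by simpa using hg), dif_pos (by simpa using hg2)]
      refine ext fun w' g' hg' => ?_
      rw [mulOf_of _ hg', mulOf_of _ hg', append_assoc, append_assoc, append_assoc, len_append,
        len_append, len_append, len_cons]
      have h' := hg.glue hg'
      refine (of_red h u (v.append w') (by
        rw [len_append]; simpa only [Nat.add_assoc] using h')).trans
        (congrArg (of (p + q) _) (funext fun i => ?_))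
      by_cases hi : i ≤ p
      · rw [glueVertex_of_le hi, glueVertex_of_le hi]
      · rw [glueVertex, glueVertex, if_neg hi, if_neg hi,
          show u.len + (m + 1 + v.len) + g' (i - p) = u.len + (m + 1) + (v.len + g' (i - p)) by lia,
          h.contextMap_add_add]
        lia)

theorem mul_of {p q : ℕ} {w : A.Word a c} {w' : A.Word c b} {g g' : ℕ → ℕ}
    (hg : IsVertexMap p w.len g) (hg' : IsVertexMap q w'.len g') :
    mul a c b p q (of p w g) (of q w' g') = of (p + q) (w.append w') (glueVertex p w.len g g') := by
  rw [mul, desc_of hg, dif_pos hg, mulOf_of hg hg']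

end Free

end NarrowCat

/-! ### The comultiplication on the free module -/

namespace NarrowCat

open Word

variable {k : Type u} [CommRing k] (A : NarrowCat k)

/-- The quiver of `n`-simplices of the free Frobenius templicial module. -/
noncomputable def freeQuiver (n : ℕ) : ModQuiver A.Ob k := ⟨fun a b => ModuleCat.of k (Free n a b)⟩

/-- The tensor product of two quivers of simplices. -/
noncomputable abbrev freeTensor (p q : ℕ) : ModQuiver A.Ob k :=
  ModQuiver.tensorObj (A.freeQuiver p) (A.freeQuiver q)

variable {A}

namespace Free

variable {a b c d : A.Ob} {n : ℕ}

/-- The simple tensors of simplices. -/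
noncomputable def tmul (a c b : A.Ob) (p q : ℕ) :
    Free p a c →ₗ[k] Free q c b →ₗ[k] (A.freeTensor p q).obj a b :=
  ModQuiver.tmul (A.freeQuiver p) (A.freeQuiver q) a c b

/-- The comultiplication of a generator: the vertex map is cut at the vertex `p` if it is mapped to
an endpoint of a letter. -/
noncomputable def comulOf (p q : ℕ) {a b : A.Ob} (w : A.Word a b) (g : ℕ → ℕ) :
    (A.freeTensor p q).obj a b :=
  (w.split (g p)).elim 0 fun s => tmul a s.1 b p q (of p s.2.1 fun i => g (min i p))
    (of q s.2.2 fun j => g (p + j) - g p)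

theorem comulOf_eq_zero {p q : ℕ} {w : A.Word a b} {g : ℕ → ℕ} (h : w.split (g p) = none) :
    comulOf p q w g = 0 := by
  rw [comulOf, h]
  rfl

theorem comulOf_append {p q : ℕ} (u : A.Word a c) (v : A.Word c b) {g : ℕ → ℕ} (h : g p = u.len) :
    comulOf p q (u.append v) g = tmul a c b p q (of p u fun i => g (min i p))
      (of q v fun j => g (p + j) - g p) := by
  rw [comulOf, h, split_append_len]
  rfl

/-- The position of a vertex relative to a letter in a word. -/
theorem vertex_cases {a c d b : A.Ob} {l : ℕ} (u : A.Word a c) (v : A.Word d b) (t : ℕ)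
    {P : Prop}
    (left : ∀ e (u₁ : A.Word a e) (u₂ : A.Word e c), u = u₁.append u₂ → t = u₁.len → P)
    (left_none : t ≤ u.len → u.split t = none → P)
    (mid : ∀ i, 0 < i → i ≤ l → t = u.len + i → P)
    (right : ∀ e (v₁ : A.Word d e) (v₂ : A.Word e b), v = v₁.append v₂ →
      t = u.len + (l + 1) + v₁.len → P)
    (right_none : ∀ j, t = u.len + (l + 1) + j → v.split j = none → P) : P := by
  by_cases h1 : t ≤ u.len
  · cases h : u.split t with
    | none => exact left_none h1 h
    | some s =>
      obtain ⟨e, u₁, u₂⟩ := s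
      obtain ⟨h2, h3⟩ := eq_append_of_split h
      exact left e u₁ u₂ h2 h3.symm
  by_cases h2 : t ≤ u.len + l
  · exact mid (t - u.len) (by lia) (by lia) (by lia)
  · have ht : t = u.len + (l + 1) + (t - (u.len + (l + 1))) := by lia
    cases h : v.split (t - (u.len + (l + 1))) with
    | none => exact right_none _ ht h
    | some s =>
      obtain ⟨e, v₁, v₂⟩ := s
      obtain ⟨h3, h4⟩ := eq_append_of_split h
      exact right e v₁ v₂ h3 (by rw [h4]; exact ht)

theorem split_left_none (u : A.Word a c) (w : A.Word c b) {t : ℕ} (h : t ≤ u.len)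
    (h' : u.split t = none) : (u.append w).split t = none := by
  rw [split_append_of_le u w h, h']
  rfl

theorem split_mid_none {m i : ℕ} (u : A.Word a c) (x : (A.hom c d).deg m) (v : A.Word d b)
    (h : 0 < i) (h' : i ≤ m) : (u.append (cons m x v)).split (u.len + i) = none := by
  rw [split_append_add, split_cons_of_le x v h h']
  rfl

theorem split_right_none {m j : ℕ} (u : A.Word a c) (x : (A.hom c d).deg m) (v : A.Word d b)
    (h : v.split j = none) : (u.append (cons m x v)).split (u.len + (m + 1) + j) = none := by
  rw [Nat.add_assoc, split_append_add, split_cons_add, h]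
  rfl

theorem append_cons_append {m : ℕ} (u : A.Word a c) (x : (A.hom c d).deg m) {e : A.Ob}
    (v₁ : A.Word d e) (v₂ : A.Word e b) :
    u.append (cons m x (v₁.append v₂)) = (u.append (cons m x v₁)).append v₂ := by
  rw [append_assoc, cons_append]

/-- The comultiplication respects the linearity relations. -/
theorem comulOf_lin {p q m : ℕ} (u : A.Word a c) (x y : (A.hom c d).deg m) (r : k)
    (v : A.Word d b) {g : ℕ → ℕ} (hg : IsVertexMap (p + q) (u.len + (m + 1 + v.len)) g) :
    comulOf p q (u.append (cons m (x + r • y) v)) g =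
      comulOf p q (u.append (cons m x v)) g + r • comulOf p q (u.append (cons m y v)) g := by
  refine vertex_cases (l := m) u v (g p) (fun e u₁ u₂ hu ht => ?_) (fun ht hu => ?_)
    (fun i h0 hi ht => ?_) (fun e v₁ v₂ hv ht => ?_) (fun j ht hv => ?_)
  · subst hu
    have h2 := hg.right (p := p) (q := q) le_rfl
    rw [append_assoc, append_assoc, append_assoc, comulOf_append _ _ ht, comulOf_append _ _ ht,
      comulOf_append _ _ ht, of_lin u₂ x y r v (by
        rw [len_append, ht, Nat.add_assoc, Nat.add_sub_cancel_left] at h2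
        rwa [ht]), map_add, map_smul]
  · rw [comulOf_eq_zero (split_left_none _ _ ht hu), comulOf_eq_zero (split_left_none _ _ ht hu),
      comulOf_eq_zero (split_left_none _ _ ht hu), smul_zero, add_zero]
  · rw [comulOf_eq_zero (ht ▸ split_mid_none u _ v h0 hi),
      comulOf_eq_zero (ht ▸ split_mid_none u _ v h0 hi),
      comulOf_eq_zero (ht ▸ split_mid_none u _ v h0 hi), smul_zero, add_zero]
  · subst hv
    have h1 := hg.left (p := p)
    have ht' : g p = u.len + (m + 1 + v₁.len) := by lia
    rw [append_cons_append, append_cons_append, append_cons_append,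
      comulOf_append _ _ (by simpa using ht'), comulOf_append _ _ (by simpa using ht'),
      comulOf_append _ _ (by simpa using ht'), of_lin u x y r v₁ (ht' ▸ h1), map_add, map_smul,
      LinearMap.add_apply, LinearMap.smul_apply]
  · rw [comulOf_eq_zero (ht ▸ split_right_none u _ v hv),
      comulOf_eq_zero (ht ▸ split_right_none u _ v hv),
      comulOf_eq_zero (ht ▸ split_right_none u _ v hv), smul_zero, add_zero]

/-- The comultiplication respects reductions: these do not affect at which vertices a word can be
cut, and the reduced letter lies in one of the two parts. -/
theorem comulOf_red {p q m : ℕ} {z : (A.hom c d).deg m} {s : A.Word c d} {φ : ℕ → ℕ}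
    (h : Red A z s φ) (u : A.Word a c) (v : A.Word d b) {g : ℕ → ℕ}
    (hg : IsVertexMap (p + q) (u.len + (m + 1 + v.len)) g) :
    comulOf p q (u.append (cons m z v)) g =
      comulOf p q (u.append (s.append v)) fun i => contextMap u.len m s.len φ (g i) := by
  refine vertex_cases (l := m) u v (g p) (fun e u₁ u₂ hu ht => ?_) (fun ht hu => ?_)
    (fun i h0 hi ht => ?_) (fun e v₁ v₂ hv ht => ?_) (fun j ht hv => ?_)
  · subst hu
    have h2 := hg.right (p := p) (q := q) le_rfl
    have hc : contextMap (u₁.append u₂).len m s.len φ (g p) = g p :=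
      contextMap_of_le (by rw [len_append]; lia)
    rw [append_assoc, append_assoc, comulOf_append _ _ ht, comulOf_append _ _ (g := fun i =>
      contextMap _ m s.len φ (g i)) (hc.trans ht), hc]
    refine congrArg₂ (fun x y => tmul a e b p q x y) (congrArg (of p u₁) (funext fun i => ?_)) ?_
    · exact (contextMap_of_le (by
        have := hg.mono (min_le_right i p)
        rw [len_append]; lia)).symm
    · rw [of_red h u₂ v (by
        rw [len_append, ht, Nat.add_assoc, Nat.add_sub_cancel_left] at h2
        rwa [ht])]
      refine congrArg (of q _) (funext fun j => ?_)
      have h3 := hg.mono (Nat.le_add_right p j)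
      obtain ⟨t, ht'⟩ : ∃ t, g (p + j) = u₁.len + t := ⟨g (p + j) - u₁.len, by lia⟩
      rw [ht', ht, len_append, contextMap_shift, Nat.add_sub_cancel_left, Nat.add_sub_cancel_left]
  · rw [comulOf_eq_zero (split_left_none _ _ ht hu), comulOf_eq_zero]
    rw [contextMap_of_le ht]
    exact split_left_none _ _ ht hu
  · rw [comulOf_eq_zero (ht ▸ split_mid_none u _ v h0 hi), comulOf_eq_zero]
    rw [ht, h.contextMap_add u.len (by lia), split_append_add,
      split_append_of_le s v (h.le_len (by lia)), h.split_eq_none h0 hi]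
    rfl
  · subst hv
    have h1 := hg.left (p := p)
    have ht' : g p = u.len + (m + 1 + v₁.len) := by lia
    have hc : contextMap u.len m s.len φ (g p) = u.len + s.len + v₁.len := by
      rw [ht, h.contextMap_add_add]
    rw [append_cons_append, comulOf_append _ _ (by simpa using ht'),
      of_red h u v₁ (ht' ▸ h1), show u.append (s.append (v₁.append v₂)) =
        (u.append (s.append v₁)).append v₂ by rw [append_assoc, append_assoc],
      comulOf_append _ _ (g := fun i => contextMap _ m s.len φ (g i))
        (by rw [hc, len_append, len_append, Nat.add_assoc])]
    refine congrArg (fun y => tmul a e b p q _ y) (congrArg (of q v₂) (funext fun j => ?_))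
    have h3 := hg.mono (Nat.le_add_right p j)
    obtain ⟨t, ht''⟩ : ∃ t, g (p + j) = u.len + (m + 1) + (v₁.len + t) :=
      ⟨g (p + j) - g p, by lia⟩
    rw [hc, ht'', h.contextMap_add_add, ht]
    lia
  · rw [comulOf_eq_zero (ht ▸ split_right_none u _ v hv), comulOf_eq_zero]
    rw [ht, h.contextMap_add_add, Nat.add_assoc, split_append_add, split_append_add, hv]
    rfl

/-- The comultiplication of simplices. -/
noncomputable def comul (a b : A.Ob) (p q : ℕ) :
    Free (p + q) a b →ₗ[k] (A.freeTensor p q).obj a b :=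
  desc (comulOf p q) (fun _ _ _ u x y r v _ hg => comulOf_lin u x y r v hg)
    (fun _ _ _ _ _ _ h u v _ hg => comulOf_red h u v hg)

theorem comul_of {p q : ℕ} {w : A.Word a b} {g : ℕ → ℕ} (h : IsVertexMap (p + q) w.len g) :
    comul a b p q (of (p + q) w g) = comulOf p q w g :=
  desc_of h

/-- The counit of a word: only the empty word contributes. -/
noncomputable def counitOf {a b : A.Ob} : A.Word a b → (ModQuiver.tensorUnit A.Ob k).obj a b
  | nil a => ModQuiver.one a
  | cons _ _ _ => 0

theorem counitOf_append_cons {m : ℕ} (u : A.Word a c) (x : (A.hom c d).deg m) (v : A.Word d b) :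
    counitOf (u.append (cons m x v)) = 0 := by
  cases u <;> rfl

/-- The counit of simplices of degree zero. -/
noncomputable def counit (a b : A.Ob) : Free 0 a b →ₗ[k] (ModQuiver.tensorUnit A.Ob k).obj a b :=
  desc (fun w _ => counitOf w)
    (fun _ _ _ u x y r v _ _ => by
      rw [counitOf_append_cons, counitOf_append_cons, counitOf_append_cons, smul_zero, add_zero])
    (fun _ _ m _ _ _ _ u v g hg => by
      have := hg.last 0 le_rfl
      rw [hg.zero] at this
      lia)

theorem isVertexMap_zero (n : ℕ) (a : A.Ob) : IsVertexMap n (nil a : A.Word a a).len fun _ => 0 :=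
  ⟨rfl, fun _ _ _ => le_rfl, fun _ _ => rfl⟩

/-- The unit of degree zero. -/
noncomputable def one (a : A.Ob) : Free 0 a a := of 0 (nil a) fun _ => 0

theorem counit_one (a : A.Ob) : counit a a (one a) = ModQuiver.one a :=
  desc_of (isVertexMap_zero 0 a)

/-- The only generators of degree zero are the units. -/
theorem ext_zero {M : Type*} [AddCommGroup M] [Module k M] {f g : Free 0 a b →ₗ[k] M}
    (h : ∀ e : a = b, f (e ▸ one a) = g (e ▸ one a)) : f = g := by
  refine ext fun w v hv => ?_
  have hw : w.len = 0 := by rw [← hv.last 0 le_rfl, hv.zero]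
  obtain rfl : v = fun _ => 0 := funext fun i => by rw [hv.last i (Nat.zero_le i), hw]
  clear hv
  cases w with
  | nil => exact h rfl
  | cons n x w => rw [len_cons] at hw; lia

/-- Linear maps out of a tensor product that agree on pairs of generators are equal. -/
theorem tensor_ext {p q : ℕ} {M : Type u} [AddCommGroup M] [Module k M]
    {f g : (A.freeTensor p q).obj a b →ₗ[k] M}
    (h : ∀ c (w : A.Word a c) (v) (w' : A.Word c b) (v'), IsVertexMap p w.len v →
      IsVertexMap q w'.len v' → f (tmul a c b p q (of p w v) (of q w' v')) =
        g (tmul a c b p q (of p w v) (of q w' v'))) : f = g := by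
  have h1 : ∀ c, (tmul a c b p q).compr₂ f = (tmul a c b p q).compr₂ g := fun c =>
    ext fun w v hv => ext fun w' v' hv' => h c w v w' v' hv hv'
  exact ModQuiver.tensor_ext fun c x y => LinearMap.congr_fun₂ (h1 c) x y

end Free

end NarrowCat

/-! ### The multiplication on the free module -/

namespace FinInterval

theorem nat_sum {m₁ m₂ p q : ℕ} (u : (⟨m₁⟩ : FinInterval) ⟶ ⟨p⟩) (v : (⟨m₂⟩ : FinInterval) ⟶ ⟨q⟩)
    (i : ℕ) : Hom.nat (sum rfl rfl u v) i =
      if i ≤ m₁ then Hom.nat u i else p + Hom.nat v (i - m₁) := by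
  have h := isSum_sum rfl rfl u v
  by_cases hi : i ≤ m₁ + m₂
  · exact h.nat_eq i hi
  · rw [Hom.nat_of_len_le _ (by dsimp only; lia), if_neg (by lia),
      Hom.nat_of_len_le v (by dsimp only; lia)]

theorem nat_sum_add {m₁ m₂ p q : ℕ} (u : (⟨m₁⟩ : FinInterval) ⟶ ⟨p⟩)
    (v : (⟨m₂⟩ : FinInterval) ⟶ ⟨q⟩) (j : ℕ) :
    Hom.nat (sum rfl rfl u v) (m₁ + j) = p + Hom.nat v j := by
  rw [nat_sum]
  split_ifs with h
  · obtain rfl : j = 0 := by lia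
    rw [Nat.add_zero, Hom.nat_self, Hom.nat_zero, Nat.add_zero]
  · rw [Nat.add_sub_cancel_left]

end FinInterval

namespace NarrowCat

open Word

variable {k : Type u} [CommRing k] {A : NarrowCat k}

namespace Free

variable {a b c d : A.Ob} {n : ℕ}

theorem glue_append {p q : ℕ} {w : A.Word a c} {w' : A.Word c b} {g g' : ℕ → ℕ}
    (hg : IsVertexMap p w.len g) (hg' : IsVertexMap q w'.len g') :
    IsVertexMap (p + q) (w.append w').len (glueVertex p w.len g g') :=
  (len_append w w').symm ▸ hg.glue hg'

theorem act_cast_of {m n : ℕ} (h : m = n) {w : A.Word a b} {g : ℕ → ℕ}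
    (hg : IsVertexMap n w.len g) : act (FinInterval.cast h) a b (of n w g) = of m w g := by
  subst h
  rw [act_of _ hg]
  refine congrArg (of m w) (funext fun i => ?_)
  by_cases hi : i ≤ m
  · rw [FinInterval.nat_cast _ hi]
  · rw [FinInterval.Hom.nat_of_len_le _ (by dsimp only; lia), hg.last i (by lia), hg.last m le_rfl]

theorem comulOf_cases {p : ℕ} {w : A.Word a b} {g : ℕ → ℕ} {P : Prop}
    (none : w.split (g p) = none → P)
    (some : ∀ c (u : A.Word a c) (v : A.Word c b), w = u.append v → g p = u.len → P) : P := by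
  cases h : w.split (g p) with
  | none => exact none h
  | some s =>
    obtain ⟨c, u, v⟩ := s
    obtain ⟨h1, h2⟩ := eq_append_of_split h
    exact some c u v h1 h2.symm

/-- The action on the free Frobenius templicial module as a morphism of quivers. -/
noncomputable def actHom {m n : ℕ} (f : (⟨m⟩ : FinInterval) ⟶ ⟨n⟩) :
    A.freeQuiver n ⟶ A.freeQuiver m :=
  ⟨fun a b => ModuleCat.ofHom (act f a b)⟩

/-- The unit as a morphism of quivers. -/
noncomputable def unitHom : ModQuiver.tensorUnit A.Ob k ⟶ A.freeQuiver 0 :=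
  ⟨fun a b => ModuleCat.ofHom (ModQuiver.unitDesc (M := Free 0 a b) fun h => h ▸ one a)⟩

/-- The counit as a morphism of quivers. -/
noncomputable def counitHom : A.freeQuiver 0 ⟶ ModQuiver.tensorUnit A.Ob k :=
  ⟨fun a b => ModuleCat.ofHom (counit a b)⟩

/-- The multiplication as a morphism of quivers. -/
noncomputable def multHom (p q : ℕ) : A.freeTensor p q ⟶ A.freeQuiver (p + q) :=
  ⟨fun a b => ModuleCat.ofHom (ModQuiver.tensorDesc (M := Free (p + q) a b) fun c => mul a c b p q)⟩

/-- The comultiplication as a morphism of quivers. -/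
noncomputable def comultHom (p q : ℕ) : A.freeQuiver (p + q) ⟶ A.freeTensor p q :=
  ⟨fun a b => ModuleCat.ofHom (comul a b p q)⟩

theorem unitHom_one (a : A.Ob) : (unitHom.app a a).hom (ModQuiver.one a) = one (A := A) a :=
  ModQuiver.unitDesc_one (M := Free 0 a a) _

theorem multHom_tmul {a c b : A.Ob} {p q : ℕ} (x : Free p a c) (y : Free q c b) :
    ((multHom p q).app a b).hom (tmul a c b p q x y) = mul a c b p q x y :=
  ModQuiver.tensorDesc_tmul (M := Free (p + q) a b) _ _ _ _

theorem tensorHom_tmul {p q p' q' : ℕ} (f : A.freeQuiver p ⟶ A.freeQuiver p')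
    (g : A.freeQuiver q ⟶ A.freeQuiver q') {a c b : A.Ob} (x : Free p a c) (y : Free q c b) :
    ((ModQuiver.tensorHom f g).app a b).hom (tmul a c b p q x y) =
      tmul a c b p' q' ((f.app a c).hom x) ((g.app c b).hom y) :=
  ModQuiver.tensorHom_tmul f g a c b x y

theorem multHom_natural {p q p' q' : ℕ} (u : (⟨p⟩ : FinInterval) ⟶ ⟨p'⟩)
    (v : (⟨q⟩ : FinInterval) ⟶ ⟨q'⟩) :
    ModQuiver.tensorHom (actHom (A := A) u) (actHom v) ≫ multHom p q =
      multHom p' q' ≫ actHom (FinInterval.sum rfl rfl u v) :=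
  ModQuiver.hom_ext' fun a b => tensor_ext fun c w g w' g' hg hg' => by
    refine (congrArg ((multHom p q).app a b).hom (tensorHom_tmul _ _ _ _)).trans
      ((multHom_tmul _ _).trans ?_)
    refine Eq.trans ?_ (congrArg (act (FinInterval.sum rfl rfl u v) a b)
      (multHom_tmul (of p' w g) (of q' w' g'))).symm
    refine (congrArg₂ (fun x y => mul a c b p q x y) (act_of u hg) (act_of v hg')).trans ?_
    rw [mul_of (hg.comp_nat u) (hg'.comp_nat v), mul_of hg hg', act_of _ (glue_append hg hg')]
    refine congrArg (of (p + q) _) (funext fun i => ?_)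
    by_cases hi : i ≤ p
    · rw [glueVertex_of_le hi, FinInterval.nat_sum, if_pos hi,
        glueVertex_of_le (FinInterval.Hom.nat_le u i)]
    · rw [glueVertex, if_neg hi, FinInterval.nat_sum, if_neg hi,
        glueVertex_add (hg.last p' le_rfl) hg'.zero]

theorem multHom_assoc (p q r : ℕ) :
    ModQuiver.tensorHom (multHom p q) (𝟙 (A.freeQuiver r)) ≫ multHom (p + q) r ≫
      actHom (FinInterval.cast (Nat.add_assoc p q r).symm) =
    ModQuiver.assocHom (A.freeQuiver p) (A.freeQuiver q) (A.freeQuiver r) ≫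
      ModQuiver.tensorHom (𝟙 (A.freeQuiver p)) (multHom q r) ≫ multHom p (q + r) :=
  ModQuiver.hom_ext' fun a b => ModQuiver.tensor_ext₃ fun c d x y z => by
    have key : act (FinInterval.cast (Nat.add_assoc p q r).symm) a b
        (mul a d b (p + q) r (mul a c d p q x y) z) =
          mul a c b p (q + r) x (mul c d b q r y z) := by
      refine LinearMap.congr_fun (f := act (FinInterval.cast (Nat.add_assoc p q r).symm) a b ∘ₗ
        (mul a d b (p + q) r).flip z ∘ₗ (mul a c d p q).flip y)
        (g := (mul a c b p (q + r)).flip (mul c d b q r y z)) (ext fun w g hg => ?_) x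
      refine LinearMap.congr_fun (f := act (FinInterval.cast (Nat.add_assoc p q r).symm) a b ∘ₗ
        (mul a d b (p + q) r).flip z ∘ₗ mul a c d p q (of p w g))
        (g := mul a c b p (q + r) (of p w g) ∘ₗ (mul c d b q r).flip z) (ext fun w' g' hg' => ?_) y
      refine LinearMap.congr_fun (f := act (FinInterval.cast (Nat.add_assoc p q r).symm) a b ∘ₗ
        mul a d b (p + q) r (mul a c d p q (of p w g) (of q w' g')))
        (g := mul a c b p (q + r) (of p w g) ∘ₗ mul c d b q r (of q w' g'))
        (ext fun w'' g'' hg'' => ?_) z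
      change act _ a b (mul a d b (p + q) r (mul a c d p q (of p w g) (of q w' g'))
        (of r w'' g'')) = mul a c b p (q + r) (of p w g) (mul c d b q r (of q w' g') (of r w'' g''))
      rw [mul_of hg hg', mul_of hg' hg'', mul_of hg (glue_append hg' hg''),
        mul_of (glue_append hg hg') hg'', act_cast_of _ (glue_append (glue_append hg hg') hg''),
        append_assoc]
      refine congrArg (of (p + (q + r)) _) (funext fun i => ?_)
      rw [len_append]
      unfold glueVertex
      split_ifs with h1 h2 h3 h4 h5 <;> try lia
    refine Eq.trans ?_ (key.trans ?_)
    · refine congrArg (act (FinInterval.cast (Nat.add_assoc p q r).symm) a b) ?_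
      refine (congrArg ((multHom (p + q) r).app a b).hom
        (ModQuiver.tensorHom_tmul (multHom p q) (𝟙 (A.freeQuiver r)) a d b _ z)).trans ?_
      exact (multHom_tmul (p := p + q) (q := r) _ z).trans
        (congrArg (fun t => mul a d b (p + q) r t z) (multHom_tmul x y))
    · refine Eq.symm ?_
      refine (congrArg (fun t => ((multHom p (q + r)).app a b).hom
        (((ModQuiver.tensorHom (𝟙 (A.freeQuiver p)) (multHom q r)).app a b).hom t))
        (ModQuiver.assocHom_tmul (A.freeQuiver p) (A.freeQuiver q) (A.freeQuiver r) a c d b x y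
          z)).trans ?_
      refine (congrArg ((multHom p (q + r)).app a b).hom
        (ModQuiver.tensorHom_tmul (𝟙 (A.freeQuiver p)) (multHom q r) a c b x _)).trans ?_
      exact (multHom_tmul (p := p) (q := q + r) x _).trans
        (congrArg (mul a c b p (q + r) x) (multHom_tmul y z))

theorem unit_multHom (p : ℕ) : ModQuiver.leftUnitorHom (A.freeQuiver p) =
    ModQuiver.tensorHom unitHom (𝟙 (A.freeQuiver p)) ≫ multHom 0 p ≫
      actHom (FinInterval.cast (Nat.zero_add p).symm) :=
  ModQuiver.hom_ext' fun a b => ModQuiver.tensor_ext_left fun x => by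
    refine (ModQuiver.leftUnitorHom_tmul (A.freeQuiver p) a b x).trans ?_
    have key : act (FinInterval.cast (Nat.zero_add p).symm) a b (mul a a b 0 p (one a) x) = x :=
      LinearMap.congr_fun (f := act (FinInterval.cast (Nat.zero_add p).symm) a b ∘ₗ
        mul a a b 0 p (one a)) (g := LinearMap.id) (ext fun w g hg => by
          change act _ a b (mul a a b 0 p (of 0 (nil a) fun _ => 0) (of p w g)) = of p w g
          rw [mul_of (isVertexMap_zero 0 a) hg,
            act_cast_of _ (glue_append (isVertexMap_zero 0 a) hg)]
          refine congrArg (of p w) (funext fun i => ?_)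
          simpa using glueVertex_add (p := 0) (l := 0) (g := fun _ => 0) rfl hg.zero i) x
    refine key.symm.trans (congrArg (act (FinInterval.cast (Nat.zero_add p).symm) a b) ?_)
    refine Eq.symm ((congrArg ((multHom 0 p).app a b).hom (ModQuiver.tensorHom_tmul unitHom
      (𝟙 (A.freeQuiver p)) a a b (ModQuiver.one a) x)).trans ?_)
    exact (multHom_tmul _ x).trans (congrArg (fun t => mul a a b 0 p t x) (unitHom_one a))

theorem multHom_unit (p : ℕ) : ModQuiver.rightUnitorHom (A.freeQuiver p) =
    ModQuiver.tensorHom (𝟙 (A.freeQuiver p)) unitHom ≫ multHom p 0 ≫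
      actHom (FinInterval.cast (Nat.add_zero p).symm) :=
  ModQuiver.hom_ext' fun a b => ModQuiver.tensor_ext_right fun x => by
    refine (ModQuiver.rightUnitorHom_tmul (A.freeQuiver p) a b x).trans ?_
    have key : act (FinInterval.cast (Nat.add_zero p).symm) a b (mul a b b p 0 x (one b)) = x :=
      LinearMap.congr_fun (f := act (FinInterval.cast (Nat.add_zero p).symm) a b ∘ₗ
        (mul a b b p 0).flip (one b)) (g := LinearMap.id) (ext fun w g hg => by
          change act _ a b (mul a b b p 0 (of p w g) (of 0 (nil b) fun _ => 0)) = of p w g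
          rw [mul_of hg (isVertexMap_zero 0 b),
            act_cast_of _ (glue_append hg (isVertexMap_zero 0 b)), append_nil]
          refine congrArg (of p w) (funext fun i => ?_)
          by_cases hi : i ≤ p
          · rw [glueVertex_of_le hi]
          · rw [glueVertex, if_neg hi, hg.last i (by lia), Nat.add_zero]) x
    refine key.symm.trans (congrArg (act (FinInterval.cast (Nat.add_zero p).symm) a b) ?_)
    refine Eq.symm ((congrArg ((multHom p 0).app a b).hom (ModQuiver.tensorHom_tmul
      (𝟙 (A.freeQuiver p)) unitHom a b b x (ModQuiver.one b))).trans ?_)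
    exact (multHom_tmul x _).trans (congrArg (mul a b b p 0 x) (unitHom_one b))

end Free

end NarrowCat

/-! ### The free module is a Frobenius templicial module -/

namespace NarrowCat

open Word

variable {k : Type u} [CommRing k] {A : NarrowCat k}

namespace Free

variable {a b c d : A.Ob} {n : ℕ}

theorem isVertexMap_left {p q : ℕ} {u : A.Word a c} {v : A.Word c b} {g : ℕ → ℕ}
    (hg : IsVertexMap (p + q) (u.append v).len g) (h : g p = u.len) :
    IsVertexMap p u.len fun i => g (min i p) :=
  h ▸ hg.left

theorem isVertexMap_right {p q : ℕ} {u : A.Word a c} {v : A.Word c b} {g : ℕ → ℕ}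
    (hg : IsVertexMap (p + q) (u.append v).len g) (h : g p = u.len) :
    IsVertexMap q v.len fun j => g (p + j) - g p := by
  have h1 := hg.right (p := p) (q := q) le_rfl
  rwa [len_append, h, Nat.add_sub_cancel_left, ← h] at h1

theorem comultHom_natural {p q p' q' : ℕ} (u : (⟨p⟩ : FinInterval) ⟶ ⟨p'⟩)
    (v : (⟨q⟩ : FinInterval) ⟶ ⟨q'⟩) :
    comultHom p' q' ≫ ModQuiver.tensorHom (actHom (A := A) u) (actHom v) =
      actHom (FinInterval.sum rfl rfl u v) ≫ comultHom p q :=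
  ModQuiver.hom_ext' fun a b => ext fun w g hg => by
    change ((ModQuiver.tensorHom (actHom u) (actHom v)).app a b).hom
      (comul a b p' q' (of (p' + q') w g)) =
        comul a b p q (act (FinInterval.sum rfl rfl u v) a b (of (p' + q') w g))
    rw [act_of _ hg, comul_of hg, comul_of (hg.comp_nat _)]
    have hp : FinInterval.Hom.nat (FinInterval.sum rfl rfl u v) p = p' := by
      rw [FinInterval.nat_sum, if_pos le_rfl, FinInterval.Hom.nat_self]
    refine comulOf_cases (p := p') (w := w) (g := g) (fun h => ?_) (fun c w₁ w₂ hw h => ?_)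
    · rw [comulOf_eq_zero h, comulOf_eq_zero (by rw [hp]; exact h), map_zero]
    · subst hw
      rw [comulOf_append _ _ h, comulOf_append _ _ (by rw [hp]; exact h)]
      refine (tensorHom_tmul _ _ _ _).trans ?_
      refine (congrArg₂ (fun x y => tmul a c b p q x y) (act_of u (isVertexMap_left hg h))
        (act_of v (isVertexMap_right hg h))).trans ?_
      refine congrArg₂ (fun x y => tmul a c b p q x y) (congrArg (of p w₁) (funext fun i => ?_))
        (congrArg (of q w₂) (funext fun j => ?_))
      · rw [FinInterval.nat_sum, if_pos (min_le_right i p),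
          min_eq_left (FinInterval.Hom.nat_le u i)]
        by_cases hi : i ≤ p
        · rw [min_eq_left hi]
        · rw [min_eq_right (by lia), FinInterval.Hom.nat_of_len_le u (by dsimp only; lia),
            FinInterval.Hom.nat_self]
      · rw [FinInterval.nat_sum_add, hp]

theorem comultHom_assoc (p q r : ℕ) :
    comultHom (p + q) r ≫ ModQuiver.tensorHom (comultHom p q) (𝟙 (A.freeQuiver r)) ≫
      ModQuiver.assocHom (A.freeQuiver p) (A.freeQuiver q) (A.freeQuiver r) =
    actHom (FinInterval.cast (Nat.add_assoc p q r).symm) ≫ comultHom p (q + r) ≫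
      ModQuiver.tensorHom (𝟙 (A.freeQuiver p)) (comultHom q r) :=
  ModQuiver.hom_ext' fun a b => ext fun w g hg => by
    change ((ModQuiver.assocHom (A.freeQuiver p) (A.freeQuiver q) (A.freeQuiver r)).app a b).hom
      (((ModQuiver.tensorHom (comultHom p q) (𝟙 (A.freeQuiver r))).app a b).hom
        (comul a b (p + q) r (of (p + q + r) w g))) =
      ((ModQuiver.tensorHom (𝟙 (A.freeQuiver p)) (comultHom q r)).app a b).hom
        (comul a b p (q + r) (act (FinInterval.cast (Nat.add_assoc p q r).symm) a b
          (of (p + q + r) w g)))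
    have hg' : IsVertexMap (p + (q + r)) w.len g := by rwa [← Nat.add_assoc]
    rw [act_cast_of _ hg, comul_of hg, comul_of hg']
    have hmono : g p ≤ g (p + q) := hg.mono (Nat.le_add_right p q)
    refine comulOf_cases (p := p + q) (w := w) (g := g) (fun h => ?_) (fun c w₁ w₂ hw h => ?_)
    · rw [comulOf_eq_zero h, map_zero, map_zero]
      refine comulOf_cases (p := p) (w := w) (g := g) (fun h' => ?_) (fun d u v hw h' => ?_)
      · rw [comulOf_eq_zero h', map_zero]
      · subst hw
        rw [comulOf_append _ _ h']
        refine Eq.symm ((ModQuiver.tensorHom_tmul (𝟙 (A.freeQuiver p)) (comultHom q r) a d b _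
          _).trans ?_)
        refine (congrArg (ModQuiver.tmul (A.freeQuiver p) (A.freeTensor q r) a d b _)
          ((comul_of (isVertexMap_right hg' h')).trans (comulOf_eq_zero ?_))).trans (map_zero _)
        rw [show g (p + q) = u.len + (g (p + q) - g p) by lia, split_append_add,
          Option.map_eq_none_iff] at h
        exact h
    · subst hw
      rw [comulOf_append _ _ h]
      refine Eq.trans (congrArg ((ModQuiver.assocHom (A.freeQuiver p) (A.freeQuiver q)
        (A.freeQuiver r)).app a b).hom ((ModQuiver.tensorHom_tmul (comultHom p q)
          (𝟙 (A.freeQuiver r)) a c b _ _).trans (congrArg (fun t => ModQuiver.tmul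
            (A.freeTensor p q) (A.freeQuiver r) a c b t _)
              (comul_of (isVertexMap_left hg h))))) ?_
      have hmin : min p (p + q) = p := by lia
      refine comulOf_cases (p := p) (w := w₁) (g := fun i => g (min i (p + q))) (fun h' => ?_)
        (fun d u v hw h' => ?_)
      · rw [comulOf_eq_zero (p := p) (q := q) (g := fun i => g (min i (p + q))) h', map_zero,
          LinearMap.zero_apply, map_zero]
        rw [hmin] at h'
        rw [comulOf_eq_zero (split_left_none w₁ w₂ (by lia) h'), map_zero]
      · subst hw
        rw [hmin] at h'
        have hg'' := hg'
        rw [append_assoc] at hg''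
        rw [comulOf_append _ _ (by rw [hmin]; exact h')]
        refine (ModQuiver.assocHom_tmul (A.freeQuiver p) (A.freeQuiver q) (A.freeQuiver r) a d c b
          _ _ _).trans ?_
        rw [append_assoc, comulOf_append _ _ h']
        refine Eq.symm ((ModQuiver.tensorHom_tmul (𝟙 (A.freeQuiver p)) (comultHom q r) a d b _
          _).trans ?_)
        have hq : g (p + q) - g p = v.len := by rw [h, len_append]; lia
        refine (congrArg (ModQuiver.tmul (A.freeQuiver p) (A.freeTensor q r) a d b _)
          ((comul_of (isVertexMap_right hg'' h')).trans (comulOf_append v w₂ hq))).trans ?_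
        refine congrArg₂ (fun x y => ModQuiver.tmul (A.freeQuiver p) (A.freeTensor q r) a d b x y)
          (congrArg (of p u) (funext fun i => ?_)) (congrArg₂ (fun x y => tmul d c b q r x y)
            (congrArg (of q v) (funext fun i => ?_)) (congrArg (of r w₂) (funext fun i => ?_)))
        · rw [min_eq_left (a := min i p) (by lia)]
        · rw [show min (p + i) (p + q) = p + min i q by lia, hmin]
        · have := hg.mono (show p + q ≤ p + (q + i) by lia)
          rw [Nat.add_assoc]
          lia

theorem counitHom_comultHom (p : ℕ) : actHom (FinInterval.cast (Nat.zero_add p)) ≫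
    comultHom 0 p ≫ ModQuiver.tensorHom counitHom (𝟙 (A.freeQuiver p)) ≫
      ModQuiver.leftUnitorHom (A.freeQuiver p) = 𝟙 (A.freeQuiver p) :=
  ModQuiver.hom_ext' fun a b => ext fun w g hg => by
    change ((ModQuiver.leftUnitorHom (A.freeQuiver p)).app a b).hom
      (((ModQuiver.tensorHom counitHom (𝟙 (A.freeQuiver p))).app a b).hom
        (comul a b 0 p (act (FinInterval.cast (Nat.zero_add p)) a b (of p w g)))) = of p w g
    have h := comulOf_append (p := 0) (q := p) (nil a) w hg.zero
    rw [nil_append] at h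
    rw [act_cast_of _ hg, comul_of (by rwa [Nat.zero_add]), h]
    have h1 : (of 0 (nil a) fun i => g (min i 0)) = one a :=
      congrArg (of 0 (nil a)) (funext fun i => by rw [Nat.min_zero, hg.zero])
    have h2 : (of p w fun j => g (0 + j) - g 0) = of p w g :=
      congrArg (of p w) (funext fun i => by rw [hg.zero, Nat.zero_add, Nat.sub_zero])
    rw [h1, h2]
    refine (congrArg ((ModQuiver.leftUnitorHom (A.freeQuiver p)).app a b).hom
      ((ModQuiver.tensorHom_tmul counitHom (𝟙 (A.freeQuiver p)) a a b _ _).trans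
        (congrArg (fun t => ModQuiver.tmul (ModQuiver.tensorUnit A.Ob k) (A.freeQuiver p) a a b t _)
          (counit_one a)))).trans ?_
    exact ModQuiver.leftUnitorHom_tmul (A.freeQuiver p) a b _

theorem comultHom_counitHom (p : ℕ) : actHom (FinInterval.cast (Nat.add_zero p)) ≫
    comultHom p 0 ≫ ModQuiver.tensorHom (𝟙 (A.freeQuiver p)) counitHom ≫
      ModQuiver.rightUnitorHom (A.freeQuiver p) = 𝟙 (A.freeQuiver p) :=
  ModQuiver.hom_ext' fun a b => ext fun w g hg => by
    change ((ModQuiver.rightUnitorHom (A.freeQuiver p)).app a b).hom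
      (((ModQuiver.tensorHom (𝟙 (A.freeQuiver p)) counitHom).app a b).hom
        (comul a b p 0 (act (FinInterval.cast (Nat.add_zero p)) a b (of p w g)))) = of p w g
    have h := comulOf_append (p := p) (q := 0) w (nil b) (hg.last p le_rfl)
    rw [append_nil] at h
    rw [act_cast_of _ hg, comul_of (p := p) (q := 0) hg, h]
    have h1 : (of 0 (nil b) fun j => g (p + j) - g p) = one b :=
      congrArg (of 0 (nil b)) (funext fun i => by
        rw [hg.last p le_rfl, hg.last (p + i) (by lia), Nat.sub_self])
    have h2 : (of p w fun i => g (min i p)) = of p w g :=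
      congrArg (of p w) (funext fun i => by
        by_cases hi : i ≤ p
        · rw [min_eq_left hi]
        · rw [min_eq_right (by lia), hg.last p le_rfl, hg.last i (by lia)])
    rw [h1, h2]
    refine (congrArg ((ModQuiver.rightUnitorHom (A.freeQuiver p)).app a b).hom
      ((ModQuiver.tensorHom_tmul (𝟙 (A.freeQuiver p)) counitHom a b b _ _).trans
        (congrArg (ModQuiver.tmul (A.freeQuiver p) (ModQuiver.tensorUnit A.Ob k) a b b _)
          (counit_one b)))).trans ?_
    exact ModQuiver.rightUnitorHom_tmul (A.freeQuiver p) a b _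

theorem frobenius_left (p q r : ℕ) :
    multHom (p + q) r ≫ actHom (FinInterval.cast (Nat.add_assoc p q r).symm) ≫
      comultHom p (q + r) =
    ModQuiver.tensorHom (comultHom p q) (𝟙 (A.freeQuiver r)) ≫
      ModQuiver.assocHom (A.freeQuiver p) (A.freeQuiver q) (A.freeQuiver r) ≫
        ModQuiver.tensorHom (𝟙 (A.freeQuiver p)) (multHom q r) :=
  ModQuiver.hom_ext' fun a b => tensor_ext fun c w g w' g' hg hg' => by
    refine (congrArg (fun t => comul a b p (q + r)
      (act (FinInterval.cast (Nat.add_assoc p q r).symm) a b t))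
        ((multHom_tmul _ _).trans (mul_of hg hg'))).trans ?_
    have hgg : IsVertexMap (p + (q + r)) (w.append w').len (glueVertex (p + q) w.len g g') := by
      rw [← Nat.add_assoc]
      exact glue_append hg hg'
    rw [act_cast_of _ (glue_append hg hg'), comul_of hgg]
    refine Eq.trans ?_ (congrArg (fun t => ((ModQuiver.tensorHom (𝟙 (A.freeQuiver p))
      (multHom q r)).app a b).hom (((ModQuiver.assocHom (A.freeQuiver p) (A.freeQuiver q)
        (A.freeQuiver r)).app a b).hom t)) ((ModQuiver.tensorHom_tmul (comultHom p q)
          (𝟙 (A.freeQuiver r)) a c b _ _).trans (congrArg (fun t => ModQuiver.tmul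
            (A.freeTensor p q) (A.freeQuiver r) a c b t _) (comul_of hg)))).symm
    have hp : glueVertex (p + q) w.len g g' p = g p := glueVertex_of_le (Nat.le_add_right p q)
    refine comulOf_cases (p := p) (w := w) (g := g) (fun h => ?_) (fun d u v hw h => ?_)
    · rw [comulOf_eq_zero (w := w) h, comulOf_eq_zero (by
        rw [hp]; exact split_left_none w w' (hg.le p) h), map_zero, LinearMap.zero_apply, map_zero,
        map_zero]
    · subst hw
      rw [comulOf_append u v h, append_assoc, comulOf_append _ _ (hp.trans h), hp]
      refine Eq.symm ((congrArg ((ModQuiver.tensorHom (𝟙 (A.freeQuiver p))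
        (multHom q r)).app a b).hom (ModQuiver.assocHom_tmul (A.freeQuiver p) (A.freeQuiver q)
          (A.freeQuiver r) a d c b _ _ _)).trans ?_)
      refine (ModQuiver.tensorHom_tmul (𝟙 (A.freeQuiver p)) (multHom q r) a d b _ _).trans ?_
      refine congrArg₂ (fun x y => tmul a d b p (q + r) x y)
        (congrArg (of p u) (funext fun i => ?_))
        (((multHom_tmul _ _).trans (mul_of (isVertexMap_right hg h) hg')).trans
          (congrArg (of (q + r) _) (funext fun i => ?_)))
      · rw [glueVertex_of_le (by lia)]
      · rw [h, len_append]
        unfold glueVertex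
        split_ifs <;> try lia
        rw [show p + i - (p + q) = i - q by lia]
        lia

theorem frobenius_right (p q r : ℕ) :
    multHom p (q + r) ≫ actHom (FinInterval.cast (Nat.add_assoc p q r)) ≫
      comultHom (p + q) r =
    ModQuiver.tensorHom (𝟙 (A.freeQuiver p)) (comultHom q r) ≫
      ModQuiver.assocInv (A.freeQuiver p) (A.freeQuiver q) (A.freeQuiver r) ≫
        ModQuiver.tensorHom (multHom p q) (𝟙 (A.freeQuiver r)) :=
  ModQuiver.hom_ext' fun a b => tensor_ext fun c w g w' g' hg hg' => by
    refine (congrArg (fun t => comul a b (p + q) r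
      (act (FinInterval.cast (Nat.add_assoc p q r)) a b t))
        ((multHom_tmul _ _).trans (mul_of hg hg'))).trans ?_
    have hgg : IsVertexMap (p + q + r) (w.append w').len (glueVertex p w.len g g') := by
      rw [Nat.add_assoc]
      exact glue_append hg hg'
    rw [act_cast_of _ (glue_append hg hg'), comul_of hgg]
    refine Eq.trans ?_ (congrArg (fun t => ((ModQuiver.tensorHom (multHom p q)
      (𝟙 (A.freeQuiver r))).app a b).hom (((ModQuiver.assocInv (A.freeQuiver p) (A.freeQuiver q)
        (A.freeQuiver r)).app a b).hom t)) ((ModQuiver.tensorHom_tmul (𝟙 (A.freeQuiver p))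
          (comultHom q r) a c b _ _).trans (congrArg (ModQuiver.tmul
            (A.freeQuiver p) (A.freeTensor q r) a c b _) (comul_of hg')))).symm
    have hp : ∀ j, glueVertex p w.len g g' (p + j) = w.len + g' j :=
      glueVertex_add (hg.last p le_rfl) hg'.zero
    refine comulOf_cases (p := q) (w := w') (g := g') (fun h => ?_) (fun d u v hw h => ?_)
    · rw [comulOf_eq_zero (w := w') h, comulOf_eq_zero (by
        rw [hp, split_append_add, h]; rfl), map_zero, map_zero, map_zero]
    · subst hw
      rw [comulOf_append u v h, ← append_assoc, comulOf_append _ _ (by rw [hp, h, len_append])]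
      refine Eq.symm ((congrArg ((ModQuiver.tensorHom (multHom p q)
        (𝟙 (A.freeQuiver r))).app a b).hom (ModQuiver.assocInv_tmul (A.freeQuiver p)
          (A.freeQuiver q) (A.freeQuiver r) a c d b _ _ _)).trans ?_)
      refine (ModQuiver.tensorHom_tmul (multHom p q) (𝟙 (A.freeQuiver r)) a d b _ _).trans ?_
      refine congrArg₂ (fun x y => tmul a d b (p + q) r x y)
        (((multHom_tmul _ _).trans (mul_of hg (isVertexMap_left hg' h))).trans
          (congrArg (of (p + q) _) (funext fun i => ?_)))
        (congrArg (of r v) (funext fun i => ?_))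
      · unfold glueVertex
        split_ifs <;> try lia
        · rw [hg.last (min i (p + q)) (by lia)]
          change w.len + g' (min (i - p) q) = _
          rw [show min (i - p) q = 0 by lia, hg'.zero, Nat.add_zero]
        · rw [show min i (p + q) - p = min (i - p) q by lia]
      · rw [hp, Nat.add_assoc, hp]
        lia

theorem unitHom_counitHom : unitHom ≫ counitHom = 𝟙 (ModQuiver.tensorUnit A.Ob k) :=
  ModQuiver.hom_ext' fun a b => ModQuiver.unit_ext fun e => by
    subst e
    exact (congrArg (counit a a) (unitHom_one a)).trans (counit_one a)

theorem counitHom_unitHom : counitHom ≫ unitHom = 𝟙 (A.freeQuiver 0) :=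
  ModQuiver.hom_ext' fun a b => ext_zero fun e => by
    subst e
    exact (congrArg (unitHom.app a a).hom (counit_one a)).trans (unitHom_one a)

end Free

/-- The Frobenius templicial module freely generated by a category enriched in narrow simplicial
modules. -/
noncomputable def freeData (A : NarrowCat k) : FTemplicialModule.Data k where
  base := A.Ob
  Q := A.freeQuiver
  act := Free.actHom
  act_id n := ModQuiver.hom_ext' fun a b => Free.ext fun w g hg => by
    refine (Free.act_of _ hg).trans (congrArg (Free.of n w) (funext fun i => ?_))
    by_cases hi : i ≤ n
    · rw [FinInterval.Hom.nat_id _ hi]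
    · rw [FinInterval.Hom.nat_of_len_le _ (by dsimp only; lia), hg.last n le_rfl,
        hg.last i (by lia)]
  act_comp {l m n} f g := ModQuiver.hom_ext' fun a b => Free.ext fun w h hh => by
    refine (Free.act_of _ hh).trans (Eq.symm ?_)
    refine (congrArg (Free.act f a b) (Free.act_of g hh)).trans
      ((Free.act_of f (hh.comp_nat g)).trans (congrArg (Free.of l w) (funext fun i => ?_)))
    rw [FinInterval.Hom.nat_comp]
  unit := Free.unitHom
  counit := Free.counitHom
  mult := Free.multHom
  comult := Free.comultHom
  mult_natural := Free.multHom_natural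
  mult_assoc := Free.multHom_assoc
  unit_mult := Free.unit_multHom
  mult_unit := Free.multHom_unit
  comult_natural := Free.comultHom_natural
  comult_assoc := Free.comultHom_assoc
  counit_comult := Free.counitHom_comultHom
  comult_counit := Free.comultHom_counitHom
  frobenius_left := Free.frobenius_left
  frobenius_right := Free.frobenius_right
  unit_counit := Free.unitHom_counitHom
  counit_unit := Free.counitHom_unitHom

/-- The Frobenius templicial module freely generated by a category enriched in narrow simplicial
modules. -/
noncomputable def free (A : NarrowCat k) : FTemplicialModule k := A.freeData.toModule

end NarrowCat

/-! ### Composites of words -/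

namespace NarrowModule

variable {k : Type u} [CommRing k] (A : NarrowModule k)

theorem act_eq_act_act {l m n : ℕ} {f : (⟨l⟩ : NarrowSimplex) ⟶ ⟨n⟩}
    {g : (⟨l⟩ : NarrowSimplex) ⟶ ⟨m⟩} {g' : (⟨m⟩ : NarrowSimplex) ⟶ ⟨n⟩}
    (h : ∀ i ≤ l + 1, NarrowSimplex.Hom.nat f i =
      NarrowSimplex.Hom.nat g' (NarrowSimplex.Hom.nat g i)) {x : A.deg n} :
    A.act f x = A.act g (A.act g' x) := by
  rw [← act_comp]
  exact congrArg (A.act · x) (NarrowSimplex.hom_ext_nat fun i hi => by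
    rw [h i hi, NarrowSimplex.Hom.nat_comp])

end NarrowModule

namespace NarrowCat

open Word

variable {k : Type u} [CommRing k] {A : NarrowCat k}

namespace Word

variable {a b c d e : A.Ob}

/-- The degree of the composite of a word. -/
def compDeg {a b : A.Ob} : A.Word a b → ℕ
  | nil _ => 0
  | cons n _ w => n + compDeg w

/-- The composite of the letters of a word. -/
noncomputable def compose {a b : A.Ob} : (w : A.Word a b) → (A.hom a b).deg w.compDeg
  | nil a => A.one a
  | cons n x w => A.comp _ _ _ n w.compDeg x (compose w)

/-- The effect on vertices of composing the letters of a word. The endpoints of letters are no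
vertices of the composite; the values at them are irrelevant. -/
def composeVertex {a b : A.Ob} : A.Word a b → ℕ → ℕ
  | nil _, _ => 1
  | cons n _ w, t => if t ≤ n then t else n + composeVertex w (t - (n + 1))

theorem composeVertex_cons_of_le {n t : ℕ} (x : (A.hom a c).deg n) (w : A.Word c b) (h : t ≤ n) :
    (cons n x w).composeVertex t = t := if_pos h

theorem composeVertex_cons_add {n : ℕ} (x : (A.hom a c).deg n) (w : A.Word c b) (t : ℕ) :
    (cons n x w).composeVertex (n + 1 + t) = n + w.composeVertex t := by
  refine (if_neg (by lia)).trans ?_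
  rw [Nat.add_sub_cancel_left]

theorem composeVertex_le (w : A.Word a b) (t : ℕ) :
    t ≤ w.len → w.composeVertex t ≤ w.compDeg + 1 := by
  induction w generalizing t with
  | nil a => intro _; exact le_rfl
  | cons n x w ih =>
    intro h
    have h : t ≤ n + 1 + w.len := h
    change _ ≤ n + w.compDeg + 1
    by_cases h1 : t ≤ n
    · rw [composeVertex_cons_of_le x w h1]
      lia
    · obtain ⟨s, rfl⟩ : ∃ s, t = n + 1 + s := ⟨t - (n + 1), by lia⟩
      rw [composeVertex_cons_add]
      have := ih s (by lia)
      lia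

theorem composeVertex_len (w : A.Word a b) : w.composeVertex w.len = w.compDeg + 1 := by
  induction w with
  | nil a => rfl
  | cons n x w ih => rw [len_cons, composeVertex_cons_add, ih]; rfl

theorem composeVertex_mono (w : A.Word a b) : Monotone w.composeVertex := by
  induction w with
  | nil a => exact fun _ _ _ => le_rfl
  | cons n x w ih =>
    intro i j hij
    have := ih (Nat.sub_le_sub_right hij (n + 1))
    unfold composeVertex
    split_ifs <;> lia

theorem composeVertex_pos (w : A.Word a b) {t : ℕ} (h : w.split t = none) :
    0 < w.composeVertex t := by
  induction w generalizing t with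
  | nil a => exact Nat.one_pos
  | cons n x w ih =>
    by_cases h1 : t ≤ n
    · rw [composeVertex_cons_of_le x w h1]
      obtain rfl | h0 := Nat.eq_zero_or_pos t
      · rw [split_zero] at h
        cases h
      · exact h0
    · obtain ⟨s, rfl⟩ : ∃ s, t = n + 1 + s := ⟨t - (n + 1), by lia⟩
      rw [split_cons_add, Option.map_eq_none_iff] at h
      rw [composeVertex_cons_add]
      have := ih h
      lia

theorem composeVertex_lt (w : A.Word a b) {t : ℕ} (h : w.split t = none) (ht : t ≤ w.len) :
    w.composeVertex t < w.compDeg + 1 := by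
  induction w generalizing t with
  | nil a =>
    obtain rfl : t = 0 := Nat.le_zero.1 ht
    rw [split_zero] at h
    cases h
  | cons n x w ih =>
    change _ < n + w.compDeg + 1
    by_cases h1 : t ≤ n
    · rw [composeVertex_cons_of_le x w h1]
      lia
    · obtain ⟨s, rfl⟩ : ∃ s, t = n + 1 + s := ⟨t - (n + 1), by lia⟩
      rw [split_cons_add, Option.map_eq_none_iff] at h
      rw [composeVertex_cons_add]
      have := ih h (by rw [len_cons] at ht; lia)
      lia

theorem composeVertex_append_of_split (u : A.Word a c) (v : A.Word c b) {t : ℕ} (ht : t ≤ u.len)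
    (h : u.split t = none) : (u.append v).composeVertex t = u.composeVertex t := by
  induction u generalizing t with
  | nil a =>
    obtain rfl : t = 0 := Nat.le_zero.1 ht
    rw [split_zero] at h
    cases h
  | cons n x u ih =>
    rw [cons_append]
    by_cases h1 : t ≤ n
    · rw [composeVertex_cons_of_le x _ h1, composeVertex_cons_of_le x _ h1]
    · obtain ⟨s, rfl⟩ : ∃ s, t = n + 1 + s := ⟨t - (n + 1), by lia⟩
      rw [split_cons_add, Option.map_eq_none_iff] at h
      rw [composeVertex_cons_add, composeVertex_cons_add, ih v (by rw [len_cons] at ht; lia) h]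

theorem composeVertex_append_add (u : A.Word a c) (v : A.Word c b) (t : ℕ) :
    (u.append v).composeVertex (u.len + t) = u.compDeg + v.composeVertex t := by
  induction u with
  | nil a => rw [nil_append, len_nil, Nat.zero_add]; exact (Nat.zero_add _).symm
  | cons n x u ih =>
    rw [cons_append, len_cons, Nat.add_assoc, composeVertex_cons_add, ih v]
    exact (Nat.add_assoc _ _ _).symm

theorem compDeg_append (u : A.Word a c) (v : A.Word c b) :
    (u.append v).compDeg = u.compDeg + v.compDeg := by
  induction u with
  | nil a => exact (Nat.zero_add _).symm
  | cons n x u ih => exact (congrArg (n + ·) (ih v)).trans (Nat.add_assoc _ _ _).symm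

theorem compose_append (u : A.Word a c) (v : A.Word c b) :
    (u.append v).compose = (A.hom a b).act (NarrowSimplex.cast (compDeg_append u v))
      (A.comp a c b u.compDeg v.compDeg u.compose v.compose) := by
  induction u with
  | nil a =>
    refine Eq.trans ?_ (congrArg _ (A.one_comp v.compose).symm)
    refine (NarrowModule.act_id _ _).symm.trans (NarrowModule.act_eq_act_act _ fun i hi => ?_)
    have hi : i ≤ v.compDeg + 1 := hi
    refine (NarrowSimplex.Hom.nat_id hi).trans (Eq.symm ?_)
    refine (NarrowSimplex.nat_cast _ ?_).trans (NarrowSimplex.nat_cast _ hi)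
    refine (NarrowSimplex.nat_cast _ hi).le.trans ?_
    lia
  | cons n x u ih =>
    have h1 : ((cons n x u).append v).compose = A.comp _ _ _ n _ x (u.append v).compose := rfl
    have h2 := A.comp_assoc x u.compose v.compose
    have h3 := A.comp_act (𝟙 _) (NarrowSimplex.cast (compDeg_append u v)) x
      (A.comp _ _ _ _ _ u.compose v.compose)
    rw [NarrowModule.act_id] at h3
    refine h1.trans ((congrArg _ (ih v)).trans (h3.trans ?_))
    refine Eq.trans ?_ (congrArg _ h2)
    refine NarrowModule.act_eq_act_act _ fun i hi => ?_
    have hi : i ≤ n + (u.append v).compDeg + 1 := hi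
    have e := compDeg_append u v
    refine Eq.trans ?_ (((NarrowSimplex.nat_cast _ ((NarrowSimplex.nat_cast _ hi).le.trans
      ?_)).trans
      (NarrowSimplex.nat_cast _ hi)).symm)
    · rw [NarrowSimplex.nat_join _ _ hi]
      split_ifs with h
      · exact NarrowSimplex.Hom.nat_id (by dsimp only; lia)
      · rw [NarrowSimplex.nat_cast _ (by lia)]
        lia
    · lia

/-- A word `w` reduces to `w'` along the map of vertices `θ`, as far as composites are concerned. -/
def ComposeRed (w w' : A.Word a b) (θ : ℕ → ℕ) : Prop :=
  ∃ ψ : (⟨w.compDeg⟩ : NarrowSimplex) ⟶ ⟨w'.compDeg⟩,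
    w.compose = (A.hom a b).act ψ w'.compose ∧
      ∀ t ≤ w.len, w.split t = none →
        w'.composeVertex (θ t) = NarrowSimplex.Hom.nat ψ (w.composeVertex t)

/-- The letter of an elementary reduction is the image of the composite of the reduced word. -/
theorem Red.compose {m : ℕ} {z : (A.hom a b).deg m} {s : A.Word a b} {φ : ℕ → ℕ}
    (h : Red A z s φ) : ∃ ψ : (⟨m⟩ : NarrowSimplex) ⟶ ⟨s.compDeg⟩,
      z = (A.hom a b).act ψ s.compose ∧
        ∀ i, 0 < i → i ≤ m → s.composeVertex (φ i) = NarrowSimplex.Hom.nat ψ i := by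
  cases h with
  | act f x =>
    refine ⟨f, ?_, fun i h0 hi => ?_⟩
    · refine congrArg _ (Eq.trans ?_ (A.comp_one x).symm)
      exact (NarrowModule.act_cast_rfl _ _ _).symm
    · exact composeVertex_cons_of_le x _ (NarrowSimplex.Hom.nat_le_inner f hi)
  | @comp c _ p q x y =>
    refine ⟨𝟙 (⟨p + q⟩ : NarrowSimplex), ?_, fun i h0 hi => ?_⟩
    · refine Eq.trans ?_ (NarrowModule.act_id _ _).symm
      refine congrArg (A.comp _ _ _ p q x) (Eq.trans ?_ (A.comp_one y).symm)
      exact (NarrowModule.act_cast_rfl _ _ _).symm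
    · refine Eq.trans ?_ (NarrowSimplex.Hom.nat_id (by dsimp only; lia)).symm
      beta_reduce
      split_ifs with h1
      · exact composeVertex_cons_of_le x _ h1
      · rw [show i + 1 = p + 1 + (i - p) by lia, composeVertex_cons_add,
          composeVertex_cons_of_le y _ (by lia)]
        lia
  | one =>
    refine ⟨𝟙 (⟨0⟩ : NarrowSimplex), (NarrowModule.act_id _ _).symm, fun i h0 hi => ?_⟩
    lia

theorem Red.composeRed_cons {m : ℕ} {z : (A.hom a d).deg m} {s : A.Word a d} {φ : ℕ → ℕ}
    (h : Red A z s φ) (v : A.Word d b) :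
    ComposeRed (cons m z v) (s.append v) (contextMap 0 m s.len φ) := by
  obtain ⟨ψ, h1, h2⟩ := h.compose
  have e := compDeg_append s v
  have hχ : ∀ i ≤ m + v.compDeg + 1, NarrowSimplex.Hom.nat
      (NarrowSimplex.join ψ (𝟙 (⟨v.compDeg⟩ : NarrowSimplex)) ≫
      NarrowSimplex.cast e.symm) i =
      if i < m + 1 then NarrowSimplex.Hom.nat ψ i else s.compDeg + (i - m) := fun i hi => by
    rw [NarrowSimplex.Hom.nat_comp, NarrowSimplex.nat_cast _ (NarrowSimplex.Hom.nat_le _ _),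
      NarrowSimplex.nat_join _ _ hi]
    split_ifs with h3
    · rfl
    · rw [NarrowSimplex.Hom.nat_id (by dsimp only; lia)]
  refine ⟨NarrowSimplex.join ψ (𝟙 (⟨v.compDeg⟩ : NarrowSimplex)) ≫
    NarrowSimplex.cast e.symm, ?_, fun t ht hs => ?_⟩
  · have h3 := A.comp_act ψ (𝟙 _) s.compose v.compose
    rw [NarrowModule.act_id, ← h1] at h3
    refine h3.trans (Eq.trans ?_ (congrArg _ (compose_append s v).symm))
    refine NarrowModule.act_eq_act_act _ fun i hi => ?_
    have h4 := NarrowSimplex.Hom.nat_le (NarrowSimplex.join ψ (𝟙 (⟨v.compDeg⟩ : NarrowSimplex)) ≫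
      NarrowSimplex.cast e.symm) i
    refine Eq.trans ?_ (NarrowSimplex.nat_cast _ h4).symm
    rw [NarrowSimplex.Hom.nat_comp, NarrowSimplex.nat_cast _ (NarrowSimplex.Hom.nat_le _ _)]
  · have ht : t ≤ m + 1 + v.len := ht
    by_cases h3 : t ≤ m
    · obtain rfl | h0 := Nat.eq_zero_or_pos t
      · rw [split_zero] at hs
        cases hs
      rw [composeVertex_cons_of_le z v h3]
      refine Eq.symm ((hχ _ (by lia)).trans ?_)
      have h4 := h.contextMap_add 0 (i := t) (by lia)
      rw [Nat.zero_add, Nat.zero_add] at h4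
      rw [if_pos (by lia), ← h2 t h0 h3, h4,
        composeVertex_append_of_split s v (h.le_len (by lia)) (h.split_eq_none h0 h3)]
    · obtain ⟨j, rfl⟩ : ∃ j, t = m + 1 + j := ⟨t - (m + 1), by lia⟩
      rw [split_cons_add, Option.map_eq_none_iff] at hs
      have h4 := h.contextMap_add_add 0 j
      rw [Nat.zero_add, Nat.zero_add] at h4
      have h5 := composeVertex_pos v hs
      have h6 := composeVertex_le v j (by lia)
      rw [h4, composeVertex_append_add, composeVertex_cons_add]
      refine Eq.symm ((hχ _ (by lia)).trans ?_)
      rw [if_neg (by lia)]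
      lia

theorem ComposeRed.cons {n : ℕ} (x : (A.hom a c).deg n) {w w' : A.Word c b} {θ : ℕ → ℕ}
    {θ' : ℕ → ℕ} (h : ComposeRed w w' θ) (h₁ : ∀ t ≤ n, θ' t = t)
    (h₂ : ∀ t, θ' (n + 1 + t) = n + 1 + θ t) :
    ComposeRed (cons n x w) (cons n x w') θ' := by
  obtain ⟨ψ, h1, h2⟩ := h
  refine ⟨NarrowSimplex.join (𝟙 (⟨n⟩ : NarrowSimplex)) ψ, ?_, fun t ht hs => ?_⟩
  · have h3 := A.comp_act (𝟙 (⟨n⟩ : NarrowSimplex)) ψ x w'.compose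
    rw [NarrowModule.act_id, ← h1] at h3
    exact h3
  · have ht : t ≤ n + 1 + w.len := ht
    by_cases h3 : t ≤ n
    · rw [h₁ t h3, composeVertex_cons_of_le x _ h3, composeVertex_cons_of_le x _ h3]
      refine Eq.symm ((NarrowSimplex.nat_join _ _ (by lia)).trans ?_)
      rw [if_pos (by lia), NarrowSimplex.Hom.nat_id (by dsimp only; lia)]
    · obtain ⟨j, rfl⟩ : ∃ j, t = n + 1 + j := ⟨t - (n + 1), by lia⟩
      rw [split_cons_add, Option.map_eq_none_iff] at hs
      have h7 := composeVertex_pos _ hs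
      have h8 := composeVertex_le _ j (by lia : j ≤ w.len)
      rw [h₂, composeVertex_cons_add, composeVertex_cons_add, h2 j (by lia) hs]
      refine Eq.symm ((NarrowSimplex.nat_join _ _ (by lia)).trans ?_)
      rw [if_neg (by lia), Nat.add_sub_cancel_left]

theorem Red.composeRed {m : ℕ} {z : (A.hom c d).deg m} {s : A.Word c d} {φ : ℕ → ℕ}
    (h : Red A z s φ) (u : A.Word a c) (v : A.Word d b) :
    ComposeRed (u.append (cons m z v)) (u.append (s.append v)) (contextMap u.len m s.len φ) := by
  induction u with
  | nil a => exact h.composeRed_cons v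
  | cons n x u ih =>
    exact (ih h).cons x (fun t ht => contextMap_of_le (by rw [len_cons]; lia))
      fun t => contextMap_shift t

end Word

end NarrowCat

/-! ### The retraction of the free module -/

namespace NarrowCat

open Word

variable {k : Type u} [CommRing k] {A : NarrowCat k}

namespace Word

variable {a b c d e : A.Ob}

theorem split_append_cons_eq_none_iff {m : ℕ} (u : A.Word a c) (x y : (A.hom c d).deg m)
    (v : A.Word d b) (t : ℕ) :
    (u.append (cons m x v)).split t = none ↔ (u.append (cons m y v)).split t = none := by
  refine Free.vertex_cases (l := m) u v t (fun e u₁ u₂ hu ht => ?_) (fun ht hu => ?_)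
    (fun i h0 hi ht => ?_) (fun e v₁ v₂ hv ht => ?_) (fun j ht hv => ?_)
  · subst hu ht
    rw [append_assoc, append_assoc, split_append_len, split_append_len]
    simp
  · simp only [Free.split_left_none _ _ ht hu]
  · simp only [ht, Free.split_mid_none u _ v h0 hi]
  · subst hv
    have h : ∀ x : (A.hom c d).deg m, (u.append (cons m x v₁)).len = t := fun x => by
      rw [len_append, len_cons]; lia
    have h1 := split_append_len (u.append (cons m x v₁)) v₂
    have h2 := split_append_len (u.append (cons m y v₁)) v₂
    rw [h] at h1 h2
    rw [Free.append_cons_append, Free.append_cons_append, h1, h2]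
    simp
  · simp only [ht, Free.split_right_none u _ v hv]

theorem Red.split_eq_none_iff {m : ℕ} {z : (A.hom c d).deg m} {s : A.Word c d} {φ : ℕ → ℕ}
    (h : Red A z s φ) (u : A.Word a c) (v : A.Word d b) (t : ℕ) :
    (u.append (cons m z v)).split t = none ↔
      (u.append (s.append v)).split (contextMap u.len m s.len φ t) = none := by
  refine Free.vertex_cases (l := m) u v t (fun e u₁ u₂ hu ht => ?_) (fun ht hu => ?_)
    (fun i h0 hi ht => ?_) (fun e v₁ v₂ hv ht => ?_) (fun j ht hv => ?_)
  · subst hu ht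
    rw [contextMap_of_le (by rw [len_append]; lia), append_assoc, append_assoc, split_append_len,
      split_append_len]
    simp
  · rw [contextMap_of_le ht]
    simp only [Free.split_left_none _ _ ht hu]
  · rw [ht, h.contextMap_add u.len (by lia)]
    simp only [Free.split_mid_none u _ v h0 hi, true_iff]
    rw [split_append_add, split_append_of_le s v (h.le_len (by lia)), h.split_eq_none h0 hi]
    rfl
  · subst hv
    have h1 := split_append_len (u.append (cons m z v₁)) v₂
    have h2 := split_append_len ((u.append s).append v₁) v₂
    rw [len_append, len_cons, ← Nat.add_assoc, ← ht] at h1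
    rw [len_append, len_append, ← h.contextMap_add_add, ← ht, append_assoc, append_assoc] at h2
    rw [Free.append_cons_append, h1, h2]
    simp
  · rw [ht, h.contextMap_add_add]
    simp only [Free.split_right_none u _ v hv, true_iff]
    rw [Nat.add_assoc, split_append_add, split_append_add, hv]
    rfl

/-- A vertex map that sends no inner vertex to an endpoint of a letter induces a map to the
composite. -/
theorem exists_composeVertex {n : ℕ} {w : A.Word a b} {g : ℕ → ℕ} (hg : IsVertexMap (n + 1) w.len g)
    (hs : ∀ i, 0 < i → i ≤ n → w.split (g i) = none) :
    ∃ h : (⟨n⟩ : NarrowSimplex) ⟶ ⟨w.compDeg⟩,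
      ∀ i, 0 < i → i ≤ n → NarrowSimplex.Hom.nat h i = w.composeVertex (g i) := by
  refine ⟨NarrowSimplex.homMk _ _ (fun i => if i = 0 then 0 else w.composeVertex (g i))
    (fun i j hij _ => ?_) (if_pos rfl) ?_ (fun i h0 hi => ?_) (fun i hi => ?_), fun i h0 hi => ?_⟩
  · have := w.composeVertex_mono (hg.mono hij)
    split_ifs <;> lia
  · rw [if_neg (by lia)]
    exact (congrArg _ (hg.last _ le_rfl)).trans w.composeVertex_len
  · rw [if_neg (by lia)]
    rcases (show i ≤ n + 1 from hi).eq_or_lt with rfl | hi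
    · rw [hg.last _ le_rfl, composeVertex_len]
      lia
    · exact w.composeVertex_pos (hs i h0 (by lia))
  · split_ifs with h1
    · lia
    · exact w.composeVertex_lt (hs i (by lia) (by dsimp only at hi; lia)) (hg.le i)
  · rw [NarrowSimplex.nat_homMk _ _ _ _ _ _ (by dsimp only; lia), if_neg (by lia)]

theorem narrow_hom_ext {m n : ℕ} {f g : (⟨m⟩ : NarrowSimplex) ⟶ ⟨n⟩}
    (h : ∀ i, 0 < i → i ≤ m → NarrowSimplex.Hom.nat f i = NarrowSimplex.Hom.nat g i) : f = g :=
  NarrowSimplex.hom_ext_nat fun i hi => by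
    obtain rfl | h0 := Nat.eq_zero_or_pos i
    · rw [NarrowSimplex.Hom.nat_zero, NarrowSimplex.Hom.nat_zero]
    rcases (show i ≤ m + 1 from hi).eq_or_lt with rfl | hi
    · rw [NarrowSimplex.Hom.nat_last', NarrowSimplex.Hom.nat_last']
    · exact h i h0 (by lia)

theorem composeVertex_append_cons {m : ℕ} (u : A.Word a c) (x y : (A.hom c d).deg m)
    (v : A.Word d b) (t : ℕ) :
    (u.append (cons m x v)).composeVertex t = (u.append (cons m y v)).composeVertex t := by
  induction u generalizing t with
  | nil a => rfl
  | cons n x' u ih =>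
    rw [cons_append, cons_append]
    unfold composeVertex
    rw [ih x y]

open scoped Classical in
/-- The value of a word and a vertex map in `A`: the image of the composite of the word if no inner
vertex is mapped to an endpoint of a letter, and zero otherwise. -/
noncomputable def value (n : ℕ) {a b : A.Ob} (w : A.Word a b) (g : ℕ → ℕ) : (A.hom a b).deg n :=
  if h : ∃ h : (⟨n⟩ : NarrowSimplex) ⟶ ⟨w.compDeg⟩, ∀ i, 0 < i → i ≤ n → w.split (g i) = none ∧
    NarrowSimplex.Hom.nat h i = w.composeVertex (g i) then (A.hom a b).act h.choose w.compose else 0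

theorem value_eq {n : ℕ} {w : A.Word a b} {g : ℕ → ℕ} (h : (⟨n⟩ : NarrowSimplex) ⟶ ⟨w.compDeg⟩)
    (hs : ∀ i, 0 < i → i ≤ n → w.split (g i) = none)
    (hh : ∀ i, 0 < i → i ≤ n → NarrowSimplex.Hom.nat h i = w.composeVertex (g i)) :
    w.value n g = (A.hom a b).act h w.compose := by
  have hex : ∃ h : (⟨n⟩ : NarrowSimplex) ⟶ ⟨w.compDeg⟩, ∀ i, 0 < i → i ≤ n →
      w.split (g i) = none ∧ NarrowSimplex.Hom.nat h i = w.composeVertex (g i) :=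
    ⟨h, fun i h0 hi => ⟨hs i h0 hi, hh i h0 hi⟩⟩
  rw [value, dif_pos hex, show hex.choose = h from narrow_hom_ext fun i h0 hi =>
    (hex.choose_spec i h0 hi).2.trans (hh i h0 hi).symm]

theorem value_eq_zero {n i : ℕ} {w : A.Word a b} {g : ℕ → ℕ} (h0 : 0 < i) (hi : i ≤ n)
    (hs : w.split (g i) ≠ none) : w.value n g = 0 :=
  dif_neg fun ⟨_, h⟩ => hs (h i h0 hi).1

theorem value_cases {n : ℕ} {w : A.Word a b} {g : ℕ → ℕ} (hg : IsVertexMap (n + 1) w.len g)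
    {P : Prop} (zero : ∀ i, 0 < i → i ≤ n → w.split (g i) ≠ none → P)
    (eq : ∀ h : (⟨n⟩ : NarrowSimplex) ⟶ ⟨w.compDeg⟩,
      (∀ i, 0 < i → i ≤ n → w.split (g i) = none) →
      (∀ i, 0 < i → i ≤ n → NarrowSimplex.Hom.nat h i = w.composeVertex (g i)) → P) : P := by
  by_cases hs : ∀ i, 0 < i → i ≤ n → w.split (g i) = none
  · obtain ⟨h, hh⟩ := exists_composeVertex hg hs
    exact eq h hs hh
  · push Not at hs
    obtain ⟨i, h0, hi, hs⟩ := hs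
    exact zero i h0 hi hs

/-- The value in terms of the composites of the parts before and after a given letter. -/
theorem value_append_cons {n m : ℕ} {u : A.Word a c} {x : (A.hom c d).deg m} {v : A.Word d b}
    {g : ℕ → ℕ} (h : (⟨n⟩ : NarrowSimplex) ⟶ ⟨u.compDeg + (m + v.compDeg)⟩)
    (hs : ∀ i, 0 < i → i ≤ n → (u.append (cons m x v)).split (g i) = none)
    (hh : ∀ i, 0 < i → i ≤ n →
      NarrowSimplex.Hom.nat h i = (u.append (cons m x v)).composeVertex (g i)) :
    (u.append (cons m x v)).value n g = (A.hom a b).act h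
      (A.comp a c b u.compDeg (m + v.compDeg) u.compose
        (A.comp c d b m v.compDeg x v.compose)) := by
  have e := compDeg_append u (cons m x v)
  rw [value_eq (h ≫ NarrowSimplex.cast e.symm) hs fun i h0 hi => ?_]
  · refine (congrArg _ (compose_append u (cons m x v))).trans
      (NarrowModule.act_eq_act_act _ fun i hi => ?_).symm
    refine Eq.symm ((NarrowSimplex.nat_cast _ (NarrowSimplex.Hom.nat_le _ _)).trans ?_)
    rw [NarrowSimplex.Hom.nat_comp]
    exact NarrowSimplex.nat_cast _ (NarrowSimplex.Hom.nat_le _ _)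
  · rw [← hh i h0 hi, NarrowSimplex.Hom.nat_comp]
    exact NarrowSimplex.nat_cast _ (NarrowSimplex.Hom.nat_le _ _)

/-- The value respects the linearity relations. -/
theorem value_lin {n m : ℕ} (u : A.Word a c) (x y : (A.hom c d).deg m) (r : k) (v : A.Word d b)
    {g : ℕ → ℕ} (hg : IsVertexMap (n + 1) (u.len + (m + 1 + v.len)) g) :
    (u.append (cons m (x + r • y) v)).value n g =
      (u.append (cons m x v)).value n g + r • (u.append (cons m y v)).value n g := by
  have hg' : IsVertexMap (n + 1) (u.append (cons m x v)).len g := by simpa using hg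
  refine value_cases hg' (fun i h0 hi hs => ?_) (fun h hs hh => ?_)
  · rw [value_eq_zero h0 hi hs,
      value_eq_zero h0 hi (mt (split_append_cons_eq_none_iff u _ _ v _).1 hs),
      value_eq_zero h0 hi (mt (split_append_cons_eq_none_iff u _ _ v _).1 hs), smul_zero, add_zero]
  · have e := compDeg_append u (cons m x v)
    have key := fun z : (A.hom c d).deg m => value_append_cons (u := u) (x := z) (v := v) (g := g)
      (h ≫ NarrowSimplex.cast e)
      (fun i h0 hi => (split_append_cons_eq_none_iff u x z v _).1 (hs i h0 hi))
      (fun i h0 hi => by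
        rw [composeVertex_append_cons u z x v, ← hh i h0 hi, NarrowSimplex.Hom.nat_comp]
        exact NarrowSimplex.nat_cast _ (NarrowSimplex.Hom.nat_le _ _))
    rw [key, key, key, map_add, map_smul, LinearMap.add_apply, LinearMap.smul_apply, map_add,
      map_smul, map_add, map_smul]

/-- The value respects reductions, because the composites of the words do. -/
theorem value_red {n m : ℕ} {z : (A.hom c d).deg m} {s : A.Word c d} {φ : ℕ → ℕ}
    (h : Red A z s φ) (u : A.Word a c) (v : A.Word d b) {g : ℕ → ℕ}
    (hg : IsVertexMap (n + 1) (u.len + (m + 1 + v.len)) g) :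
    (u.append (cons m z v)).value n g =
      (u.append (s.append v)).value n fun i => contextMap u.len m s.len φ (g i) := by
  have hg' : IsVertexMap (n + 1) (u.append (cons m z v)).len g := by simpa using hg
  refine value_cases hg' (fun i h0 hi hs => ?_) (fun f hs hf => ?_)
  · rw [value_eq_zero h0 hi hs, value_eq_zero h0 hi (mt (h.split_eq_none_iff u v (g i)).2 hs)]
  · obtain ⟨ψ, h1, h2⟩ := h.composeRed u v
    rw [value_eq f hs hf, h1, ← NarrowModule.act_comp]
    exact (value_eq (f ≫ ψ) (fun i h0 hi => (h.split_eq_none_iff u v _).1 (hs i h0 hi))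
      fun i h0 hi => by
        rw [NarrowSimplex.Hom.nat_comp, hf i h0 hi, h2 _ (hg'.le i) (hs i h0 hi)]).symm

end Word

namespace Free

variable {a b c d : A.Ob} {n : ℕ}

/-- The linear map to `A` that composes words. -/
noncomputable def retraction (a b : A.Ob) (n : ℕ) : Free (n + 1) a b →ₗ[k] (A.hom a b).deg n :=
  desc (fun w g => w.value n g) (fun _ _ _ u x y r v _ hg => value_lin u x y r v hg)
    (fun _ _ _ _ _ _ h u v _ hg => value_red h u v hg)

theorem isVertexMap_min (n : ℕ) : IsVertexMap n n fun i => min i n :=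
  ⟨Nat.zero_min n, fun _ _ h => min_le_min_right n h, fun _ h => min_eq_right h⟩

/-- The inclusion of `A` as the words with a single letter. -/
noncomputable def incl (a b : A.Ob) (n : ℕ) : (A.hom a b).deg n →ₗ[k] Free (n + 1) a b where
  toFun x := of (n + 1) (letter n x) fun i => min i (n + 1)
  map_add' x y := by
    have h := of_lin (nil a) x y 1 (nil b) (by simpa using isVertexMap_min (n + 1))
    rwa [one_smul, one_smul] at h
  map_smul' r x := by
    have h0 := of_lin (nil a) x x 0 (nil b) (by simpa using isVertexMap_min (n + 1))
    have h1 := of_lin (nil a) 0 0 1 (nil b) (by simpa using isVertexMap_min (n + 1))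
    have h := of_lin (nil a) 0 x r (nil b) (by simpa using isVertexMap_min (n + 1))
    rw [one_smul, one_smul, add_zero, left_eq_add] at h1
    rw [zero_add, h1, zero_add] at h
    exact h

theorem incl_apply (x : (A.hom a b).deg n) :
    incl a b n x = of (n + 1) (letter n x) fun i => min i (n + 1) := rfl

theorem incl_zero (a b : A.Ob) (n : ℕ) : incl a b n 0 = 0 := map_zero _

theorem retraction_incl (x : (A.hom a b).deg n) : retraction a b n (incl a b n x) = x := by
  refine (desc_of (by simpa using isVertexMap_min (n + 1))).trans ?_
  rw [value_eq (NarrowSimplex.cast (Nat.add_zero n).symm) (fun i h0 hi => ?_) (fun i h0 hi => ?_)]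
  · refine (congrArg _ (A.comp_one x)).trans ?_
    refine (NarrowModule.act_eq_act_act (f := 𝟙 _) _ fun i hi => ?_).symm.trans
      (NarrowModule.act_id _ _)
    exact (NarrowSimplex.Hom.nat_id hi).trans ((NarrowSimplex.nat_cast _
      ((NarrowSimplex.nat_cast _ hi).le.trans hi)).trans (NarrowSimplex.nat_cast _ hi)).symm
  · exact split_cons_of_le x _ (by lia) (by lia)
  · rw [min_eq_left (by lia), composeVertex_cons_of_le x _ hi]
    exact NarrowSimplex.nat_cast _ (by lia)

end Free

end NarrowCat

/-! ### Joint kernels of the free module -/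

namespace NarrowCat

open Word

variable {k : Type u} [CommRing k] {A : NarrowCat k}

namespace Free

variable {a b c d : A.Ob} {n : ℕ}

theorem free_one (a : A.Ob) : A.free.one a = of 0 (nil a) fun _ => 0 := unitHom_one a

theorem free_mul_of {p q : ℕ} (h : p + q = n) {w : A.Word a c} {w' : A.Word c b} {g g' : ℕ → ℕ}
    (hg : IsVertexMap p w.len g) (hg' : IsVertexMap q w'.len g') :
    A.free.mul a c b p q n h (of p w g) (of q w' g') =
      of n (w.append w') (glueVertex p w.len g g') := by
  refine (congrArg (act (FinInterval.cast h.symm) a b) ((multHom_tmul _ _).trans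
    (mul_of hg hg'))).trans (act_cast_of _ (glue_append hg hg'))

theorem free_comul_of {p q : ℕ} (h : p + q = n) {w : A.Word a b} {g : ℕ → ℕ}
    (hg : IsVertexMap n w.len g) : A.free.comul a b p q n h (of n w g) = comulOf p q w g := by
  refine (congrArg (comul a b p q) (act_cast_of h hg)).trans (comul_of ?_)
  rwa [h]

theorem isVertexMap_letter (x : (A.hom a b).deg n) :
    IsVertexMap (n + 1) (letter n x).len fun i => min i (n + 1) :=
  isVertexMap_min (n + 1)

/-- The reduction of the single letter of a word. -/
theorem incl_of_red {z : (A.hom a b).deg n} {s : A.Word a b} {φ : ℕ → ℕ} (h : Red A z s φ) :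
    incl a b n z = of (n + 1) s fun i => φ (min i (n + 1)) := by
  have h1 := of_red h (nil a) (nil b) (g := fun i => min i (n + 1))
    (by simpa using isVertexMap_min (n + 1))
  refine h1.trans ?_
  rw [append_nil, nil_append]
  refine congrArg (of (n + 1) s) (funext fun i => ?_)
  have h2 := h.contextMap_add 0 (i := min i (n + 1)) (min_le_right _ _)
  rwa [Nat.zero_add, Nat.zero_add] at h2

theorem incl_act {m : ℕ} (f : (⟨m⟩ : NarrowSimplex) ⟶ ⟨n⟩) (x : (A.hom a b).deg n) :
    incl a b m ((A.hom a b).act f x) =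
      A.free.act (NarrowSimplex.interval f) a b (incl a b n x) := by
  rw [incl_of_red (Red.act f x)]
  refine Eq.symm ((act_of (NarrowSimplex.interval f) (isVertexMap_letter x)).trans ?_)
  refine congrArg (of (m + 1) _) (funext fun i => ?_)
  rw [NarrowSimplex.nat_interval, min_eq_left (NarrowSimplex.Hom.nat_le f i)]
  by_cases hi : i ≤ m + 1
  · rw [min_eq_left hi]
  · rw [min_eq_right (by lia), NarrowSimplex.Hom.nat_last']
    exact FinInterval.Hom.nat_of_len_le _ (by change m + 1 ≤ i; lia)

theorem incl_one (a : A.Ob) : incl a a 0 (A.one a) = A.free.degenerateEdge a := by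
  refine (incl_of_red (Red.one a)).trans (Eq.symm ?_)
  exact (congrArg (act FinInterval.codegeneracyZero a a) (free_one a)).trans
    (act_of FinInterval.codegeneracyZero (isVertexMap_zero 0 a))

theorem incl_comp {p q : ℕ} (x : (A.hom a c).deg p) (y : (A.hom c b).deg q) :
    incl a b (p + q) (A.comp a c b p q x y) =
      A.free.glueMap a c b p q (incl a c p x) (incl c b q y) := by
  have hx := isVertexMap_letter x
  have hy := isVertexMap_letter y
  rw [incl_of_red (Red.comp x y)]
  refine Eq.symm ((congrArg (act (FinInterval.glueCoface p q) a b) (free_mul_of rfl hx hy)).trans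
    ((act_of (FinInterval.glueCoface p q) (glue_append hx hy)).trans ?_))
  refine congrArg (of (p + q + 1) _) (funext fun i => ?_)
  have h : FinInterval.Hom.nat (FinInterval.glueCoface p q) i =
      if min i (p + q + 1) ≤ p then min i (p + q + 1) else min i (p + q + 1) + 1 := by
    by_cases hi : i ≤ p + q + 1
    · rw [min_eq_left hi, FTemplicialModule.nat_glueCoface p q hi]
    · rw [min_eq_right (by lia), if_neg (by lia)]
      exact (FinInterval.Hom.nat_of_len_le _ (by change p + q + 1 ≤ i; lia)).trans
        (by change p + 1 + (q + 1) = _; lia)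
  rw [h, glueVertex]
  change (if _ then _ else p + 1 + 0 + _) = _
  split_ifs <;> lia

/-- A word with a single letter cannot be cut at an inner vertex. -/
theorem incl_mem_kernel (x : (A.hom a b).deg n) : incl a b n x ∈ A.free.kernel ⟨n + 1⟩ a b :=
  A.free.mem_kernel.2 fun p q hp hq h => by
    rw [incl_apply, free_comul_of h (isVertexMap_letter x)]
    refine comulOf_eq_zero ?_
    rw [min_eq_left (by lia)]
    exact split_cons_of_le x _ hp (by lia)

/-- A simplex that maps no inner vertex to an endpoint of a letter is represented by a word with a
single letter: adjacent letters can be composed. -/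
theorem exists_eq_incl {w : A.Word a b} {g : ℕ → ℕ} (hg : IsVertexMap (n + 1) w.len g)
    (hs : ∀ i, 0 < i → i ≤ n → w.split (g i) = none) : ∃ y, of (n + 1) w g = incl a b n y := by
  have key : ∀ {c b : A.Ob} (w : A.Word c b) {a : A.Ob} {p : ℕ} (x : (A.hom a c).deg p) (g : ℕ → ℕ),
      IsVertexMap (n + 1) (p + 1 + w.len) g →
      (∀ i, 0 < i → i ≤ n → (cons p x w).split (g i) = none) →
        ∃ y, of (n + 1) (cons p x w) g = incl a b n y := by
    intro c b w
    induction w with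
    | nil c =>
      intro a p x g hg hs
      obtain ⟨f, hf⟩ := exists_composeVertex (w := letter p x) hg hs
      refine ⟨(A.hom a c).act (n := p) f x, Eq.symm ((incl_of_red (Red.act (n := p) f x)).trans ?_)⟩
      refine congrArg (of (n + 1) _) (funext fun i => ?_)
      obtain rfl | h0 := Nat.eq_zero_or_pos i
      · rw [Nat.zero_min, hg.zero]
        exact NarrowSimplex.Hom.nat_zero _
      by_cases hi : i ≤ n
      · rw [min_eq_left (by lia)]
        refine (hf i h0 hi).trans (composeVertex_cons_of_le x _ ?_)
        by_contra h1
        have h2 := hs i h0 hi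
        have h3 : g i = (letter p x).len := by
          have := hg.le i
          simp only [len_nil, len_cons] at this ⊢
          lia
        rw [h3, split_len] at h2
        cases h2
      · rw [min_eq_right (by lia), hg.last i (by lia)]
        exact NarrowSimplex.Hom.nat_last' (n := p) f
    | @cons c d b q y w ih =>
      intro a p x g hg hs
      have hg : IsVertexMap (n + 1) (p + 1 + (q + 1 + w.len)) g := hg
      have hred := Red.comp x y
      have hne : ∀ i, g i ≠ p + 1 := fun i h => by
        obtain rfl | h0 := Nat.eq_zero_or_pos i
        · rw [hg.zero] at h
          lia
        by_cases hi : i ≤ n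
        · have h1 := hs i h0 hi
          have h2 := split_append_len (letter p x) (cons q y w)
          rw [h] at h1
          have h3 : (cons p x (cons q y w)).split (p + 1) = none := h1
          rw [show (letter p x).len = p + 1 from rfl, cons_append, nil_append, h3] at h2
          cases h2
        · rw [hg.last i (by lia)] at h
          lia
      have hg' : IsVertexMap (n + 1) (p + q + 1 + w.len)
          fun i => if g i ≤ p then g i else g i - 1 :=
        { zero := by simp [hg.zero]
          mono := fun i j hij => by
            have := hg.mono hij
            have := hne i
            have := hne j
            beta_reduce
            split_ifs <;> lia
          last := fun i hi => by
            rw [hg.last i hi, if_neg (by lia)]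
            lia }
      have hcon : ∀ i, contextMap 0 (p + q) (p + 1 + (q + 1))
          (fun i => if i ≤ p then i else i + 1) (if g i ≤ p then g i else g i - 1) = g i :=
        fun i => by
          have := hne i
          unfold contextMap
          split_ifs <;> lia
      obtain ⟨z, hz⟩ := ih (A.comp _ _ _ p q x y) _ hg' fun i h0 hi =>
        (hred.split_eq_none_iff (nil a) w _).2 (by
          have h1 := hs i h0 hi
          rw [← hcon i] at h1
          exact h1)
      refine ⟨z, Eq.trans ?_ hz⟩
      refine Eq.symm ((of_red hred (nil a) w (by simpa using hg')).trans ?_)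
      exact congrArg (of (n + 1) _) (funext hcon)
  cases w with
  | nil a =>
    have hg0 : g = fun _ => 0 := funext fun i => Nat.le_zero.1 (hg.le i)
    obtain rfl : n = 0 := by
      by_contra h
      have h1 := hs 1 Nat.one_pos (by lia)
      rw [hg0, split_zero] at h1
      cases h1
    exact ⟨A.one a, by rw [hg0, incl_of_red (Red.one a)]⟩
  | cons p x w => exact key w x g hg hs

/-- The free Frobenius templicial module is generated by the words with a single letter. -/
theorem mem_of_incl_mem {S : ∀ n (a b : A.Ob), Submodule k (Free n a b)}
    (one : ∀ a, A.free.one a ∈ S 0 a a) (incl : ∀ n a b x, incl a b n x ∈ S (n + 1) a b)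
    (mul : ∀ (a c b : A.Ob) p q n h, ∀ x ∈ S p a c, ∀ y ∈ S q c b,
      A.free.mul a c b p q n h x y ∈ S n a b) (n : ℕ) (a b : A.Ob) (x : Free n a b) :
    x ∈ S n a b := by
  have key : ∀ n (a b : A.Ob) (w : A.Word a b) g, IsVertexMap n w.len g → of n w g ∈ S n a b := by
    intro n
    induction n using Nat.strong_induction_on with
    | _ n ih =>
      intro a b w g hg
      obtain _ | n := n
      · have hg0 : g = fun _ => 0 := funext fun i => by
          rw [hg.last i (Nat.zero_le i), ← hg.last 0 le_rfl, hg.zero]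
        have hw : w.len = 0 := by rw [← hg.last 0 le_rfl, hg.zero]
        cases w with
        | nil a => exact hg0 ▸ free_one a ▸ one a
        | cons m x w => rw [len_cons] at hw; lia
      by_cases hs : ∀ i, 0 < i → i ≤ n → w.split (g i) = none
      · obtain ⟨y, hy⟩ := exists_eq_incl hg hs
        rw [hy]
        exact incl n a b y
      · push Not at hs
        obtain ⟨i, h0, hi, hs⟩ := hs
        obtain ⟨j, hj⟩ : ∃ j, i + j = n + 1 := ⟨n + 1 - i, by lia⟩
        refine comulOf_cases (p := i) (w := w) (g := g) (fun h => absurd h hs)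
          fun c u v hw h => ?_
        subst hw
        have hg' : IsVertexMap (i + j) (u.append v).len g := by rwa [hj]
        have h1 := isVertexMap_left hg' h
        have h2 := isVertexMap_right hg' h
        have h3 := mul a c b i j (n + 1) hj _ (ih i (by lia) _ _ u _ h1) _
          (ih j (by lia) _ _ v _ h2)
        rw [free_mul_of hj h1 h2] at h3
        have h4 : glueVertex i u.len (fun l => g (min l i)) (fun l => g (i + l) - g i) = g :=
          funext fun l => by
            unfold glueVertex
            split_ifs with h5 <;> beta_reduce
            · rw [min_eq_left h5]
            · have := hg.mono (show i ≤ l by lia)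
              rw [show i + (l - i) = l by lia]
              lia
        rwa [h4] at h3
  have h1 : (S n a b).mkQ = 0 := ext fun w g hg =>
    (Submodule.Quotient.mk_eq_zero _).2 (key n a b w g hg)
  exact (Submodule.Quotient.mk_eq_zero _).1 (LinearMap.congr_fun h1 x)

/-- The words with a single letter lie in the joint kernels and generate the free module, hence are
all of the joint kernels. -/
theorem range_incl (a b : A.Ob) (n : ℕ) :
    LinearMap.range (incl a b n) = A.free.kernel ⟨n + 1⟩ a b := by
  refine le_antisymm ?_ ?_
  · rintro _ ⟨x, rfl⟩
    exact incl_mem_kernel x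
  · refine A.free.kernel_le_of_generates (B := fun n a b =>
      LinearMap.range (incl a b n)) ?_ ?_ n a b
    · rintro n a b _ ⟨x, rfl⟩
      exact incl_mem_kernel x
    · intro S h1 h2 h3 n a b x
      exact mem_of_incl_mem (S := S) h1 (fun n a b x => h2 n a b ⟨x, rfl⟩) h3 n a b x

theorem incl_injective (a b : A.Ob) (n : ℕ) : Function.Injective (incl a b n) :=
  Function.LeftInverse.injective retraction_incl

/-- The inclusion of `A`, with values in the joint kernel. -/
noncomputable def inclKernel (a b : A.Ob) (n : ℕ) :
    (A.hom a b).deg n →ₗ[k] (A.free.kernelModule a b).deg n :=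
  (incl a b n).codRestrict (A.free.kernel ⟨n + 1⟩ a b) incl_mem_kernel

theorem inclKernel_bijective (a b : A.Ob) (n : ℕ) : Function.Bijective (inclKernel a b n) := by
  refine ⟨fun x y h => incl_injective a b n (congrArg (A.free.kernelIncl a b n) h), fun y => ?_⟩
  obtain ⟨x, hx⟩ : A.free.kernelIncl a b n y ∈ LinearMap.range (incl a b n) := by
    rw [range_incl]
    exact A.free.kernelIncl_mem y
  exact ⟨x, A.free.kernelIncl_injective a b n hx⟩

variable (A) in
/-- The category of joint kernels of the free Frobenius templicial module on `A` is `A`. -/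
noncomputable def unit : A ⟶ (FTemplicialModule.kernelFunctor k).obj A.free :=
  homMk (A := A) (B := A.free.kernelData.toCat) id inclKernel
    (fun a b _ _ f x => A.free.kernelIncl_injective a b _ (incl_act f x))
    (fun a => A.free.kernelIncl_injective a a 0 ((incl_one a).trans
      (congrArg (A.free.kernelIncl a a 0) (A.free.kernelData.toCat_one a)).symm))
    (fun a c b p q x y => A.free.kernelIncl_injective a b _ ((incl_comp x y).trans
      (congrArg (fun t => A.free.kernelIncl a b (p + q) (t (inclKernel a c p x)
        (inclKernel c b q y)))
        (A.free.kernelData.toCat_comp a c b p q)).symm))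

variable (A) in
theorem isIso_unit : IsIso (unit A) :=
  isIso_homMk_id (O := A.Ob) (a := A.enriched) (b := A.free.kernelData.toCat.enriched) _ _ _ _
    inclKernel_bijective

end Free

end NarrowCat

instance {k : Type u} [CommRing k] : (FTemplicialModule.kernelFunctor k).EssSurj where
  mem_essImage A := ⟨A.free, ⟨by
    have := NarrowCat.Free.isIso_unit A
    exact (asIso (NarrowCat.Free.unit A)).symm⟩⟩

/-! ### The universal property of the free module -/

/-- The map of finite intervals with a given effect on vertices. -/
def NarrowCat.IsVertexMap.hom {n l : ℕ} {g : ℕ → ℕ} (h : NarrowCat.IsVertexMap n l g) :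
    (⟨n⟩ : FinInterval) ⟶ ⟨l⟩ :=
  FinInterval.homMk _ _ g (fun _ _ hij _ => h.mono hij) h.zero (h.last n le_rfl)

theorem NarrowCat.IsVertexMap.nat_hom {n l : ℕ} {g : ℕ → ℕ} (h : NarrowCat.IsVertexMap n l g)
    (i : ℕ) : FinInterval.Hom.nat h.hom i = g i := by
  by_cases hi : i ≤ n
  · exact FinInterval.nat_homMk _ _ _ _ hi
  · rw [h.last i (by lia)]
    exact FinInterval.Hom.nat_of_len_le _ (by change n ≤ i; lia)

/-- A functor from `A` to the category of joint kernels of `Y`, in terms of elements of `Y`. -/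
structure NarrowCat.KernelMap {k : Type u} [CommRing k] (A : NarrowCat k)
    (Y : FTemplicialModule k) where
  ob : A.Ob → Y.base
  map (a b : A.Ob) (n : ℕ) : (A.hom a b).deg n →ₗ[k] Y.deg (n + 1) (ob a) (ob b)
  mem_kernel {a b : A.Ob} {n : ℕ} (x : (A.hom a b).deg n) :
    map a b n x ∈ Y.kernel ⟨n + 1⟩ (ob a) (ob b)
  map_act {a b : A.Ob} {m n : ℕ} (f : (⟨m⟩ : NarrowSimplex) ⟶ ⟨n⟩) (x : (A.hom a b).deg n) :
    map a b m ((A.hom a b).act f x) =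
      Y.act (NarrowSimplex.interval f) (ob a) (ob b) (map a b n x)
  map_one (a : A.Ob) : map a a 0 (A.one a) = Y.degenerateEdge (ob a)
  map_comp {a b c : A.Ob} {p q : ℕ} (x : (A.hom a b).deg p) (y : (A.hom b c).deg q) :
    map a c (p + q) (A.comp a b c p q x y) =
      Y.glueMap (ob a) (ob b) (ob c) p q (map a b p x) (map b c q y)

namespace NarrowCat

open Word FinInterval

namespace KernelMap

variable {k : Type u} [CommRing k] {A : NarrowCat k} {Y : FTemplicialModule k} (H : KernelMap A Y)

variable {a b c d : A.Ob} {n : ℕ}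

/-- The product in `Y` of the letters of a word. -/
noncomputable def prod {a b : A.Ob} : (w : A.Word a b) → Y.deg w.len (H.ob a) (H.ob b)
  | nil a => Y.one (H.ob a)
  | cons n x w => Y.mul _ _ _ (n + 1) w.len (n + 1 + w.len) rfl (H.map _ _ n x) (prod w)

theorem prod_append (u : A.Word a c) (v : A.Word c b) :
    H.prod (u.append v) = Y.mul (H.ob a) (H.ob c) (H.ob b) u.len v.len (u.append v).len
      (len_append u v).symm (H.prod u) (H.prod v) := by
  induction u with
  | nil a => exact (Y.one_mul _).symm
  | cons n x u ih =>
    refine (congrArg _ (ih v)).trans ?_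
    exact (Y.mul_assoc rfl (len_append (cons n x u) v).symm (len_append u v).symm rfl
      (H.map _ _ n x) (H.prod u) (H.prod v)).symm

theorem prod_letter (x : (A.hom a b).deg n) : H.prod (letter n x) = H.map a b n x :=
  Y.mul_one _

/-- The map of `Y`-simplices given by a word and a vertex map. -/
noncomputable def simplex {w : A.Word a b} {g : ℕ → ℕ} (hg : IsVertexMap n w.len g) :
    Y.deg n (H.ob a) (H.ob b) :=
  Y.act hg.hom (H.ob a) (H.ob b) (H.prod w)

theorem simplex_append {u : A.Word a c} {v : A.Word c b} {g : ℕ → ℕ}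
    (hg : IsVertexMap n (u.append v).len g) {N : ℕ} (hN : u.len + v.len = N)
    (hg' : IsVertexMap n N g) :
    H.simplex hg = Y.act hg'.hom (H.ob a) (H.ob b)
      (Y.mul (H.ob a) (H.ob c) (H.ob b) u.len v.len N hN (H.prod u) (H.prod v)) := by
  obtain rfl : (u.append v).len = N := (len_append u v).trans hN
  exact congrArg (Y.act hg'.hom (H.ob a) (H.ob b)) (H.prod_append u v)

theorem simplex_append₃ {u : A.Word a c} {s : A.Word c d} {v : A.Word d b} {g : ℕ → ℕ}
    (hg : IsVertexMap n (u.append (s.append v)).len g)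
    (hg' : IsVertexMap n (u.len + (s.len + v.len)) g) :
    H.simplex hg = Y.act hg'.hom (H.ob a) (H.ob b)
      (Y.mul (H.ob a) (H.ob c) (H.ob b) u.len (s.len + v.len) _ rfl (H.prod u)
        (Y.mul (H.ob c) (H.ob d) (H.ob b) s.len v.len _ rfl (H.prod s) (H.prod v))) := by
  rw [H.simplex_append hg (by rw [len_append]) hg', H.prod_append s v]
  have key : ∀ N (h : s.len + v.len = N) (h' : u.len + N = u.len + (s.len + v.len)),
      Y.mul (H.ob a) (H.ob c) (H.ob b) u.len N (u.len + (s.len + v.len)) h' (H.prod u)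
        (Y.mul (H.ob c) (H.ob d) (H.ob b) s.len v.len N h (H.prod s) (H.prod v)) =
      Y.mul (H.ob a) (H.ob c) (H.ob b) u.len (s.len + v.len) _ rfl (H.prod u)
        (Y.mul (H.ob c) (H.ob d) (H.ob b) s.len v.len _ rfl (H.prod s) (H.prod v)) := by
    rintro N rfl h'
    rfl
  exact congrArg _ (key _ _ _)

/-- The letter of an elementary reduction is mapped to the image of the product of the reduced
word. -/
theorem map_of_red {m : ℕ} {z : (A.hom a b).deg m} {s : A.Word a b} {φ : ℕ → ℕ}
    (h : Red A z s φ) : ∃ f : (⟨m + 1⟩ : FinInterval) ⟶ ⟨s.len⟩,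
      (∀ i ≤ m + 1, Hom.nat f i = φ i) ∧
        H.map a b m z = Y.act f (H.ob a) (H.ob b) (H.prod s) := by
  cases h with
  | act f x =>
    exact ⟨NarrowSimplex.interval f, fun i _ => rfl,
      (H.map_act f x).trans (congrArg _ (H.prod_letter x).symm)⟩
  | @comp c _ p q x y =>
    refine ⟨glueCoface p q, fun i hi => FTemplicialModule.nat_glueCoface p q hi, ?_⟩
    refine (H.map_comp x y).trans ?_
    exact congrArg (fun t => Y.act (glueCoface p q) _ _ (Y.mul _ _ _ (p + 1) (q + 1) _ rfl
      (H.map _ _ p x) t)) (H.prod_letter y).symm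
  | one => exact ⟨codegeneracyZero, fun i _ => FTemplicialModule.nat_codegeneracyZero, H.map_one a⟩

/-- The images of words in `Y` are compatible with reductions. -/
theorem simplex_red {m : ℕ} {z : (A.hom c d).deg m} {s : A.Word c d} {φ : ℕ → ℕ}
    (h : Red A z s φ) (u : A.Word a c) (v : A.Word d b) {g : ℕ → ℕ}
    (hg : IsVertexMap n (u.len + (m + 1 + v.len)) g)
    (h₁ : IsVertexMap n (u.append (cons m z v)).len g)
    (h₂ : IsVertexMap n (u.append (s.append v)).len fun i => contextMap u.len m s.len φ (g i)) :
    H.simplex h₁ = H.simplex h₂ := by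
  obtain ⟨f, hf, hz⟩ := H.map_of_red h
  have hs1 : IsSum (sum rfl rfl f (𝟙 (⟨v.len⟩ : FinInterval))) f (𝟙 (⟨v.len⟩ : FinInterval)) :=
    isSum_sum _ _ _ _
  have hs2 : IsSum (sum rfl rfl (𝟙 (⟨u.len⟩ : FinInterval))
    (sum rfl rfl f (𝟙 (⟨v.len⟩ : FinInterval)))) (𝟙 (⟨u.len⟩ : FinInterval))
    (sum rfl rfl f (𝟙 (⟨v.len⟩ : FinInterval))) := isSum_sum _ _ _ _
  have e1 := Y.act_mul hs1 (H.prod s) (H.prod v)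
  have e2 := Y.act_mul hs2 (H.prod u) (Y.mul _ _ _ _ _ _ rfl (H.prod s) (H.prod v))
  rw [Y.act_id] at e1 e2
  rw [H.simplex_append h₁ rfl hg, H.simplex_append₃ h₂ (hg.contextMap h)]
  refine (congrArg (fun t => Y.act hg.hom _ _ (Y.mul _ _ _ _ _ _ rfl (H.prod u)
    (Y.mul _ _ _ _ _ _ rfl t (H.prod v)))) hz).trans ?_
  refine (congrArg (fun t => Y.act hg.hom _ _ (Y.mul _ _ _ _ _ _ rfl (H.prod u) t))
    e1.symm).trans ((congrArg (Y.act hg.hom _ _) e2.symm).trans ?_)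
  rw [← Y.act_comp]
  refine congrArg (fun t => Y.act t _ _ _) (hom_ext_nat fun i _ => ?_)
  have hgi := hg.le i
  rw [Hom.nat_comp, IsVertexMap.nat_hom, IsVertexMap.nat_hom, nat_sum]
  by_cases h1 : g i ≤ u.len
  · rw [if_pos h1, contextMap_of_le h1, Hom.nat_id _ h1]
  rw [if_neg h1, nat_sum]
  by_cases h2 : g i - u.len ≤ m + 1
  · rw [if_pos h2, hf _ h2, ← h.contextMap_add u.len h2]
    congr 1
    lia
  · have h3 := h.contextMap_add_add u.len (g i - u.len - (m + 1))
    rw [show u.len + (m + 1) + (g i - u.len - (m + 1)) = g i by lia] at h3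
    rw [if_neg h2, h3, Hom.nat_id _ (by dsimp only; lia), Nat.add_assoc]

open scoped Classical in
/-- The linear map induced on the free Frobenius templicial module. -/
noncomputable def lift (n : ℕ) (a b : A.Ob) : A.free.deg n a b →ₗ[k] Y.deg n (H.ob a) (H.ob b) :=
  Free.desc (n := n) (a := a) (b := b)
    (fun w g => if hg : IsVertexMap n w.len g then H.simplex hg else 0)
    (fun c d m u x y r v g hg => by
      have h : ∀ x : (A.hom c d).deg m, IsVertexMap n (u.append (cons m x v)).len g := fun x => by
        simpa using hg
      have key : ∀ x : (A.hom c d).deg m, H.simplex (h x) =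
          (Y.act hg.hom (H.ob a) (H.ob b) ∘ₗ Y.mul (H.ob a) (H.ob c) (H.ob b) u.len
            (m + 1 + v.len) _ rfl (H.prod u) ∘ₗ (Y.mul (H.ob c) (H.ob d) (H.ob b) (m + 1) v.len _
              rfl).flip (H.prod v)) (H.map c d m x) :=
        fun x => H.simplex_append (h x) rfl hg
      rw [dif_pos (h _), dif_pos (h _), dif_pos (h _), key, key, key, map_add, map_smul, map_add,
        map_smul])
    (fun c d m z s φ h u v g hg => by
      have h1 : IsVertexMap n (u.append (cons m z v)).len g := by simpa using hg
      have h2 : IsVertexMap n (u.append (s.append v)).len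
          fun i => contextMap u.len m s.len φ (g i) := by simpa using hg.contextMap h
      rw [dif_pos h1, dif_pos h2, H.simplex_red h u v hg h1 h2])

theorem lift_of {w : A.Word a b} {g : ℕ → ℕ} (hg : IsVertexMap n w.len g) :
    H.lift n a b (Free.of n w g) = Y.act hg.hom (H.ob a) (H.ob b) (H.prod w) := by
  refine (Free.desc_of hg).trans ?_
  rw [dif_pos hg]
  rfl

theorem lift_incl (x : (A.hom a b).deg n) :
    H.lift (n + 1) a b (Free.incl a b n x) = H.map a b n x := by
  refine (H.lift_of (Free.isVertexMap_letter x)).trans ?_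
  refine Eq.trans ?_ ((Y.act_id _ _ _).trans (H.prod_letter x))
  refine congrArg (fun t => Y.act t _ _ _) (hom_ext_nat fun i hi => ?_)
  refine (IsVertexMap.nat_hom _ i).trans (Eq.trans ?_ (Hom.nat_id i hi).symm)
  exact min_eq_left hi

theorem lift_act {m : ℕ} (f : (⟨m⟩ : FinInterval) ⟶ ⟨n⟩) (x : A.free.deg n a b) :
    H.lift m a b (A.free.act f a b x) = Y.act f (H.ob a) (H.ob b) (H.lift n a b x) := by
  refine LinearMap.congr_fun (f := H.lift m a b ∘ₗ Free.act f a b)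
    (g := Y.act f (H.ob a) (H.ob b) ∘ₗ H.lift n a b) (Free.ext fun w g hg => ?_) x
  refine (congrArg (H.lift m a b) (Free.act_of f hg)).trans
    ((H.lift_of (hg.comp_nat f)).trans (Eq.symm ?_))
  refine (congrArg (Y.act f (H.ob a) (H.ob b)) (H.lift_of hg)).trans ?_
  rw [← Y.act_comp]
  refine congrArg (fun t => Y.act t _ _ _) (hom_ext_nat fun i hi => ?_)
  rw [Hom.nat_comp, IsVertexMap.nat_hom, IsVertexMap.nat_hom]

theorem lift_one (a : A.Ob) : H.lift 0 a a (A.free.one a) = Y.one (H.ob a) := by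
  refine (congrArg (H.lift 0 a a) (Free.free_one a)).trans
    ((H.lift_of (Free.isVertexMap_zero 0 a)).trans ?_)
  refine Eq.trans ?_ (Y.act_id _ _ _)
  refine congrArg (fun t => Y.act t _ _ _) (hom_ext_nat fun i hi => ?_)
  refine (IsVertexMap.nat_hom _ i).trans (Eq.trans ?_ (Hom.nat_id i hi).symm)
  exact (Nat.le_zero.1 hi).symm

theorem lift_mul (a c b : A.Ob) (p q : ℕ) (x : A.free.deg p a c) (y : A.free.deg q c b) :
    H.lift (p + q) a b (A.free.mul a c b p q (p + q) rfl x y) =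
      Y.mul (H.ob a) (H.ob c) (H.ob b) p q (p + q) rfl (H.lift p a c x) (H.lift q c b y) := by
  have h1 : (A.free.mul a c b p q (p + q) rfl).compr₂ (H.lift (p + q) a b) =
      (Y.mul (H.ob a) (H.ob c) (H.ob b) p q (p + q) rfl).compl₁₂ (H.lift p a c) (H.lift q c b) := by
    refine Free.ext fun w g hg => Free.ext fun w' g' hg' => ?_
    have hgg := Free.glue_append hg hg'
    refine (congrArg (H.lift (p + q) a b) (Free.free_mul_of rfl hg hg')).trans
      ((H.lift_of hgg).trans ?_)
    refine Eq.trans ?_ (congrArg₂ (fun s t => Y.mul (H.ob a) (H.ob c) (H.ob b) p q (p + q) rfl s t)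
      (H.lift_of hg) (H.lift_of hg')).symm
    have hs : IsSum hgg.hom hg.hom hg'.hom := ⟨rfl, (len_append w w').symm, fun i _ => by
      rw [IsVertexMap.nat_hom, IsVertexMap.nat_hom, IsVertexMap.nat_hom]
      rfl⟩
    exact (congrArg _ (H.prod_append w w')).trans (Y.act_mul hs _ _)
  exact LinearMap.congr_fun₂ h1 x y

/-- The comultiplications of a product of elements of the joint kernels vanish, except at the
vertices where the factors meet. -/
theorem comul_prod_eq_zero {w : A.Word a b} {t s : ℕ} (h : t + s = w.len)
    (hs : w.split t = none) : Y.comul (H.ob a) (H.ob b) t s w.len h (H.prod w) = 0 := by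
  induction w generalizing t with
  | nil a =>
    obtain rfl : t = 0 := by rw [len_nil] at h; lia
    rw [split_zero] at hs
    cases hs
  | cons n x w ih =>
    by_cases h1 : t ≤ n
    · obtain rfl | h0 := Nat.eq_zero_or_pos t
      · rw [split_zero] at hs
        cases hs
      have h2 := Y.mem_kernel.1 (H.mem_kernel x) t (n + 1 - t) h0 (by lia) (by lia)
      refine (Y.comul_mul_right (q := n + 1 - t) (by lia) rfl (by rw [len_cons] at h; lia) h
        (H.map _ _ n x) (H.prod w)).trans ?_
      rw [h2, map_zero]
    · obtain ⟨j, rfl⟩ : ∃ j, t = n + 1 + j := ⟨t - (n + 1), by lia⟩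
      rw [split_cons_add, Option.map_eq_none_iff] at hs
      have h3 : j + s = w.len := by rw [len_cons] at h; lia
      refine (Y.comul_mul_left h3 rfl rfl h (H.map _ _ n x) (H.prod w)).trans ?_
      rw [ih h3 hs, map_zero]

/-- The map from the free module respects comultiplications. At an endpoint of a letter both sides
are the tensor product of the images of the two parts of the word, at other vertices both are
zero. -/
theorem lift_comul (a b : A.Ob) (p q : ℕ) (x : A.free.deg (p + q) a b) :
    Y.comul (H.ob a) (H.ob b) p q (p + q) rfl (H.lift (p + q) a b x) =
      FTemplicialModule.tensorMap (X := A.free) (f := H.ob) H.lift p q a b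
        (A.free.comul a b p q (p + q) rfl x) := by
  refine LinearMap.congr_fun (f := Y.comul (H.ob a) (H.ob b) p q (p + q) rfl ∘ₗ H.lift (p + q) a b)
    (g := FTemplicialModule.tensorMap (X := A.free) (f := H.ob) H.lift p q a b ∘ₗ
      A.free.comul a b p q (p + q) rfl) (Free.ext fun w g hg => ?_) x
  refine (congrArg (Y.comul (H.ob a) (H.ob b) p q (p + q) rfl) (H.lift_of hg)).trans
    (Eq.trans ?_ (congrArg (FTemplicialModule.tensorMap (X := A.free) (f := H.ob) H.lift p q a b)
      (Free.free_comul_of rfl hg)).symm)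
  refine Free.comulOf_cases (p := p) (w := w) (g := g) (fun h => ?_) fun c u v hw h => ?_
  · refine Eq.trans ?_ ((congrArg _ (Free.comulOf_eq_zero h)).trans (map_zero _)).symm
    obtain ⟨r, u, v, hs⟩ := exists_isSum hg.hom (rfl : p + q = p + q)
    refine (Y.comul_act hs _).trans ?_
    rw [H.comul_prod_eq_zero hs.target (by rw [IsVertexMap.nat_hom]; exact h), map_zero]
  · subst hw
    have h1 := Free.isVertexMap_left hg h
    have h2 := Free.isVertexMap_right hg h
    have hs : IsSum hg.hom h1.hom h2.hom := ⟨rfl, (len_append u v).symm, fun i _ => by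
      rw [IsVertexMap.nat_hom, IsVertexMap.nat_hom, IsVertexMap.nat_hom]
      split_ifs with h3
      · rw [min_eq_left h3]
      · have := hg.mono (show p ≤ i by lia)
        rw [show p + (i - p) = i by lia]
        lia⟩
    rw [Free.comulOf_append u v h, H.prod_append u v]
    refine (Y.comul_act hs _).trans ?_
    rw [Y.comul_mul, Y.actTensor_tmul]
    refine Eq.symm ((FTemplicialModule.tensorMap_tmul (X := A.free) (f := H.ob) H.lift p q a c b
      _ _).trans ?_)
    exact congrArg₂ (fun s t => Y.tmul (H.ob a) (H.ob c) (H.ob b) p q s t) (H.lift_of h1)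
      (H.lift_of h2)

end KernelMap

end NarrowCat

/-! ### The functor of joint kernels is an equivalence -/

namespace NarrowCat.KernelMap

open FTemplicialModule

variable {k : Type u} [CommRing k] {A : NarrowCat k} {Y : FTemplicialModule k}

/-- The elements of `Y` associated with a functor to the category of joint kernels. -/
noncomputable def ofHom (G : A ⟶ (kernelFunctor k).obj Y) : KernelMap A Y where
  ob := SmallEnrichedCat.onOb (B := Y.kernelData.toCat) G
  map a b n := Y.kernelIncl _ _ n ∘ₗ NarrowCat.onDeg (B := Y.kernelData.toCat) G a b n
  mem_kernel _ := Y.kernelIncl_mem _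
  map_act {a b m _} f x :=
    congrArg (Y.kernelIncl _ _ m) (NarrowCat.onDeg_act (B := Y.kernelData.toCat) G a b f x)
  map_one a := congrArg (Y.kernelIncl _ _ 0)
    ((NarrowCat.onDeg_one (B := Y.kernelData.toCat) G a).trans (Y.kernelData.toCat_one _))
  map_comp {a b c p q} x y :=
    (congrArg (Y.kernelIncl _ _ (p + q))
      (NarrowCat.onDeg_comp (B := Y.kernelData.toCat) G a b c p q x y)).trans
      (congrArg (fun t => Y.kernelIncl _ _ (p + q) (t (NarrowCat.onDeg (B := Y.kernelData.toCat) G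
        a b p x) (NarrowCat.onDeg (B := Y.kernelData.toCat) G b c q y)))
        (Y.kernelData.toCat_comp _ _ _ p q))

end NarrowCat.KernelMap

namespace FTemplicialModule

open NarrowCat

variable {k : Type u} [CommRing k] {X Y : FTemplicialModule k}

variable (X) in
/-- The identity of the category of joint kernels of `X`, in terms of elements of `X`. -/
noncomputable def kernelMapId : KernelMap X.kernelData.toCat X :=
  KernelMap.ofHom (A := X.kernelData.toCat) (Y := X) (𝟙 X.kernelData.toCat)

variable (X) in
/-- The counit: the map to `X` from the free Frobenius templicial module on the category of joint
kernels of `X`. -/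
noncomputable def counitDeg (n : ℕ) (a b : X.base) :
    X.kernelData.toCat.free.deg n a b →ₗ[k] X.deg n a b :=
  X.kernelMapId.lift n a b

theorem counitDeg_incl (n : ℕ) (a b : X.base) (x : (X.kernelModule a b).deg n) :
    X.counitDeg (n + 1) a b (Free.incl (A := X.kernelData.toCat) a b n x) = X.kernelIncl a b n x :=
  X.kernelMapId.lift_incl x

theorem counitDeg_act {m n : ℕ} (f : (⟨m⟩ : FinInterval) ⟶ ⟨n⟩) (a b : X.base)
    (x : X.kernelData.toCat.free.deg n a b) :
    X.counitDeg m a b (X.kernelData.toCat.free.act f a b x) = X.act f a b (X.counitDeg n a b x) :=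
  X.kernelMapId.lift_act f x

theorem counitDeg_one (a : X.base) :
    X.counitDeg 0 a a (X.kernelData.toCat.free.one a) = X.one a :=
  X.kernelMapId.lift_one a

theorem counitDeg_mul (a c b : X.base) (p q : ℕ) (x : X.kernelData.toCat.free.deg p a c)
    (y : X.kernelData.toCat.free.deg q c b) :
    X.counitDeg (p + q) a b (X.kernelData.toCat.free.mul a c b p q (p + q) rfl x y) =
      X.mul a c b p q (p + q) rfl (X.counitDeg p a c x) (X.counitDeg q c b y) :=
  X.kernelMapId.lift_mul a c b p q x y

theorem counitDeg_comul (a b : X.base) (p q : ℕ) (x : X.kernelData.toCat.free.deg (p + q) a b) :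
    X.comul a b p q (p + q) rfl (X.counitDeg (p + q) a b x) =
      tensorMap (X := X.kernelData.toCat.free) (Y := X) (f := id) X.counitDeg p q a b
        (X.kernelData.toCat.free.comul a b p q (p + q) rfl x) :=
  X.kernelMapId.lift_comul a b p q x

variable (X) in
/-- The free module on the category of joint kernels of `X` is `X`: both have the same joint
kernels. -/
theorem counitDeg_bijective (n : ℕ) (a b : X.base) : Function.Bijective (X.counitDeg n a b) := by
  refine bijective_of_bijective_kernel (S := X.base) (F₁ := X.kernelData.toCat.free.functor)
    (F₂ := X.functor) (r₁ := X.kernelData.toCat.free.frobenius) (r₂ := X.frobenius) X.counitDeg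
    (counitDeg_act (X := X)) (counitDeg_one (X := X)) (counitDeg_mul (X := X))
    (counitDeg_comul (X := X)) (fun n a b x hx h => ?_)
    (fun n a b y hy => ?_) n a b
  · obtain ⟨y, rfl⟩ : ∃ y, Free.incl (A := X.kernelData.toCat) a b n y = x :=
      (Free.range_incl (A := X.kernelData.toCat) a b n).ge hx
    have h1 : X.kernelIncl a b n y = 0 := (counitDeg_incl n a b y).symm.trans h
    obtain rfl : y = 0 := X.kernelIncl_injective a b n (h1.trans (map_zero _).symm)
    exact Free.incl_zero (A := X.kernelData.toCat) a b n
  · exact ⟨_, counitDeg_incl n a b (X.kernelMk y hy)⟩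

variable (X) in
/-- The counit as an equivalence in a single degree. -/
noncomputable def counitEquiv (n : ℕ) (a b : X.base) :
    X.kernelData.toCat.free.deg n a b ≃ₗ[k] X.deg n a b :=
  LinearEquiv.ofBijective _ (X.counitDeg_bijective n a b)

section

variable (G : (kernelFunctor k).obj X ⟶ (kernelFunctor k).obj Y)

/-- The elements of `Y` associated with a functor between categories of joint kernels. -/
noncomputable def kernelMapOf : KernelMap X.kernelData.toCat Y :=
  KernelMap.ofHom (A := X.kernelData.toCat) G

/-- The extension of a functor between categories of joint kernels. -/
noncomputable def extendDeg (n : ℕ) (a b : X.base) :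
    X.deg n a b →ₗ[k] Y.deg n ((kernelMapOf G).ob a) ((kernelMapOf G).ob b) :=
  (kernelMapOf G).lift n a b ∘ₗ (X.counitEquiv n a b).symm.toLinearMap

theorem extendDeg_counit (n : ℕ) (a b : X.base) (x : X.kernelData.toCat.free.deg n a b) :
    extendDeg G n a b (X.counitDeg n a b x) = (kernelMapOf G).lift n a b x :=
  congrArg ((kernelMapOf G).lift n a b) ((X.counitEquiv n a b).symm_apply_apply x)

/-- The extension of a functor between categories of joint kernels to a morphism of Frobenius
templicial modules. -/
noncomputable def extend : X ⟶ Y :=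
  Hom.ofDeg (kernelMapOf G).ob (extendDeg G)
    (fun {m n} f a b x => by
      obtain ⟨x, rfl⟩ := (X.counitDeg_bijective n a b).2 x
      rw [← counitDeg_act, extendDeg_counit, extendDeg_counit]
      exact (kernelMapOf G).lift_act f x)
    (fun a => by
      rw [← counitDeg_one, extendDeg_counit]
      exact (kernelMapOf G).lift_one a)
    (fun a c b p q x y => by
      obtain ⟨x, rfl⟩ := (X.counitDeg_bijective p a c).2 x
      obtain ⟨y, rfl⟩ := (X.counitDeg_bijective q c b).2 y
      rw [← counitDeg_mul, extendDeg_counit, extendDeg_counit, extendDeg_counit]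
      exact (kernelMapOf G).lift_mul a c b p q x y)
    (fun a b p q x => by
      obtain ⟨x, rfl⟩ := (X.counitDeg_bijective (p + q) a b).2 x
      rw [counitDeg_comul, extendDeg_counit]
      refine ((kernelMapOf G).lift_comul a b p q x).trans ?_
      refine LinearMap.congr_fun (f := tensorMap (X := X.kernelData.toCat.free)
          (f := (kernelMapOf G).ob) (kernelMapOf G).lift p q a b)
        (g := tensorMap (extendDeg G) p q a b ∘ₗ tensorMap (X := X.kernelData.toCat.free)
          (Y := X) (f := id) X.counitDeg p q a b) (ModQuiver.tensor_ext fun c y z => ?_) _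
      refine (tensorMap_tmul (X := X.kernelData.toCat.free) (f := (kernelMapOf G).ob)
        (kernelMapOf G).lift p q a c b y z).trans (Eq.symm ?_)
      refine (congrArg (tensorMap (extendDeg G) p q a b) (tensorMap_tmul
        (X := X.kernelData.toCat.free) (Y := X) (f := id) X.counitDeg p q a c b y z)).trans ?_
      refine (tensorMap_tmul (extendDeg G) p q a c b _ _).trans ?_
      exact congrArg₂ (fun s t => Y.tmul _ _ _ p q s t) (extendDeg_counit G p a c y)
        (extendDeg_counit G q c b z))

theorem kernelFunctor_map_extend : (kernelFunctor k).map (extend G) = G :=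
  NarrowCat.functor_ext (A := X.kernelData.toCat) (B := Y.kernelData.toCat) (fun _ => rfl)
    fun a b n x => heq_of_eq (Y.kernelIncl_injective _ _ n
      ((congrArg (extendDeg G (n + 1) a b) (counitDeg_incl n a b x).symm).trans
        ((extendDeg_counit G (n + 1) a b _).trans ((kernelMapOf G).lift_incl x))))

end

instance : (kernelFunctor k).Full where
  map_surjective G := ⟨extend G, kernelFunctor_map_extend G⟩

instance : (kernelFunctor k).IsEquivalence where

end FTemplicialModule

theorem mainTheorem1 (k : Type u) [CommRing k] :
    ∃ (E : FTemplicialModule k ≌ DGCat k) (K : FTemplicialModule k ≌ NarrowCat k)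
      (N : NarrowCat k ≌ DGCat k),
      Nonempty (KernelIdentification K.functor) ∧
      Nonempty (NormalizedIdentification N.functor) ∧
      Nonempty (E.functor ≅ K.functor ⋙ N.functor) :=
  ⟨(FTemplicialModule.kernelFunctor k).asEquivalence.trans
      (NarrowCat.normalization k).asEquivalence,
    (FTemplicialModule.kernelFunctor k).asEquivalence, (NarrowCat.normalization k).asEquivalence,
    ⟨FTemplicialModule.kernelIdentification⟩, ⟨NarrowCat.normalizedIdentification k⟩,
    ⟨Iso.refl _⟩⟩
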